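/- Let $q,x\in\mathbb C^*$ with $|q|<1$, and write $p=xq^v$ ($v\in\mathbb Z$). Fix $\alpha_r,\beta_r,\gamma_r,\delta_r\in\mathbb Q$ and $t_r,u_r,v_r,w_r\in\mathbb C^*$ (four finite, possibly empty families). Logarithms of $q,x,t_r,u_r,v_r,w_r$ (and of $z$ where needed) are chosen arbitrarily and fixed, $\log p=\log x+v\log q$, and $a^s=\exp(s\log a)$. Put $(y;q)=\prod_{r\ge0}(1-yq^r)$, $\theta(y;q)=(y;q)(q/y;q)$, $\Gamma(y)=\Gamma(y;p,q)=\prod_{r,s\ge 0}\frac{1-p^{r+1}q^{s+1}/y}{1-p^rq^sy}$ and $$I(z)=\prod_r\Gamma(p^{\alpha_r}t_rz)\prod_r\Gamma(p^{\beta_r}u_r/z)\prod_r\theta(p^{\gamma_r}v_rz;q)\prod_r\theta(p^{\delta_r}w_rz;p).$$ With $b(a)=\binom a2-\binom{\{a\}}2$, $g(a)=\frac16a(a-1)(2a-1)$, $G(a)=g(a)-g(\{a\})$, where $\{a\}$ is the fractional part of $a$, define $$fob(\zeta)=\sum_rG(\alpha_r+\zeta)+\sum_rG(\beta_r-\zeta)+\sum_r(\gamma_r+\zeta)^2,$$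 $$sob(\zeta)=sob(\zeta;z)=x^{fob(\zeta)}\prod_r\Big(\frac{t_rz}{\sqrt q}\Big)^{b(\alpha_r+\zeta)}\prod_r\Big(\frac{u_r}{z\sqrt q}\Big)^{b(\beta_r-\zeta)}\prod_r\Big(\frac{v_rz}{\sqrt q}\Big)^{\gamma_r+\zeta}\prod_rq^{b(\delta_r+\zeta)} .$$ Let $m_-=\min(0,\beta_r)$, $m_+=-\min(0,\alpha_r)$ (minima over all $r$), let $fob_{max}$ be the maximum of $fob$ on $[m_-,m_+]$, and let $M$ be the set of points of $[m_-,m_+]$ where it is attained. Assume that $fob'(\zeta)=0$ if $\zeta\in\{m_-,m_+\}\cap M$. Then the following hold. (0) $fob$ and $sob$ are first and second order behaviours of $I$: for all $K,\epsilon>0$ there are $C_1,C_2>0$ such that $C_1<\left|I(p^\zeta z)\,q^{\frac12v^2fob(\zeta)}sob(\zeta;z)^v\right|<C_2$ for all $\zeta\in[-K,K]$, all $z$ with $\frac1K\le|z|\le K$ and all integers $v$ with $|p|<|q|$ such that $|1-p^\zeta z/y|>\epsilon$ for all poles and zeros $y\in\mathbb C^*$ of the factors of $I$. (1) For $\zeta\in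 M$, $sob(\zeta;z)$ does not depend on $z$. (2) Let $M_0$ be the set of points of $M$ where $|sob|$ attains its minimum over $M$, and suppose that $M_0$ is finite. Then $M_0\subset\mathbb Q$. (3) Suppose moreover that $s\ge1$ is an integer such that $\alpha_rs,\beta_rs,\gamma_rs\in2\mathbb Z$ for all $r$ and $\mu s\in2\mathbb Z$ for all $\mu\in M_0$; that $sob_{min}\in\mathbb C$ satisfies $sob(\mu)^s=sob_{min}^s$ for all $\mu\in M_0$; and that * if $m_-=0\in M_0$, then for all $\zeta<0$ close enough to $0$ either $fob(\zeta)<fob(0)$, or $fob(\zeta)=fob(0)$ and $|sob(\zeta;1)|>|sob(0;1)|$; * $t_rx^{\alpha_r+l}\notin q^{\mathbb Z}t_{r'}x^{\alpha_{r'}+l'}$ for all $(r,l)\ne(r',l')$ with $l,l'\in\mathbb Z_{\ge0}$, $\alpha_r+l\le0$, $\alpha_{r'}+l'\le0$; and $u_rx^{\beta_r+l}\notin q^{\mathbb Z}u_{r'}x^{\beta_{r'}+l'}$ for all $(r,l)\ne(r',l')$ with $l,l'\in\mathbb Z_{\ge0}$, $\beta_r+l<0$, $\beta_{r'}+l'<0$;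 * for all sufficiently large $v\in s\mathbb Z_{>0}$, $C=C_v$ is a closed contour in $\mathbb C^*$, avoiding the points below, with winding number $1$ around $0$ and around every $p^{\beta_r+l}q^ku_r$, and winding number $0$ around every $p^{-\alpha_r-l}q^{-k}/t_r$ ($k,l\in\mathbb Z_{\ge0}$). (Contours may be any continuous closed curves, differentiable off a finite set with integrable derivative.) Then, with $v$ running through the positive multiples of $s$, $$\lim_{v\to\infty}q^{\frac12fob_{max}v^2}sob_{min}^v\int_CI(z)\frac{dz}{2\pi iz}=-\sum_{\substack{\mu\in M_0\\\mu\ge0}}\ \sum_{l\ge0}\ \sum_{r:\,\alpha_r+\mu+l\le0}seq_{+,\mu,r,l}+\sum_{\substack{\mu\in M_0\\\mu<0}}\ \sum_{l\ge0}\ \sum_{r:\,\beta_r-\mu+l\le0}seq_{-,\mu,r,l},$$ where $$seq_{+,\mu,r,l}=\sum_n\lim_{v\to\infty}q^{\frac12fob_{max}v^2}sob_{min}^v\,\mathrm{Res}\Big(\frac{I(z)}z,\ z=q^{-n}\frac1{t_r}p^\mu x^{-\alpha_r-l-\mu}\Big)$$ with $n$ running over $\mathbb Z_{\ge0}$ if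 $\mu=-\alpha_r-l$ and over $\mathbb Z$ if $\mu<-\alpha_r-l$, and $$seq_{-,\mu,r,l}=\sum_n\lim_{v\to\infty}q^{\frac12fob_{max}v^2}sob_{min}^v\,\mathrm{Res}\Big(\frac{I(z)}z,\ z=q^nu_rp^\mu x^{l+\beta_r-\mu}\Big)$$ with $n$ running over $\mathbb Z_{\ge0}$ if $\mu=\beta_r+l$ and over $\mathbb Z$ if $\mu>\beta_r+l$. All the limits of residues in these series exist, and the series converge absolutely. -/

import Mathlib

open Filter Topology

noncomputable section

namespace EllipticLimit

/-! ### Theta functions and the elliptic gamma function -/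

/-- The infinite `q`-Pochhammer symbol `(x;q) = ∏_{r ≥ 0} (1 - x q^r)`. -/
def qSymbol (x q : ℂ) : ℂ := ∏' r : ℕ, (1 - x * q ^ r)

/-- The `pq`-symbol `(x;p,q) = ∏_{r,s ≥ 0} (1 - x p^r q^s)`. -/
def pqSymbol (x p q : ℂ) : ℂ := ∏' rs : ℕ × ℕ, (1 - x * p ^ rs.1 * q ^ rs.2)

/-- The theta function `θ(x;q) = (x;q) (q/x;q)`. -/
def theta (x q : ℂ) : ℂ := qSymbol x q * qSymbol (q / x) q

/-- The elliptic gamma function `Γ(z;p,q) = (pq/z;p,q) / (z;p,q)`. -/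
def ellGamma (z p q : ℂ) : ℂ := pqSymbol (p * q / z) p q / pqSymbol z p q

/-- The poles and zeros of `Γ(·;p,q)` on `ℂ*`. -/
def gammaDivisor (p q : ℂ) : Set ℂ :=
  {y | ∃ j k : ℕ, y = (p ^ j * q ^ k)⁻¹ ∨ y = p ^ (j + 1) * q ^ (k + 1)}

/-- The zeros of `θ(·;q)` on `ℂ*`. -/
def thetaDivisor (q : ℂ) : Set ℂ := {y | ∃ k : ℤ, y = q ^ k}

/-! ### The order functions of the building blocks -/

/-- `binom(a,2) = a (a - 1) / 2`. -/
def binomTwo (a : ℝ) : ℝ := a * (a - 1) / 2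

/-- `g(a) = a (a - 1) (2 a - 1) / 6`. -/
def gPoly (a : ℝ) : ℝ := a * (a - 1) * (2 * a - 1) / 6

/-- `binom(a,2) - binom({a},2)`. -/
def binomDiff (a : ℝ) : ℝ := binomTwo a - binomTwo (Int.fract a)

/-- `g(a) - g({a})`. -/
def gDiff (a : ℝ) : ℝ := gPoly a - gPoly (Int.fract a)

/-- Second order behaviour of `Γ(p^a y)`, as a function of `a` and of `logy = log y`:
`y^{b(a)} x^{G(a)} q^{-b(a)/2}` with `b = binomDiff`, `G = gDiff`. -/
def sobGamma (logq logx : ℂ) (a : ℝ) (logy : ℂ) : ℂ :=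
  Complex.exp ((binomDiff a : ℂ) * logy + (gDiff a : ℂ) * logx - (binomDiff a : ℂ) * logq / 2)

/-- Second order behaviour of `θ(p^a y;q)`: `y^a x^{a^2} q^{-a/2}`. -/
def sobThetaQ (logq logx : ℂ) (a : ℝ) (logy : ℂ) : ℂ :=
  Complex.exp ((a : ℂ) * logy + (a : ℂ) ^ 2 * logx - (a : ℂ) * logq / 2)

/-- Second order behaviour of `θ(p^a y;p)`: `q^{b(a)}`. -/
def sobThetaP (logq : ℂ) (a : ℝ) : ℂ := Complex.exp ((binomDiff a : ℂ) * logq)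

/-! ### Residues and contours -/

/-- The residue of `f` at an isolated singularity `z₀`: the value of `(2πi)⁻¹ ∮ f` over all
sufficiently small positively oriented circles around `z₀`. -/
def residue (f : ℂ → ℂ) (z₀ : ℂ) : ℂ :=
  limUnder (𝓝[>] (0 : ℝ)) fun ρ : ℝ =>
    (2 * (Real.pi : ℂ) * Complex.I)⁻¹ * ∮ z in C(z₀, ρ), f z

/-- `(2πi)⁻¹ ∫_C f(z) dz` along the curve `C` parametrized by `c` on `[0,1]`. -/
def curveIntegral (c : ℝ → ℂ) (f : ℂ → ℂ) : ℂ :=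
  (2 * (Real.pi : ℂ) * Complex.I)⁻¹ * ∫ τ in (0 : ℝ)..1, f (c τ) * deriv c τ

/-- The winding number of the closed curve `c` around a point `a` that is not on it. -/
def winding (c : ℝ → ℂ) (a : ℂ) : ℂ := curveIntegral c fun z => (z - a)⁻¹

/-- Closed curves of finite length on `[0,1]`, differentiable off a finite set; in particular all
piecewise continuously differentiable closed curves. -/
structure IsClosedCurve (c : ℝ → ℂ) : Prop where
  continuousOn : ContinuousOn c (Set.Icc 0 1)
  closed : c 0 = c 1
  differentiable : ∃ S : Finset ℝ, ∀ τ ∈ Set.Ioo (0 : ℝ) 1, τ ∉ S → DifferentiableAt ℝ c τ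
  integrable : IntervalIntegrable (deriv c) MeasureTheory.volume 0 1

/-! ### The integrand -/

/-- The parameters of the integrand
`∏ Γ(p^{α_r} t_r z) ∏ Γ(p^{β_r} u_r / z) ∏ θ(p^{γ_r} v_r z;q) ∏ θ(p^{δ_r} w_r z;p)`, `p = x q^v`.
For each of the non-zero complex numbers `q`, `x`, `t_r`, `u_r`, `v_r`, `w_r` an (arbitrary) choice
of its logarithm is recorded, and `a ^ s` means `exp (s * log a)` with that logarithm. -/
structure Data where
  /-- the chosen logarithm of `q` -/
  logq : ℂ
  /-- the chosen logarithm of `x` -/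
  logx : ℂ
  /-- number of factors `Γ(p^{α_r} t_r z)` -/
  nα : ℕ
  /-- number of factors `Γ(p^{β_r} u_r / z)` -/
  nβ : ℕ
  /-- number of factors `θ(p^{γ_r} v_r z;q)` -/
  nγ : ℕ
  /-- number of factors `θ(p^{δ_r} w_r z;p)` -/
  nδ : ℕ
  /-- the exponents `α_r` -/
  α : Fin nα → ℚ
  /-- the exponents `β_r` -/
  β : Fin nβ → ℚ
  /-- the exponents `γ_r` -/
  γ : Fin nγ → ℚ
  /-- the exponents `δ_r` -/
  δ : Fin nδ → ℚ
  /-- the chosen logarithms of the `t_r` -/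
  logt : Fin nα → ℂ
  /-- the chosen logarithms of the `u_r` -/
  logu : Fin nβ → ℂ
  /-- the chosen logarithms of the `v_r` -/
  logv : Fin nγ → ℂ
  /-- the chosen logarithms of the `w_r` -/
  logw : Fin nδ → ℂ

namespace Data

variable (P : Data)

/-- The base `q`. -/
def q : ℂ := Complex.exp P.logq

/-- `x ^ a`. -/
def xpow (a : ℝ) : ℂ := Complex.exp ((a : ℂ) * P.logx)

/-- `p ^ a` for `p = x q^v`, with `log p = log x + v log q`. -/
def ppow (v : ℤ) (a : ℝ) : ℂ := Complex.exp ((a : ℂ) * (P.logx + (v : ℂ) * P.logq))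

/-- The base `p = x q^v`. -/
def p (v : ℤ) : ℂ := P.ppow v 1

/-- The number `t_r`. -/
def t (r : Fin P.nα) : ℂ := Complex.exp (P.logt r)

/-- The number `u_r`. -/
def u (r : Fin P.nβ) : ℂ := Complex.exp (P.logu r)

/-- The number `v_r`. -/
def vv (r : Fin P.nγ) : ℂ := Complex.exp (P.logv r)

/-- The number `w_r`. -/
def w (r : Fin P.nδ) : ℂ := Complex.exp (P.logw r)

/-- The integrand `I(z)` at `p = x q^v`. -/
def integrand (v : ℤ) (z : ℂ) : ℂ :=
  (∏ r, ellGamma (P.ppow v (P.α r) * P.t r * z) (P.p v) P.q) *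
  (∏ r, ellGamma (P.ppow v (P.β r) * P.u r / z) (P.p v) P.q) *
  (∏ r, theta (P.ppow v (P.γ r) * P.vv r * z) P.q) *
  (∏ r, theta (P.ppow v (P.δ r) * P.w r * z) (P.p v))

/-- The poles and zeros in `ℂ*` of the factors of the integrand at `p = x q^v`. -/
def divisor (v : ℤ) : Set ℂ :=
  {y | (∃ r, P.ppow v (P.α r) * P.t r * y ∈ gammaDivisor (P.p v) P.q) ∨
    (∃ r, y ≠ 0 ∧ P.ppow v (P.β r) * P.u r / y ∈ gammaDivisor (P.p v) P.q) ∨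
    (∃ r, P.ppow v (P.γ r) * P.vv r * y ∈ thetaDivisor P.q) ∨
    (∃ r, P.ppow v (P.δ r) * P.w r * y ∈ thetaDivisor (P.p v))}

/-- The first order behaviour `fob(ζ)` of `I(z p^ζ)`. -/
def fob (ζ : ℝ) : ℝ :=
  ∑ r, gDiff (P.α r + ζ) + ∑ r, gDiff (P.β r - ζ) + ∑ r, ((P.γ r : ℝ) + ζ) ^ 2

/-- The second order behaviour `sob(ζ)` of `I(z p^ζ)`, with its dependence on `logz = log z`. -/
def sob (ζ : ℝ) (logz : ℂ) : ℂ :=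
  (∏ r, sobGamma P.logq P.logx (P.α r + ζ) (P.logt r + logz)) *
  (∏ r, sobGamma P.logq P.logx (P.β r - ζ) (P.logu r - logz)) *
  (∏ r, sobThetaQ P.logq P.logx (P.γ r + ζ) (P.logv r + logz)) *
  (∏ r, sobThetaP P.logq (P.δ r + ζ))

/-- `F` and `S` are a first and a second order behaviour of the integrand: uniformly for `ζ` and `z`
in compact sets (of `ℝ` and `ℂ*`) and for all integers `v` with `|p| < |q|`, the quantity
`I(p^ζ z) q^{F(ζ) v^2 / 2} S(ζ)^v` is bounded and bounded away from zero, as long as `p^ζ z` keeps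
a fixed relative distance from the poles and zeros. -/
def IsOrderBehaviour (F : ℝ → ℝ) (S : ℝ → ℂ → ℂ) : Prop :=
  ∀ K > (0 : ℝ), ∀ ε > (0 : ℝ), ∃ C₁ > (0 : ℝ), ∃ C₂ > (0 : ℝ),
    ∀ ζ ∈ Set.Icc (-K) K, ∀ logz : ℂ, ‖Complex.exp logz‖ ∈ Set.Icc (1 / K) K →
    ∀ v : ℤ, ‖P.p v‖ < ‖P.q‖ →
      (∀ y ∈ P.divisor v, ε < ‖1 - P.ppow v ζ * Complex.exp logz / y‖) →
      ‖P.integrand v (P.ppow v ζ * Complex.exp logz) *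
          Complex.exp ((F ζ : ℂ) * (v : ℂ) ^ 2 / 2 * P.logq) * S ζ logz ^ v‖ ∈ Set.Ioo C₁ C₂

/-! ### Maximizers of the first, minimizers of the second order behaviour -/

/-- `m_- = min(0, β_1, β_2, …)`. -/
def mMinus : ℚ := (insert 0 (Finset.univ.image P.β)).min' (Finset.insert_nonempty _ _)

/-- `m_+ = - min(0, α_1, α_2, …)`. -/
def mPlus : ℚ := -(insert 0 (Finset.univ.image P.α)).min' (Finset.insert_nonempty _ _)

/-- The interval `[m_-, m_+]`. -/
def interval : Set ℝ := Set.Icc (P.mMinus : ℝ) (P.mPlus : ℝ)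

/-- The maximum `fob_max` of `fob` on `[m_-, m_+]`. -/
def fobMax : ℝ := sSup (P.fob '' P.interval)

/-- The set `M ⊆ [m_-, m_+]` in which `fob` is maximized. -/
def M : Set ℝ := {ζ | ζ ∈ P.interval ∧ IsMaxOn P.fob P.interval ζ}

/-- The set `M₀ ⊆ M` in which `|sob|` is minimized (`sob` being evaluated at `z = 1`). -/
def M₀ : Set ℝ := {ζ | ζ ∈ P.M ∧ IsMinOn (fun ξ => ‖P.sob ξ 0‖) P.M ζ}

/-! ### The integral and the residues -/

/-- `c` parametrizes a contour `C` for the integrand at `p = x q^v`: a closed curve in `ℂ*` that winds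
once around `0`, once around each of the poles `p^{β_r + l} q^k u_r`, and not at all around any of
the poles `p^{-α_r - l} q^{-k} / t_r`, where `k, l ≥ 0`. -/
structure IsContour (v : ℤ) (c : ℝ → ℂ) : Prop where
  isClosedCurve : IsClosedCurve c
  avoids_zero : ∀ τ ∈ Set.Icc (0 : ℝ) 1, c τ ≠ 0
  avoids_inner : ∀ r, ∀ k l : ℕ, ∀ τ ∈ Set.Icc (0 : ℝ) 1,
    c τ ≠ P.ppow v (P.β r + l) * P.q ^ k * P.u r
  avoids_outer : ∀ r, ∀ k l : ℕ, ∀ τ ∈ Set.Icc (0 : ℝ) 1,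
    c τ ≠ (P.ppow v (P.α r + l) * P.q ^ k * P.t r)⁻¹
  winding_zero : winding c 0 = 1
  winding_inner : ∀ r, ∀ k l : ℕ, winding c (P.ppow v (P.β r + l) * P.q ^ k * P.u r) = 1
  winding_outer : ∀ r, ∀ k l : ℕ, winding c (P.ppow v (P.α r + l) * P.q ^ k * P.t r)⁻¹ = 0

/-- `∫_C I(z) dz / (2πiz)` at `p = x q^v`. -/
def integral (v : ℤ) (c : ℝ → ℂ) : ℂ := curveIntegral c fun z => P.integrand v z / z

/-- The rescaling factor `q^{fob_max v^2 / 2} sob_min^v`. -/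
def scale (sobMin : ℂ) (v : ℤ) : ℂ :=
  Complex.exp ((P.fobMax : ℂ) * (v : ℂ) ^ 2 / 2 * P.logq) * sobMin ^ v

/-- `Res(I(z) / z, z = q^{-n} t_r⁻¹ p^μ x^{-α_r - l - μ})`. -/
def resPlus (v : ℤ) (μ : ℝ) (r : Fin P.nα) (l : ℕ) (n : ℤ) : ℂ :=
  residue (fun z => P.integrand v z / z)
    (P.q ^ (-n) * (P.t r)⁻¹ * P.ppow v μ * P.xpow (-P.α r - l - μ))

/-- `Res(I(z) / z, z = q^n u_r p^μ x^{l + β_r - μ})`. -/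
def resMinus (v : ℤ) (μ : ℝ) (r : Fin P.nβ) (l : ℕ) (n : ℤ) : ℂ :=
  residue (fun z => P.integrand v z / z)
    (P.q ^ n * P.u r * P.ppow v μ * P.xpow (l + P.β r - μ))

end Data

/-- The range of summation of a series of residues: the integers `n ≥ 0` (a unilateral series)
if `a = 0`, and all integers (a bilateral series) otherwise. -/
def indexRange (a : ℝ) : Set ℤ := {n | a = 0 → 0 ≤ n}

end EllipticLimit

end

open Filter Topology

noncomputable section

namespace EllipticLimit

/-! ### Bounds for infinite products -/

/-! Put p = x q^v and look at z = p^ζ y with y bounded. On this logarithmic scale the size of every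
factor of the integrand is the exponential of a quadratic polynomial in v. The coefficient of v²
gives `fob ζ`, that of v gives `log |sob ζ|`, and what remains is bounded above and below as long as
z keeps a relative distance from the zeros and poles.

The source of this is the elementary symbol (y;q). If |y| is large, its first roughly log|y| /
(-log|q|) factors are large, and their product is explicit up to a bounded factor
(`exists_large_factors`); multiplication by `thetaFactor` cancels it (`growth_add_log_norm`).
Peeling off symbols (p^{a+j} y; q) from (p^a y; p, q) reduces Γ to this case, and summing the
exponents a+j and (a+j)² produces b and G (`prod_thetaFactor`, `scaleFactor_gamma`). For θ(·;p) only
finitely many factors are large. Multiplying the bounds gives (0).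

For (1), the exponent `sobExp` of z in `sob` is half of `fob'`, hence zero at every maximizer. For
(2), near an irrational point all floors are constant, so `fob` is quadratic and `log |sob|` is
linear up to a multiple of `fob`. Either criticality is a linear equation with rational
coefficients, or `fob` is locally constant and the minimizers fill an interval.

For (3), the rescaled integrand at |z| ≍ |q|^{ζv} is at most a constant times exp(-κ v dist(ζ, M₀)):
`fob` falls below its maximum, or `log |sob|` exceeds its minimum, at least linearly on the scale
1/v (`energyBound_Icc`). The contour is compared with a circle |z| ≍ |q|^{ζ₀v} that separates the
negative from the non-negative elements of M₀. Since ζ₀ is not in M₀, the circle contributes nothing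
in the limit. By the residue theorem (`integral_eq`) there remain the inner poles outside the
circle, counted positively, and the outer poles inside it, counted negatively.

These poles lie in finitely many progressions A q^m whose base points A do not depend on v. The
residue at A q^m is at most a constant times exp(-κ v dist(m/v, M₀)), so with m = vμ + n, μ ∈ M₀,
the sum over m is dominated by a multiple of exp(-κ|n|) near each μ
(`tendsto_tsum_of_concentrated`). Each rescaled residue converges for fixed n: integrality of the
exponents of q makes the normalized factors converge up to roots of unity, and these cancel in the
product because `sobExp μ = 0` (`exists_tendsto_normalized`). Dominated convergence then gives both
the limit and the absolute convergence of the series. A series is unilateral exactly when the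
progression starts at p^μ itself. -/

/-- The exponent in the lower bound `exp (-lowerExp ε * ∑ ‖f i‖) ≤ ‖∏ (1 - f i)‖`. -/
def lowerExp (ε : ℝ) : ℝ := 2 + 2 * |Real.log ε|

lemma lowerExp_pos (ε : ℝ) : 0 < lowerExp ε := by
  have := abs_nonneg (Real.log ε); unfold lowerExp; linarith

/-- For |w| ≤ 1/2 one has 1 - |w| ≥ exp(-2|w|). For |w| ≥ 1/2 the term 2|log ε||w| is at least |log
ε|, which pushes the exponential below ε. -/
lemma exp_neg_lowerExp_mul_le {ε : ℝ} (hε : 0 < ε) {w : ℂ} (hw : ε ≤ ‖1 - w‖) :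
    Real.exp (-(lowerExp ε * ‖w‖)) ≤ ‖1 - w‖ := by
  have hlog := abs_nonneg (Real.log ε)
  rcases le_total ‖w‖ (1 / 2) with h | h
  · have h1 : 1 - ‖w‖ ≤ ‖1 - w‖ := by simpa using norm_sub_norm_le (1 : ℂ) w
    have hn := norm_nonneg w
    refine le_trans ?_ h1
    have h2 : Real.exp (-(lowerExp ε * ‖w‖)) ≤ Real.exp (-(2 * ‖w‖)) := by
      apply Real.exp_le_exp.2; unfold lowerExp; nlinarith
    refine h2.trans ?_
    rw [Real.exp_neg]
    have h3 : 1 + 2 * ‖w‖ ≤ Real.exp (2 * ‖w‖) := by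
      have := Real.add_one_le_exp (2 * ‖w‖); linarith
    rw [inv_le_comm₀ (Real.exp_pos _) (by linarith)]
    refine le_trans ?_ h3
    rw [inv_le_iff_one_le_mul₀ (by linarith)]
    nlinarith
  · refine le_trans ?_ hw
    rw [← Real.exp_log hε]
    apply Real.exp_le_exp.2
    rw [Real.exp_log hε]
    have := neg_abs_le (Real.log ε)
    unfold lowerExp; nlinarith

section Products

variable {ι : Type*} (f : ι → ℂ)

lemma norm_prod_one_sub_le (s : Finset ι) :
    ‖∏ i ∈ s, (1 - f i)‖ ≤ Real.exp (∑ i ∈ s, ‖f i‖) := by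
  rw [norm_prod, Real.exp_sum]
  refine Finset.prod_le_prod (fun i _ => norm_nonneg _) fun i _ => ?_
  refine (norm_sub_le _ _).trans ?_
  rw [norm_one, add_comm]
  exact Real.add_one_le_exp _

lemma exp_neg_le_norm_prod_one_sub {ε : ℝ} (hε : 0 < ε) (s : Finset ι)
    (h : ∀ i ∈ s, ε ≤ ‖1 - f i‖) :
    Real.exp (-(lowerExp ε * ∑ i ∈ s, ‖f i‖)) ≤ ‖∏ i ∈ s, (1 - f i)‖ := by
  rw [norm_prod, Finset.mul_sum, ← Finset.sum_neg_distrib, Real.exp_sum]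
  exact Finset.prod_le_prod (fun i _ => (Real.exp_pos _).le)
    fun i hi => exp_neg_lowerExp_mul_le hε (h i hi)

variable {f}

lemma multipliable_one_sub (hf : Summable fun i => ‖f i‖) : Multipliable fun i => 1 - f i := by
  simpa [sub_eq_add_neg] using multipliable_one_add_of_summable (f := fun i => -f i) (by simpa using hf)

lemma norm_tprod_one_sub_le (hf : Summable fun i => ‖f i‖) :
    ‖∏' i, (1 - f i)‖ ≤ Real.exp (∑' i, ‖f i‖) := by
  refine le_of_tendsto (Tendsto.norm (multipliable_one_sub hf).hasProd) (Eventually.of_forall fun s => ?_)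
  exact (norm_prod_one_sub_le f s).trans
    (Real.exp_le_exp.2 (hf.sum_le_tsum _ fun _ _ => norm_nonneg _))

lemma norm_tprod_one_sub_sub_one_le (hf : Summable fun i => ‖f i‖) :
    ‖∏' i, (1 - f i) - 1‖ ≤ Real.exp (∑' i, ‖f i‖) - 1 := by
  refine le_of_tendsto (Tendsto.norm (Tendsto.sub_const (multipliable_one_sub hf).hasProd 1))
    (Eventually.of_forall fun s => ?_)
  have := Finset.norm_prod_one_add_sub_one_le s fun i => -f i
  simp only [norm_neg, ← sub_eq_add_neg] at this
  exact this.trans (sub_le_sub_right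
    (Real.exp_le_exp.2 (hf.sum_le_tsum _ fun _ _ => norm_nonneg _)) _)

lemma exp_neg_le_norm_tprod_one_sub (hf : Summable fun i => ‖f i‖) {ε : ℝ} (hε : 0 < ε)
    (h : ∀ i, ε ≤ ‖1 - f i‖) :
    Real.exp (-(lowerExp ε * ∑' i, ‖f i‖)) ≤ ‖∏' i, (1 - f i)‖ := by
  refine ge_of_tendsto (Tendsto.norm (multipliable_one_sub hf).hasProd) (Eventually.of_forall fun s => ?_)
  refine le_trans (Real.exp_le_exp.2 ?_) (exp_neg_le_norm_prod_one_sub f hε s fun i _ => h i)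
  have := hf.sum_le_tsum s fun _ _ => norm_nonneg _
  have := lowerExp_pos ε
  nlinarith

end Products

/-! ### The symbols `(y;q)` and `(y;p,q)` -/

section Symbols

variable {p q : ℂ} (y : ℂ)

lemma summable_qSymbol (hq : ‖q‖ < 1) : Summable fun r : ℕ => ‖y * q ^ r‖ := by
  simpa [norm_mul, norm_pow] using
    (summable_geometric_of_lt_one (norm_nonneg q) hq).mul_left ‖y‖

lemma tsum_qSymbol (hq : ‖q‖ < 1) : ∑' r : ℕ, ‖y * q ^ r‖ = ‖y‖ / (1 - ‖q‖) := by
  simp only [norm_mul, norm_pow]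
  rw [tsum_mul_left, tsum_geometric_of_lt_one (norm_nonneg q) hq, div_eq_mul_inv]

lemma hasSum_pqSymbol (hp : ‖p‖ < 1) (hq : ‖q‖ < 1) :
    HasSum (fun rs : ℕ × ℕ => ‖y * p ^ rs.1 * q ^ rs.2‖) (‖y‖ / ((1 - ‖p‖) * (1 - ‖q‖))) := by
  have h := (hasSum_geometric_of_lt_one (norm_nonneg p) hp).mul
    (hasSum_geometric_of_lt_one (norm_nonneg q) hq)
    ((summable_geometric_of_lt_one (norm_nonneg p) hp).mul_of_nonneg
      (summable_geometric_of_lt_one (norm_nonneg q) hq) (fun _ => by positivity)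
      (fun _ => by positivity))
  have h2 := h.mul_left ‖y‖
  simp only [norm_mul, norm_pow, mul_assoc]
  rwa [div_eq_mul_inv, mul_inv]

lemma qSymbol_succ (hq : ‖q‖ < 1) : qSymbol y q = (1 - y) * qSymbol (y * q) q := by
  unfold qSymbol
  rw [tprod_eq_zero_mul']
  · simp [pow_succ', mul_assoc]
  · have := multipliable_one_sub (summable_qSymbol (y * q) hq)
    simpa [pow_succ', mul_assoc] using this

lemma qSymbol_eq_prod_mul (hq : ‖q‖ < 1) (n : ℕ) :
    qSymbol y q = (∏ j ∈ Finset.range n, (1 - y * q ^ j)) * qSymbol (y * q ^ n) q := by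
  induction n with
  | zero => simp
  | succ n ih =>
    rw [Finset.prod_range_succ, mul_assoc, pow_succ, ← mul_assoc y, ← qSymbol_succ _ hq, ih]

lemma pqSymbol_eq_tprod (hp : ‖p‖ < 1) (hq : ‖q‖ < 1) :
    HasProd (fun r : ℕ => qSymbol (y * p ^ r) q) (pqSymbol y p q) := by
  have h := (multipliable_one_sub (hasSum_pqSymbol y hp hq).summable).hasProd
  exact h.prod_fiberwise fun r => (multipliable_one_sub (summable_qSymbol (y * p ^ r) hq)).hasProd

lemma pqSymbol_succ (hp : ‖p‖ < 1) (hq : ‖q‖ < 1) :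
    pqSymbol y p q = qSymbol y q * pqSymbol (y * p) p q := by
  have h := pqSymbol_eq_tprod (y * p) hp hq
  rw [← (pqSymbol_eq_tprod y hp hq).tprod_eq, ← h.tprod_eq, tprod_eq_zero_mul']
  · simp [pow_succ', mul_assoc]
  · simpa [pow_succ', mul_assoc] using h.multipliable

lemma pqSymbol_eq_prod_mul (hp : ‖p‖ < 1) (hq : ‖q‖ < 1) (n : ℕ) :
    pqSymbol y p q =
      (∏ j ∈ Finset.range n, qSymbol (y * p ^ j) q) * pqSymbol (y * p ^ n) p q := by
  induction n with
  | zero => simp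
  | succ n ih =>
    rw [Finset.prod_range_succ, mul_assoc, pow_succ, ← mul_assoc y, ← pqSymbol_succ _ hp hq, ih]

lemma differentiable_tprod_one_sub {ι : Type*} (a : ι → ℂ) (ha : Summable fun i => ‖a i‖) :
    Differentiable ℂ fun y : ℂ => ∏' i, (1 - y * a i) := by
  intro y
  -- The Weierstrass test needs a majorant independent of the variable, hence the restriction to a
  -- disc around the origin.
  set U : Set ℂ := Metric.ball 0 (‖y‖ + 1)
  have hU : IsOpen U := Metric.isOpen_ball
  have hy : y ∈ U := by simp [U]
  have h := Summable.hasProdLocallyUniformlyOn_one_add (f := fun i (y : ℂ) => -(y * a i)) hU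
    (ha.mul_left (‖y‖ + 1)) (Eventually.of_forall fun i z hz => by
      rw [norm_neg, norm_mul]
      have : ‖z‖ < ‖y‖ + 1 := by simpa [U] using hz
      gcongr) (fun i => by fun_prop)
  rw [hasProdLocallyUniformlyOn_iff_tendstoLocallyUniformlyOn] at h
  have h2 := h.differentiableOn (Eventually.of_forall fun s => by fun_prop) hU
  simpa [sub_eq_add_neg] using (h2.differentiableAt (hU.mem_nhds hy))

lemma differentiable_qSymbol (hq : ‖q‖ < 1) : Differentiable ℂ fun y => qSymbol y q :=
  differentiable_tprod_one_sub (fun r : ℕ => q ^ r) (by simpa using summable_qSymbol 1 hq)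

lemma differentiable_pqSymbol (hp : ‖p‖ < 1) (hq : ‖q‖ < 1) :
    Differentiable ℂ fun y => pqSymbol y p q := by
  have := differentiable_tprod_one_sub (fun r : ℕ × ℕ => p ^ r.1 * q ^ r.2)
    (by simpa using (hasSum_pqSymbol 1 hp hq).summable)
  simpa [pqSymbol, mul_assoc] using this

variable {y}

lemma norm_qSymbol_le {K : ℝ} (hq : ‖q‖ < 1) (hy : ‖y‖ ≤ K) :
    ‖qSymbol y q‖ ≤ Real.exp (K / (1 - ‖q‖)) := by
  refine (norm_tprod_one_sub_le (summable_qSymbol y hq)).trans (Real.exp_le_exp.2 ?_)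
  rw [tsum_qSymbol y hq]
  have : 0 < 1 - ‖q‖ := by linarith
  gcongr

lemma le_norm_qSymbol {K ε : ℝ} (hq : ‖q‖ < 1) (hy : ‖y‖ ≤ K) (hε : 0 < ε)
    (h : ∀ k : ℕ, ε ≤ ‖1 - y * q ^ k‖) :
    Real.exp (-(lowerExp ε * (K / (1 - ‖q‖)))) ≤ ‖qSymbol y q‖ := by
  refine le_trans (Real.exp_le_exp.2 ?_)
    (exp_neg_le_norm_tprod_one_sub (summable_qSymbol y hq) hε h)
  rw [tsum_qSymbol y hq]
  have : 0 < 1 - ‖q‖ := by linarith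
  have := lowerExp_pos ε
  gcongr

/-- Replacing 1 - |p| by 1 - |q| makes this and the bounds derived from it uniform in v. -/
lemma pqSymbol_sum_le {K : ℝ} (hp : ‖p‖ ≤ ‖q‖) (hq : ‖q‖ < 1) (hy : ‖y‖ ≤ K) :
    ∑' rs : ℕ × ℕ, ‖y * p ^ rs.1 * q ^ rs.2‖ ≤ K / (1 - ‖q‖) ^ 2 := by
  rw [(hasSum_pqSymbol y (hp.trans_lt hq) hq).tsum_eq]
  have h1 : 0 < 1 - ‖q‖ := by linarith
  have hK : 0 ≤ K := (norm_nonneg y).trans hy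
  rw [sq]
  gcongr

lemma norm_pqSymbol_le {K : ℝ} (hp : ‖p‖ ≤ ‖q‖) (hq : ‖q‖ < 1) (hy : ‖y‖ ≤ K) :
    ‖pqSymbol y p q‖ ≤ Real.exp (K / (1 - ‖q‖) ^ 2) :=
  (norm_tprod_one_sub_le (hasSum_pqSymbol y (hp.trans_lt hq) hq).summable).trans
    (Real.exp_le_exp.2 (pqSymbol_sum_le hp hq hy))

lemma norm_pqSymbol_sub_one_le (hp : ‖p‖ ≤ ‖q‖) (hq : ‖q‖ < 1) :
    ‖pqSymbol y p q - 1‖ ≤ Real.exp (‖y‖ / (1 - ‖q‖) ^ 2) - 1 :=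
  (norm_tprod_one_sub_sub_one_le (hasSum_pqSymbol y (hp.trans_lt hq) hq).summable).trans
    (sub_le_sub_right (Real.exp_le_exp.2 (pqSymbol_sum_le hp hq le_rfl)) _)

lemma norm_qSymbol_sub_one_le (hq : ‖q‖ < 1) :
    ‖qSymbol y q - 1‖ ≤ Real.exp (‖y‖ / (1 - ‖q‖)) - 1 := by
  rw [← tsum_qSymbol y hq]
  exact norm_tprod_one_sub_sub_one_le (summable_qSymbol y hq)

lemma le_norm_pqSymbol {K ε : ℝ} (hp : ‖p‖ ≤ ‖q‖) (hq : ‖q‖ < 1) (hy : ‖y‖ ≤ K) (hε : 0 < ε)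
    (h : ∀ j k : ℕ, ε ≤ ‖1 - y * p ^ j * q ^ k‖) :
    Real.exp (-(lowerExp ε * (K / (1 - ‖q‖) ^ 2))) ≤ ‖pqSymbol y p q‖ := by
  refine le_trans (Real.exp_le_exp.2 ?_) (exp_neg_le_norm_tprod_one_sub
    (hasSum_pqSymbol y (hp.trans_lt hq) hq).summable hε fun i => h i.1 i.2)
  have := pqSymbol_sum_le hp hq hy
  have := lowerExp_pos ε
  gcongr

lemma pqSymbol_ne_zero (hp : ‖p‖ < 1) (hq : ‖q‖ < 1)
    (h : ∀ j k : ℕ, y * p ^ j * q ^ k ≠ 1) : pqSymbol y p q ≠ 0 := by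
  have := tprod_one_add_ne_zero_of_summable (f := fun rs : ℕ × ℕ => -(y * p ^ rs.1 * q ^ rs.2))
    (fun i => by rw [← sub_eq_add_neg, sub_ne_zero]; exact (h i.1 i.2).symm)
    (by simpa using (hasSum_pqSymbol y hp hq).summable)
  simpa [pqSymbol, sub_eq_add_neg] using this

end Symbols

/-! ### Growth of `(y;q)` for large `y` -/

/-- The exponent of growth of `(y;q)` as a function of `log |y|`, for `ℓ = log |q|`. -/
def growth (ℓ t : ℝ) : ℝ := -t ^ 2 / (2 * ℓ) + t / 2

/-- For |w| ≤ 2 this is |1 - 1/w| = |1 - w|/|w|; for |w| ≥ 2 the inverse is at most 1/2. It serves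
to write a large factor 1 - w as -w(1 - 1/w), and to pass from relative distances w/y to y/w. -/
lemma norm_one_sub_inv_ge {ε : ℝ} (hε : 0 < ε) {w : ℂ} (h0 : w ≠ 0) (h : ε ≤ ‖1 - w‖) :
    min (1 / 2) (ε / 2) ≤ ‖1 - w⁻¹‖ := by
  have hw : 0 < ‖w‖ := norm_pos_iff.2 h0
  rcases le_total ‖w‖ 2 with h2 | h2
  · have : ‖1 - w⁻¹‖ = ‖1 - w‖ / ‖w‖ := by
      rw [← norm_div, ← norm_neg]; congr 1; field_simp; ring
    rw [this, le_div_iff₀ hw]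
    refine le_trans ?_ h
    have := min_le_right (1 / 2 : ℝ) (ε / 2)
    have h3 : 0 ≤ min (1 / 2 : ℝ) (ε / 2) := le_min (by norm_num) (by linarith)
    nlinarith
  · refine (min_le_left _ _).trans ?_
    have h1 : 1 - ‖w⁻¹‖ ≤ ‖1 - w⁻¹‖ := by simpa using norm_sub_norm_le (1 : ℂ) w⁻¹
    have h3 : ‖w⁻¹‖ ≤ 1 / 2 := by
      rw [norm_inv, one_div]; exact inv_anti₀ (by norm_num) h2
    linarith

section Growth

variable {logq : ℂ}

lemma norm_exp_lt_one (hq : logq.re < 0) : ‖Complex.exp logq‖ < 1 := by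
  rw [Complex.norm_exp]; exact Real.exp_lt_one_iff.2 hq

/-- The product of the factors of `(y;q)` that are large, for `y = exp L`. -/
lemma exists_large_factors (hq : logq.re < 0) (B : ℝ) (hB : 0 ≤ B) : ∃ R : ℝ, ∀ L : ℂ, -B ≤ L.re →
    ∃ n : ℕ, ‖Complex.exp L * Complex.exp logq ^ n‖ ≤ 1 ∧
      (∀ j < n, ‖(Complex.exp L * Complex.exp logq ^ j)⁻¹‖ ≤ ‖Complex.exp logq‖ ^ (n - 1 - j)) ∧
      |Real.log (∏ j ∈ Finset.range n, ‖Complex.exp L * Complex.exp logq ^ j‖)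
        - growth logq.re L.re| ≤ R := by
  set ℓ := logq.re
  have hl : 0 < -ℓ := by linarith
  -- The term -ℓ is the error of rounding the number of large factors when t > 0. The terms with B
  -- bound the growth exponent for -B ≤ t ≤ 0, where no factor is split off.
  refine ⟨-ℓ + B ^ 2 / (2 * -ℓ) + B / 2, fun L hL => ?_⟩
  set t := L.re
  have hnorm : ∀ j : ℕ, ‖Complex.exp L * Complex.exp logq ^ j‖ = Real.exp (t + j * ℓ) := fun j => by
    rw [norm_mul, norm_pow, Complex.norm_exp, Complex.norm_exp, ← Real.exp_nat_mul, ← Real.exp_add]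
  have hsum : ∀ n : ℕ, Real.log (∏ j ∈ Finset.range n, ‖Complex.exp L * Complex.exp logq ^ j‖)
      = n * t + ℓ * (n * (n - 1) / 2) := by
    intro n
    simp only [hnorm]
    rw [← Real.exp_sum, Real.log_exp, Finset.sum_add_distrib, ← Finset.sum_mul]
    have : (∑ j ∈ Finset.range n, (j : ℝ)) = n * (n - 1) / 2 := by
      induction n with
      | zero => simp
      | succ n ih => rw [Finset.sum_range_succ, ih]; push_cast; ring
    rw [this]; simp; ring
  -- This is the first index n with |y q^n| ≤ 1.
  refine ⟨⌈t / -ℓ⌉₊, ?_, ?_, ?_⟩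
  · rw [hnorm]
    apply Real.exp_le_one_iff.2
    have := Nat.le_ceil (t / -ℓ)
    rw [div_le_iff₀ hl] at this
    linarith
  · intro j hj
    rw [norm_inv, hnorm, ← Real.exp_neg, Complex.norm_exp, ← Real.exp_nat_mul]
    apply Real.exp_le_exp.2
    set n := ⌈t / -ℓ⌉₊
    have hn : 0 < t / -ℓ := by
      by_contra h; push Not at h
      have := Nat.ceil_eq_zero.2 h; omega
    have := Nat.ceil_lt_add_one hn.le
    have hle : (n : ℝ) * -ℓ < t + -ℓ := by
      have := mul_lt_mul_of_pos_right this hl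
      rwa [add_mul, div_mul_cancel₀ _ hl.ne', one_mul] at this
    have hc : ((n - 1 - j : ℕ) : ℝ) = n - 1 - j := by
      rw [Nat.cast_sub (by omega), Nat.cast_sub (by omega)]; simp
    change -(t + j * ℓ) ≤ ((n - 1 - j : ℕ) : ℝ) * ℓ
    rw [hc]; nlinarith
  · rw [hsum]
    rcases le_or_gt t 0 with ht | ht
    · have h0 : ⌈t / -ℓ⌉₊ = 0 := Nat.ceil_eq_zero.2 (div_nonpos_of_nonpos_of_nonneg ht hl.le)
      have e : growth ℓ t = t ^ 2 / (2 * -ℓ) + t / 2 := by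
        unfold growth; field_simp
      rw [h0, e]
      simp only [Nat.cast_zero, zero_mul, zero_div, mul_zero, add_zero, zero_sub, abs_neg]
      have h1 : t ^ 2 / (2 * -ℓ) ≤ B ^ 2 / (2 * -ℓ) := by
        apply div_le_div_of_nonneg_right _ (by positivity); nlinarith
      have h2 : 0 ≤ t ^ 2 / (2 * -ℓ) := by positivity
      rw [abs_le]; constructor <;> linarith
    · set n := ⌈t / -ℓ⌉₊
      have h1 : t / -ℓ ≤ n := Nat.le_ceil (t / -ℓ)
      have h2 : (n : ℝ) < t / -ℓ + 1 := Nat.ceil_lt_add_one (div_nonneg ht.le hl.le)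
      -- With r ∈ [0,1] the rounding error, the exponent of the product differs from the growth
      -- exponent by exactly -ℓ(r - r²)/2.
      obtain ⟨r, hr⟩ : ∃ r : ℝ, r = n - t / -ℓ := ⟨_, rfl⟩
      have hn : (n : ℝ) = t / -ℓ + r := by rw [hr]; ring
      have hr0 : 0 ≤ r := by rw [hr]; linarith
      have hr1 : r ≤ 1 := by rw [hr]; linarith
      have e : (n : ℝ) * t + ℓ * (n * (n - 1) / 2) - growth ℓ t = -ℓ * (r - r ^ 2) / 2 := by
        rw [hn]; unfold growth
        have : ℓ ≠ 0 := by linarith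
        field_simp; ring
      have h3 : 0 ≤ B ^ 2 / (2 * -ℓ) := by positivity
      have h4 : 0 ≤ r - r ^ 2 := by nlinarith
      have h5 : 0 ≤ -ℓ * (r - r ^ 2) := mul_nonneg hl.le h4
      have h6 : -ℓ * (r - r ^ 2) ≤ -ℓ := by nlinarith
      rw [e, abs_le]
      constructor <;> linarith

/-- Read from the last large factor backwards, the inverses are dominated by a geometric series, so
the bound does not depend on their number. -/
lemma sum_large_factors_le (hq : logq.re < 0) {L : ℂ} {n : ℕ}
    (h : ∀ j < n, ‖(Complex.exp L * Complex.exp logq ^ j)⁻¹‖ ≤ ‖Complex.exp logq‖ ^ (n - 1 - j)) :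
    ∑ j ∈ Finset.range n, ‖(Complex.exp L * Complex.exp logq ^ j)⁻¹‖ ≤
      (1 - ‖Complex.exp logq‖)⁻¹ := by
  have hq1 := norm_exp_lt_one hq
  calc _ ≤ ∑ j ∈ Finset.range n, ‖Complex.exp logq‖ ^ (n - 1 - j) :=
        Finset.sum_le_sum fun j hj => h j (Finset.mem_range.1 hj)
    _ = ∑ j ∈ Finset.range n, ‖Complex.exp logq‖ ^ j := Finset.sum_range_reflect _ _
    _ ≤ _ := by
        rw [← tsum_geometric_of_lt_one (norm_nonneg _) hq1]
        exact (summable_geometric_of_lt_one (norm_nonneg _) hq1).sum_le_tsum _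
          fun _ _ => by positivity

lemma norm_prod_large_factors {L : ℂ} (n : ℕ) :
    ‖∏ j ∈ Finset.range n, (1 - Complex.exp L * Complex.exp logq ^ j)‖ =
      (∏ j ∈ Finset.range n, ‖Complex.exp L * Complex.exp logq ^ j‖) *
      ‖∏ j ∈ Finset.range n, (1 - (Complex.exp L * Complex.exp logq ^ j)⁻¹)‖ := by
  rw [norm_prod, norm_prod, ← Finset.prod_mul_distrib]
  refine Finset.prod_congr rfl fun j _ => ?_
  have : Complex.exp L * Complex.exp logq ^ j ≠ 0 :=
    mul_ne_zero (Complex.exp_ne_zero _) (pow_ne_zero _ (Complex.exp_ne_zero _))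
  rw [← norm_mul, ← norm_neg]; congr 1; field_simp; ring

lemma prod_large_factors_pos {L : ℂ} (n : ℕ) :
    0 < ∏ j ∈ Finset.range n, ‖Complex.exp L * Complex.exp logq ^ j‖ :=
  Finset.prod_pos fun _ _ => norm_pos_iff.2
    (mul_ne_zero (Complex.exp_ne_zero _) (pow_ne_zero _ (Complex.exp_ne_zero _)))

/-- The large factors contribute their absolute values, which give the growth term, times factors 1
- 1/w with uniformly summable 1/w. The remaining symbol has its argument in the closed unit disc. -/
lemma norm_qSymbol_exp_le (hq : logq.re < 0) {B : ℝ} (hB : 0 ≤ B) : ∃ C > 0, ∀ L : ℂ, -B ≤ L.re →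
    ‖qSymbol (Complex.exp L) (Complex.exp logq)‖ ≤ C * Real.exp (growth logq.re L.re) := by
  obtain ⟨R, hR⟩ := exists_large_factors hq B hB
  have hq1 := norm_exp_lt_one hq
  refine ⟨Real.exp R * Real.exp ((1 - ‖Complex.exp logq‖)⁻¹) *
    Real.exp (1 / (1 - ‖Complex.exp logq‖)), by positivity, fun L hL => ?_⟩
  obtain ⟨n, h1, h2, h3⟩ := hR L hL
  rw [qSymbol_eq_prod_mul _ hq1 n, norm_mul, norm_prod_large_factors]
  have h4 : (∏ j ∈ Finset.range n, ‖Complex.exp L * Complex.exp logq ^ j‖) ≤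
      Real.exp R * Real.exp (growth logq.re L.re) := by
    rw [← Real.exp_add, ← Real.log_le_iff_le_exp (prod_large_factors_pos n)]
    linarith [(abs_le.1 h3).2]
  have h5 := (norm_prod_one_sub_le (fun j => (Complex.exp L * Complex.exp logq ^ j)⁻¹)
    (Finset.range n)).trans (Real.exp_le_exp.2 (sum_large_factors_le hq h2))
  have h6 := norm_qSymbol_le hq1 h1
  calc _ ≤ (Real.exp R * Real.exp (growth logq.re L.re)) *
        Real.exp ((1 - ‖Complex.exp logq‖)⁻¹) * Real.exp (1 / (1 - ‖Complex.exp logq‖)) := by gcongr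
    _ = _ := by ring

lemma le_norm_qSymbol_exp (hq : logq.re < 0) {B : ℝ} (hB : 0 ≤ B) {ε : ℝ} (hε : 0 < ε) :
    ∃ c > 0, ∀ L : ℂ, -B ≤ L.re →
    (∀ k : ℕ, ε ≤ ‖1 - Complex.exp L * Complex.exp logq ^ k‖) →
    c * Real.exp (growth logq.re L.re) ≤ ‖qSymbol (Complex.exp L) (Complex.exp logq)‖ := by
  obtain ⟨R, hR⟩ := exists_large_factors hq B hB
  have hq1 := norm_exp_lt_one hq
  set ε' := min (1 / 2) (ε / 2)
  have hε' : 0 < ε' := lt_min (by norm_num) (by linarith)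
  refine ⟨Real.exp (-R) * Real.exp (-(lowerExp ε' * (1 - ‖Complex.exp logq‖)⁻¹)) *
    Real.exp (-(lowerExp ε * (1 / (1 - ‖Complex.exp logq‖)))), by positivity, fun L hL hd => ?_⟩
  obtain ⟨n, h1, h2, h3⟩ := hR L hL
  rw [qSymbol_eq_prod_mul _ hq1 n, norm_mul, norm_prod_large_factors]
  have h4 : Real.exp (-R) * Real.exp (growth logq.re L.re) ≤
      (∏ j ∈ Finset.range n, ‖Complex.exp L * Complex.exp logq ^ j‖) := by
    rw [← Real.exp_add, ← Real.le_log_iff_exp_le (prod_large_factors_pos n)]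
    linarith [(abs_le.1 h3).1]
  have h5 := exp_neg_le_norm_prod_one_sub (fun j => (Complex.exp L * Complex.exp logq ^ j)⁻¹)
    hε' (Finset.range n) fun j _ => norm_one_sub_inv_ge hε
      (mul_ne_zero (Complex.exp_ne_zero _) (pow_ne_zero _ (Complex.exp_ne_zero _))) (hd j)
  have h5' : Real.exp (-(lowerExp ε' * (1 - ‖Complex.exp logq‖)⁻¹)) ≤
      ‖∏ j ∈ Finset.range n, (1 - (Complex.exp L * Complex.exp logq ^ j)⁻¹)‖ := by
    refine le_trans (Real.exp_le_exp.2 ?_) h5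
    have := sum_large_factors_le hq h2
    have := lowerExp_pos ε'
    gcongr
  have h6 := le_norm_qSymbol hq1 h1 hε fun k => by
    have := hd (n + k)
    rwa [pow_add, ← mul_assoc] at this
  calc _ = (Real.exp (-R) * Real.exp (growth logq.re L.re)) *
        Real.exp (-(lowerExp ε' * (1 - ‖Complex.exp logq‖)⁻¹)) *
        Real.exp (-(lowerExp ε * (1 / (1 - ‖Complex.exp logq‖)))) := by ring
    _ ≤ _ := by gcongr

end Growth

/-! ### Normalizing factors -/

/-- `q^{G v² / 2} (y^b x^G q^{-b/2})^v`. -/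
def scaleFactor (logq logx : ℂ) (v : ℤ) (b G : ℝ) (logy : ℂ) : ℂ :=
  Complex.exp ((G : ℂ) * (v : ℂ) ^ 2 / 2 * logq +
    (v : ℂ) * ((b : ℂ) * logy + (G : ℂ) * logx - (b : ℂ) * logq / 2))

/-- The factor by which `(p^b y;q)` has to be multiplied in order to be bounded. -/
def thetaFactor (logq logx : ℂ) (v : ℤ) (b : ℝ) (logy : ℂ) : ℂ :=
  scaleFactor logq logx v b (b ^ 2) logy

section Factors

variable (logq logx : ℂ) (v : ℤ)

lemma scaleFactor_ne_zero (b G : ℝ) (logy : ℂ) : scaleFactor logq logx v b G logy ≠ 0 :=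
  Complex.exp_ne_zero _

lemma scaleFactor_mul (b b' G G' : ℝ) (logy : ℂ) :
    scaleFactor logq logx v b G logy * scaleFactor logq logx v b' G' logy =
      scaleFactor logq logx v (b + b') (G + G') logy := by
  unfold scaleFactor
  rw [← Complex.exp_add]; congr 1; push_cast; ring

lemma scaleFactor_zero (logy : ℂ) : scaleFactor logq logx v 0 0 logy = 1 := by
  simp [scaleFactor]

lemma scaleFactor_inv (b G : ℝ) (logy : ℂ) :
    (scaleFactor logq logx v b G logy)⁻¹ = scaleFactor logq logx v (-b) (-G) logy := by
  unfold scaleFactor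
  rw [← Complex.exp_neg]; congr 1; push_cast; ring

/-- This mirrors θ(q/y;q) = θ(y;q) and later allows the assumption b ≤ 0. -/
lemma thetaFactor_neg (b : ℝ) (logy : ℂ) :
    thetaFactor logq logx v (-b) (logq - logy) = thetaFactor logq logx v b logy := by
  unfold thetaFactor scaleFactor
  congr 1; push_cast; ring

lemma norm_scaleFactor (b G : ℝ) (logy : ℂ) :
    ‖scaleFactor logq logx v b G logy‖ = Real.exp (G * (v : ℝ) ^ 2 / 2 * logq.re +
      v * (b * logy.re + G * logx.re - b * logq.re / 2)) := by
  have e : (G : ℂ) * (v : ℂ) ^ 2 / 2 * logq +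
    (v : ℂ) * ((b : ℂ) * logy + (G : ℂ) * logx - (b : ℂ) * logq / 2) =
    ((G * (v : ℝ) ^ 2 / 2 : ℝ) : ℂ) * logq + ((v : ℝ) : ℂ) * ((b : ℂ) * logy + (G : ℂ) * logx -
      ((b / 2 : ℝ) : ℂ) * logq) := by push_cast; ring
  rw [scaleFactor, Complex.norm_exp, e]
  simp only [Complex.add_re, Complex.sub_re, Complex.re_ofReal_mul]
  congr 2; ring

/-- The sums of a+j and of (a+j)² telescope to differences of `binomTwo` and `gPoly`; this is where
the order functions b and G of Γ come from. -/
lemma prod_thetaFactor (a : ℝ) (logy : ℂ) (n : ℕ) :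
    ∏ j ∈ Finset.range n, thetaFactor logq logx v (a + j) logy =
      scaleFactor logq logx v (binomTwo (a + n) - binomTwo a) (gPoly (a + n) - gPoly a) logy := by
  induction n with
  | zero => simp [scaleFactor_zero]
  | succ n ih =>
    rw [Finset.prod_range_succ, ih, thetaFactor, scaleFactor_mul]
    congr 1 <;> simp only [binomTwo, gPoly] <;> push_cast <;> ring

lemma sobGamma_zpow (a : ℝ) (logy : ℂ) :
    Complex.exp ((gDiff a : ℂ) * (v : ℂ) ^ 2 / 2 * logq) * sobGamma logq logx a logy ^ v =
      scaleFactor logq logx v (binomDiff a) (gDiff a) logy := by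
  rw [sobGamma, ← Complex.exp_int_mul, ← Complex.exp_add, scaleFactor]

lemma sobThetaQ_zpow (a : ℝ) (logy : ℂ) :
    Complex.exp (((a ^ 2 : ℝ) : ℂ) * (v : ℂ) ^ 2 / 2 * logq) * sobThetaQ logq logx a logy ^ v =
      thetaFactor logq logx v a logy := by
  rw [sobThetaQ, ← Complex.exp_int_mul, ← Complex.exp_add, thetaFactor, scaleFactor]
  push_cast; rfl

end Factors

/-- The substitution a ↦ 1 - a belongs to the reflection y ↦ pq/y, which inverts Γ. Together with y
↦ q/y this symmetry of b and the antisymmetry of G invert the normalizing factor as well. -/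
lemma binomDiff_one_sub (a : ℝ) : binomDiff (1 - a) = binomDiff a := by
  have : binomTwo (Int.fract (1 - a)) = binomTwo (Int.fract a) := by
    rw [show (1 - a : ℝ) = -a + (1 : ℤ) by push_cast; ring, Int.fract_add_intCast]
    rcases eq_or_ne (Int.fract a) 0 with h | h
    · rw [h, Int.fract_neg_eq_zero.2 h]
    · rw [Int.fract_neg h]; unfold binomTwo; ring
  unfold binomDiff; rw [this]; unfold binomTwo; ring

lemma gDiff_one_sub (a : ℝ) : gDiff (1 - a) = -gDiff a := by
  have : gPoly (Int.fract (1 - a)) = -gPoly (Int.fract a) := by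
    rw [show (1 - a : ℝ) = -a + (1 : ℤ) by push_cast; ring, Int.fract_add_intCast]
    rcases eq_or_ne (Int.fract a) 0 with h | h
    · rw [h, Int.fract_neg_eq_zero.2 h]; simp [gPoly]
    · rw [Int.fract_neg h]; unfold gPoly; ring
  unfold gDiff; rw [this]; unfold gPoly; ring

lemma scaleFactor_one_sub (logq logx : ℂ) (v : ℤ) (a : ℝ) (logy : ℂ) :
    scaleFactor logq logx v (binomDiff (1 - a)) (gDiff (1 - a)) (logq - logy) =
      (scaleFactor logq logx v (binomDiff a) (gDiff a) logy)⁻¹ := by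
  rw [scaleFactor_inv, binomDiff_one_sub, gDiff_one_sub]
  unfold scaleFactor; congr 1; push_cast; ring

lemma ellGamma_reflect {p q y : ℂ} (hp : p ≠ 0) (hq : q ≠ 0) (hy : y ≠ 0) :
    ellGamma (p * q / y) p q = (ellGamma y p q)⁻¹ := by
  unfold ellGamma
  rw [inv_div, show p * q / (p * q / y) = y by field_simp]

lemma theta_reflect {q y : ℂ} (hq : q ≠ 0) (hy : y ≠ 0) : theta (q / y) q = theta y q := by
  unfold theta
  rw [show q / (q / y) = y by field_simp, mul_comm]

/-! ### Bounds for the building blocks -/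

namespace Data

variable (P : Data)

lemma q_ne_zero : P.q ≠ 0 := Complex.exp_ne_zero _
lemma ppow_ne_zero (v : ℤ) (a : ℝ) : P.ppow v a ≠ 0 := Complex.exp_ne_zero _

lemma norm_q : ‖P.q‖ = Real.exp P.logq.re := Complex.norm_exp _

lemma norm_q_lt_one (hq : P.logq.re < 0) : ‖P.q‖ < 1 := norm_exp_lt_one hq

lemma ppow_add (v : ℤ) (a b : ℝ) : P.ppow v (a + b) = P.ppow v a * P.ppow v b := by
  unfold ppow; rw [← Complex.exp_add]; congr 1; push_cast; ring

lemma ppow_neg (v : ℤ) (a : ℝ) : P.ppow v (-a) = (P.ppow v a)⁻¹ := by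
  unfold ppow; rw [← Complex.exp_neg]; congr 1; push_cast; ring

lemma ppow_zero (v : ℤ) : P.ppow v 0 = 1 := by simp [ppow]

lemma p_pow (v : ℤ) (j : ℕ) : P.p v ^ j = P.ppow v j := by
  unfold p ppow; rw [← Complex.exp_nat_mul]; congr 1; push_cast; ring

lemma norm_ppow (v : ℤ) (a : ℝ) :
    ‖P.ppow v a‖ = Real.exp (a * (P.logx.re + v * P.logq.re)) := by
  have : (a : ℂ) * (P.logx + (v : ℂ) * P.logq) =
      (a : ℂ) * (P.logx + ((v : ℝ) : ℂ) * P.logq) := by push_cast; rfl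
  rw [ppow, Complex.norm_exp, this, Complex.re_ofReal_mul, Complex.add_re, Complex.re_ofReal_mul]

/-- `log |p|`. -/
def logp (v : ℤ) : ℝ := P.logx.re + v * P.logq.re

lemma norm_p (v : ℤ) : ‖P.p v‖ = Real.exp (P.logp v) := by
  rw [p, norm_ppow, one_mul]; rfl

lemma logp_lt {v : ℤ} (hv : ‖P.p v‖ < ‖P.q‖) : P.logp v < P.logq.re := by
  rwa [norm_p, norm_q, Real.exp_lt_exp] at hv

lemma ppow_mul_exp (v : ℤ) (a : ℝ) (logy : ℂ) :
    P.ppow v a * Complex.exp logy = Complex.exp ((a : ℂ) * (P.logx + (v : ℂ) * P.logq) + logy) := by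
  rw [ppow, ← Complex.exp_add]

lemma re_log (v : ℤ) (a : ℝ) (logy : ℂ) :
    ((a : ℂ) * (P.logx + (v : ℂ) * P.logq) + logy).re = a * P.logp v + logy.re := by
  have : (a : ℂ) * (P.logx + (v : ℂ) * P.logq) =
      (a : ℂ) * (P.logx + ((v : ℝ) : ℂ) * P.logq) := by push_cast; rfl
  rw [Complex.add_re, this, Complex.re_ofReal_mul, Complex.add_re, Complex.re_ofReal_mul]; rfl

lemma norm_ppow_mul_exp (v : ℤ) (a : ℝ) (logy : ℂ) :
    ‖P.ppow v a * Complex.exp logy‖ = Real.exp (a * P.logp v + logy.re) := by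
  rw [ppow_mul_exp, Complex.norm_exp, re_log]

/-- With log|p^b y| inserted, the growth exponent is a quadratic polynomial in v. The normalizing
factor cancels its terms in v² and v exactly, so s is the value at v = 0, which is bounded. -/
lemma growth_add_log_norm (hq : P.logq.re < 0) {B : ℝ} {b : ℝ} {logy : ℂ} (v : ℤ)
    (hb : |b| ≤ B) (hy : |logy.re| ≤ B) :
    ∃ s : ℝ, |s| ≤ (B * |P.logx.re| + B) ^ 2 / (2 * -P.logq.re) + (B * |P.logx.re| + B) ∧
      Real.exp (growth P.logq.re (b * P.logp v + logy.re)) *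
        ‖thetaFactor P.logq P.logx v b logy‖ = Real.exp s := by
  have hl : P.logq.re ≠ 0 := hq.ne
  refine ⟨growth P.logq.re (b * P.logx.re + logy.re), ?_, ?_⟩
  · set t := b * P.logx.re + logy.re
    have ht : |t| ≤ B * |P.logx.re| + B := by
      refine (abs_add_le _ _).trans (add_le_add ?_ hy)
      rw [abs_mul]; gcongr
    have h0 := abs_nonneg t
    have h1 : growth P.logq.re t = t ^ 2 / (2 * -P.logq.re) + t / 2 := by
      unfold growth; field_simp
    have h2 : t ^ 2 ≤ (B * |P.logx.re| + B) ^ 2 := sq_le_sq' (by linarith [neg_abs_le t]) (by linarith [le_abs_self t])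
    rw [h1]
    refine (abs_add_le _ _).trans (add_le_add ?_ ?_)
    · rw [abs_of_nonneg (div_nonneg (sq_nonneg _) (by linarith))]
      exact div_le_div_of_nonneg_right h2 (by linarith)
    · rw [abs_div, abs_two]; linarith
  · rw [thetaFactor, norm_scaleFactor, ← Real.exp_add]
    congr 1
    unfold growth logp; field_simp; ring

/-- `(p^b y;q)` has a first and second order upper bound. -/
lemma norm_qSymbol_mul_le (hq : P.logq.re < 0) (B : ℝ) : ∃ C ≥ 1, ∀ (v : ℤ) (b : ℝ) (logy : ℂ),
    |b| ≤ B → |logy.re| ≤ B → 0 ≤ b * P.logp v →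
    ‖qSymbol (P.ppow v b * Complex.exp logy) P.q * thetaFactor P.logq P.logx v b logy‖ ≤ C := by
  obtain ⟨C, hC, h⟩ := norm_qSymbol_exp_le hq (abs_nonneg B)
  set R := (B * |P.logx.re| + B) ^ 2 / (2 * -P.logq.re) + (B * |P.logx.re| + B)
  refine ⟨max 1 (C * Real.exp R), le_max_left _ _, fun v b logy hb hy hp => ?_⟩
  obtain ⟨s, hs, hs'⟩ := P.growth_add_log_norm hq v hb hy
  have h1 := h ((b : ℂ) * (P.logx + (v : ℂ) * P.logq) + logy) (by
    rw [re_log]; linarith [neg_abs_le logy.re, le_abs_self B])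
  rw [re_log] at h1
  refine le_trans ?_ (le_max_right _ _)
  rw [norm_mul, ppow_mul_exp]
  calc _ ≤ C * Real.exp (growth P.logq.re (b * P.logp v + logy.re)) *
        ‖thetaFactor P.logq P.logx v b logy‖ := by gcongr; exact h1
    _ = C * Real.exp s := by rw [mul_assoc, hs']
    _ ≤ _ := by gcongr; exact (le_abs_self s).trans hs

lemma le_norm_qSymbol_mul (hq : P.logq.re < 0) (B : ℝ) {ε : ℝ} (hε : 0 < ε) :
    ∃ c > 0, c ≤ 1 ∧ ∀ (v : ℤ) (b : ℝ) (logy : ℂ),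
    |b| ≤ B → |logy.re| ≤ B → 0 ≤ b * P.logp v →
    (∀ k : ℕ, ε ≤ ‖1 - P.ppow v b * Complex.exp logy * P.q ^ k‖) →
    c ≤ ‖qSymbol (P.ppow v b * Complex.exp logy) P.q * thetaFactor P.logq P.logx v b logy‖ := by
  obtain ⟨c, hc, h⟩ := le_norm_qSymbol_exp hq (abs_nonneg B) hε
  set R := (B * |P.logx.re| + B) ^ 2 / (2 * -P.logq.re) + (B * |P.logx.re| + B)
  refine ⟨min 1 (c * Real.exp (-R)), lt_min one_pos (by positivity), min_le_left _ _,
    fun v b logy hb hy hp hd => ?_⟩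
  obtain ⟨s, hs, hs'⟩ := P.growth_add_log_norm hq v hb hy
  have h1 := h ((b : ℂ) * (P.logx + (v : ℂ) * P.logq) + logy) (by
    rw [re_log]; linarith [neg_abs_le logy.re, le_abs_self B])
    (by rw [← ppow_mul_exp]; exact hd)
  rw [re_log] at h1
  refine le_trans (min_le_right _ _) ?_
  rw [norm_mul, ppow_mul_exp]
  calc c * Real.exp (-R) ≤ c * Real.exp s := by gcongr; linarith [neg_abs_le s]
    _ = c * Real.exp (growth P.logq.re (b * P.logp v + logy.re)) *
        ‖thetaFactor P.logq P.logx v b logy‖ := by rw [mul_assoc, hs']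
    _ ≤ _ := by gcongr; exact h1

lemma pqSymbol_split (hq : P.logq.re < 0) {v : ℤ} (hv : ‖P.p v‖ < ‖P.q‖) (a : ℝ) (logy : ℂ) (n : ℕ) :
    pqSymbol (P.ppow v a * Complex.exp logy) (P.p v) P.q =
      (∏ j ∈ Finset.range n, qSymbol (P.ppow v (a + j) * Complex.exp logy) P.q) *
        pqSymbol (P.ppow v (a + n) * Complex.exp logy) (P.p v) P.q := by
  have hq1 := P.norm_q_lt_one hq
  rw [pqSymbol_eq_prod_mul _ (hv.trans hq1) hq1 n]
  simp only [p_pow, ppow_add]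
  congr 2
  · ext j; ring_nf
  · ring

lemma norm_ppow_mul_exp_le {v : ℤ} (hp : P.logp v ≤ 0) {a B : ℝ} (ha : 0 ≤ a) {logy : ℂ}
    (hy : |logy.re| ≤ B) : ‖P.ppow v a * Complex.exp logy‖ ≤ Real.exp B := by
  rw [norm_ppow_mul_exp]
  apply Real.exp_le_exp.2
  nlinarith [le_abs_self logy.re]

/-- Each peeled-off q-symbol has exponent a+j ≤ 0 and is balanced by its own `thetaFactor`. The
remaining symbol has exponent a+n ≥ 0, hence a bounded argument. -/
lemma norm_pqSymbol_mul_le (hq : P.logq.re < 0) (B : ℝ) (N : ℕ) :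
    ∃ C ≥ 1, ∀ v : ℤ, ‖P.p v‖ < ‖P.q‖ → ∀ (a : ℝ) (logy : ℂ) (n : ℕ), |a| ≤ B → |logy.re| ≤ B →
      n ≤ N → 0 ≤ a + n → (∀ j < n, a + j ≤ 0) →
      ‖pqSymbol (P.ppow v a * Complex.exp logy) (P.p v) P.q *
        ∏ j ∈ Finset.range n, thetaFactor P.logq P.logx v (a + j) logy‖ ≤ C := by
  obtain ⟨C, hC, h⟩ := P.norm_qSymbol_mul_le hq B
  have hq1 := P.norm_q_lt_one hq
  refine ⟨C ^ N * Real.exp (Real.exp B / (1 - ‖P.q‖) ^ 2), ?_, fun v hv a logy n ha hy hn h1 h2 => ?_⟩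
  · have : 1 ≤ Real.exp (Real.exp B / (1 - ‖P.q‖) ^ 2) := Real.one_le_exp (by positivity)
    have := one_le_pow₀ (n := N) hC
    nlinarith
  · have hp := (P.logp_lt hv).trans hq
    rw [P.pqSymbol_split hq hv a logy n, mul_right_comm, ← Finset.prod_mul_distrib, norm_mul,
      norm_prod]
    have h3 : ∏ j ∈ Finset.range n, ‖qSymbol (P.ppow v (a + j) * Complex.exp logy) P.q *
        thetaFactor P.logq P.logx v (a + j) logy‖ ≤ C ^ n := by
      rw [← Finset.card_range n, ← Finset.prod_const]
      rw [Finset.card_range]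
      refine Finset.prod_le_prod (fun _ _ => norm_nonneg _) fun j hj => h _ _ _ ?_ hy ?_
      · have := h2 j (Finset.mem_range.1 hj)
        rw [abs_of_nonpos this]; linarith [neg_abs_le a, (Nat.cast_nonneg j : (0 : ℝ) ≤ j)]
      · exact mul_nonneg_of_nonpos_of_nonpos (h2 j (Finset.mem_range.1 hj)) hp.le
    have h4 := norm_pqSymbol_le hv.le hq1 (P.norm_ppow_mul_exp_le hp.le h1 hy)
    have h5 : C ^ n ≤ C ^ N := pow_le_pow_right₀ hC hn
    gcongr
    exact h3.trans h5

lemma le_norm_pqSymbol_mul (hq : P.logq.re < 0) (B : ℝ) (N : ℕ) {ε : ℝ} (hε : 0 < ε) :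
    ∃ c > 0, ∀ v : ℤ, ‖P.p v‖ < ‖P.q‖ → ∀ (a : ℝ) (logy : ℂ) (n : ℕ), |a| ≤ B → |logy.re| ≤ B →
      n ≤ N → 0 ≤ a + n → (∀ j < n, a + j ≤ 0) →
      (∀ j k : ℕ, ε ≤ ‖1 - P.ppow v a * Complex.exp logy * P.p v ^ j * P.q ^ k‖) →
      c ≤ ‖pqSymbol (P.ppow v a * Complex.exp logy) (P.p v) P.q *
        ∏ j ∈ Finset.range n, thetaFactor P.logq P.logx v (a + j) logy‖ := by
  obtain ⟨c, hc, hc1, h⟩ := P.le_norm_qSymbol_mul hq B hε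
  have hq1 := P.norm_q_lt_one hq
  refine ⟨c ^ N * Real.exp (-(lowerExp ε * (Real.exp B / (1 - ‖P.q‖) ^ 2))), by positivity,
    fun v hv a logy n ha hy hn h1 h2 hd => ?_⟩
  have hp := (P.logp_lt hv).trans hq
  rw [P.pqSymbol_split hq hv a logy n, mul_right_comm, ← Finset.prod_mul_distrib, norm_mul,
    norm_prod]
  have hd' : ∀ j k i : ℕ, ε ≤ ‖1 - P.ppow v (a + j) * Complex.exp logy * P.p v ^ i * P.q ^ k‖ := by
    intro j k i
    have := hd (j + i) k
    rw [pow_add, p_pow, p_pow] at this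
    rw [ppow_add, p_pow]
    convert this using 3; ring
  have h3 : c ^ n ≤ ∏ j ∈ Finset.range n, ‖qSymbol (P.ppow v (a + j) * Complex.exp logy) P.q *
      thetaFactor P.logq P.logx v (a + j) logy‖ := by
    calc c ^ n = ∏ _j ∈ Finset.range n, c := by simp
      _ ≤ _ := Finset.prod_le_prod (fun _ _ => hc.le) fun j hj => h _ _ _ ?_ hy ?_ ?_
    · have := h2 j (Finset.mem_range.1 hj)
      rw [abs_of_nonpos this]; linarith [neg_abs_le a, (Nat.cast_nonneg j : (0 : ℝ) ≤ j)]
    · exact mul_nonneg_of_nonpos_of_nonpos (h2 j (Finset.mem_range.1 hj)) hp.le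
    · intro k; simpa using hd' j k 0
  have h4 := le_norm_pqSymbol hv.le hq1 (P.norm_ppow_mul_exp_le hp.le h1 hy) hε
    (fun i k => hd' n k i)
  have h5 : c ^ N ≤ c ^ n := pow_le_pow_of_le_one hc.le hc1 hn
  gcongr
  exact h5.trans h3

end Data

/-! ### Two-sided bounds for the elliptic gamma function. -/

lemma scaleFactor_neg_left (logq logx : ℂ) (v : ℤ) (b G : ℝ) (logy : ℂ) :
    scaleFactor logq logx v (-b) G (logq - logy) = scaleFactor logq logx v b G logy := by
  unfold scaleFactor; congr 1; push_cast; ring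

/-- The numerator (pq/y;p,q) of Γ requires ⌊a⌋ peeled factors and the denominator -⌊a⌋. As `toNat`
truncates at zero, at least one of the two products is empty. -/
lemma scaleFactor_gamma (logq logx : ℂ) (v : ℤ) (a : ℝ) (logy : ℂ) :
    scaleFactor logq logx v (binomDiff a) (gDiff a) logy =
      (∏ j ∈ Finset.range ⌊a⌋.toNat, thetaFactor logq logx v (1 - a + j) (logq - logy)) /
      ∏ j ∈ Finset.range (-⌊a⌋).toNat, thetaFactor logq logx v (a + j) logy := by
  rw [prod_thetaFactor, prod_thetaFactor]
  have hf := Int.self_sub_floor a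
  rcases le_total 0 ⌊a⌋ with h | h
  · have h1 : (-⌊a⌋).toNat = 0 := by omega
    have h2 : ((⌊a⌋.toNat : ℕ) : ℝ) = ⌊a⌋ := by exact_mod_cast Int.toNat_of_nonneg h
    have h3 : 1 - a + (⌊a⌋ : ℝ) = 1 - Int.fract a := by rw [← hf]; ring
    rw [h1, h2, h3, ← scaleFactor_neg_left]
    simp only [Nat.cast_zero, add_zero, sub_self, scaleFactor_zero, div_one]
    congr 1 <;> simp only [binomDiff, gDiff, binomTwo, gPoly] <;> ring
  · have h1 : ⌊a⌋.toNat = 0 := by omega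
    have h2 : (((-⌊a⌋).toNat : ℕ) : ℝ) = -⌊a⌋ := by
      exact_mod_cast Int.toNat_of_nonneg (by omega : 0 ≤ -⌊a⌋)
    have h3 : a + -(⌊a⌋ : ℝ) = Int.fract a := by rw [← hf]; ring
    rw [h1, h2, h3]
    simp only [Nat.cast_zero, add_zero, sub_self, scaleFactor_zero]
    rw [one_div, scaleFactor_inv]
    congr 1 <;> simp only [binomDiff, gDiff] <;> ring

namespace Data

variable (P : Data)

lemma p_ne_zero (v : ℤ) : P.p v ≠ 0 := P.ppow_ne_zero v 1

lemma reflect_arg (v : ℤ) (a : ℝ) (logy : ℂ) :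
    P.p v * P.q / (P.ppow v a * Complex.exp logy) =
      P.ppow v (1 - a) * Complex.exp (P.logq - logy) := by
  rw [p, q, ppow_mul_exp, ppow_mul_exp, ppow, ← Complex.exp_add, ← Complex.exp_sub]
  congr 1; push_cast; ring

lemma ellGamma_mul_scaleFactor (v : ℤ) (a : ℝ) (logy : ℂ) :
    ellGamma (P.ppow v a * Complex.exp logy) (P.p v) P.q *
      scaleFactor P.logq P.logx v (binomDiff a) (gDiff a) logy =
    (pqSymbol (P.ppow v (1 - a) * Complex.exp (P.logq - logy)) (P.p v) P.q *
      ∏ j ∈ Finset.range ⌊a⌋.toNat, thetaFactor P.logq P.logx v (1 - a + j) (P.logq - logy)) /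
    (pqSymbol (P.ppow v a * Complex.exp logy) (P.p v) P.q *
      ∏ j ∈ Finset.range (-⌊a⌋).toNat, thetaFactor P.logq P.logx v (a + j) logy) := by
  rw [ellGamma, reflect_arg, scaleFactor_gamma, div_mul_div_comm]

lemma toNat_floor_cond (a : ℝ) : 0 ≤ a + ((-⌊a⌋).toNat : ℕ) ∧
    (∀ j < (-⌊a⌋).toNat, a + (j : ℝ) ≤ 0) ∧ 0 ≤ 1 - a + (⌊a⌋.toNat : ℕ) ∧
    ∀ j < ⌊a⌋.toNat, 1 - a + (j : ℝ) ≤ 0 := by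
  have h1 := Int.floor_le a
  have h2 := Int.lt_floor_add_one a
  have h3 : (-(⌊a⌋ : ℝ)) ≤ ((-⌊a⌋).toNat : ℕ) := by exact_mod_cast Int.self_le_toNat (-⌊a⌋)
  have h4 : (⌊a⌋ : ℝ) ≤ (⌊a⌋.toNat : ℕ) := by exact_mod_cast Int.self_le_toNat ⌊a⌋
  refine ⟨by linarith, fun j hj => ?_, by linarith, fun j hj => ?_⟩
  · have : (j : ℤ) + 1 ≤ -⌊a⌋ := by omega
    have : (j : ℝ) + 1 ≤ -⌊a⌋ := by exact_mod_cast this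
    linarith
  · have : (j : ℤ) + 1 ≤ ⌊a⌋ := by omega
    have : (j : ℝ) + 1 ≤ ⌊a⌋ := by exact_mod_cast this
    linarith

lemma toNat_floor_le {a B : ℝ} (h : |a| ≤ B) : ⌊a⌋.toNat ≤ ⌈B⌉₊ + 1 ∧ (-⌊a⌋).toNat ≤ ⌈B⌉₊ + 1 := by
  have h1 := Int.floor_le a
  have h2 := Int.lt_floor_add_one a
  have h3 := Nat.le_ceil B
  have h4 := abs_le.1 h
  have h5 : (⌊a⌋ : ℝ) < ((⌈B⌉₊ + 1 : ℕ) : ℤ) := by push_cast; linarith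
  have h6 : ((-⌊a⌋ : ℤ) : ℝ) < ((⌈B⌉₊ + 1 : ℕ) : ℤ) := by push_cast; linarith
  have h7 := Int.cast_lt.1 h5
  have h8 := Int.cast_lt.1 h6
  omega

/-- The numerator is bounded above everywhere and the denominator below away from its zeros, so only
the poles have to be avoided. -/
lemma norm_ellGamma_mul_le (hq : P.logq.re < 0) (B : ℝ) {ε : ℝ} (hε : 0 < ε) :
    ∃ C > 0, ∀ v : ℤ, ‖P.p v‖ < ‖P.q‖ → ∀ (a : ℝ) (logy : ℂ), |a| ≤ B → |logy.re| ≤ B →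
      (∀ j k : ℕ, ε ≤ ‖1 - P.ppow v a * Complex.exp logy * P.p v ^ j * P.q ^ k‖) →
      ‖ellGamma (P.ppow v a * Complex.exp logy) (P.p v) P.q *
        scaleFactor P.logq P.logx v (binomDiff a) (gDiff a) logy‖ ≤ C := by
  -- The enlarged bound accommodates both 1 - a and log q - log y, the data of the reflected
  -- argument.
  obtain ⟨C, hC, h⟩ := P.norm_pqSymbol_mul_le hq (B + 1 - P.logq.re) (⌈B⌉₊ + 1)
  obtain ⟨c, hc, h'⟩ := P.le_norm_pqSymbol_mul hq B (⌈B⌉₊ + 1) hε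
  refine ⟨C / c, by positivity, fun v hv a logy ha hy hd => ?_⟩
  rw [ellGamma_mul_scaleFactor, norm_div]
  obtain ⟨h1, h2, h3, h4⟩ := toNat_floor_cond a
  obtain ⟨h5, h6⟩ := toNat_floor_le ha
  have h7 := h v hv (1 - a) (P.logq - logy) _ ?_ ?_ h5 h3 h4
  · have h8 := h' v hv a logy _ ha hy h6 h1 h2 hd
    gcongr
  · rw [abs_le] at ha ⊢; constructor <;> linarith
  · rw [abs_le] at hy ⊢; rw [Complex.sub_re]; constructor <;> linarith

/-- The upper bound is applied to the reflected function Γ(pq/y) = 1/Γ(y), whose poles are the zeros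
of Γ. -/
lemma le_norm_ellGamma_mul (hq : P.logq.re < 0) (B : ℝ) {ε : ℝ} (hε : 0 < ε) :
    ∃ c > 0, ∀ v : ℤ, ‖P.p v‖ < ‖P.q‖ → ∀ (a : ℝ) (logy : ℂ), |a| ≤ B → |logy.re| ≤ B →
      (∀ j k : ℕ, ε ≤ ‖1 - P.ppow v (1 - a) * Complex.exp (P.logq - logy) * P.p v ^ j * P.q ^ k‖) →
      (∀ j k : ℕ, P.ppow v a * Complex.exp logy * P.p v ^ j * P.q ^ k ≠ 1) →
      c ≤ ‖ellGamma (P.ppow v a * Complex.exp logy) (P.p v) P.q *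
        scaleFactor P.logq P.logx v (binomDiff a) (gDiff a) logy‖ := by
  obtain ⟨C, hC, h⟩ := P.norm_ellGamma_mul_le hq (B + 1 - P.logq.re) hε
  refine ⟨C⁻¹ / 2, by positivity, fun v hv a logy ha hy hd hd' => ?_⟩
  have h1 := h v hv (1 - a) (P.logq - logy) ?_ ?_ hd
  · rw [scaleFactor_one_sub, ← reflect_arg, ellGamma_reflect (P.p_ne_zero v) P.q_ne_zero
      (mul_ne_zero (P.ppow_ne_zero _ _) (Complex.exp_ne_zero _)), ← mul_inv, norm_inv] at h1
    set w := ‖ellGamma (P.ppow v a * Complex.exp logy) (P.p v) P.q *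
        scaleFactor P.logq P.logx v (binomDiff a) (gDiff a) logy‖ with hw
    -- Since the inverse of 0 is 0, an upper bound for the inverse says nothing about w unless w is
    -- known to be non-zero.
    have h2 : 0 < w := by
      rw [hw, norm_pos_iff]
      refine mul_ne_zero ?_ (scaleFactor_ne_zero _ _ _ _ _ _)
      have hp1 := hv.trans (P.norm_q_lt_one hq)
      intro h0
      unfold ellGamma at h0
      rcases div_eq_zero_iff.1 h0 with h0 | h0
      · refine pqSymbol_ne_zero hp1 (P.norm_q_lt_one hq) (fun j k hjk => ?_) h0
        have := hd j k
        rw [← reflect_arg, hjk, sub_self, norm_zero] at this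
        linarith
      · exact pqSymbol_ne_zero hp1 (P.norm_q_lt_one hq) hd' h0
    rw [inv_le_comm₀ h2 hC] at h1
    have : 0 < C⁻¹ := by positivity
    linarith
  · rw [abs_le] at ha ⊢; constructor <;> linarith
  · rw [abs_le] at hy ⊢; rw [Complex.sub_re]; constructor <;> linarith


/-! ### Two-sided bounds for theta functions of base q. -/

lemma theta_exp_reflect (v : ℤ) (b : ℝ) (logy : ℂ) :
    theta (P.ppow v (-b) * Complex.exp (P.logq - logy)) P.q =
      theta (P.ppow v b * Complex.exp logy) P.q := by
  rw [← theta_reflect P.q_ne_zero (mul_ne_zero (P.ppow_ne_zero v b) (Complex.exp_ne_zero logy)),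
    ppow_neg, Complex.exp_sub]
  congr 1; unfold q; field_simp

lemma q_div_arg (v : ℤ) (b : ℝ) (logy : ℂ) : P.q / (P.ppow v b * Complex.exp logy) =
    P.ppow v (-b) * Complex.exp (P.logq - logy) := by
  rw [ppow_neg, Complex.exp_sub]; unfold q; field_simp

/-- The symmetry y ↦ q/y reduces to b ≤ 0. Then all the growth comes from (p^b y;q), while the
argument of (q p^{-b}/y;q) is bounded. -/
lemma norm_theta_mul_le (hq : P.logq.re < 0) (B : ℝ) :
    ∃ C > 0, ∀ v : ℤ, ‖P.p v‖ < ‖P.q‖ → ∀ (b : ℝ) (logy : ℂ), |b| ≤ B → |logy.re| ≤ B →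
      ‖theta (P.ppow v b * Complex.exp logy) P.q * thetaFactor P.logq P.logx v b logy‖ ≤ C := by
  obtain ⟨C, hC, h⟩ := P.norm_qSymbol_mul_le hq (B - P.logq.re)
  have hq1 := P.norm_q_lt_one hq
  refine ⟨C * Real.exp (Real.exp (B - P.logq.re) / (1 - ‖P.q‖)), by positivity, ?_⟩
  have key : ∀ v : ℤ, ‖P.p v‖ < ‖P.q‖ → ∀ (b : ℝ) (logy : ℂ), |b| ≤ B → |logy.re| ≤ B - P.logq.re →
      |(P.logq - logy).re| ≤ B - P.logq.re → b ≤ 0 →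
      ‖theta (P.ppow v b * Complex.exp logy) P.q * thetaFactor P.logq P.logx v b logy‖ ≤
        C * Real.exp (Real.exp (B - P.logq.re) / (1 - ‖P.q‖)) := by
    intro v hv b logy hb hy hy' hb0
    have hp := (P.logp_lt hv).trans hq
    rw [theta, mul_right_comm, norm_mul, q_div_arg]
    have h1 := h v b logy (by linarith) hy (mul_nonneg_of_nonpos_of_nonpos hb0 hp.le)
    have h2 := norm_qSymbol_le hq1 (P.norm_ppow_mul_exp_le hp.le (by linarith : 0 ≤ -b) hy')
    gcongr
  intro v hv b logy hb hy
  have hy1 := abs_le.1 hy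
  rcases le_total b 0 with h0 | h0
  · exact key v hv b logy hb (by linarith)
      (by rw [abs_le, Complex.sub_re]; constructor <;> linarith) h0
  · rw [← theta_exp_reflect, ← thetaFactor_neg]
    refine key v hv (-b) _ (by rwa [abs_neg])
      (by rw [abs_le, Complex.sub_re]; constructor <;> linarith) ?_ (by linarith)
    rw [sub_sub_cancel]; linarith

lemma le_norm_theta_mul (hq : P.logq.re < 0) (B : ℝ) {ε : ℝ} (hε : 0 < ε) :
    ∃ c > 0, ∀ v : ℤ, ‖P.p v‖ < ‖P.q‖ → ∀ (b : ℝ) (logy : ℂ), |b| ≤ B → |logy.re| ≤ B →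
      (∀ k : ℕ, ε ≤ ‖1 - P.ppow v b * Complex.exp logy * P.q ^ k‖) →
      (∀ k : ℕ, ε ≤ ‖1 - P.ppow v (-b) * Complex.exp (P.logq - logy) * P.q ^ k‖) →
      c ≤ ‖theta (P.ppow v b * Complex.exp logy) P.q * thetaFactor P.logq P.logx v b logy‖ := by
  obtain ⟨c, hc, -, h⟩ := P.le_norm_qSymbol_mul hq (B - P.logq.re) hε
  have hq1 := P.norm_q_lt_one hq
  set c' := Real.exp (-(lowerExp ε * (Real.exp (B - P.logq.re) / (1 - ‖P.q‖))))
  refine ⟨c * c', by positivity, ?_⟩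
  have key : ∀ v : ℤ, ‖P.p v‖ < ‖P.q‖ → ∀ (b : ℝ) (logy : ℂ), |b| ≤ B → |logy.re| ≤ B - P.logq.re →
      |(P.logq - logy).re| ≤ B - P.logq.re → b ≤ 0 →
      (∀ k : ℕ, ε ≤ ‖1 - P.ppow v b * Complex.exp logy * P.q ^ k‖) →
      (∀ k : ℕ, ε ≤ ‖1 - P.ppow v (-b) * Complex.exp (P.logq - logy) * P.q ^ k‖) →
      c * c' ≤
        ‖theta (P.ppow v b * Complex.exp logy) P.q * thetaFactor P.logq P.logx v b logy‖ := by
    intro v hv b logy hb hy hy' hb0 hd hd'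
    have hp := (P.logp_lt hv).trans hq
    rw [theta, mul_right_comm, norm_mul, q_div_arg]
    have h1 := h v b logy (by linarith) hy (mul_nonneg_of_nonpos_of_nonpos hb0 hp.le) hd
    have h2 := le_norm_qSymbol hq1 (P.norm_ppow_mul_exp_le hp.le (by linarith : 0 ≤ -b) hy') hε hd'
    gcongr
  intro v hv b logy hb hy hd hd'
  have hy1 := abs_le.1 hy
  rcases le_total b 0 with h0 | h0
  · exact key v hv b logy hb (by linarith)
      (by rw [abs_le, Complex.sub_re]; constructor <;> linarith) h0 hd hd'
  · rw [← theta_exp_reflect, ← thetaFactor_neg]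
    refine key v hv (-b) _ (by rwa [abs_neg])
      (by rw [abs_le, Complex.sub_re]; constructor <;> linarith) ?_ (by linarith) hd' ?_
    · rw [sub_sub_cancel]; linarith
    · simpa using hd

/-! ### Theta functions of base `p` -/

lemma theta_p_reflect (v : ℤ) (a : ℝ) (logy : ℂ) :
    theta (P.ppow v (1 - a) * Complex.exp (-logy)) (P.p v) =
      theta (P.ppow v a * Complex.exp logy) (P.p v) := by
  rw [← theta_reflect (P.p_ne_zero v)
    (mul_ne_zero (P.ppow_ne_zero v a) (Complex.exp_ne_zero logy)), sub_eq_add_neg, ppow_add,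
    ppow_neg, Complex.exp_neg]
  congr 1; unfold p; field_simp

lemma p_div_arg (v : ℤ) (a : ℝ) (logy : ℂ) : P.p v / (P.ppow v a * Complex.exp logy) =
    P.ppow v (1 - a) * Complex.exp (-logy) := by
  rw [sub_eq_add_neg, ppow_add, ppow_neg, Complex.exp_neg]; unfold p; field_simp

lemma theta_p_split (hq : P.logq.re < 0) {v : ℤ} (hv : ‖P.p v‖ < ‖P.q‖) (a : ℝ) (logy : ℂ) (n : ℕ) :
    theta (P.ppow v a * Complex.exp logy) (P.p v) =
      (∏ j ∈ Finset.range n, (1 - P.ppow v (a + j) * Complex.exp logy)) *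
        qSymbol (P.ppow v (a + n) * Complex.exp logy) (P.p v) *
        qSymbol (P.ppow v (1 - a) * Complex.exp (-logy)) (P.p v) := by
  have hp1 := hv.trans (P.norm_q_lt_one hq)
  rw [theta, p_div_arg, qSymbol_eq_prod_mul _ hp1 n]
  simp only [p_pow, ppow_add]
  congr 3
  · ext j; ring_nf
  · ring

lemma norm_sobThetaP_zpow (v : ℤ) (a : ℝ) :
    ‖sobThetaP P.logq a ^ v‖ = Real.exp (binomDiff a * v * P.logq.re) := by
  rw [sobThetaP, ← Complex.exp_int_mul, Complex.norm_exp]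
  have : (v : ℂ) * ((binomDiff a : ℂ) * P.logq) = ((v * binomDiff a : ℝ) : ℂ) * P.logq := by
    push_cast; ring
  rw [this, Complex.re_ofReal_mul]; congr 1; ring

/-- The absolute values of the large factors of `θ(p^a y;p)`, multiplied by the second order
behaviour. -/
lemma prod_norm_mul_norm_sobThetaP {a : ℝ} (ha : a < 1) (v : ℤ) (logy : ℂ) :
    (∏ j ∈ Finset.range (-⌊a⌋).toNat, ‖P.ppow v (a + j) * Complex.exp logy‖) *
      ‖sobThetaP P.logq a ^ v‖ =
    Real.exp (-(binomDiff a * P.logx.re) + ((-⌊a⌋).toNat : ℕ) * logy.re) := by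
  have hfl : ⌊a⌋ ≤ 0 := by
    have := Int.floor_lt.2 (show a < ((1 : ℤ) : ℝ) by simpa using ha); omega
  have h2 : (((-⌊a⌋).toNat : ℕ) : ℝ) = -⌊a⌋ := by
    exact_mod_cast Int.toNat_of_nonneg (by omega : 0 ≤ -⌊a⌋)
  have h4 : ∀ n : ℕ, ∑ j ∈ Finset.range n, ((a + j) * P.logp v + logy.re) =
      (binomTwo (a + n) - binomTwo a) * P.logp v + n * logy.re := by
    intro n
    induction n with
    | zero => simp
    | succ n ih => rw [Finset.sum_range_succ, ih]; simp only [binomTwo]; push_cast; ring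
  simp only [norm_ppow_mul_exp]
  rw [← Real.exp_sum, h4, norm_sobThetaP_zpow, ← Real.exp_add]
  have h3 : a + -(⌊a⌋ : ℝ) = Int.fract a := by rw [← Int.self_sub_floor a]; ring
  rw [h2, h3]
  congr 1
  unfold binomDiff logp; ring

end Data

lemma abs_binomDiff_le {a B : ℝ} (ha : |a| ≤ B) : |binomDiff a| ≤ B ^ 2 + B + 1 := by
  have h1 := Int.fract_nonneg a
  have h2 := Int.fract_lt_one a
  have h3 := abs_le.1 ha
  have h4 : a ^ 2 ≤ B ^ 2 := sq_le_sq' h3.1 h3.2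
  unfold binomDiff binomTwo
  rw [abs_le]; constructor <;> nlinarith

namespace Data

variable (P : Data)

/-- The dependence on v has cancelled in `prod_norm_mul_norm_sobThetaP`; the exponent that is left
there is bounded on compact sets. -/
lemma theta_p_bounds (B : ℝ) :
    ∃ R : ℝ, ∀ v : ℤ, ‖P.p v‖ < ‖P.q‖ → ∀ (a : ℝ) (logy : ℂ), |a| ≤ B → |logy.re| ≤ B → a < 1 →
      |-(binomDiff a * P.logx.re) + ((-⌊a⌋).toNat : ℕ) * logy.re| ≤ R := by
  refine ⟨(B ^ 2 + B + 1) * |P.logx.re| + (⌈B⌉₊ + 1 : ℕ) * B, fun v hv a logy ha hy h1 => ?_⟩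
  refine (abs_add_le _ _).trans (add_le_add ?_ ?_)
  · rw [abs_neg, abs_mul]; gcongr; exact abs_binomDiff_le ha
  · rw [abs_mul, Nat.abs_cast]
    have := (toNat_floor_le ha).2
    gcongr

/-- Reflection a ↦ 1 - a reduces to a < 1. Then only the -⌊a⌋ factors with a+j ≤ 0 can be large;
both remaining symbols have bounded arguments. -/
lemma norm_theta_p_mul_le (hq : P.logq.re < 0) (B : ℝ) :
    ∃ C > 0, ∀ v : ℤ, ‖P.p v‖ < ‖P.q‖ → ∀ (a : ℝ) (logy : ℂ), |a| ≤ B → |logy.re| ≤ B →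
      ‖theta (P.ppow v a * Complex.exp logy) (P.p v) * sobThetaP P.logq a ^ v‖ ≤ C := by
  obtain ⟨R, hR⟩ := P.theta_p_bounds (B + 1)
  have hq1 := P.norm_q_lt_one hq
  have hq2 : 0 < 1 - ‖P.q‖ := by linarith
  set D := Real.exp (Real.exp (B + 1) / (1 - ‖P.q‖))
  have hD : 0 < D := Real.exp_pos _
  refine ⟨(1 + Real.exp (B + 1)) ^ (⌈B + 1⌉₊ + 1) * Real.exp R * D * D, by positivity, ?_⟩
  have key : ∀ v : ℤ, ‖P.p v‖ < ‖P.q‖ → ∀ (a : ℝ) (logy : ℂ), |a| ≤ B + 1 → |logy.re| ≤ B + 1 →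
      a < 1 → ‖theta (P.ppow v a * Complex.exp logy) (P.p v) * sobThetaP P.logq a ^ v‖ ≤
        (1 + Real.exp (B + 1)) ^ (⌈B + 1⌉₊ + 1) * Real.exp R * D * D := by
    intro v hv a logy ha hy ha1
    have hp := (P.logp_lt hv).trans hq
    have hp1 := hv.trans hq1
    set n := (-⌊a⌋).toNat with hn
    obtain ⟨h1, h2, -, -⟩ := toNat_floor_cond a
    have hbase : ∀ w : ℂ, ‖w‖ ≤ Real.exp (B + 1) → ‖qSymbol w (P.p v)‖ ≤ D := fun w hw =>
      (norm_qSymbol_le hp1 hw).trans (Real.exp_le_exp.2 (by gcongr))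
    have h3 := hbase _ (P.norm_ppow_mul_exp_le hp.le h1 hy)
    have h4 := hbase _ (P.norm_ppow_mul_exp_le hp.le (by linarith : 0 ≤ 1 - a)
      (logy := -logy) (by rwa [Complex.neg_re, abs_neg]))
    have h5 : ‖∏ j ∈ Finset.range n, (1 - P.ppow v (a + j) * Complex.exp logy)‖ ≤
        (1 + Real.exp (B + 1)) ^ n *
          ∏ j ∈ Finset.range n, ‖P.ppow v (a + j) * Complex.exp logy‖ := by
      rw [norm_prod, ← Finset.card_range n, ← Finset.prod_const, Finset.card_range,
        ← Finset.prod_mul_distrib]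
      refine Finset.prod_le_prod (fun _ _ => norm_nonneg _) fun j hj => ?_
      set w := P.ppow v (a + j) * Complex.exp logy with hw
      -- A large factor w may have absolute value below 1, but not below e^{-(B+1)}. Hence |1 - w| ≤
      -- 1 + |w| ≤ (1 + e^{B+1})|w|.
      have h6 : Real.exp (-(B + 1)) ≤ ‖w‖ := by
        rw [hw, norm_ppow_mul_exp]
        apply Real.exp_le_exp.2
        have := mul_nonneg_of_nonpos_of_nonpos (h2 j (Finset.mem_range.1 hj)) hp.le
        linarith [neg_abs_le logy.re]
      have h7 : 1 ≤ Real.exp (B + 1) * ‖w‖ := by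
        calc (1 : ℝ) = Real.exp (B + 1) * Real.exp (-(B + 1)) := by rw [← Real.exp_add]; simp
          _ ≤ _ := by gcongr
      refine (norm_sub_le _ _).trans ?_
      rw [norm_one]; linarith
    have h6 : (1 + Real.exp (B + 1)) ^ n ≤ (1 + Real.exp (B + 1)) ^ (⌈B + 1⌉₊ + 1) :=
      pow_le_pow_right₀ (by linarith [Real.exp_pos (B + 1)]) (toNat_floor_le ha).2
    rw [P.theta_p_split hq hv a logy n, norm_mul, norm_mul, norm_mul]
    calc _ ≤ ((1 + Real.exp (B + 1)) ^ n *
          ∏ j ∈ Finset.range n, ‖P.ppow v (a + j) * Complex.exp logy‖) * D * D *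
            ‖sobThetaP P.logq a ^ v‖ := by gcongr
      _ = (1 + Real.exp (B + 1)) ^ n * ((∏ j ∈ Finset.range n, ‖P.ppow v (a + j) *
            Complex.exp logy‖) * ‖sobThetaP P.logq a ^ v‖) * D * D := by ring
      _ ≤ _ := by
        rw [prod_norm_mul_norm_sobThetaP _ ha1]
        have := (le_abs_self _).trans (hR v hv a logy ha hy ha1)
        gcongr
  intro v hv a logy ha hy
  rcases lt_or_ge a 1 with h1 | h1
  · exact key v hv a logy (by linarith) (by linarith) h1
  · have := key v hv (1 - a) (-logy) ?_ (by rw [Complex.neg_re, abs_neg]; linarith) (by linarith)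
    · rwa [theta_p_reflect, sobThetaP, binomDiff_one_sub] at this
    · rw [abs_le] at ha ⊢; constructor <;> linarith

lemma le_norm_theta_p_mul (hq : P.logq.re < 0) (B : ℝ) {ε : ℝ} (hε : 0 < ε) :
    ∃ c > 0, ∀ v : ℤ, ‖P.p v‖ < ‖P.q‖ → ∀ (a : ℝ) (logy : ℂ), |a| ≤ B → |logy.re| ≤ B →
      (∀ k : ℕ, ε ≤ ‖1 - P.ppow v a * Complex.exp logy * P.p v ^ k‖) →
      (∀ k : ℕ, ε ≤ ‖1 - P.ppow v (1 - a) * Complex.exp (-logy) * P.p v ^ k‖) →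
      c ≤ ‖theta (P.ppow v a * Complex.exp logy) (P.p v) * sobThetaP P.logq a ^ v‖ := by
  obtain ⟨R, hR⟩ := P.theta_p_bounds (B + 1)
  have hq1 := P.norm_q_lt_one hq
  have hq2 : 0 < 1 - ‖P.q‖ := by linarith
  set D := Real.exp (-(lowerExp ε * (Real.exp (B + 1) / (1 - ‖P.q‖))))
  have hD : 0 < D := Real.exp_pos _
  set ε' := min (1 / 2) (ε / 2)
  have hε' : 0 < ε' := lt_min (by norm_num) (by linarith)
  have hε1 : ε' ≤ 1 := (min_le_left _ _).trans (by norm_num)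
  refine ⟨ε' ^ (⌈B + 1⌉₊ + 1) * Real.exp (-R) * D * D, by positivity, ?_⟩
  have key : ∀ v : ℤ, ‖P.p v‖ < ‖P.q‖ → ∀ (a : ℝ) (logy : ℂ), |a| ≤ B + 1 → |logy.re| ≤ B + 1 →
      a < 1 → (∀ k : ℕ, ε ≤ ‖1 - P.ppow v a * Complex.exp logy * P.p v ^ k‖) →
      (∀ k : ℕ, ε ≤ ‖1 - P.ppow v (1 - a) * Complex.exp (-logy) * P.p v ^ k‖) →
      ε' ^ (⌈B + 1⌉₊ + 1) * Real.exp (-R) * D * D ≤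
        ‖theta (P.ppow v a * Complex.exp logy) (P.p v) * sobThetaP P.logq a ^ v‖ := by
    intro v hv a logy ha hy ha1 hd hd'
    have hp := (P.logp_lt hv).trans hq
    have hp1 := hv.trans hq1
    set n := (-⌊a⌋).toNat with hn
    obtain ⟨h1, h2, -, -⟩ := toNat_floor_cond a
    have hl := lowerExp_pos ε
    have hbase : ∀ w : ℂ, ‖w‖ ≤ Real.exp (B + 1) → (∀ k : ℕ, ε ≤ ‖1 - w * P.p v ^ k‖) →
        D ≤ ‖qSymbol w (P.p v)‖ := fun w hw h =>
      le_trans (Real.exp_le_exp.2 (by gcongr)) (le_norm_qSymbol hp1 hw hε h)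
    have hshift : ∀ j k : ℕ, ε ≤ ‖1 - P.ppow v (a + j) * Complex.exp logy * P.p v ^ k‖ := by
      intro j k
      have := hd (j + k)
      rw [pow_add, P.p_pow v j] at this
      rw [ppow_add]
      convert this using 3; ring
    have h3 := hbase _ (P.norm_ppow_mul_exp_le hp.le h1 hy) (hshift n)
    have h4 := hbase _ (P.norm_ppow_mul_exp_le hp.le (by linarith : 0 ≤ 1 - a)
      (logy := -logy) (by rwa [Complex.neg_re, abs_neg])) hd'
    have h5 : ε' ^ n * ∏ j ∈ Finset.range n, ‖P.ppow v (a + j) * Complex.exp logy‖ ≤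
        ‖∏ j ∈ Finset.range n, (1 - P.ppow v (a + j) * Complex.exp logy)‖ := by
      rw [norm_prod, ← Finset.card_range n, ← Finset.prod_const, Finset.card_range,
        ← Finset.prod_mul_distrib]
      refine Finset.prod_le_prod (fun _ _ => by positivity) fun j hj => ?_
      set w := P.ppow v (a + j) * Complex.exp logy with hw
      have hw0 : w ≠ 0 := mul_ne_zero (P.ppow_ne_zero _ _) (Complex.exp_ne_zero _)
      have h6 := norm_one_sub_inv_ge hε hw0 (by simpa using hshift j 0)
      have h7 : 1 - w = -(w * (1 - w⁻¹)) := by field_simp; ring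
      rw [h7, norm_neg, norm_mul w, mul_comm ε' ‖w‖]
      exact mul_le_mul_of_nonneg_left h6 (norm_nonneg w)
    have h6 : ε' ^ (⌈B + 1⌉₊ + 1) ≤ ε' ^ n :=
      pow_le_pow_of_le_one hε'.le hε1 (toNat_floor_le ha).2
    rw [P.theta_p_split hq hv a logy n, norm_mul, norm_mul, norm_mul]
    calc _ ≤ ε' ^ n * ((∏ j ∈ Finset.range n, ‖P.ppow v (a + j) *
            Complex.exp logy‖) * ‖sobThetaP P.logq a ^ v‖) * D * D := by
          rw [prod_norm_mul_norm_sobThetaP _ ha1]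
          have := hR v hv a logy ha hy ha1
          have : -R ≤ -(binomDiff a * P.logx.re) + (n : ℕ) * logy.re := by
            linarith [neg_abs_le (-(binomDiff a * P.logx.re) + (n : ℕ) * logy.re)]
          gcongr
      _ = (ε' ^ n * ∏ j ∈ Finset.range n, ‖P.ppow v (a + j) * Complex.exp logy‖) * D * D *
            ‖sobThetaP P.logq a ^ v‖ := by ring
      _ ≤ _ := by gcongr
  intro v hv a logy ha hy hd hd'
  rcases lt_or_ge a 1 with h1 | h1
  · exact key v hv a logy (by linarith) (by linarith) h1 hd hd'
  · have := key v hv (1 - a) (-logy) ?_ (by rw [Complex.neg_re, abs_neg]; linarith) (by linarith)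
      hd' (by simpa using hd)
    · rwa [theta_p_reflect, sobThetaP, binomDiff_one_sub] at this
    · rw [abs_le] at ha ⊢; constructor <;> linarith

end Data

/-! ### From the individual factors to the integrand: first and second order behaviour. -/

/-- Uniform upper bounds for finitely many families multiply. -/
lemma exists_norm_prod_le {X : Type*} {n : ℕ} (S : Set X) (f : Fin n → X → ℂ)
    (h : ∀ r, ∃ C > 0, ∀ x ∈ S, ‖f r x‖ ≤ C) : ∃ C > 0, ∀ x ∈ S, ‖∏ r, f r x‖ ≤ C := by
  choose C hC h using h
  refine ⟨∏ r, C r, Finset.prod_pos fun r _ => hC r, fun x hx => ?_⟩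
  rw [norm_prod]
  exact Finset.prod_le_prod (fun _ _ => norm_nonneg _) fun r _ => h r x hx

lemma exists_le_norm_prod {X : Type*} {n : ℕ} (S : Set X) (f : Fin n → X → ℂ)
    (h : ∀ r, ∃ c > 0, ∀ x ∈ S, c ≤ ‖f r x‖) : ∃ c > 0, ∀ x ∈ S, c ≤ ‖∏ r, f r x‖ := by
  choose c hc h using h
  refine ⟨∏ r, c r, Finset.prod_pos fun r _ => hc r, fun x hx => ?_⟩
  rw [norm_prod]
  exact Finset.prod_le_prod (fun r _ => (hc r).le) fun r _ => h r x hx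

namespace Data

variable (P : Data)

lemma ppow_mul_mul_exp (v : ℤ) (a ζ : ℝ) (logt logz : ℂ) :
    P.ppow v a * Complex.exp logt * (P.ppow v ζ * Complex.exp logz) =
      P.ppow v (a + ζ) * Complex.exp (logt + logz) := by
  rw [ppow_add, Complex.exp_add]; ring

lemma ppow_mul_div_exp (v : ℤ) (a ζ : ℝ) (logt logz : ℂ) :
    P.ppow v a * Complex.exp logt / (P.ppow v ζ * Complex.exp logz) =
      P.ppow v (a - ζ) * Complex.exp (logt - logz) := by
  rw [sub_eq_add_neg, ppow_add, ppow_neg, Complex.exp_sub]; field_simp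

lemma integrand_exp (v : ℤ) (ζ : ℝ) (logz : ℂ) :
    P.integrand v (P.ppow v ζ * Complex.exp logz) =
      (∏ r, ellGamma (P.ppow v (P.α r + ζ) * Complex.exp (P.logt r + logz)) (P.p v) P.q) *
      (∏ r, ellGamma (P.ppow v (P.β r - ζ) * Complex.exp (P.logu r - logz)) (P.p v) P.q) *
      (∏ r, theta (P.ppow v (P.γ r + ζ) * Complex.exp (P.logv r + logz)) P.q) *
      (∏ r, theta (P.ppow v (P.δ r + ζ) * Complex.exp (P.logw r + logz)) (P.p v)) := by
  simp only [integrand, t, u, vv, w, ppow_mul_mul_exp, ppow_mul_div_exp]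

/-- The integrand at `p^ζ z`, multiplied by its first and second order behaviours. -/
def normalized (v : ℤ) (ζ : ℝ) (logz : ℂ) : ℂ :=
  P.integrand v (P.ppow v ζ * Complex.exp logz) *
    Complex.exp ((P.fob ζ : ℂ) * (v : ℂ) ^ 2 / 2 * P.logq) * P.sob ζ logz ^ v

/-- The first and second order behaviours as a product over the factors of the integrand. -/
lemma exp_fob_mul_sob_zpow (v : ℤ) (ζ : ℝ) (logz : ℂ) :
    Complex.exp ((P.fob ζ : ℂ) * (v : ℂ) ^ 2 / 2 * P.logq) * P.sob ζ logz ^ v =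
      (∏ r, scaleFactor P.logq P.logx v (binomDiff (P.α r + ζ)) (gDiff (P.α r + ζ))
        (P.logt r + logz)) *
      (∏ r, scaleFactor P.logq P.logx v (binomDiff (P.β r - ζ)) (gDiff (P.β r - ζ))
        (P.logu r - logz)) *
      (∏ r, thetaFactor P.logq P.logx v (P.γ r + ζ) (P.logv r + logz)) *
      ∏ r, sobThetaP P.logq (P.δ r + ζ) ^ v := by
  simp only [← sobGamma_zpow, ← sobThetaQ_zpow, Finset.prod_mul_distrib, Finset.prod_zpow]
  rw [← Complex.exp_sum, ← Complex.exp_sum, ← Complex.exp_sum, sob, mul_zpow, mul_zpow, mul_zpow]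
  have : Complex.exp ((P.fob ζ : ℂ) * (v : ℂ) ^ 2 / 2 * P.logq) =
      Complex.exp (∑ r, (gDiff (P.α r + ζ) : ℂ) * (v : ℂ) ^ 2 / 2 * P.logq) *
      Complex.exp (∑ r, (gDiff (P.β r - ζ) : ℂ) * (v : ℂ) ^ 2 / 2 * P.logq) *
      Complex.exp (∑ r, (((P.γ r + ζ) ^ 2 : ℝ) : ℂ) * (v : ℂ) ^ 2 / 2 * P.logq) := by
    rw [← Complex.exp_add, ← Complex.exp_add]
    congr 1
    unfold fob; push_cast
    simp only [← Finset.sum_mul, ← Finset.sum_div]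
    ring
  rw [this]; ring

lemma normalized_eq (v : ℤ) (ζ : ℝ) (logz : ℂ) :
    P.normalized v ζ logz =
      (∏ r, ellGamma (P.ppow v (P.α r + ζ) * Complex.exp (P.logt r + logz)) (P.p v) P.q *
        scaleFactor P.logq P.logx v (binomDiff (P.α r + ζ)) (gDiff (P.α r + ζ))
          (P.logt r + logz)) *
      (∏ r, ellGamma (P.ppow v (P.β r - ζ) * Complex.exp (P.logu r - logz)) (P.p v) P.q *
        scaleFactor P.logq P.logx v (binomDiff (P.β r - ζ)) (gDiff (P.β r - ζ))
          (P.logu r - logz)) *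
      (∏ r, theta (P.ppow v (P.γ r + ζ) * Complex.exp (P.logv r + logz)) P.q *
        thetaFactor P.logq P.logx v (P.γ r + ζ) (P.logv r + logz)) *
      (∏ r, theta (P.ppow v (P.δ r + ζ) * Complex.exp (P.logw r + logz)) (P.p v) *
        sobThetaP P.logq (P.δ r + ζ) ^ v) := by
  rw [normalized, mul_assoc, exp_fob_mul_sob_zpow, integrand_exp]
  simp only [Finset.prod_mul_distrib]
  ring

/-- `w` has relative distance at least `ε` to all poles of the integrand. -/
def AwayFromPoles (v : ℤ) (ε : ℝ) (w : ℂ) : Prop :=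
  (∀ r, ∀ j k : ℕ, ε ≤ ‖1 - P.ppow v (P.α r) * P.t r * w * P.p v ^ j * P.q ^ k‖) ∧
  ∀ r, ∀ j k : ℕ, ε ≤ ‖1 - P.ppow v (P.β r) * P.u r / w * P.p v ^ j * P.q ^ k‖

/-- A uniform upper bound for the integrand, away from its poles. -/
theorem exists_norm_normalized_le (hq : P.logq.re < 0) (B : ℝ) {ε : ℝ} (hε : 0 < ε) :
    ∃ C > 0, ∀ v : ℤ, ‖P.p v‖ < ‖P.q‖ → ∀ (ζ : ℝ) (logz : ℂ), |ζ| ≤ B → |logz.re| ≤ B →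
      P.AwayFromPoles v ε (P.ppow v ζ * Complex.exp logz) → ‖P.normalized v ζ logz‖ ≤ C := by
  -- The parameters v, ζ, log z over which the bounds are uniform are bundled into one point, so
  -- that the bounds for finite products apply.
  set S : Set (ℤ × ℝ × ℂ) := {x | ‖P.p x.1‖ < ‖P.q‖ ∧ |x.2.1| ≤ B ∧ |x.2.2.re| ≤ B ∧
    P.AwayFromPoles x.1 ε (P.ppow x.1 x.2.1 * Complex.exp x.2.2)}
  have hadd : ∀ (c : ℝ) (x : ℝ), |x| ≤ B → |c + x| ≤ B + |c| := fun c x hx => by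
    linarith [abs_add_le c x]
  have hsub : ∀ (c : ℝ) (x : ℝ), |x| ≤ B → |c - x| ≤ B + |c| := fun c x hx => by
    linarith [abs_sub c x]
  obtain ⟨C₁, h₁, H₁⟩ := exists_norm_prod_le S (fun r x =>
    ellGamma (P.ppow x.1 (P.α r + x.2.1) * Complex.exp (P.logt r + x.2.2)) (P.p x.1) P.q *
        scaleFactor P.logq P.logx x.1 (binomDiff (P.α r + x.2.1)) (gDiff (P.α r + x.2.1))
          (P.logt r + x.2.2)) (fun r => by
      obtain ⟨C, hC, h⟩ := P.norm_ellGamma_mul_le hq (B + |(P.α r : ℝ)| + |(P.logt r).re|) hε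
      refine ⟨C, hC, fun x hx => h _ hx.1 _ _ ?_ ?_ fun j k => ?_⟩
      · linarith [hadd (P.α r) _ hx.2.1, abs_nonneg (P.logt r).re]
      · rw [Complex.add_re]; linarith [hadd (P.logt r).re _ hx.2.2.1, abs_nonneg (P.α r : ℝ)]
      · rw [← ppow_mul_mul_exp]; exact hx.2.2.2.1 r j k)
  obtain ⟨C₂, h₂, H₂⟩ := exists_norm_prod_le S (fun r x =>
    ellGamma (P.ppow x.1 (P.β r - x.2.1) * Complex.exp (P.logu r - x.2.2)) (P.p x.1) P.q *
        scaleFactor P.logq P.logx x.1 (binomDiff (P.β r - x.2.1)) (gDiff (P.β r - x.2.1))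
          (P.logu r - x.2.2)) (fun r => by
      obtain ⟨C, hC, h⟩ := P.norm_ellGamma_mul_le hq (B + |(P.β r : ℝ)| + |(P.logu r).re|) hε
      refine ⟨C, hC, fun x hx => h _ hx.1 _ _ ?_ ?_ fun j k => ?_⟩
      · linarith [hsub (P.β r) _ hx.2.1, abs_nonneg (P.logu r).re]
      · rw [Complex.sub_re]; linarith [hsub (P.logu r).re _ hx.2.2.1, abs_nonneg (P.β r : ℝ)]
      · rw [← ppow_mul_div_exp]; exact hx.2.2.2.2 r j k)
  obtain ⟨C₃, h₃, H₃⟩ := exists_norm_prod_le S (fun r x =>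
    theta (P.ppow x.1 (P.γ r + x.2.1) * Complex.exp (P.logv r + x.2.2)) P.q *
        thetaFactor P.logq P.logx x.1 (P.γ r + x.2.1) (P.logv r + x.2.2)) (fun r => by
      obtain ⟨C, hC, h⟩ := P.norm_theta_mul_le hq (B + |(P.γ r : ℝ)| + |(P.logv r).re|)
      refine ⟨C, hC, fun x hx => h _ hx.1 _ _ ?_ ?_⟩
      · linarith [hadd (P.γ r) _ hx.2.1, abs_nonneg (P.logv r).re]
      · rw [Complex.add_re]; linarith [hadd (P.logv r).re _ hx.2.2.1, abs_nonneg (P.γ r : ℝ)])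
  obtain ⟨C₄, h₄, H₄⟩ := exists_norm_prod_le S (fun r x =>
    theta (P.ppow x.1 (P.δ r + x.2.1) * Complex.exp (P.logw r + x.2.2)) (P.p x.1) *
        sobThetaP P.logq (P.δ r + x.2.1) ^ x.1) (fun r => by
      obtain ⟨C, hC, h⟩ := P.norm_theta_p_mul_le hq (B + |(P.δ r : ℝ)| + |(P.logw r).re|)
      refine ⟨C, hC, fun x hx => h _ hx.1 _ _ ?_ ?_⟩
      · linarith [hadd (P.δ r) _ hx.2.1, abs_nonneg (P.logw r).re]
      · rw [Complex.add_re]; linarith [hadd (P.logw r).re _ hx.2.2.1, abs_nonneg (P.δ r : ℝ)])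
  refine ⟨C₁ * C₂ * C₃ * C₄, by positivity, fun v hv ζ logz hζ hz hd => ?_⟩
  have hx : ((v, ζ, logz) : ℤ × ℝ × ℂ) ∈ S := ⟨hv, hζ, hz, hd⟩
  have := H₁ _ hx
  have := H₂ _ hx
  have := H₃ _ hx
  have := H₄ _ hx
  rw [normalized_eq, norm_mul, norm_mul, norm_mul]
  dsimp only at *
  gcongr

lemma ne_of_lt_norm_one_sub {ε : ℝ} (hε : 0 < ε) {y : ℂ} (h : ε ≤ ‖1 - y‖) : y ≠ 1 := by
  rintro rfl; simp at h; linarith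

/-- In addition to the poles, the point must avoid the zeros of all factors. The conditions are
given one symbol at a time, in the form in which the building blocks use them. -/
theorem exists_le_norm_normalized (hq : P.logq.re < 0) (B : ℝ) {ε : ℝ} (hε : 0 < ε) :
    ∃ c > 0, ∀ v : ℤ, ‖P.p v‖ < ‖P.q‖ → ∀ (ζ : ℝ) (logz : ℂ), |ζ| ≤ B → |logz.re| ≤ B →
      P.AwayFromPoles v ε (P.ppow v ζ * Complex.exp logz) →
      (∀ r, ∀ j k : ℕ, ε ≤ ‖1 - P.p v * P.q / (P.ppow v (P.α r) * P.t r *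
        (P.ppow v ζ * Complex.exp logz)) * P.p v ^ j * P.q ^ k‖) →
      (∀ r, ∀ j k : ℕ, ε ≤ ‖1 - P.p v * P.q / (P.ppow v (P.β r) * P.u r /
        (P.ppow v ζ * Complex.exp logz)) * P.p v ^ j * P.q ^ k‖) →
      (∀ r, ∀ k : ℕ, ε ≤ ‖1 - P.ppow v (P.γ r) * P.vv r *
        (P.ppow v ζ * Complex.exp logz) * P.q ^ k‖) →
      (∀ r, ∀ k : ℕ, ε ≤ ‖1 - P.q / (P.ppow v (P.γ r) * P.vv r *
        (P.ppow v ζ * Complex.exp logz)) * P.q ^ k‖) →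
      (∀ r, ∀ k : ℕ, ε ≤ ‖1 - P.ppow v (P.δ r) * P.w r *
        (P.ppow v ζ * Complex.exp logz) * P.p v ^ k‖) →
      (∀ r, ∀ k : ℕ, ε ≤ ‖1 - P.p v / (P.ppow v (P.δ r) * P.w r *
        (P.ppow v ζ * Complex.exp logz)) * P.p v ^ k‖) →
      c ≤ ‖P.normalized v ζ logz‖ := by
  have hadd : ∀ (c : ℝ) (x : ℝ), |x| ≤ B → |c + x| ≤ B + |c| := fun c x hx => by
    linarith [abs_add_le c x]
  have hsub : ∀ (c : ℝ) (x : ℝ), |x| ≤ B → |c - x| ≤ B + |c| := fun c x hx => by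
    linarith [abs_sub c x]
  simp only [AwayFromPoles, t, u, vv, w, ppow_mul_mul_exp, ppow_mul_div_exp, reflect_arg, q_div_arg,
    p_div_arg]
  set S : Set (ℤ × ℝ × ℂ) := {x | ‖P.p x.1‖ < ‖P.q‖ ∧ |x.2.1| ≤ B ∧ |x.2.2.re| ≤ B}
  obtain ⟨C₁, h₁, H₁⟩ := exists_le_norm_prod (S ∩ {x | ∀ r, ∀ j k : ℕ,
      ε ≤ ‖1 - P.ppow x.1 (P.α r + x.2.1) * Complex.exp (P.logt r + x.2.2) *
        P.p x.1 ^ j * P.q ^ k‖ ∧ ε ≤ ‖1 - P.ppow x.1 (1 - (P.α r + x.2.1)) *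
        Complex.exp (P.logq - (P.logt r + x.2.2)) * P.p x.1 ^ j * P.q ^ k‖}) (fun r x =>
    ellGamma (P.ppow x.1 (P.α r + x.2.1) * Complex.exp (P.logt r + x.2.2)) (P.p x.1) P.q *
        scaleFactor P.logq P.logx x.1 (binomDiff (P.α r + x.2.1)) (gDiff (P.α r + x.2.1))
          (P.logt r + x.2.2)) (fun r => by
      obtain ⟨C, hC, h⟩ := P.le_norm_ellGamma_mul hq (B + |(P.α r : ℝ)| + |(P.logt r).re|) hε
      refine ⟨C, hC, fun x hx => h _ hx.1.1 _ _ ?_ ?_ (fun j k => (hx.2 r j k).2)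
        fun j k => ne_of_lt_norm_one_sub hε (hx.2 r j k).1⟩
      · linarith [hadd (P.α r) _ hx.1.2.1, abs_nonneg (P.logt r).re]
      · rw [Complex.add_re]; linarith [hadd (P.logt r).re _ hx.1.2.2, abs_nonneg (P.α r : ℝ)])
  obtain ⟨C₂, h₂, H₂⟩ := exists_le_norm_prod (S ∩ {x | ∀ r, ∀ j k : ℕ,
      ε ≤ ‖1 - P.ppow x.1 (P.β r - x.2.1) * Complex.exp (P.logu r - x.2.2) *
        P.p x.1 ^ j * P.q ^ k‖ ∧ ε ≤ ‖1 - P.ppow x.1 (1 - (P.β r - x.2.1)) *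
        Complex.exp (P.logq - (P.logu r - x.2.2)) * P.p x.1 ^ j * P.q ^ k‖}) (fun r x =>
    ellGamma (P.ppow x.1 (P.β r - x.2.1) * Complex.exp (P.logu r - x.2.2)) (P.p x.1) P.q *
        scaleFactor P.logq P.logx x.1 (binomDiff (P.β r - x.2.1)) (gDiff (P.β r - x.2.1))
          (P.logu r - x.2.2)) (fun r => by
      obtain ⟨C, hC, h⟩ := P.le_norm_ellGamma_mul hq (B + |(P.β r : ℝ)| + |(P.logu r).re|) hε
      refine ⟨C, hC, fun x hx => h _ hx.1.1 _ _ ?_ ?_ (fun j k => (hx.2 r j k).2)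
        fun j k => ne_of_lt_norm_one_sub hε (hx.2 r j k).1⟩
      · linarith [hsub (P.β r) _ hx.1.2.1, abs_nonneg (P.logu r).re]
      · rw [Complex.sub_re]; linarith [hsub (P.logu r).re _ hx.1.2.2, abs_nonneg (P.β r : ℝ)])
  obtain ⟨C₃, h₃, H₃⟩ := exists_le_norm_prod (S ∩ {x | ∀ r, ∀ k : ℕ,
      ε ≤ ‖1 - P.ppow x.1 (P.γ r + x.2.1) * Complex.exp (P.logv r + x.2.2) * P.q ^ k‖ ∧
      ε ≤ ‖1 - P.ppow x.1 (-(P.γ r + x.2.1)) * Complex.exp (P.logq - (P.logv r + x.2.2)) *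
        P.q ^ k‖}) (fun r x =>
    theta (P.ppow x.1 (P.γ r + x.2.1) * Complex.exp (P.logv r + x.2.2)) P.q *
        thetaFactor P.logq P.logx x.1 (P.γ r + x.2.1) (P.logv r + x.2.2)) (fun r => by
      obtain ⟨C, hC, h⟩ := P.le_norm_theta_mul hq (B + |(P.γ r : ℝ)| + |(P.logv r).re|) hε
      refine ⟨C, hC, fun x hx => h _ hx.1.1 _ _ ?_ ?_ (fun k => (hx.2 r k).1)
        fun k => (hx.2 r k).2⟩
      · linarith [hadd (P.γ r) _ hx.1.2.1, abs_nonneg (P.logv r).re]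
      · rw [Complex.add_re]; linarith [hadd (P.logv r).re _ hx.1.2.2, abs_nonneg (P.γ r : ℝ)])
  obtain ⟨C₄, h₄, H₄⟩ := exists_le_norm_prod (S ∩ {x | ∀ r, ∀ k : ℕ,
      ε ≤ ‖1 - P.ppow x.1 (P.δ r + x.2.1) * Complex.exp (P.logw r + x.2.2) * P.p x.1 ^ k‖ ∧
      ε ≤ ‖1 - P.ppow x.1 (1 - (P.δ r + x.2.1)) * Complex.exp (-(P.logw r + x.2.2)) *
        P.p x.1 ^ k‖}) (fun r x =>
    theta (P.ppow x.1 (P.δ r + x.2.1) * Complex.exp (P.logw r + x.2.2)) (P.p x.1) *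
        sobThetaP P.logq (P.δ r + x.2.1) ^ x.1) (fun r => by
      obtain ⟨C, hC, h⟩ := P.le_norm_theta_p_mul hq (B + |(P.δ r : ℝ)| + |(P.logw r).re|) hε
      refine ⟨C, hC, fun x hx => h _ hx.1.1 _ _ ?_ ?_ (fun k => (hx.2 r k).1)
        fun k => (hx.2 r k).2⟩
      · linarith [hadd (P.δ r) _ hx.1.2.1, abs_nonneg (P.logw r).re]
      · rw [Complex.add_re]; linarith [hadd (P.logw r).re _ hx.1.2.2, abs_nonneg (P.δ r : ℝ)])
  refine ⟨C₁ * C₂ * C₃ * C₄, by positivity,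
    fun v hv ζ logz hζ hz hd d₁ d₂ d₃ d₄ d₅ d₆ => ?_⟩
  have hx : ((v, ζ, logz) : ℤ × ℝ × ℂ) ∈ S := ⟨hv, hζ, hz⟩
  have := H₁ (v, ζ, logz) ⟨hx, fun r j k => ⟨hd.1 r j k, d₁ r j k⟩⟩
  have := H₂ (v, ζ, logz) ⟨hx, fun r j k => ⟨hd.2 r j k, d₂ r j k⟩⟩
  have := H₃ (v, ζ, logz) ⟨hx, fun r k => ⟨d₃ r k, d₄ r k⟩⟩
  have := H₄ (v, ζ, logz) ⟨hx, fun r k => ⟨d₅ r k, d₆ r k⟩⟩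
  rw [normalized_eq, norm_mul, norm_mul, norm_mul]
  dsimp only at *
  gcongr

/-- `fob` and `sob` are first and second order behaviours of the integrand. -/
theorem isOrderBehaviour (hq : P.logq.re < 0) : P.IsOrderBehaviour P.fob P.sob := by
  intro K hK ε hε
  -- The building blocks need |1 - w/y| to be bounded below for some points y of the divisor and |1
  -- - y/w| for others. By `norm_one_sub_inv_ge` this ε' serves for both.
  set ε' := min (1 / 2) (ε / 2)
  have hε' : 0 < ε' := lt_min (by norm_num) (by linarith)
  have hle : ε' ≤ ε := (min_le_right _ _).trans (by linarith)
  obtain ⟨C, hC, H⟩ := P.exists_norm_normalized_le hq (K + |Real.log K|) hε'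
  obtain ⟨c, hc, H'⟩ := P.exists_le_norm_normalized hq (K + |Real.log K|) hε'
  refine ⟨c / 2, by positivity, C + 1, by positivity, fun ζ hζ logz hz v hv hd => ?_⟩
  have hζ' : |ζ| ≤ K + |Real.log K| := by
    have := abs_le.2 ⟨hζ.1, hζ.2⟩
    linarith [abs_nonneg (Real.log K)]
  have hz' : |logz.re| ≤ K + |Real.log K| := by
    rw [Complex.norm_exp] at hz
    have h1 := Real.log_le_log (by positivity) hz.1
    have h2 := Real.log_le_log (by positivity) hz.2
    rw [Real.log_exp] at h1 h2
    rw [one_div, Real.log_inv] at h1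
    rw [abs_le]; constructor <;> linarith [le_abs_self (Real.log K)]
  set w := P.ppow v ζ * Complex.exp logz with hw
  have hw0 : w ≠ 0 := mul_ne_zero (P.ppow_ne_zero _ _) (Complex.exp_ne_zero _)
  have hp0 := P.p_ne_zero v
  have hq0 := P.q_ne_zero
  have hpj : ∀ j : ℕ, P.p v ^ j ≠ 0 := fun j => pow_ne_zero _ hp0
  have hqk : ∀ j : ℕ, P.q ^ j ≠ 0 := fun j => pow_ne_zero _ hq0
  have hinv : ∀ y ∈ P.divisor v, y ≠ 0 → ε' ≤ ‖1 - y / w‖ := fun y hy hy0 => by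
    rw [← inv_div]
    exact norm_one_sub_inv_ge hε (div_ne_zero hw0 hy0) (hd y hy).le
  have hdir : ∀ y ∈ P.divisor v, ε' ≤ ‖1 - w / y‖ := fun y hy => hle.trans (hd y hy).le
  have ha : ∀ r, P.ppow v (P.α r) * P.t r ≠ 0 := fun r =>
    mul_ne_zero (P.ppow_ne_zero _ _) (Complex.exp_ne_zero _)
  have hb : ∀ r, P.ppow v (P.β r) * P.u r ≠ 0 := fun r =>
    mul_ne_zero (P.ppow_ne_zero _ _) (Complex.exp_ne_zero _)
  have hg : ∀ r, P.ppow v (P.γ r) * P.vv r ≠ 0 := fun r =>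
    mul_ne_zero (P.ppow_ne_zero _ _) (Complex.exp_ne_zero _)
  have hδ : ∀ r, P.ppow v (P.δ r) * P.w r ≠ 0 := fun r =>
    mul_ne_zero (P.ppow_ne_zero _ _) (Complex.exp_ne_zero _)
  have hpoles : P.AwayFromPoles v ε' w := by
    refine ⟨fun r j k => ?_, fun r j k => ?_⟩
    · have := hdir ((P.p v ^ j * P.q ^ k)⁻¹ / (P.ppow v (P.α r) * P.t r))
        (Or.inl ⟨r, j, k, Or.inl (mul_div_cancel₀ _ (ha r))⟩)
      convert this using 3
      have := ha r; have := hpj j; have := hqk k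
      rw [div_div_eq_mul_div, div_inv_eq_mul]; ring
    · have hy0 : P.ppow v (P.β r) * P.u r * (P.p v ^ j * P.q ^ k) ≠ 0 :=
        mul_ne_zero (hb r) (mul_ne_zero (hpj j) (hqk k))
      have := hinv _ (Or.inr (Or.inl ⟨r, hy0, j, k, Or.inl (by
        rw [div_mul_eq_div_div, div_self (hb r), one_div])⟩)) hy0
      convert this using 3
      ring
  have key := H v hv ζ logz hζ' hz' hpoles
  have key' := H' v hv ζ logz hζ' hz' hpoles ?_ ?_ ?_ ?_ ?_ ?_
  · change ‖P.normalized v ζ logz‖ ∈ _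
    constructor <;> linarith
  · intro r j k
    have hy0 : P.p v ^ (j + 1) * P.q ^ (k + 1) / (P.ppow v (P.α r) * P.t r) ≠ 0 :=
      div_ne_zero (mul_ne_zero (hpj _) (hqk _)) (ha r)
    have := hinv _ (Or.inl ⟨r, j, k, Or.inr (mul_div_cancel₀ _ (ha r))⟩) hy0
    convert this using 3
    rw [div_div, pow_succ, pow_succ]; ring
  · intro r j k
    have h0 : P.p v ^ (j + 1) * P.q ^ (k + 1) ≠ 0 := mul_ne_zero (hpj _) (hqk _)
    have hy0 : P.ppow v (P.β r) * P.u r / (P.p v ^ (j + 1) * P.q ^ (k + 1)) ≠ 0 :=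
      div_ne_zero (hb r) h0
    have := hdir _ (Or.inr (Or.inl ⟨r, hy0, j, k, Or.inr (div_div_cancel₀ (hb r))⟩))
    convert this using 3
    rw [div_div_eq_mul_div, div_div_eq_mul_div, pow_succ, pow_succ]; ring
  · intro r k
    have hy : P.q ^ (-(k : ℤ)) / (P.ppow v (P.γ r) * P.vv r) ∈ P.divisor v :=
      Or.inr (Or.inr (Or.inl ⟨r, -(k : ℤ), mul_div_cancel₀ _ (hg r)⟩))
    have := hdir _ hy
    convert this using 3
    rw [div_div_eq_mul_div, zpow_neg, div_inv_eq_mul, zpow_natCast]; ring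
  · intro r k
    have hy : P.q ^ ((k + 1 : ℕ) : ℤ) / (P.ppow v (P.γ r) * P.vv r) ∈ P.divisor v :=
      Or.inr (Or.inr (Or.inl ⟨r, ((k + 1 : ℕ) : ℤ), mul_div_cancel₀ _ (hg r)⟩))
    have := hinv _ hy (div_ne_zero (zpow_ne_zero _ hq0) (hg r))
    convert this using 3
    rw [div_div, zpow_natCast, pow_succ]; ring
  · intro r k
    have hy : P.p v ^ (-(k : ℤ)) / (P.ppow v (P.δ r) * P.w r) ∈ P.divisor v :=
      Or.inr (Or.inr (Or.inr ⟨r, -(k : ℤ), mul_div_cancel₀ _ (hδ r)⟩))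
    have := hdir _ hy
    convert this using 3
    rw [div_div_eq_mul_div, zpow_neg, div_inv_eq_mul, zpow_natCast]; ring
  · intro r k
    have hy : P.p v ^ ((k + 1 : ℕ) : ℤ) / (P.ppow v (P.δ r) * P.w r) ∈ P.divisor v :=
      Or.inr (Or.inr (Or.inr ⟨r, ((k + 1 : ℕ) : ℤ), mul_div_cancel₀ _ (hδ r)⟩))
    have := hinv _ hy (div_ne_zero (zpow_ne_zero _ hp0) (hδ r))
    convert this using 3
    rw [div_div, zpow_natCast, pow_succ]; ring

end Data

/-! ### The order functions are piecewise polynomial -/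

/-- The formula extends to the right end a = k+1, where the floor jumps, because binom(0,2) =
binom(1,2). The same continuity of G rests on g(0) = g(1). -/
lemma binomDiff_of_mem {a : ℝ} {k : ℤ} (h1 : k ≤ a) (h2 : a ≤ k + 1) :
    binomDiff a = k * a - k * (k + 1) / 2 := by
  rcases h2.lt_or_eq with h | h
  · have : ⌊a⌋ = k := Int.floor_eq_iff.2 ⟨h1, h⟩
    unfold binomDiff binomTwo; rw [← Int.self_sub_floor, this]; ring
  · have : Int.fract a = 0 := by
      rw [h]; exact_mod_cast Int.fract_intCast (R := ℝ) (k + 1)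
    unfold binomDiff binomTwo; rw [this, h]; ring

lemma gDiff_of_mem {a : ℝ} {k : ℤ} (h1 : k ≤ a) (h2 : a ≤ k + 1) :
    gDiff a = gPoly a - gPoly (a - k) := by
  rcases h2.lt_or_eq with h | h
  · have : ⌊a⌋ = k := Int.floor_eq_iff.2 ⟨h1, h⟩
    unfold gDiff; rw [← Int.self_sub_floor, this]
  · have : Int.fract a = 0 := by
      rw [h]; exact_mod_cast Int.fract_intCast (R := ℝ) (k + 1)
    unfold gDiff gPoly; rw [this, h]; ring

lemma binomDiff_add {a d : ℝ} {k : ℤ} (h1 : k ≤ a) (h2 : a ≤ k + 1) (h3 : k ≤ a + d)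
    (h4 : a + d ≤ k + 1) : binomDiff (a + d) = binomDiff a + k * d := by
  rw [binomDiff_of_mem h1 h2, binomDiff_of_mem h3 h4]; ring

/-- This is an exact Taylor expansion between consecutive integers. The linear coefficient 2b is the
reason for `fob' = 2 * sobExp`. -/
lemma gDiff_add {a d : ℝ} {k : ℤ} (h1 : k ≤ a) (h2 : a ≤ k + 1) (h3 : k ≤ a + d)
    (h4 : a + d ≤ k + 1) : gDiff (a + d) = gDiff a + 2 * binomDiff a * d + k * d ^ 2 := by
  rw [gDiff_of_mem h1 h2, gDiff_of_mem h3 h4, binomDiff_of_mem h1 h2]; unfold gPoly; ring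

/-- Either of the two unit intervals adjacent to `a`. -/
lemma exists_adjacent_interval (a : ℝ) {σ : ℝ} (hσ : σ = 1 ∨ σ = -1) :
    ∃ k : ℤ, (k : ℝ) ≤ a ∧ a ≤ k + 1 ∧ ∀ᶠ d in 𝓝[≥] (0 : ℝ), k ≤ a + σ * d ∧ a + σ * d ≤ k + 1 := by
  have hd : ∀ η > (0 : ℝ), ∀ᶠ d in 𝓝[≥] (0 : ℝ), d ∈ Set.Ico 0 η := fun η hη =>
    Ico_mem_nhdsGE hη
  rcases hσ with rfl | rfl
  · have h1 := Int.floor_le a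
    have h2 := Int.lt_floor_add_one a
    refine ⟨⌊a⌋, h1, h2.le, ?_⟩
    filter_upwards [hd (⌊a⌋ + 1 - a) (by linarith)] with d hd
    constructor <;> linarith [hd.1, hd.2]
  · have h1 := Int.le_ceil a
    have h2 := Int.ceil_lt_add_one a
    -- For an integer a the adjacent interval on the left is [a-1, a], so the floor would be the
    -- wrong choice.
    refine ⟨⌈a⌉ - 1, by push_cast; linarith, by push_cast; linarith, ?_⟩
    filter_upwards [hd (a - (⌈a⌉ - 1)) (by linarith)] with d hd
    push_cast
    constructor <;> linarith [hd.1, hd.2]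

lemma exists_oneSided (a : ℝ) {σ : ℝ} (hσ : σ = 1 ∨ σ = -1) :
    ∃ k : ℤ, ∀ᶠ d in 𝓝[≥] (0 : ℝ), binomDiff (a + σ * d) = binomDiff a + k * (σ * d) ∧
      gDiff (a + σ * d) = gDiff a + 2 * binomDiff a * (σ * d) + k * d ^ 2 := by
  obtain ⟨k, h1, h2, h⟩ := exists_adjacent_interval a hσ
  refine ⟨k, h.mono fun d hd => ⟨binomDiff_add h1 h2 hd.1 hd.2, ?_⟩⟩
  rw [gDiff_add h1 h2 hd.1 hd.2, mul_pow, show σ ^ 2 = 1 by rcases hσ with rfl | rfl <;> norm_num]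
  ring

namespace Data

variable (P : Data)

/-- The exponent of `z` in `sob(ζ;z)`, which is half of the derivative of `fob`. -/
def sobExp (ζ : ℝ) : ℝ :=
  ∑ r, binomDiff (P.α r + ζ) - ∑ r, binomDiff (P.β r - ζ) + ∑ r, ((P.γ r : ℝ) + ζ)

/-- The piecewise linear part of `log |sob|`. -/
def logSobLin (ζ : ℝ) : ℝ :=
  ∑ r, binomDiff (P.α r + ζ) * ((P.logt r).re - P.logq.re / 2) +
  ∑ r, binomDiff (P.β r - ζ) * ((P.logu r).re - P.logq.re / 2) +
  ∑ r, ((P.γ r : ℝ) + ζ) * ((P.logv r).re - P.logq.re / 2) +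
  ∑ r, binomDiff (P.δ r + ζ) * P.logq.re

/-- `log |sob|` at `z = 1`. -/
def logSob (ζ : ℝ) : ℝ := P.fob ζ * P.logx.re + P.logSobLin ζ

lemma sob_eq_mul_exp (ζ : ℝ) (logz : ℂ) :
    P.sob ζ logz = P.sob ζ 0 * Complex.exp ((P.sobExp ζ : ℂ) * logz) := by
  simp only [sob, sobGamma, sobThetaQ, sobThetaP, ← Complex.exp_sum, ← Complex.exp_add]
  congr 1
  unfold sobExp
  push_cast
  simp only [Finset.sum_add_distrib, Finset.sum_sub_distrib, mul_add, mul_sub, add_mul, sub_mul,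
    Finset.sum_mul, add_zero, sub_zero]
  ring

lemma norm_sob_zero (ζ : ℝ) : ‖P.sob ζ 0‖ = Real.exp (P.logSob ζ) := by
  simp only [sob, sobGamma, sobThetaQ, sobThetaP, norm_mul, norm_prod, Complex.norm_exp]
  simp only [← Real.exp_sum, ← Real.exp_add]
  congr 1
  have e : ∀ (b G : ℝ) (l : ℂ), ((b : ℂ) * (l + 0) + (G : ℂ) * P.logx - (b : ℂ) * P.logq / 2).re =
      b * (l.re - P.logq.re / 2) + G * P.logx.re := by
    intro b G l
    have : (b : ℂ) * P.logq / 2 = ((b / 2 : ℝ) : ℂ) * P.logq := by push_cast; ring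
    rw [this, Complex.sub_re, Complex.add_re, Complex.re_ofReal_mul, Complex.re_ofReal_mul,
      Complex.re_ofReal_mul, add_zero]; ring
  have e2 : ∀ (b : ℝ) (l : ℂ), ((b : ℂ) * (l + 0) + (b : ℂ) ^ 2 * P.logx -
      (b : ℂ) * P.logq / 2).re = b * (l.re - P.logq.re / 2) + b ^ 2 * P.logx.re := by
    intro b l; rw [← e b (b ^ 2) l]; push_cast; rfl
  simp only [sub_eq_add_neg, neg_zero] at *
  simp only [e, e2, Complex.re_ofReal_mul]
  unfold logSob logSobLin fob
  simp only [Finset.sum_add_distrib, Finset.sum_mul, add_mul, sub_eq_add_neg]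
  ring

lemma norm_sob (ζ : ℝ) (logz : ℂ) :
    ‖P.sob ζ logz‖ = Real.exp (P.logSob ζ + P.sobExp ζ * logz.re) := by
  rw [sob_eq_mul_exp, norm_mul, norm_sob_zero, Complex.norm_exp, Complex.re_ofReal_mul, Real.exp_add]

/-- On either side of a point, `fob` is quadratic and `log |sob|` is linear up to a multiple of
`fob`. -/
lemma exists_oneSided_fob (ζ : ℝ) {σ : ℝ} (hσ : σ = 1 ∨ σ = -1) :
    ∃ A l : ℝ, ∀ᶠ d in 𝓝[≥] (0 : ℝ),
      P.fob (ζ + σ * d) = P.fob ζ + 2 * P.sobExp ζ * (σ * d) + A * d ^ 2 ∧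
      P.logSobLin (ζ + σ * d) = P.logSobLin ζ + l * d := by
  have hσ' : -σ = 1 ∨ -σ = -1 := by rcases hσ with rfl | rfl <;> simp
  have hσ2 : σ ^ 2 = 1 := by rcases hσ with rfl | rfl <;> norm_num
  choose ka ha using fun r => exists_oneSided ((P.α r : ℝ) + ζ) hσ
  choose kb hb using fun r => exists_oneSided ((P.β r : ℝ) - ζ) hσ'
  choose kd hd using fun r => exists_oneSided ((P.δ r : ℝ) + ζ) hσ
  refine ⟨∑ r, (ka r : ℝ) + ∑ r, (kb r : ℝ) + ∑ _r : Fin P.nγ, 1,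
    ∑ r, ka r * σ * ((P.logt r).re - P.logq.re / 2) +
    ∑ r, kb r * -σ * ((P.logu r).re - P.logq.re / 2) +
    ∑ r, σ * ((P.logv r).re - P.logq.re / 2) + ∑ r, kd r * σ * P.logq.re, ?_⟩
  filter_upwards [eventually_all.2 ha, eventually_all.2 hb, eventually_all.2 hd] with d ha hb hd
  have e1 : ∀ r, (P.α r : ℝ) + (ζ + σ * d) = P.α r + ζ + σ * d := fun r => by ring
  have e2 : ∀ r, (P.β r : ℝ) - (ζ + σ * d) = P.β r - ζ + -σ * d := fun r => by ring
  have e3 : ∀ r, (P.δ r : ℝ) + (ζ + σ * d) = P.δ r + ζ + σ * d := fun r => by ring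
  have e4 : ∀ r, ((P.γ r : ℝ) + (ζ + σ * d)) ^ 2 =
      (P.γ r + ζ) ^ 2 + 2 * (P.γ r + ζ) * (σ * d) + 1 * d ^ 2 := fun r => by
    linear_combination d ^ 2 * hσ2
  have e5 : ∀ r, ((P.γ r : ℝ) + (ζ + σ * d)) = (P.γ r + ζ) + σ * d := fun r => by ring
  constructor
  · simp only [fob, e1, e2, e4, fun r => (ha r).2, fun r => (hb r).2, Finset.sum_add_distrib,
      ← Finset.sum_mul, ← Finset.mul_sum, sobExp]
    ring
  · simp only [logSobLin, e1, e2, e3, e5, fun r => (ha r).1, fun r => (hb r).1, fun r => (hd r).1,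
      add_mul, Finset.sum_add_distrib]
    rw [Finset.sum_mul, Finset.sum_mul, Finset.sum_mul, Finset.sum_mul]
    have c1 : ∀ {n : ℕ} (k x : Fin n → ℝ) (τ : ℝ),
        ∑ r, k r * (τ * d) * x r = ∑ r, k r * τ * x r * d := fun k x τ =>
      Finset.sum_congr rfl fun _ _ => by ring
    have c3 : ∑ r, σ * d * ((P.logv r).re - P.logq.re / 2) =
        ∑ r, σ * ((P.logv r).re - P.logq.re / 2) * d := Finset.sum_congr rfl fun _ _ => by ring
    rw [c1, c1, c1 _ (fun _ => P.logq.re), c3]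
    ring

lemma hasDerivWithinAt_of_oneSided {f : ℝ → ℝ} {ζ D A σ : ℝ} (hσ : σ = 1 ∨ σ = -1)
    (h : ∀ᶠ d in 𝓝[≥] (0 : ℝ), f (ζ + σ * d) = f ζ + D * (σ * d) + A * d ^ 2) :
    HasDerivWithinAt f D {ξ | 0 ≤ σ * (ξ - ζ)} ζ := by
  have hσ2 : σ * σ = 1 := by rcases hσ with rfl | rfl <;> norm_num
  have h1 : HasDerivAt (fun ξ => f ζ + D * (ξ - ζ) + A * (σ * (ξ - ζ)) ^ 2) D ζ := by
    have := (((hasDerivAt_id ζ).sub_const ζ).const_mul D).const_add (f ζ)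
    have h2 := ((((hasDerivAt_id ζ).sub_const ζ).const_mul σ).pow 2).const_mul A
    exact (this.add h2).congr_deriv (by simp)
  refine h1.hasDerivWithinAt.congr_of_eventuallyEq ?_ (by simp)
  have ht : Tendsto (fun ξ => σ * (ξ - ζ)) (𝓝[{ξ | 0 ≤ σ * (ξ - ζ)}] ζ) (𝓝[≥] 0) := by
    refine tendsto_nhdsWithin_iff.2 ⟨?_, eventually_mem_nhdsWithin⟩
    have : Tendsto (fun ξ => σ * (ξ - ζ)) (𝓝 ζ) (𝓝 (σ * (ζ - ζ))) := by
      apply Continuous.tendsto; fun_prop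
    rw [sub_self, mul_zero] at this
    exact this.mono_left nhdsWithin_le_nhds
  filter_upwards [ht.eventually h] with ξ hξ
  rw [← mul_assoc, hσ2, one_mul, add_sub_cancel] at hξ
  exact hξ

lemma hasDerivAt_of_twoSided {f : ℝ → ℝ} {ζ D A A' : ℝ}
    (h : ∀ᶠ d in 𝓝[≥] (0 : ℝ), f (ζ + 1 * d) = f ζ + D * (1 * d) + A * d ^ 2)
    (h' : ∀ᶠ d in 𝓝[≥] (0 : ℝ), f (ζ + -1 * d) = f ζ + D * (-1 * d) + A' * d ^ 2) :
    HasDerivAt f D ζ := by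
  have := (hasDerivWithinAt_of_oneSided (Or.inl rfl) h).union
    (hasDerivWithinAt_of_oneSided (Or.inr rfl) h')
  rw [← hasDerivWithinAt_univ]
  refine this.mono fun ξ _ => ?_
  rcases le_total ζ ξ with h | h
  · left; change 0 ≤ 1 * (ξ - ζ); linarith
  · right; change 0 ≤ -1 * (ξ - ζ); linarith

/-- The expansions on the two sides may differ in their quadratic coefficients, but share the linear
coefficient 2 `sobExp`. -/
lemma hasDerivAt_fob (ζ : ℝ) : HasDerivAt P.fob (2 * P.sobExp ζ) ζ := by
  obtain ⟨A, l, h⟩ := P.exists_oneSided_fob ζ (Or.inl rfl)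
  obtain ⟨A', l', h'⟩ := P.exists_oneSided_fob ζ (Or.inr rfl)
  exact hasDerivAt_of_twoSided (h.mono fun _ h => h.1) (h'.mono fun _ h => h.1)

lemma continuous_fob : Continuous P.fob :=
  continuous_iff_continuousAt.2 fun ζ => (P.hasDerivAt_fob ζ).continuousAt

/-- The one-sided slopes may differ, so each side is treated separately and only continuity results.
-/
lemma continuous_logSobLin : Continuous P.logSobLin := by
  refine continuous_iff_continuousAt.2 fun ζ => ?_
  obtain ⟨_, l, h⟩ := P.exists_oneSided_fob ζ (Or.inl rfl)
  obtain ⟨_, l', h'⟩ := P.exists_oneSided_fob ζ (Or.inr rfl)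
  have h1 := (hasDerivWithinAt_of_oneSided (f := P.logSobLin) (ζ := ζ) (D := l) (A := 0) (Or.inl rfl)
    (h.mono fun d h => by rw [h.2]; ring)).continuousWithinAt
  have h2 := (hasDerivWithinAt_of_oneSided (f := P.logSobLin) (ζ := ζ) (D := -l') (A := 0) (Or.inr rfl)
    (h'.mono fun d h => by rw [h.2]; ring)).continuousWithinAt
  rw [← continuousWithinAt_univ]
  refine (h1.union h2).mono fun ξ _ => ?_
  rcases le_total ζ ξ with h | h
  · left; change 0 ≤ 1 * (ξ - ζ); linarith
  · right; change 0 ≤ -1 * (ξ - ζ); linarith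

lemma continuous_logSob : Continuous P.logSob :=
  (P.continuous_fob.mul continuous_const).add P.continuous_logSobLin

/-! ### Maximizers of `fob` -/

lemma mMinus_le_zero : P.mMinus ≤ 0 := Finset.min'_le _ _ (Finset.mem_insert_self _ _)

lemma zero_le_mPlus : 0 ≤ P.mPlus :=
  neg_nonneg.2 (Finset.min'_le _ _ (Finset.mem_insert_self _ _))

lemma mMinus_le (r : Fin P.nβ) : P.mMinus ≤ P.β r :=
  Finset.min'_le _ _ (Finset.mem_insert_of_mem (Finset.mem_image_of_mem _ (Finset.mem_univ r)))

lemma le_mPlus (r : Fin P.nα) : -P.α r ≤ P.mPlus :=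
  neg_le_neg (Finset.min'_le _ _
    (Finset.mem_insert_of_mem (Finset.mem_image_of_mem _ (Finset.mem_univ r))))

lemma zero_mem_interval : (0 : ℝ) ∈ P.interval :=
  ⟨by exact_mod_cast P.mMinus_le_zero, by exact_mod_cast P.zero_le_mPlus⟩

lemma M_nonempty : P.M.Nonempty := by
  obtain ⟨ζ, h1, h2⟩ := isCompact_Icc.exists_isMaxOn ⟨0, P.zero_mem_interval⟩
    P.continuous_fob.continuousOn
  exact ⟨ζ, h1, h2⟩

lemma fobMax_eq {ζ : ℝ} (hζ : ζ ∈ P.M) : P.fobMax = P.fob ζ := by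
  refine IsGreatest.csSup_eq ⟨⟨ζ, hζ.1, rfl⟩, ?_⟩
  rintro _ ⟨ξ, hξ, rfl⟩
  exact hζ.2 hξ

lemma fob_le_fobMax {ζ : ℝ} (hζ : ζ ∈ P.interval) : P.fob ζ ≤ P.fobMax := by
  obtain ⟨ξ, hξ⟩ := P.M_nonempty
  rw [P.fobMax_eq hξ]; exact hξ.2 hζ

lemma mem_M_iff {ζ : ℝ} : ζ ∈ P.M ↔ ζ ∈ P.interval ∧ P.fob ζ = P.fobMax :=
  ⟨fun h => ⟨h.1, (P.fobMax_eq h).symm⟩,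
    fun h => ⟨h.1, fun ξ hξ => by change P.fob ξ ≤ P.fob ζ; rw [h.2]; exact P.fob_le_fobMax hξ⟩⟩

lemma isCompact_M : IsCompact P.M := by
  have : P.M = P.interval ∩ P.fob ⁻¹' {P.fobMax} := by
    ext ζ; exact P.mem_M_iff
  rw [this]
  exact isCompact_Icc.inter_right (isClosed_singleton.preimage P.continuous_fob)

lemma M₀_nonempty : P.M₀.Nonempty := by
  obtain ⟨ζ, h1, h2⟩ := P.isCompact_M.exists_isMinOn P.M_nonempty P.continuous_logSob.continuousOn
  refine ⟨ζ, h1, fun ξ hξ => ?_⟩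
  change ‖P.sob ζ 0‖ ≤ ‖P.sob ξ 0‖
  rw [norm_sob_zero, norm_sob_zero]
  exact Real.exp_le_exp.2 (h2 hξ)

lemma M₀_subset_M : P.M₀ ⊆ P.M := fun _ h => h.1

lemma logSob_le_of_mem_M₀ {μ ζ : ℝ} (hμ : μ ∈ P.M₀) (hζ : ζ ∈ P.M) : P.logSob μ ≤ P.logSob ζ := by
  have : ‖P.sob μ 0‖ ≤ ‖P.sob ζ 0‖ := hμ.2 hζ
  rwa [norm_sob_zero, norm_sob_zero, Real.exp_le_exp] at this

lemma mem_M₀_of_le {μ ζ : ℝ} (hμ : μ ∈ P.M₀) (hζ : ζ ∈ P.M) (h : P.logSob ζ ≤ P.logSob μ) :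
    ζ ∈ P.M₀ := by
  refine ⟨hζ, fun ξ hξ => ?_⟩
  change ‖P.sob ζ 0‖ ≤ ‖P.sob ξ 0‖
  rw [norm_sob_zero, norm_sob_zero]
  exact Real.exp_le_exp.2 (h.trans (P.logSob_le_of_mem_M₀ hμ hξ))

/-- An endpoint of the interval at which `fob` is maximal is a critical point of `fob`. -/
def CriticalEnds : Prop :=
  ∀ ζ ∈ P.M, ζ = (P.mMinus : ℝ) ∨ ζ = (P.mPlus : ℝ) → deriv P.fob ζ = 0

/-- A maximizer in the interior is a critical point by Fermat's theorem, and one at an end by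
assumption. The derivative is twice `sobExp`. -/
lemma sobExp_eq_zero (hend : P.CriticalEnds) {ζ : ℝ} (hζ : ζ ∈ P.M) : P.sobExp ζ = 0 := by
  have h0 : deriv P.fob ζ = 0 := by
    by_cases h : ζ = (P.mMinus : ℝ) ∨ ζ = (P.mPlus : ℝ)
    · exact hend ζ hζ h
    · push Not at h
      refine IsLocalMax.deriv_eq_zero (hζ.2.isLocalMax ?_)
      exact Icc_mem_nhds (lt_of_le_of_ne hζ.1.1 h.1.symm) (lt_of_le_of_ne hζ.1.2 h.2)
  rw [(P.hasDerivAt_fob ζ).deriv] at h0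
  linarith

theorem sob_eq_of_mem_M (hend : P.CriticalEnds) {ζ : ℝ} (hζ : ζ ∈ P.M) (logz : ℂ) : P.sob ζ logz = P.sob ζ 0 := by
  rw [sob_eq_mul_exp, P.sobExp_eq_zero hend hζ]; simp

end Data

namespace Data

variable (P : Data)

/-! ### Rationality of the minimizers -/

/-- At an irrational μ no shifted argument is an integer, so on a two-sided neighbourhood `fob` has
one integer quadratic coefficient A and `logSobLin` one slope l. If A ≠ 0, then `sobExp μ = 0` reads
Aμ + c = 0 with c rational. If A = 0, `fob` is constant near μ; minimality in both directions forces
l = 0, and a whole neighbourhood of μ lies in M₀, against finiteness. -/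
theorem rational_of_mem_M₀ (hend : P.CriticalEnds) (hfin : P.M₀.Finite) {μ : ℝ} (hμ : μ ∈ P.M₀) :
    ∃ a : ℚ, (a : ℝ) = μ := by
  by_contra! hirr
  have hM := P.M₀_subset_M hμ
  have hadj : ∀ (b : ℚ) (σ : ℝ), σ = 1 ∨ σ = -1 → ∃ k : ℤ, (k : ℝ) ≤ b + σ * μ ∧
      b + σ * μ ≤ k + 1 ∧
      ∀ᶠ d in 𝓝 (0 : ℝ), k ≤ b + σ * μ + σ * d ∧ b + σ * μ + σ * d ≤ k + 1 := by
    intro b σ hσ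
    have h1 := Int.floor_le (b + σ * μ)
    have h2 := Int.lt_floor_add_one (b + σ * μ)
    have h3 : (⌊b + σ * μ⌋ : ℝ) ≠ b + σ * μ := by
      intro h
      rcases hσ with rfl | rfl
      · exact hirr (⌊b + 1 * μ⌋ - b) (by push_cast; linarith)
      · exact hirr (b - ⌊b + -1 * μ⌋) (by push_cast; linarith)
    refine ⟨⌊b + σ * μ⌋, h1, h2.le, ?_⟩
    have hc : Tendsto (fun d => b + σ * μ + σ * d) (𝓝 0) (𝓝 (b + σ * μ)) := by
      have : Continuous fun d => b + σ * μ + σ * d := by fun_prop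
      simpa using this.tendsto 0
    filter_upwards [hc.eventually_const_lt (lt_of_le_of_ne h1 h3), hc.eventually_lt_const h2] with d a b
    exact ⟨a.le, b.le⟩
  choose ka ka1 ka2 ha using fun r => hadj (P.α r) 1 (Or.inl rfl)
  choose kb kb1 kb2 hb using fun r => hadj (P.β r) (-1) (Or.inr rfl)
  choose kd kd1 kd2 hd using fun r => hadj (P.δ r) 1 (Or.inl rfl)
  have fa : ∀ r, (P.α r : ℝ) + 1 * μ = P.α r + μ := fun r => by ring
  have fb : ∀ r, (P.β r : ℝ) + -1 * μ = P.β r - μ := fun r => by ring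
  have fd : ∀ r, (P.δ r : ℝ) + 1 * μ = P.δ r + μ := fun r => by ring
  simp only [fa, fb, fd] at ka1 ka2 ha kb1 kb2 hb kd1 kd2 hd
  set A : ℤ := ∑ r, ka r + ∑ r, kb r + ∑ _r : Fin P.nγ, 1 with hA
  set l : ℝ := ∑ r, ka r * ((P.logt r).re - P.logq.re / 2) -
    ∑ r, kb r * ((P.logu r).re - P.logq.re / 2) +
    ∑ r, ((P.logv r).re - P.logq.re / 2) + ∑ r, kd r * P.logq.re with hl
  have hloc : ∀ᶠ d in 𝓝 (0 : ℝ), P.fob (μ + d) = P.fob μ + 2 * P.sobExp μ * d + A * d ^ 2 ∧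
      P.logSobLin (μ + d) = P.logSobLin μ + l * d := by
    filter_upwards [eventually_all.2 ha, eventually_all.2 hb, eventually_all.2 hd] with d ha hb hd
    have e1 : ∀ r, (P.α r : ℝ) + (μ + d) = P.α r + μ + 1 * d := fun r => by ring
    have e2 : ∀ r, (P.β r : ℝ) - (μ + d) = P.β r - μ + -1 * d := fun r => by ring
    have e3 : ∀ r, (P.δ r : ℝ) + (μ + d) = P.δ r + μ + 1 * d := fun r => by ring
    have e4 : ∀ r, ((P.γ r : ℝ) + (μ + d)) ^ 2 =
        (P.γ r + μ) ^ 2 + 2 * (P.γ r + μ) * d + 1 * d ^ 2 := fun r => by ring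
    have e5 : ∀ r, (P.γ r : ℝ) + (μ + d) = (P.γ r + μ) + d := fun r => by ring
    have ga := fun r => gDiff_add (ka1 r) (ka2 r) (ha r).1 (ha r).2
    have gb := fun r => gDiff_add (kb1 r) (kb2 r) (hb r).1 (hb r).2
    have ba := fun r => binomDiff_add (ka1 r) (ka2 r) (ha r).1 (ha r).2
    have bb := fun r => binomDiff_add (kb1 r) (kb2 r) (hb r).1 (hb r).2
    have bd := fun r => binomDiff_add (kd1 r) (kd2 r) (hd r).1 (hd r).2
    constructor
    · simp only [fob, e1, e2, e4, ga, gb, Finset.sum_add_distrib, ← Finset.sum_mul,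
        ← Finset.mul_sum, sobExp, hA]
      push_cast
      ring
    · simp only [logSobLin, e1, e2, e3, e5, ba, bb, bd, add_mul, Finset.sum_add_distrib]
      have c1 : ∀ {n : ℕ} (k x : Fin n → ℝ) (τ : ℝ),
          ∑ r, k r * (τ * d) * x r = (∑ r, k r * x r) * τ * d := fun k x τ => by
        rw [Finset.sum_mul, Finset.sum_mul]
        exact Finset.sum_congr rfl fun _ _ => by ring
      have c3 : ∑ r, d * ((P.logv r).re - P.logq.re / 2) =
          d * ∑ r, ((P.logv r).re - P.logq.re / 2) := (Finset.mul_sum _ _ _).symm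
      rw [c1, c1, c1 _ (fun _ => P.logq.re), c3, hl]
      ring
  have h0 := P.sobExp_eq_zero hend hM
  have hA0 : A = 0 := by
    by_contra hA0
    have h1 : ∃ c : ℚ, P.sobExp μ = A * μ + c := by
      -- On the interval [k, k+1] one has b(a) = ka - k(k+1)/2; the slopes of the three sums combine
      -- to A and the rest is rational.
      refine ⟨∑ r, (ka r * P.α r - ka r * (ka r + 1) / 2) -
        ∑ r, (kb r * P.β r - kb r * (kb r + 1) / 2) + ∑ r, P.γ r, ?_⟩
      have ea := fun r => binomDiff_of_mem (ka1 r) (ka2 r)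
      have eb := fun r => binomDiff_of_mem (kb1 r) (kb2 r)
      unfold sobExp
      simp only [ea, eb, hA]
      push_cast
      simp only [mul_add, mul_sub, Finset.sum_add_distrib, Finset.sum_sub_distrib,
        ← Finset.sum_mul, Finset.sum_const, add_mul]
      simp only [nsmul_eq_mul, mul_one]
      ring
    obtain ⟨c, hc⟩ := h1
    have hA1 : (A : ℝ) ≠ 0 := by exact_mod_cast hA0
    refine hirr (-c / A) ?_
    push_cast
    rw [div_eq_iff hA1]
    linarith
  have hint : ∀ᶠ d in 𝓝 (0 : ℝ), μ + d ∈ P.interval := by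
    have h1 : P.interval ∈ 𝓝 μ := Icc_mem_nhds (lt_of_le_of_ne hM.1.1 (hirr _))
      (lt_of_le_of_ne hM.1.2 (hirr _).symm)
    have h2 : Tendsto (fun d => μ + d) (𝓝 0) (𝓝 μ) := by
      have : Continuous fun d => μ + d := by fun_prop
      simpa using this.tendsto 0
    exact h2 h1
  have hMd : ∀ᶠ d in 𝓝 (0 : ℝ), μ + d ∈ P.M ∧ P.logSob (μ + d) = P.logSob μ + l * d := by
    filter_upwards [hloc, hint] with d h1 h2
    have h3 : P.fob (μ + d) = P.fob μ := by rw [h1.1, h0, hA0]; simp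
    refine ⟨P.mem_M_iff.2 ⟨h2, by rw [h3, P.fobMax_eq hM]⟩, ?_⟩
    rw [logSob, logSob, h3, h1.2]; ring
  have hl0 : l = 0 := by
    obtain ⟨η, hη, hball⟩ := Metric.eventually_nhds_iff.1 hMd
    have h1 := hball (y := η / 2) (by simp [abs_of_pos hη]; linarith)
    have h2 := hball (y := -(η / 2)) (by simp [abs_of_pos hη]; linarith)
    have h3 := P.logSob_le_of_mem_M₀ hμ h1.1
    have h4 := P.logSob_le_of_mem_M₀ hμ h2.1
    rw [h1.2] at h3
    rw [h2.2] at h4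
    nlinarith
  have hM₀ : ∀ᶠ d in 𝓝 (0 : ℝ), μ + d ∈ P.M₀ := by
    filter_upwards [hMd] with d hd
    exact P.mem_M₀_of_le hμ hd.1 (by rw [hd.2, hl0]; simp)
  have : P.M₀ ∈ 𝓝 μ := by
    have h2 : Tendsto (fun ξ => ξ - μ) (𝓝 μ) (𝓝 0) := by
      have : Continuous fun ξ => ξ - μ := by fun_prop
      simpa using this.tendsto μ
    filter_upwards [h2.eventually hM₀] with ξ hξ
    simpa using hξ
  exact infinite_of_mem_nhds μ this hfin

/-! ### Decay of the integrand away from the minimizers -/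

/-- The logarithm of the decay of the rescaled integrand at `p^ζ`, relative to its size at the
minimizers of `|sob|`, where `Lmin` is the minimal value of `log |sob|`. -/
def energy (Lmin v ζ : ℝ) : ℝ :=
  (P.fobMax - P.fob ζ) * v ^ 2 / 2 * (-P.logq.re) + v * (P.logSob ζ - Lmin)

/-- The interval `[a, b]` on which `fob` is at most `fobMax`, and `log |sob|` is at least `Lmin`
wherever `fob` equals `fobMax`, with equality only in `M₀`. -/
structure IsDecayInterval (Lmin a b : ℝ) : Prop where
  fob_le : ∀ ζ ∈ Set.Icc a b, P.fob ζ ≤ P.fobMax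
  sobExp_eq : ∀ ζ ∈ Set.Icc a b, P.fob ζ = P.fobMax → P.sobExp ζ = 0
  le_logSob : ∀ ζ ∈ Set.Icc a b, P.fob ζ = P.fobMax → Lmin ≤ P.logSob ζ
  mem_M₀ : ∀ ζ ∈ Set.Icc a b, P.fob ζ = P.fobMax → P.logSob ζ ≤ Lmin → ζ ∈ P.M₀

/-- The lower bound for the energy, near the points of `s`. -/
def EnergyBound (Lmin K : ℝ) (s : Set ℝ) : Prop :=
  ∃ κ > 0, ∃ C, ∃ V ≥ 1, ∀ v ≥ V, ∀ ζ ∈ s, ∀ ζ', |ζ' - ζ| ≤ K / v →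
    κ * (v * Metric.infDist ζ P.M₀) - C ≤ P.energy Lmin v ζ'

variable {P}

lemma EnergyBound.mono {Lmin K : ℝ} {s s' : Set ℝ} (h : s ⊆ s') (hs : P.EnergyBound Lmin K s') :
    P.EnergyBound Lmin K s := by
  obtain ⟨κ, hκ, C, V, hV, H⟩ := hs
  exact ⟨κ, hκ, C, V, hV, fun v hv ζ hζ => H v hv ζ (h hζ)⟩

lemma EnergyBound.union {Lmin K : ℝ} {s s' : Set ℝ} (hs : P.EnergyBound Lmin K s)
    (hs' : P.EnergyBound Lmin K s') : P.EnergyBound Lmin K (s ∪ s') := by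
  obtain ⟨κ, hκ, C, V, hV, H⟩ := hs
  obtain ⟨κ', hκ', C', V', hV', H'⟩ := hs'
  refine ⟨min κ κ', lt_min hκ hκ', max C C', max V V', le_max_of_le_left hV,
    fun v hv ζ hζ ζ' h => ?_⟩
  have h0 : 0 ≤ v * Metric.infDist ζ P.M₀ :=
    mul_nonneg (by linarith [le_max_left V V']) Metric.infDist_nonneg
  rcases hζ with hζ | hζ
  · have := H v ((le_max_left _ _).trans hv) ζ hζ ζ' h
    have := mul_le_mul_of_nonneg_right (min_le_left κ κ') h0
    linarith [le_max_left C C']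
  · have := H' v ((le_max_right _ _).trans hv) ζ hζ ζ' h
    have := mul_le_mul_of_nonneg_right (min_le_right κ κ') h0
    linarith [le_max_right C C']

/-- Near a point where `fob` is below its maximum the energy grows like v², which beats any multiple
of v. -/
lemma energyBound_of_fob_lt (hq : P.logq.re < 0) (Lmin K : ℝ) {ξ : ℝ}
    (h : P.fob ξ < P.fobMax) : ∃ s ∈ 𝓝 ξ, P.EnergyBound Lmin K s := by
  set δ := (P.fobMax - P.fob ξ) / 2 with hδ
  have hδ0 : 0 < δ := by rw [hδ]; linarith
  have h1 : ∀ᶠ ζ in 𝓝 ξ, P.fob ζ < P.fobMax - δ :=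
    P.continuous_fob.continuousAt.eventually_lt_const (by linarith)
  have h2 : ∀ᶠ ζ in 𝓝 ξ, P.logSob ξ - 1 < P.logSob ζ :=
    P.continuous_logSob.continuousAt.eventually_const_lt (by linarith)
  obtain ⟨η, hη, hball⟩ := Metric.eventually_nhds_iff.1 (h1.and h2)
  set D := Metric.infDist ξ P.M₀ + η + |P.logSob ξ - 1 - Lmin| with hD
  have hD0 : 0 ≤ D := by have := Metric.infDist_nonneg (x := ξ) (s := P.M₀); positivity
  have hl : 0 < -P.logq.re := by linarith
  -- The first threshold for v keeps ζ' in the ball of radius η. The second makes the quadratic gain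
  -- exceed v D, where D bounds the distance to M₀ plus the possible deficit of `logSob`.
  refine ⟨Metric.ball ξ (η / 2), Metric.ball_mem_nhds _ (by linarith), 1, one_pos, 0,
    max 1 (max (2 * K / η + 1) (D / (δ / 2 * -P.logq.re))), le_max_left _ _,
    fun v hv ζ hζ ζ' hζ' => ?_⟩
  have hv1 : 1 ≤ v := (le_max_left _ _).trans hv
  have hv2 : 2 * K / η + 1 ≤ v := (le_max_left _ _).trans ((le_max_right _ _).trans hv)
  have hv3 : D / (δ / 2 * -P.logq.re) ≤ v := (le_max_right _ _).trans ((le_max_right _ _).trans hv)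
  have hv0 : 0 < v := by linarith
  rw [Metric.mem_ball, Real.dist_eq] at hζ
  have h3 : |ζ' - ξ| < η := by
    have : K / v < η / 2 := by
      rw [div_lt_iff₀ hv0]
      have : 2 * K / η < v := by linarith
      rw [div_lt_iff₀ hη] at this
      linarith
    have := abs_sub_le ζ' ζ ξ
    linarith
  obtain ⟨h4, h5⟩ := hball (show dist ζ' ξ < η by rwa [Real.dist_eq])
  have h6 : Metric.infDist ζ P.M₀ ≤ Metric.infDist ξ P.M₀ + η := by
    have := Metric.infDist_le_infDist_add_dist (s := P.M₀) (x := ζ) (y := ξ)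
    rw [Real.dist_eq] at this
    linarith
  rw [div_le_iff₀ (by positivity)] at hv3
  have h7 := neg_abs_le (P.logSob ξ - 1 - Lmin)
  unfold energy
  have h8 : δ * v ^ 2 / 2 * -P.logq.re ≤ (P.fobMax - P.fob ζ') * v ^ 2 / 2 * -P.logq.re := by
    gcongr; linarith
  have h9 : v * D ≤ δ * v ^ 2 / 2 * -P.logq.re := by nlinarith
  have h10 : v * Metric.infDist ζ P.M₀ ≤ v * (Metric.infDist ξ P.M₀ + η) := by gcongr
  have h11 : v * (-|P.logSob ξ - 1 - Lmin|) ≤ v * (P.logSob ζ' - Lmin) := by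
    gcongr; linarith
  rw [hD] at h9
  nlinarith


/-- The behaviour of `fob` and `log |sob|` on one side of a maximizer of `fob`. -/
lemma exists_side {Lmin a b : ℝ} (hd : P.IsDecayInterval Lmin a b) {ξ : ℝ}
    (hξ : ξ ∈ Set.Icc a b) (h : P.fob ξ = P.fobMax) {σ : ℝ} (hσ : σ = 1 ∨ σ = -1) :
    ∃ A l η : ℝ, 0 < η ∧ (∀ d, 0 ≤ d → d < η → P.fob (ξ + σ * d) = P.fobMax + A * d ^ 2 ∧
      P.logSob (ξ + σ * d) = P.logSob ξ + l * d + P.logx.re * A * d ^ 2) ∧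
      ((∀ d, 0 < d → d < η → ξ + σ * d ∈ Set.Icc a b) ∨ ∀ ζ ∈ Set.Icc a b, σ * (ζ - ξ) ≤ 0) := by
  obtain ⟨A, l, hloc⟩ := P.exists_oneSided_fob ξ hσ
  obtain ⟨η, hη, hη'⟩ := (mem_nhdsGE_iff_exists_Ico_subset).1 hloc
  have hη0 : 0 < η := hη
  have hexp : ∀ d, 0 ≤ d → d < η → P.fob (ξ + σ * d) = P.fobMax + A * d ^ 2 ∧
      P.logSob (ξ + σ * d) = P.logSob ξ + l * d + P.logx.re * A * d ^ 2 := by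
    intro d h0 h1
    obtain ⟨h2, h3⟩ : _ ∧ _ := hη' ⟨h0, h1⟩
    rw [hd.sobExp_eq ξ hξ h] at h2
    have h4 : P.fob (ξ + σ * d) = P.fobMax + A * d ^ 2 := by rw [h2, h]; ring
    refine ⟨h4, ?_⟩
    rw [logSob, logSob, h4, h3, h]; ring
  by_cases hside : ∃ ζ ∈ Set.Icc a b, 0 < σ * (ζ - ξ)
  · obtain ⟨ζ, hζ, hpos⟩ := hside
    refine ⟨A, l, min η (σ * (ζ - ξ)), lt_min hη0 hpos,
      fun d h0 h1 => hexp d h0 (h1.trans_le (min_le_left _ _)), Or.inl fun d h0 h1 => ?_⟩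
    have h2 := h1.trans_le (min_le_right _ _)
    rcases hσ with rfl | rfl
    · exact ⟨by linarith [hξ.1], by linarith [hζ.2]⟩
    · exact ⟨by linarith [hζ.1], by linarith [hξ.2]⟩
  · push Not at hside
    exact ⟨A, l, η, hη0, hexp, Or.inr hside⟩

/-- Write ζ' = ξ + σd and s = vd. The energy is -A s²/2 · (-log|q|) + vΔ + l s + X A d s, where Δ ≥
0 is the excess of `logSob ξ` over the minimum. If Δ > 0, the term vΔ dominates. If Δ = 0, then ξ ∈
M₀, and when the interval continues on this side A ≤ 0; for A < 0 the square dominates, while for A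
= 0 finiteness of M₀ forces l > 0. If ξ is the end of the interval on this side, s ≤ K and all terms
in s are bounded. -/
lemma energyBound_side (hq : P.logq.re < 0) {Lmin K a b : ℝ}
    (hfin : P.M₀.Finite) (hd : P.IsDecayInterval Lmin a b) {ξ : ℝ} (hξ : ξ ∈ Set.Icc a b)
    (h : P.fob ξ = P.fobMax) {σ : ℝ} (hσ : σ = 1 ∨ σ = -1) :
    ∃ κ > 0, ∃ C, ∃ V ≥ 1, ∃ η > 0, ∀ v ≥ V, ∀ ζ ∈ Set.Icc a b, |ζ - ξ| < η → ∀ ζ', |ζ' - ζ| ≤ K / v →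
      0 ≤ σ * (ζ' - ξ) → κ * (v * Metric.infDist ζ P.M₀) - C ≤ P.energy Lmin v ζ' := by
  obtain ⟨A, l, η, hη, hexp, hside⟩ := exists_side hd hξ h hσ
  have hl : 0 < -P.logq.re := by linarith
  have hσ2 : σ * σ = 1 := by rcases hσ with rfl | rfl <;> norm_num
  set Δ := P.logSob ξ - Lmin with hΔ
  have hΔ0 : 0 ≤ Δ := sub_nonneg.2 (hd.le_logSob ξ hξ h)
  set X := P.logx.re with hX
  have hen : ∀ v d, 0 ≤ d → d < η → P.energy Lmin v (ξ + σ * d) =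
      -A * (v * d) ^ 2 / 2 * -P.logq.re + v * Δ + l * (v * d) + X * A * d * (v * d) := by
    intro v d h0 h1
    obtain ⟨h2, h3⟩ := hexp d h0 h1
    unfold energy
    rw [h2, h3, hΔ]; ring
  -- on the side of `ζ'`, the distance to `ξ` is either controlled by `K`, or `A ≤ 0`
  have hA : (∀ ζ ∈ Set.Icc a b, σ * (ζ - ξ) ≤ 0) ∨ A ≤ 0 := by
    rcases hside with h1 | h1
    · right
      have h2 := hd.fob_le _ (h1 (η / 2) (by linarith) (by linarith))
      rw [(hexp (η / 2) (by linarith) (by linarith)).1] at h2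
      by_contra h3; push Not at h3
      have : 0 < A * (η / 2) ^ 2 := by positivity
      linarith
    · exact Or.inl h1
  have habsσ : ∀ x, |σ * x| = |x| := fun x => by
    rw [abs_mul]; rcases hσ with rfl | rfl <;> simp
  -- When Δ > 0, the radius η' is so small that the terms with l and XA cost at most half of vΔ.
  obtain ⟨η', hη', hη1, hηη, hsmall⟩ : ∃ η' > 0, η' ≤ 1 ∧ η' ≤ η ∧
      (0 < Δ → (|l| + |X * A|) * η' ≤ Δ / 2) := by
    rcases hΔ0.eq_or_lt with h0 | h0
    · exact ⟨min 1 η, lt_min one_pos hη, min_le_left _ _, min_le_right _ _, fun h => by linarith⟩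
    · have hpos : 0 < |l| + |X * A| + 1 := by positivity
      refine ⟨min (min 1 η) (Δ / 2 / (|l| + |X * A| + 1)),
        lt_min (lt_min one_pos hη) (by positivity), (min_le_left _ _).trans (min_le_left _ _),
        (min_le_left _ _).trans (min_le_right _ _), fun _ => ?_⟩
      calc (|l| + |X * A|) * min (min 1 η) (Δ / 2 / (|l| + |X * A| + 1))
          ≤ (|l| + |X * A| + 1) * (Δ / 2 / (|l| + |X * A| + 1)) := by
            refine mul_le_mul (by linarith) (min_le_right _ _) ?_ hpos.le
            exact le_min (le_min zero_le_one hη.le) (by positivity)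
        _ = Δ / 2 := by field_simp
  -- reduction to an estimate in terms of `d = |ζ' - ξ|`
  suffices hmain : ∃ κ > 0, ∃ C, ∀ v ≥ 1, ∀ ζ ∈ Set.Icc a b, |ζ - ξ| < η' / 2 → ∀ d, 0 ≤ d → d < η' →
      |ζ - ξ| ≤ K / v + d → (A ≤ 0 ∨ v * d ≤ K) →
      (0 < Δ ∨ (∀ d, 0 < d → d < η → ξ + σ * d ∈ Set.Icc a b) ∨ v * d ≤ K) →
      κ * (v * Metric.infDist ζ P.M₀) - C ≤ P.energy Lmin v (ξ + σ * d) by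
    obtain ⟨κ, hκ, C, hmain⟩ := hmain
    refine ⟨κ, hκ, C, max 1 (2 * K / η' + 1), le_max_left _ _, η' / 2, by linarith,
      fun v hv ζ hζ hζξ ζ' hζ' hpos => ?_⟩
    have hv1 : 1 ≤ v := (le_max_left _ _).trans hv
    have hv0 : 0 < v := by linarith
    have hv2 : 2 * K / η' + 1 ≤ v := (le_max_right _ _).trans hv
    have hKv : K / v < η' / 2 := by
      rw [div_lt_iff₀ hv0]
      have : 2 * K / η' < v := by linarith
      rw [div_lt_iff₀ hη'] at this
      linarith
    have hd' : σ * (ζ' - ξ) = |ζ' - ξ| := by rw [← habsσ, abs_of_nonneg hpos]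
    have e : ζ' = ξ + σ * (σ * (ζ' - ξ)) := by rw [← mul_assoc, hσ2]; ring
    have hK' : (∀ ζ ∈ Set.Icc a b, σ * (ζ - ξ) ≤ 0) → v * (σ * (ζ' - ξ)) ≤ K := by
      intro h1
      have h2 : σ * (ζ' - ξ) ≤ K / v := by
        have h3 : σ * (ζ' - ζ) ≤ |ζ' - ζ| := (le_abs_self _).trans (habsσ _).le
        have h4 := h1 ζ hζ
        linarith
      rw [le_div_iff₀ hv0] at h2
      linarith
    rw [e]
    refine hmain v hv1 ζ hζ hζξ _ hpos ?_ ?_ ?_ ?_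
    · rw [hd']; have := abs_sub_le ζ' ζ ξ; linarith
    · rw [hd']; have := abs_sub_le ζ ζ' ξ; rw [abs_sub_comm ζ ζ'] at this; linarith
    · exact hA.symm.imp_right hK'
    · right; exact hside.imp_right hK'
  rcases hΔ0.eq_or_lt with h0 | h0
  · -- `ξ` is a minimizer
    have hξM : ξ ∈ P.M₀ := hd.mem_M₀ ξ hξ h (by linarith)
    suffices hlow : ∃ κ > 0, ∃ C, ∀ v ≥ 1, ∀ d, 0 ≤ d → d < η' → (A ≤ 0 ∨ v * d ≤ K) →
        ((∀ d, 0 < d → d < η → ξ + σ * d ∈ Set.Icc a b) ∨ v * d ≤ K) →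
        κ * (v * d) - C ≤ P.energy Lmin v (ξ + σ * d) by
      obtain ⟨κ, hκ, C, hlow⟩ := hlow
      refine ⟨κ, hκ, C + κ * K, fun v hv ζ hζ _ d h1 h2 h3 h4 h5 => ?_⟩
      have h6 := hlow v hv d h1 h2 h4 (h5.resolve_left h0.not_lt)
      have h7 : v * Metric.infDist ζ P.M₀ ≤ K + v * d := by
        have h8 : Metric.infDist ζ P.M₀ ≤ K / v + d :=
          (Metric.infDist_le_dist_of_mem hξM).trans h3
        have hv0 : 0 < v := by linarith
        calc v * Metric.infDist ζ P.M₀ ≤ v * (K / v + d) := by gcongr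
          _ = K + v * d := by field_simp
      have := mul_le_mul_of_nonneg_left h7 hκ.le
      linarith
    rcases hside with h1 | h1
    · have hA' : A ≤ 0 := by
        rcases hA with h2 | h2
        · have := h2 _ (h1 (η / 2) (by linarith) (by linarith))
          rw [add_sub_cancel_left, ← mul_assoc, hσ2] at this
          linarith
        · exact h2
      rcases hA'.eq_or_lt with hA0 | hA0
      -- With A = 0 and l ≤ 0 the whole one-sided segment would consist of minimizers, contradicting
      -- finiteness of M₀.
      · have hl0 : 0 < l := by
          by_contra hl0; push Not at hl0
          have hsub : ∀ d, 0 < d → d < η → ξ + σ * d ∈ P.M₀ := by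
            intro d h2 h3
            obtain ⟨h4, h5⟩ := hexp d h2.le h3
            refine hd.mem_M₀ _ (h1 d h2 h3) (by rw [h4, hA0]; ring) ?_
            rw [h5, hA0]
            nlinarith
          have hinf : (Set.Ioo 0 η).Infinite := Set.Ioo_infinite hη
          refine hinf.image (f := fun d => ξ + σ * d) ?_ (hfin.subset ?_)
          · intro x _ y _ hxy
            have : σ * x = σ * y := by simpa using hxy
            have := congrArg (σ * ·) this
            simpa [← mul_assoc, hσ2] using this
          · rintro _ ⟨d, hd, rfl⟩
            exact hsub d hd.1 hd.2
        refine ⟨l, hl0, 0, fun v hv d h2 h3 _ _ => ?_⟩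
        rw [hen v d h2 (h3.trans_le hηη), ← h0, hA0]
        apply le_of_eq; ring
      · set c := -A / 2 * -P.logq.re with hc
        have hc0 : 0 < c := by rw [hc]; apply mul_pos <;> linarith
        set m := 1 + |l| + |X * A| with hm
        -- The constant completes the square: m s ≤ c s² + m²/(4c). The three parts of m pay for the
        -- slope 1 and for the two linear terms.
        refine ⟨1, one_pos, m ^ 2 / (4 * c), fun v hv d h2 h3 _ _ => ?_⟩
        have hs : 0 ≤ v * d := mul_nonneg (by linarith) h2
        rw [hen v d h2 (h3.trans_le hηη), ← h0]
        have h4 : -(|l| * (v * d)) ≤ l * (v * d) := by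
          have := neg_abs_le l; nlinarith
        have h5 : -(|X * A| * (v * d)) ≤ X * A * d * (v * d) := by
          have h6 : |X * A * d| ≤ |X * A| := by
            rw [abs_mul, abs_of_nonneg h2]
            exact mul_le_of_le_one_right (abs_nonneg _) (by linarith)
          have := neg_abs_le (X * A * d); nlinarith
        have h6 : m * (v * d) ≤ c * (v * d) ^ 2 + m ^ 2 / (4 * c) := by
          have h7 : 0 ≤ (2 * c * (v * d) - m) ^ 2 / (4 * c) := by positivity
          have h8 : (2 * c * (v * d) - m) ^ 2 / (4 * c) =
              c * (v * d) ^ 2 + m ^ 2 / (4 * c) - m * (v * d) := by field_simp; ring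
          linarith
        have h7 : -A * (v * d) ^ 2 / 2 * -P.logq.re = c * (v * d) ^ 2 := by rw [hc]; ring
        rw [h7]
        rw [hm] at h6
        nlinarith
    · refine ⟨1, one_pos, K + |A| * K ^ 2 / 2 * -P.logq.re + |l| * K + |X * A| * K,
        fun v hv d h2 h3 _ h4 => ?_⟩
      have hsK : v * d ≤ K := by
        rcases h4 with h4 | h4
        · have := h1 _ (h4 (η / 2) (by linarith) (by linarith))
          rw [add_sub_cancel_left, ← mul_assoc, hσ2] at this
          linarith
        · exact h4
      have hs : 0 ≤ v * d := mul_nonneg (by linarith) h2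
      rw [hen v d h2 (h3.trans_le hηη), ← h0]
      have h5 : -(|A| * K ^ 2 / 2 * -P.logq.re) ≤ -A * (v * d) ^ 2 / 2 * -P.logq.re := by
        have h6 : (v * d) ^ 2 ≤ K ^ 2 := by gcongr
        have h7 : A * (v * d) ^ 2 ≤ |A| * K ^ 2 :=
          mul_le_mul (le_abs_self A) h6 (by positivity) (abs_nonneg _)
        nlinarith
      have h6 : -(|l| * K) ≤ l * (v * d) := by
        have := neg_abs_le l; have := abs_nonneg l; nlinarith
      have h7 : -(|X * A| * K) ≤ X * A * d * (v * d) := by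
        have h8 : |X * A * d| ≤ |X * A| := by
          rw [abs_mul, abs_of_nonneg h2]
          exact mul_le_of_le_one_right (abs_nonneg _) (by linarith)
        have := neg_abs_le (X * A * d); have := abs_nonneg (X * A); nlinarith
      linarith
  · set D := Metric.infDist ξ P.M₀ + 1 with hD
    have hD0 : 0 < D := by
      have := Metric.infDist_nonneg (x := ξ) (s := P.M₀); linarith
    refine ⟨Δ / 2 / D, by positivity, |A| * K ^ 2 / 2 * -P.logq.re,
      fun v hv ζ hζ hζξ d h1 h2 _ h3 _ => ?_⟩
    have hv0 : 0 ≤ v := by linarith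
    have hs : 0 ≤ v * d := mul_nonneg hv0 h1
    rw [hen v d h1 (h2.trans_le hηη)]
    have h4 : v * Metric.infDist ζ P.M₀ ≤ v * D := by
      have := Metric.infDist_le_infDist_add_dist (s := P.M₀) (x := ζ) (y := ξ)
      rw [Real.dist_eq] at this
      gcongr
      linarith
    have h5 : Δ / 2 / D * (v * Metric.infDist ζ P.M₀) ≤ v * (Δ / 2) := by
      calc _ ≤ Δ / 2 / D * (v * D) := by gcongr
        _ = v * (Δ / 2) := by field_simp
    have h6 : -(|A| * K ^ 2 / 2 * -P.logq.re) ≤ -A * (v * d) ^ 2 / 2 * -P.logq.re := by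
      rcases h3 with h3 | h3
      · have : 0 ≤ -A * (v * d) ^ 2 / 2 * -P.logq.re := by
          have : 0 ≤ -A := by linarith
          positivity
        have : 0 ≤ |A| * K ^ 2 / 2 * -P.logq.re := by positivity
        linarith
      · have h6 : (v * d) ^ 2 ≤ K ^ 2 := by gcongr
        have h7 : A * (v * d) ^ 2 ≤ |A| * K ^ 2 :=
          mul_le_mul (le_abs_self A) h6 (by positivity) (abs_nonneg _)
        nlinarith
    have h7 : -(Δ / 2) ≤ l * d + X * A * d * d := by
      have h8 : |X * A * d| ≤ |X * A| := by
        rw [abs_mul, abs_of_nonneg h1]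
        exact mul_le_of_le_one_right (abs_nonneg _) (by linarith)
      have h9 := neg_abs_le (X * A * d)
      have h10 := neg_abs_le l
      have h11 : (|l| + |X * A|) * d ≤ Δ / 2 :=
        (mul_le_mul_of_nonneg_left h2.le (by positivity)).trans (hsmall h0)
      nlinarith
    have h8 : v * (-(Δ / 2)) ≤ v * (l * d + X * A * d * d) := by gcongr
    linarith

/-- By compactness the bound is only needed near each point. It is stated for ζ' within K/v of ζ
because a w with log|w| within a constant of ζ v log|q| has |w| = |p^ζ'| with ζ' - ζ = O(1/v). -/
theorem energyBound_Icc (hq : P.logq.re < 0) {Lmin a b : ℝ} (hfin : P.M₀.Finite)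
    (hd : P.IsDecayInterval Lmin a b) (K : ℝ) :
    P.EnergyBound Lmin K (Set.Icc a b) := by
  refine isCompact_Icc.induction_on (p := P.EnergyBound Lmin K) ?_ (fun s s' h h' => h'.mono h)
    (fun s s' h h' => h.union h') fun ξ hξ => ?_
  · exact ⟨1, one_pos, 0, 1, le_rfl, by simp⟩
  · rcases (hd.fob_le ξ hξ).lt_or_eq with h | h
    · obtain ⟨s, hs, h⟩ := energyBound_of_fob_lt hq Lmin K h
      exact ⟨s, mem_nhdsWithin_of_mem_nhds hs, h⟩
    · obtain ⟨κ, hκ, C, V, hV, η, hη, H⟩ := energyBound_side hq hfin hd hξ h (Or.inl rfl)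
      obtain ⟨κ', hκ', C', V', hV', η', hη', H'⟩ := energyBound_side hq hfin hd hξ h (Or.inr rfl)
      refine ⟨Set.Icc a b ∩ Metric.ball ξ (min η η'),
        inter_mem_nhdsWithin _ (Metric.ball_mem_nhds _ (lt_min hη hη')), min κ κ', lt_min hκ hκ',
        max C C', max V V', le_max_of_le_left hV, ?_⟩
      rintro v hv ζ ⟨hζ, hζξ⟩ ζ' hζ'
      rw [Metric.mem_ball, Real.dist_eq] at hζξ
      have h0 : 0 ≤ v * Metric.infDist ζ P.M₀ :=
        mul_nonneg (by linarith [le_max_left V V']) Metric.infDist_nonneg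
      rcases le_total ξ ζ' with h1 | h1
      · have := H v ((le_max_left _ _).trans hv) ζ hζ (hζξ.trans_le (min_le_left _ _)) ζ' hζ'
          (by linarith)
        have := mul_le_mul_of_nonneg_right (min_le_left κ κ') h0
        linarith [le_max_left C C']
      · have := H' v ((le_max_right _ _).trans hv) ζ hζ (hζξ.trans_le (min_le_right _ _)) ζ' hζ'
          (by linarith)
        have := mul_le_mul_of_nonneg_right (min_le_right κ κ') h0
        linarith [le_max_right C C']

end Data

/-! ### Principal parts -/

/-- A function with a pole at `a` is, near `a`, the sum of a multiple of `1 / (z - a)`, a derivative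
of a function on `ℂ ∖ {a}` and an analytic function. -/
lemma exists_principalPart_aux (a : ℂ) (n : ℕ) : ∀ g : ℂ → ℂ, AnalyticAt ℂ g a →
    ∃ (c : ℂ) (W W' h : ℂ → ℂ), (∀ z ≠ a, HasDerivAt W (W' z) z) ∧
      (∀ z ≠ a, DifferentiableAt ℂ W' z) ∧ AnalyticAt ℂ h a ∧
      ∀ z ≠ a, ((z - a) ^ n)⁻¹ * g z = c / (z - a) + W' z + h z := by
  induction n with
  | zero =>
    intro g hg
    exact ⟨0, 0, 0, g, fun z _ => hasDerivAt_const z 0, fun z _ => differentiableAt_const 0, hg,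
      fun z _ => by simp⟩
  | succ n ih =>
    intro g hg
    obtain ⟨p, hp⟩ := hg
    have hds : AnalyticAt ℂ (dslope g a) a := ⟨_, hp.has_fpower_series_dslope_fslope⟩
    obtain ⟨c, W, W', h, h1, h2, h3, h4⟩ := ih _ hds
    -- Splitting off g(a) leaves a pole of order one less, with the slope of g at a as new
    -- numerator. The term g(a)(z - a)^{-(n+1)} belongs to the residue if n = 0 and is a derivative
    -- otherwise.
    have hsplit : ∀ z ≠ a, ((z - a) ^ (n + 1))⁻¹ * g z =
        g a * ((z - a) ^ (n + 1))⁻¹ + ((z - a) ^ n)⁻¹ * dslope g a z := by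
      intro z hz
      have hz' : z - a ≠ 0 := sub_ne_zero.2 hz
      have := sub_smul_dslope g a z
      rw [smul_eq_mul] at this
      have e : g z = g a + (z - a) * dslope g a z := by rw [this]; ring
      rw [e]; field_simp; ring
    rcases n with _ | n
    · refine ⟨c + g a, W, W', h, h1, h2, h3, fun z hz => ?_⟩
      rw [hsplit z hz, h4 z hz]; ring
    · refine ⟨c, fun z => W z + g a * (-(n + 1 : ℂ)⁻¹ * ((z - a) ^ (n + 1))⁻¹),
        fun z => W' z + g a * ((z - a) ^ (n + 1 + 1))⁻¹, h, fun z hz => (h1 z hz).add ?_,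
        fun z hz => (h2 z hz).add ?_, h3, fun z hz => ?_⟩
      · have hz' : z - a ≠ 0 := sub_ne_zero.2 hz
        have hpow := (((hasDerivAt_id z).sub_const a).fun_pow (n + 1)).fun_inv (pow_ne_zero _ hz')
        have hn : (n + 1 : ℂ) ≠ 0 := by exact_mod_cast Nat.succ_ne_zero n
        refine ((hpow.const_mul (-(n + 1 : ℂ)⁻¹)).const_mul (g a)).congr_deriv ?_
        simp only [id]
        push_cast
        field_simp
        ring
      · have hz' : z - a ≠ 0 := sub_ne_zero.2 hz
        have : (z - a) ^ (n + 1 + 1) ≠ 0 := pow_ne_zero _ hz'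
        fun_prop (disch := assumption)
      · rw [hsplit z hz, h4 z hz]; ring

lemma exists_principalPart {f : ℂ → ℂ} {a : ℂ} (hf : MeromorphicAt f a) :
    ∃ (c : ℂ) (W W' h : ℂ → ℂ), (∀ z ≠ a, HasDerivAt W (W' z) z) ∧
      (∀ z ≠ a, DifferentiableAt ℂ W' z) ∧ AnalyticAt ℂ h a ∧
      ∀ z ≠ a, f z = c / (z - a) + W' z + h z := by
  obtain ⟨n, hn⟩ := hf
  obtain ⟨c, W, W', h, h1, h2, h3, h4⟩ := exists_principalPart_aux a n _ hn
  refine ⟨c, W, W', h, h1, h2, h3, fun z hz => ?_⟩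
  have hz' : (z - a) ^ n ≠ 0 := pow_ne_zero _ (sub_ne_zero.2 hz)
  rw [← h4 z hz, smul_eq_mul, inv_mul_cancel_left₀ hz']

/-- A meromorphic function with finitely many poles is the sum of multiples of `1 / (z - a)`, a
derivative and a holomorphic function. -/
lemma exists_principalParts {U : Set ℂ} (S : Finset ℂ) : ∀ F : ℂ → ℂ,
    (∀ z ∈ U, z ∉ S → DifferentiableAt ℂ F z) → (∀ z ∈ S, MeromorphicAt F z) →
    ∃ (c : ℂ → ℂ) (W W' h : ℂ → ℂ), (∀ z ∉ S, HasDerivAt W (W' z) z) ∧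
      (∀ z ∉ S, DifferentiableAt ℂ W' z) ∧ DifferentiableOn ℂ h U ∧
      ∀ z ∈ U, z ∉ S → F z = ∑ a ∈ S, c a / (z - a) + W' z + h z := by
  induction S using Finset.induction_on with
  | empty =>
    intro F hF _
    exact ⟨0, 0, 0, F, fun z _ => hasDerivAt_const z 0, fun z _ => differentiableAt_const 0,
      fun z hz => (hF z hz (by simp)).differentiableWithinAt, fun z _ _ => by simp⟩
  | insert a S ha ih =>
    intro F hF hmer
    obtain ⟨c, W, W', h, h1, h2, h3, h4⟩ := exists_principalPart (hmer a (Finset.mem_insert_self _ _))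
    -- The value at a is overwritten since the formula there involves a division by zero. With this
    -- choice F₁ equals h, so the pole at a has been removed.
    set F₁ : ℂ → ℂ := Function.update (fun z => F z - c / (z - a) - W' z) a (h a) with hF₁
    have hF₁ne : ∀ z ≠ a, F₁ z = F z - c / (z - a) - W' z := fun z hz => by
      rw [hF₁, Function.update_of_ne hz]
    have hF₁a : F₁ = h := by
      ext z
      by_cases hz : z = a
      · rw [hz, hF₁, Function.update_self]
      · rw [hF₁ne z hz, h4 z hz]; ring
    have hev : ∀ z ≠ a, F₁ =ᶠ[𝓝 z] fun z => F z - c / (z - a) - W' z := fun z hz => by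
      filter_upwards [isOpen_ne.mem_nhds hz] with w hw using hF₁ne w hw
    have ih1 : ∀ z ∈ U, z ∉ S → DifferentiableAt ℂ F₁ z := by
      intro z hz hzS
      by_cases hza : z = a
      · rw [hF₁a, hza]; exact h3.differentiableAt
      · have hne : z - a ≠ 0 := sub_ne_zero.2 hza
        have d1 := hF z hz (by simp [hza, hzS])
        have d2 := h2 z hza
        have : DifferentiableAt ℂ (fun z => F z - c / (z - a) - W' z) z := by
          fun_prop (disch := assumption)
        exact this.congr_of_eventuallyEq (hev z hza)
    have ih2 : ∀ z ∈ S, MeromorphicAt F₁ z := by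
      intro z hz
      have hza : z ≠ a := fun h => ha (h ▸ hz)
      have hne : z - a ≠ 0 := sub_ne_zero.2 hza
      have m1 := hmer z (Finset.mem_insert_of_mem hz)
      have m2 : AnalyticAt ℂ W' z := DifferentiableOn.analyticAt (s := {a}ᶜ)
        (fun w hw => (h2 w hw).differentiableWithinAt) (isOpen_compl_singleton.mem_nhds hza)
      have m3 : AnalyticAt ℂ (fun z => c / (z - a)) z := by fun_prop (disch := assumption)
      have := (m1.sub m3.meromorphicAt).sub m2.meromorphicAt
      exact this.congr ((hev z hza).symm.filter_mono nhdsWithin_le_nhds)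
    obtain ⟨c', V, V', k, k1, k2, k3, k4⟩ := ih F₁ ih1 ih2
    classical
    refine ⟨Function.update c' a c, fun z => W z + V z, fun z => W' z + V' z, k, ?_, ?_, k3, ?_⟩
    · intro z hz
      rw [Finset.mem_insert, not_or] at hz
      exact (h1 z hz.1).add (k1 z hz.2)
    · intro z hz
      rw [Finset.mem_insert, not_or] at hz
      exact (h2 z hz.1).add (k2 z hz.2)
    · intro z hzU hz
      rw [Finset.mem_insert, not_or] at hz
      have e := k4 z hzU hz.2
      rw [hF₁ne z hz.1] at e
      have e2 : ∑ b ∈ S, Function.update c' a c b / (z - b) = ∑ b ∈ S, c' b / (z - b) :=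
        Finset.sum_congr rfl fun b hb => by
          rw [Function.update_of_ne (fun h : b = a => ha (by rw [← h]; exact hb))]
      rw [Finset.sum_insert ha, Function.update_self, e2]
      linear_combination e

/-! ### Primitives on an annulus -/

/-- Pulled back by exp, the annulus becomes a strip, which is convex, so there is a primitive G. Its
increment under w ↦ w + 2πi is a constant 2πi c; hence G(w) - cw is periodic and descends to a
primitive of h(z) - c/z. -/
lemma exists_primitive_annulus {r R : ℝ} (hr : 0 < r) {h : ℂ → ℂ}
    (hh : DifferentiableOn ℂ h {z | r < ‖z‖ ∧ ‖z‖ < R}) :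
    ∃ (c : ℂ) (H : ℂ → ℂ), ∀ z, r < ‖z‖ → ‖z‖ < R → HasDerivAt H (h z - c / z) z := by
  set T : Set ℂ := {w | Real.log r < w.re} ∩ {w | w.re < Real.log R} with hT
  rcases le_or_gt R r with hrR | hrR
  · exact ⟨0, 0, fun z h1 h2 => absurd (h1.trans h2) (not_lt.2 hrR)⟩
  have hR : 0 < R := hr.trans hrR
  have hTconv : Convex ℝ T := (convex_halfSpace_re_gt _).inter (convex_halfSpace_re_lt _)
  have hTopen : IsOpen T := (isOpen_lt continuous_const Complex.continuous_re).inter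
    (isOpen_lt Complex.continuous_re continuous_const)
  have hopen : IsOpen {z : ℂ | r < ‖z‖ ∧ ‖z‖ < R} :=
    (isOpen_lt continuous_const continuous_norm).inter (isOpen_lt continuous_norm continuous_const)
  have hexp : ∀ w, w ∈ T ↔ r < ‖Complex.exp w‖ ∧ ‖Complex.exp w‖ < R := by
    intro w
    rw [Complex.norm_exp, ← Real.log_lt_iff_lt_exp hr, ← Real.lt_log_iff_exp_lt hR]; rfl
  have hshift : ∀ w ∈ T, ∀ n : ℤ, w + n * (2 * Real.pi * Complex.I) ∈ T := fun w hw n => by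
    rw [hexp] at hw ⊢
    rwa [Complex.exp_add, Complex.exp_int_mul_two_pi_mul_I, mul_one]
  have hd : DifferentiableOn ℂ (fun w => h (Complex.exp w) * Complex.exp w) T := by
    intro w hw
    have h1 : DifferentiableAt ℂ h (Complex.exp w) :=
      hh.differentiableAt (hopen.mem_nhds ((hexp w).1 hw))
    exact ((h1.comp w Complex.differentiableAt_exp).mul
      Complex.differentiableAt_exp).differentiableWithinAt
  obtain ⟨G, hG⟩ := hTconv.exists_forall_hasDerivWithinAt hd
  have hG' : ∀ w ∈ T, HasDerivAt G (h (Complex.exp w) * Complex.exp w) w := fun w hw =>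
    (hG w hw).hasDerivAt (hTopen.mem_nhds hw)
  have hpi : (2 * Real.pi * Complex.I : ℂ) ≠ 0 := Complex.two_pi_I_ne_zero
  obtain ⟨c, hc⟩ : ∃ c : ℂ, ∀ w ∈ T, G (w + 2 * Real.pi * Complex.I) - G w =
      c * (2 * Real.pi * Complex.I) := by
    obtain ⟨d, hd⟩ := hTopen.exists_is_const_of_deriv_eq_zero (𝕜 := ℂ)
      (f := fun w => G (w + 2 * Real.pi * Complex.I) - G w) hTconv.isPreconnected
      (fun w hw => by
        have h1 := hG' _ (by simpa using hshift w hw 1)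
        exact ((h1.comp_add_const w _).sub (hG' w hw)).differentiableAt.differentiableWithinAt)
      (fun w hw => by
        have h1 := hG' _ (by simpa using hshift w hw 1)
        refine ((h1.comp_add_const w _).fun_sub (hG' w hw)).deriv.trans ?_
        rw [Complex.exp_add, Complex.exp_two_pi_mul_I]
        simp)
    exact ⟨d / (2 * Real.pi * Complex.I), fun w hw => by rw [hd w hw, div_mul_cancel₀ _ hpi]⟩
  set G₁ : ℂ → ℂ := fun w => G w - c * w with hG₁
  have hper1 : ∀ w ∈ T, G₁ (w + 2 * Real.pi * Complex.I) = G₁ w := fun w hw => by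
    rw [hG₁]; linear_combination hc w hw
  have hper : ∀ n : ℤ, ∀ w ∈ T, G₁ (w + n * (2 * Real.pi * Complex.I)) = G₁ w := by
    intro n
    induction n using Int.induction_on with
    | zero => simp
    | succ n ih =>
      intro w hw
      have := hper1 _ (hshift w hw n)
      rw [← ih w hw, ← this]; congr 1; push_cast; ring
    | pred n ih =>
      intro w hw
      have := hper1 _ (hshift w hw (-n - 1))
      rw [← this, ← ih w hw]; congr 1; push_cast; ring
  refine ⟨c, fun z => G₁ (Complex.log z), fun z hz1 hz2 => ?_⟩
  have hz0 : z ≠ 0 := norm_pos_iff.1 (hr.trans hz1)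
  set w := Complex.log z with hw
  have hwz : Complex.exp w = z := Complex.exp_log hz0
  have hwT : w ∈ T := by rw [hexp, hwz]; exact ⟨hz1, hz2⟩
  -- This is a branch of the logarithm that is holomorphic near z even on the negative axis. By
  -- periodicity of G₁ it may replace the principal branch.
  set b : ℂ → ℂ := fun ζ => Complex.log (ζ / z) + w with hb
  have hbz : b z = w := by simp [hb, div_self hz0]
  have hbd : HasDerivAt b z⁻¹ z := by
    have h1 : HasDerivAt (fun ζ : ℂ => ζ / z) (1 / z) z := (hasDerivAt_id z).div_const z
    have h2 := (h1.clog (by rw [div_self hz0]; exact Complex.one_mem_slitPlane)).add_const w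
    refine h2.congr_deriv ?_
    rw [div_self hz0]; simp
  have hG₁d : HasDerivAt G₁ (h z * z - c) w := by
    have := (hG' w hwT).sub ((hasDerivAt_id w).const_mul c)
    rw [hwz, mul_one] at this
    exact this
  have hcomp : HasDerivAt (fun ζ => G₁ (b ζ)) ((h z * z - c) * z⁻¹) z := by
    rw [← hbz] at hG₁d
    exact hG₁d.comp z hbd
  have hval : (h z * z - c) * z⁻¹ = h z - c / z := by field_simp
  rw [hval] at hcomp
  refine hcomp.congr_of_eventuallyEq ?_
  have hcont : Tendsto b (𝓝 z) (𝓝 (b z)) := hbd.continuousAt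
  rw [hbz] at hcont
  filter_upwards [hcont (hTopen.mem_nhds hwT), isOpen_ne.mem_nhds hz0] with ζ hζT hζ0
  have he : Complex.exp (Complex.log ζ) = Complex.exp (b ζ) := by
    rw [Complex.exp_log hζ0, hb]
    simp only
    rw [Complex.exp_add, Complex.exp_log (div_ne_zero hζ0 hz0), hwz, div_mul_cancel₀ _ hz0]
  obtain ⟨n, hn⟩ := Complex.exp_eq_exp_iff_exists_int.1 he
  rw [hn]
  exact hper n _ hζT

/-! ### Curve integrals and residues -/

lemma intervalIntegrable_comp_mul_deriv {c : ℝ → ℂ} (hc : IsClosedCurve c) {f : ℂ → ℂ}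
    (hf : ∀ τ ∈ Set.Icc (0 : ℝ) 1, ContinuousAt f (c τ)) :
    IntervalIntegrable (fun τ => f (c τ) * deriv c τ) MeasureTheory.volume 0 1 := by
  refine hc.integrable.continuousOn_mul ?_
  rw [Set.uIcc_of_le zero_le_one]
  exact fun τ hτ => (hf τ hτ).comp_continuousWithinAt (hc.continuousOn τ hτ)

/-- The fundamental theorem of calculus for W along a closed curve; the finitely many parameters
where the curve is not differentiable are harmless. -/
lemma integral_deriv_comp_eq_zero {c : ℝ → ℂ} (hc : IsClosedCurve c) {W W' : ℂ → ℂ}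
    (hW : ∀ τ ∈ Set.Icc (0 : ℝ) 1, HasDerivAt W (W' (c τ)) (c τ))
    (hW' : ∀ τ ∈ Set.Icc (0 : ℝ) 1, ContinuousAt W' (c τ)) :
    ∫ τ in (0 : ℝ)..1, W' (c τ) * deriv c τ = 0 := by
  obtain ⟨S, hS⟩ := hc.differentiable
  rw [MeasureTheory.integral_eq_of_hasDerivAt_off_countable_of_le (fun τ => W (c τ)) _ zero_le_one
    S.countable_toSet
    (fun τ hτ => (hW τ hτ).continuousAt.comp_continuousWithinAt (hc.continuousOn τ hτ))
    (fun τ hτ => ?_) (intervalIntegrable_comp_mul_deriv hc hW'), hc.closed, sub_self]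
  exact (hW τ (Set.Ioo_subset_Icc_self hτ.1)).comp_of_eq τ (hS τ hτ.1 hτ.2).hasDerivAt rfl

/-- The integral of a meromorphic function on an annulus along a closed curve is determined by the
winding numbers of the curve. -/
lemma exists_curveIntegral_eq {r R : ℝ} (hr : 0 < r) (S : Finset ℂ) {F : ℂ → ℂ}
    (hF : ∀ z, r < ‖z‖ → ‖z‖ < R → z ∉ S → DifferentiableAt ℂ F z)
    (hS : ∀ z ∈ S, MeromorphicAt F z) :
    ∃ (c₀ : ℂ) (d : ℂ → ℂ), ∀ c : ℝ → ℂ, IsClosedCurve c →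
      (∀ τ ∈ Set.Icc (0 : ℝ) 1, r < ‖c τ‖ ∧ ‖c τ‖ < R ∧ c τ ∉ S) →
      curveIntegral c F = c₀ * winding c 0 + ∑ a ∈ S, d a * winding c a := by
  set U : Set ℂ := {z | r < ‖z‖ ∧ ‖z‖ < R} with hU
  have hopen : IsOpen U :=
    (isOpen_lt continuous_const continuous_norm).inter (isOpen_lt continuous_norm continuous_const)
  obtain ⟨d, W, W', h, h1, h2, h3, h4⟩ := exists_principalParts (U := U) S F
    (fun z hz hzS => hF z hz.1 hz.2 hzS) hS
  obtain ⟨c₀, H, hH⟩ := exists_primitive_annulus hr h3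
  refine ⟨c₀, d, fun c hc hcU => ?_⟩
  have hne : ∀ τ ∈ Set.Icc (0 : ℝ) 1, c τ ≠ 0 := fun τ hτ =>
    norm_pos_iff.1 (hr.trans (hcU τ hτ).1)
  have hneS : ∀ a ∈ S, ∀ τ ∈ Set.Icc (0 : ℝ) 1, c τ - a ≠ 0 := fun a ha τ hτ h =>
    (hcU τ hτ).2.2 (by rwa [sub_eq_zero.1 h])
  have hcont : ∀ τ ∈ Set.Icc (0 : ℝ) 1, ContinuousAt (fun z => W' z + (h z - c₀ / z)) (c τ) := by
    intro τ hτ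
    have e1 := (h2 _ (hcU τ hτ).2.2).continuousAt
    have e2 : ContinuousAt h (c τ) :=
      (h3.differentiableAt (hopen.mem_nhds ⟨(hcU τ hτ).1, (hcU τ hτ).2.1⟩)).continuousAt
    have := hne τ hτ
    fun_prop (disch := assumption)
  have hder : ∀ τ ∈ Set.Icc (0 : ℝ) 1,
      HasDerivAt (fun z => W z + H z) (W' (c τ) + (h (c τ) - c₀ / c τ)) (c τ) := fun τ hτ =>
    (h1 _ (hcU τ hτ).2.2).add (hH _ (hcU τ hτ).1 (hcU τ hτ).2.1)
  have hzero := integral_deriv_comp_eq_zero hc hder hcont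
  have hinv : ∀ a, (∀ τ ∈ Set.Icc (0 : ℝ) 1, c τ - a ≠ 0) →
      IntervalIntegrable (fun τ => (c τ - a)⁻¹ * deriv c τ) MeasureTheory.volume 0 1 :=
    fun a ha => intervalIntegrable_comp_mul_deriv (f := fun z => (z - a)⁻¹) hc fun τ hτ => by
      have := ha τ hτ
      fun_prop (disch := assumption)
  have hi0 := hinv 0 (by simpa using hne)
  have hint := intervalIntegrable_comp_mul_deriv hc hcont
  have hsum : IntervalIntegrable (fun τ => ∑ a ∈ S, d a * ((c τ - a)⁻¹ * deriv c τ))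
      MeasureTheory.volume 0 1 :=
    (IntervalIntegrable.sum S fun a ha => (hinv a (hneS a ha)).const_mul (d a)).congr
      (fun τ _ => by simp)
  have key : ∫ τ in (0 : ℝ)..1, F (c τ) * deriv c τ =
      ∫ τ in (0 : ℝ)..1, (c₀ * ((c τ - 0)⁻¹ * deriv c τ) +
        ∑ a ∈ S, d a * ((c τ - a)⁻¹ * deriv c τ)) +
          (W' (c τ) + (h (c τ) - c₀ / c τ)) * deriv c τ := by
    refine intervalIntegral.integral_congr fun τ hτ => ?_
    rw [Set.uIcc_of_le zero_le_one] at hτ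
    obtain ⟨u1, u2, u3⟩ := hcU τ hτ
    simp only [h4 (c τ) ⟨u1, u2⟩ u3]
    have : ∑ a ∈ S, d a * ((c τ - a)⁻¹ * deriv c τ) = (∑ a ∈ S, d a / (c τ - a)) * deriv c τ := by
      rw [Finset.sum_mul]
      exact Finset.sum_congr rfl fun a _ => by ring
    rw [this, sub_zero]
    ring
  unfold winding curveIntegral
  rw [key, intervalIntegral.integral_add ((hi0.const_mul c₀).add hsum) hint, hzero,
    intervalIntegral.integral_add (hi0.const_mul c₀) hsum, intervalIntegral.integral_const_mul,
    intervalIntegral.integral_finsetSum fun a ha => (hinv a (hneS a ha)).const_mul (d a)]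
  simp only [intervalIntegral.integral_const_mul]
  rw [add_zero, mul_add, Finset.mul_sum]
  congr 1
  · ring
  · exact Finset.sum_congr rfl fun a _ => by ring

/-- The circle of radius `ρ` around `a` as a closed curve on `[0,1]`. -/
def circleCurve (a : ℂ) (ρ : ℝ) (τ : ℝ) : ℂ := circleMap a ρ (2 * Real.pi * τ)

lemma hasDerivAt_circleCurve (a : ℂ) (ρ τ : ℝ) : HasDerivAt (circleCurve a ρ)
    ((2 * Real.pi : ℝ) * deriv (circleMap a ρ) (2 * Real.pi * τ)) τ := by
  have h1 : HasDerivAt (fun τ : ℝ => 2 * Real.pi * τ) (2 * Real.pi) τ := by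
    simpa using (hasDerivAt_id τ).const_mul (2 * Real.pi)
  have := (differentiable_circleMap a ρ (2 * Real.pi * τ)).hasDerivAt.scomp τ h1
  simpa [Function.comp_def, circleCurve, Complex.real_smul] using! this

lemma isClosedCurve_circleCurve (a : ℂ) (ρ : ℝ) : IsClosedCurve (circleCurve a ρ) := by
  have hd : deriv (circleCurve a ρ) =
      fun τ => ((2 * Real.pi : ℝ) * deriv (circleMap a ρ) (2 * Real.pi * τ) : ℂ) :=
    funext fun τ => (hasDerivAt_circleCurve a ρ τ).deriv
  refine ⟨fun τ _ => (hasDerivAt_circleCurve a ρ τ).continuousAt.continuousWithinAt, ?_,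
    ⟨∅, fun τ _ _ => (hasDerivAt_circleCurve a ρ τ).differentiableAt⟩, ?_⟩
  · simp [circleCurve, circleMap]
  · rw [hd]
    refine Continuous.intervalIntegrable ?_ _ _
    simp only [deriv_circleMap]
    have := continuous_circleMap (0 : ℂ) ρ
    fun_prop

lemma curveIntegral_circleCurve (a : ℂ) (ρ : ℝ) (f : ℂ → ℂ) :
    curveIntegral (circleCurve a ρ) f =
      (2 * (Real.pi : ℂ) * Complex.I)⁻¹ * ∮ z in C(a, ρ), f z := by
  unfold curveIntegral circleIntegral
  congr 1
  have h := intervalIntegral.smul_integral_comp_mul_left (a := 0) (b := 1)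
    (fun θ => deriv (circleMap a ρ) θ • f (circleMap a ρ θ)) (2 * Real.pi)
  rw [mul_zero, mul_one] at h
  rw [← h, ← intervalIntegral.integral_smul]
  refine intervalIntegral.integral_congr fun τ _ => ?_
  simp only [(hasDerivAt_circleCurve a ρ τ).deriv, Complex.real_smul, smul_eq_mul]
  unfold circleCurve
  ring

lemma winding_circleCurve_of_lt {a b : ℂ} {ρ : ℝ} (h : ‖b - a‖ < ρ) :
    winding (circleCurve a ρ) b = 1 := by
  unfold winding
  rw [curveIntegral_circleCurve, circleIntegral.integral_sub_inv_of_mem_ball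
    (by rwa [Metric.mem_ball, dist_eq_norm]), inv_mul_cancel₀ Complex.two_pi_I_ne_zero]

lemma winding_circleCurve_of_gt {a b : ℂ} {ρ : ℝ} (hρ : 0 ≤ ρ) (h : ρ < ‖b - a‖) :
    winding (circleCurve a ρ) b = 0 := by
  unfold winding
  have hd : ∀ z ∈ Metric.closedBall a ρ, DifferentiableAt ℂ (fun z => (z - b)⁻¹) z := by
    intro z hz
    have : z - b ≠ 0 := fun h0 => by
      rw [Metric.mem_closedBall, dist_eq_norm, sub_eq_zero.1 h0] at hz
      exact absurd hz (not_le.2 h)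
    fun_prop (disch := assumption)
  rw [curveIntegral_circleCurve, Complex.circleIntegral_eq_zero_of_differentiable_on_off_countable
    hρ Set.countable_empty (fun z hz => (hd z hz).continuousAt.continuousWithinAt)
    (fun z hz => hd z (Metric.ball_subset_closedBall hz.1)), mul_zero]

/-- The integral is the same over all circles of radius at most ρ, so the limit defining the residue
is attained at ρ. -/
lemma residue_eq_circleIntegral {f : ℂ → ℂ} {a : ℂ} {ρ : ℝ} (hρ : 0 < ρ)
    (hf : ∀ z ∈ Metric.closedBall a ρ, z ≠ a → DifferentiableAt ℂ f z) :
    residue f a = (2 * (Real.pi : ℂ) * Complex.I)⁻¹ * ∮ z in C(a, ρ), f z := by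
  refine Tendsto.limUnder_eq (tendsto_const_nhds.congr' ?_)
  filter_upwards [Ioc_mem_nhdsGT hρ] with r hr
  have hne : ∀ z, z ∉ Metric.ball a r → z ≠ a := fun z hz h =>
    hz (by rw [h]; exact Metric.mem_ball_self hr.1)
  rw [Complex.circleIntegral_eq_of_differentiable_on_annulus_off_countable hr.1 hr.2
    Set.countable_empty
    (fun z hz => (hf z hz.1 (hne z hz.2)).continuousAt.continuousWithinAt)
    (fun z hz => hf z (Metric.ball_subset_closedBall hz.1.1)
      (hne z fun h => hz.1.2 (Metric.ball_subset_closedBall h)))]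

/-- The residue theorem on an annulus, comparing a closed curve that winds once around the origin
with a circle. -/
theorem curveIntegral_eq_circleIntegral_add_sum {r R ρ : ℝ} (hr : 0 < r) (hrρ : r < ρ)
    (hρR : ρ < R) (S : Finset ℂ) {F : ℂ → ℂ}
    (hF : ∀ z, r < ‖z‖ → ‖z‖ < R → z ∉ S → DifferentiableAt ℂ F z)
    (hS : ∀ z ∈ S, r < ‖z‖ ∧ ‖z‖ < R ∧ ‖z‖ ≠ ρ ∧ MeromorphicAt F z)
    {c : ℝ → ℂ} (hc : IsClosedCurve c)
    (hcU : ∀ τ ∈ Set.Icc (0 : ℝ) 1, r < ‖c τ‖ ∧ ‖c τ‖ < R ∧ c τ ∉ S) (hc0 : winding c 0 = 1) :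
    curveIntegral c F = (2 * (Real.pi : ℂ) * Complex.I)⁻¹ * (∮ z in C(0, ρ), F z) +
      ∑ a ∈ S, residue F a * (winding c a - if ‖a‖ < ρ then 1 else 0) := by
  have hρ : 0 < ρ := hr.trans hrρ
  obtain ⟨c₀, d, h⟩ := exists_curveIntegral_eq hr S hF fun z hz => (hS z hz).2.2.2
  have hmem : ∀ (a : ℂ) (σ : ℝ), 0 ≤ σ → ∀ τ, ‖circleCurve a σ τ - a‖ = σ := fun a σ hσ τ => by
    have := circleMap_mem_sphere a hσ (2 * Real.pi * τ)
    rwa [mem_sphere_iff_norm] at this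
  -- The coefficient is recovered by applying the formula to a circle around a that encloses neither
  -- 0 nor another point of S.
  have hres : ∀ a ∈ S, residue F a = d a := by
    intro a ha
    have hopen : IsOpen {z : ℂ | r < ‖z‖ ∧ ‖z‖ < R} := (isOpen_lt continuous_const
      continuous_norm).inter (isOpen_lt continuous_norm continuous_const)
    have hopen2 : IsOpen {z : ℂ | z ∉ S.erase a} := (S.erase a).finite_toSet.isClosed.isOpen_compl
    obtain ⟨σ, hσ, hball⟩ := Metric.nhds_basis_closedBall.mem_iff.1
      (Filter.inter_mem (hopen.mem_nhds ⟨(hS a ha).1, (hS a ha).2.1⟩)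
        (hopen2.mem_nhds (Finset.notMem_erase a S)))
    rw [residue_eq_circleIntegral hσ, ← curveIntegral_circleCurve,
      h _ (isClosedCurve_circleCurve a σ)]
    · have hσ0 : σ < ‖0 - a‖ := by
        by_contra! hle
        have := (hball (by rwa [Metric.mem_closedBall, dist_eq_norm] : (0 : ℂ) ∈ _)).1.1
        rw [norm_zero] at this
        linarith
      rw [winding_circleCurve_of_gt hσ.le hσ0, mul_zero, zero_add, Finset.sum_eq_single_of_mem a ha,
        winding_circleCurve_of_lt (by simpa using hσ), mul_one]
      intro b hb hba
      rw [winding_circleCurve_of_gt hσ.le, mul_zero]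
      by_contra! hle
      exact (hball (by rwa [Metric.mem_closedBall, dist_eq_norm] : b ∈ _)).2
        (Finset.mem_erase.2 ⟨hba, hb⟩)
    · intro τ _
      have hm := hball (a := circleCurve a σ τ)
        (by rw [Metric.mem_closedBall, dist_eq_norm, hmem a σ hσ.le])
      refine ⟨hm.1.1, hm.1.2, fun hb => hm.2 (Finset.mem_erase.2 ⟨fun he => ?_, hb⟩)⟩
      have := hmem a σ hσ.le τ
      rw [he, sub_self, norm_zero] at this
      exact hσ.ne this
    · intro z hz hza
      exact hF z (hball hz).1.1 (hball hz).1.2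
        fun hzS => (hball hz).2 (Finset.mem_erase.2 ⟨hza, hzS⟩)
  -- The formula is used for the contour and for the circle. Both wind once around 0, so the term
  -- with c₀ cancels in the difference.
  rw [h c hc hcU, hc0, ← curveIntegral_circleCurve, h _ (isClosedCurve_circleCurve 0 ρ),
    winding_circleCurve_of_lt (by simpa using hρ), add_assoc, ← Finset.sum_add_distrib]
  · congr 1
    refine Finset.sum_congr rfl fun a ha => ?_
    rw [hres a ha]
    split_ifs with hlt
    · rw [winding_circleCurve_of_lt (by simpa using hlt)]; ring
    · rw [winding_circleCurve_of_gt hρ.le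
        (by simpa using lt_of_le_of_ne (not_lt.1 hlt) (hS a ha).2.2.1.symm)]; ring
  · intro τ _
    have := hmem 0 ρ hρ.le τ
    rw [sub_zero] at this
    exact ⟨by rw [this]; exact hrρ, by rw [this]; exact hρR, fun hz => (hS _ hz).2.2.1 this⟩

/-! ### Limits of the normalized building blocks -/

/-- `exp (π i v b)`, a sign if `v b` is an integer. -/
def phase (v : ℤ) (b : ℝ) : ℂ := Complex.exp (Real.pi * Complex.I * ((v : ℂ) * (b : ℂ)))

lemma phase_add (v : ℤ) (a b : ℝ) : phase v (a + b) = phase v a * phase v b := by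
  rw [phase, phase, phase, ← Complex.exp_add]; push_cast; congr 1; ring

lemma phase_zero (v : ℤ) : phase v 0 = 1 := by simp [phase]

lemma phase_neg (v : ℤ) (b : ℝ) : phase v (-b) = (phase v b)⁻¹ := by
  rw [phase, phase, ← Complex.exp_neg]; push_cast; congr 1; ring

lemma phase_sum (v : ℤ) {ι : Type*} (s : Finset ι) (b : ι → ℝ) :
    phase v (∑ i ∈ s, b i) = ∏ i ∈ s, phase v (b i) := by
  classical
  induction s using Finset.induction_on with
  | empty => simp [phase_zero]
  | insert a s ha ih => rw [Finset.sum_insert ha, Finset.prod_insert ha, phase_add, ih]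

lemma phase_two_mul {v : ℤ} {b : ℝ} {N : ℤ} (h : (v : ℝ) * b = N) : phase v (2 * b) = 1 := by
  have h' : (v : ℂ) * (b : ℂ) = N := by exact_mod_cast h
  rw [phase, Complex.exp_eq_one_iff]
  exact ⟨N, by push_cast; linear_combination 2 * Real.pi * Complex.I * h'⟩

lemma phase_neg_of_int {v : ℤ} {b : ℝ} {N : ℤ} (h : (v : ℝ) * b = N) :
    phase v (-b) = phase v b := by
  have := phase_two_mul h
  rw [two_mul, phase_add] at this
  rw [phase_neg]
  exact (eq_inv_of_mul_eq_one_left this).symm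

lemma norm_phase (v : ℤ) (b : ℝ) : ‖phase v b‖ = 1 := by
  rw [phase, Complex.norm_exp]; simp

/-- The sum of the exponents in `prod_thetaFactor`. -/
lemma sum_range_add_eq_binomTwo (a : ℝ) (n : ℕ) :
    ∑ j ∈ Finset.range n, (a + j) = binomTwo (a + n) - binomTwo a := by
  induction n with
  | zero => simp
  | succ n ih => rw [Finset.sum_range_succ, ih]; unfold binomTwo; push_cast; ring

namespace Data

variable (P : Data)

lemma xpow_ne_zero (a : ℝ) : P.xpow a ≠ 0 := Complex.exp_ne_zero _

lemma xpow_add (a b : ℝ) : P.xpow (a + b) = P.xpow a * P.xpow b := by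
  rw [xpow, xpow, xpow, ← Complex.exp_add]; push_cast; congr 1; ring

lemma xpow_neg (a : ℝ) : P.xpow (-a) = (P.xpow a)⁻¹ := by
  rw [xpow, xpow, ← Complex.exp_neg]; push_cast; congr 1; ring

lemma ppow_eq_of_int {v : ℤ} {a : ℝ} {N : ℤ} (h : (v : ℝ) * a = N) :
    P.ppow v a = P.xpow a * P.q ^ N := by
  have h' : (v : ℂ) * (a : ℂ) = N := by exact_mod_cast h
  rw [ppow, xpow, q, ← Complex.exp_int_mul, ← Complex.exp_add]
  congr 1
  linear_combination P.logq * h'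

/-- An exact evaluation of the normalized `q`-symbol with negative exponent. -/
lemma qSymbol_mul_thetaFactor_mul_phase (hq : P.logq.re < 0) {v : ℤ} {b : ℝ} {N : ℕ}
    (h : (v : ℝ) * b = -N) (logy : ℂ) :
    qSymbol (P.ppow v b * Complex.exp logy) P.q * (thetaFactor P.logq P.logx v b logy * phase v b) =
      qSymbol (P.xpow b * Complex.exp logy) P.q *
        ∏ i ∈ Finset.range N, (1 - P.q / (P.xpow b * Complex.exp logy) * P.q ^ i) := by
  set w := P.xpow b * Complex.exp logy with hw
  have hw0 : w ≠ 0 := mul_ne_zero (P.xpow_ne_zero b) (Complex.exp_ne_zero _)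
  have hq0 := P.q_ne_zero
  have hN : (v : ℝ) * b = ((-N : ℤ) : ℝ) := by push_cast; exact h
  have h' : (v : ℂ) * (b : ℂ) = -N := by exact_mod_cast h
  have harg : P.ppow v b * Complex.exp logy = w * P.q ^ (-N : ℤ) := by
    rw [P.ppow_eq_of_int hN, hw]; ring
  have hargN : w * P.q ^ (-N : ℤ) * P.q ^ N = w := by
    rw [mul_assoc, ← zpow_natCast P.q N, ← zpow_add₀ hq0, neg_add_cancel, zpow_zero, mul_one]
  have hlogw : w = Complex.exp ((b : ℂ) * P.logx + logy) := by rw [hw, xpow, Complex.exp_add]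
  -- The N large factors are 1 - w q^{-(i+1)}, with leading terms -w q^{-(i+1)}. The normalizing
  -- factor is the inverse of their product up to the sign (-1)^N, which the phase supplies because
  -- vb = -N.
  have hfac : thetaFactor P.logq P.logx v b logy * phase v b =
      (∏ i ∈ Finset.range N, (-(w * P.q ^ (-(i + 1) : ℤ))))⁻¹ := by
    have e1 : ∀ i : ℕ, -(w * P.q ^ (-(i + 1) : ℤ)) =
        Complex.exp (Real.pi * Complex.I + ((b : ℂ) * P.logx + logy) - (i + 1 : ℂ) * P.logq) := by
      intro i
      rw [Complex.exp_sub, Complex.exp_add, Complex.exp_pi_mul_I, ← hlogw, zpow_neg, q,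
        ← Complex.exp_int_mul]
      push_cast; ring
    simp only [e1]
    rw [← Complex.exp_sum, ← Complex.exp_neg, thetaFactor, scaleFactor, phase, ← Complex.exp_add]
    have e2 : ∑ i ∈ Finset.range N, (Real.pi * Complex.I + ((b : ℂ) * P.logx + logy) -
        (i + 1 : ℂ) * P.logq) = N * (Real.pi * Complex.I + ((b : ℂ) * P.logx + logy)) -
        N * (N + 1) / 2 * P.logq := by
      have : ∀ n : ℕ, ∑ i ∈ Finset.range n, (Real.pi * Complex.I + ((b : ℂ) * P.logx + logy) -
        (i + 1 : ℂ) * P.logq) = n * (Real.pi * Complex.I + ((b : ℂ) * P.logx + logy)) -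
        n * (n + 1) / 2 * P.logq := by
        intro n
        induction n with
        | zero => simp
        | succ n ih => rw [Finset.sum_range_succ, ih]; push_cast; ring
      exact this N
    rw [e2]
    congr 1
    push_cast
    linear_combination (P.logq / 2 * (v * b - N) + logy + b * P.logx - P.logq / 2 +
      Real.pi * Complex.I) * h'
  have hprod : ∏ j ∈ Finset.range N, (1 - w * P.q ^ (-N : ℤ) * P.q ^ j) =
      (∏ i ∈ Finset.range N, (-(w * P.q ^ (-(i + 1) : ℤ)))) *
        ∏ i ∈ Finset.range N, (1 - P.q / w * P.q ^ i) := by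
    rw [← Finset.prod_mul_distrib, ← Finset.prod_range_reflect]
    refine Finset.prod_congr rfl fun i hi => ?_
    have hi' : i + 1 ≤ N := Finset.mem_range.1 hi
    have e : P.q ^ (-N : ℤ) * P.q ^ (N - 1 - i) = P.q ^ (-(i + 1) : ℤ) := by
      rw [← zpow_natCast, ← zpow_add₀ hq0]; congr 1; omega
    have e3 : P.q ^ (-(i + 1) : ℤ) * (P.q * P.q ^ i) = 1 := by
      rw [← pow_succ', ← zpow_natCast, ← zpow_add₀ hq0]; push_cast; simp
    rw [mul_assoc w, e]
    have e4 : w * P.q ^ (-(i + 1) : ℤ) * (P.q / w * P.q ^ i) = 1 := by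
      rw [show w * P.q ^ (-(i + 1) : ℤ) * (P.q / w * P.q ^ i) =
        (w / w) * (P.q ^ (-(i + 1) : ℤ) * (P.q * P.q ^ i)) by ring, e3, div_self hw0, mul_one]
    linear_combination -e4
  rw [harg, qSymbol_eq_prod_mul _ (P.norm_q_lt_one hq) N, hargN, hprod, hfac]
  have hne : ∏ i ∈ Finset.range N, (-(w * P.q ^ (-(i + 1) : ℤ))) ≠ 0 :=
    Finset.prod_ne_zero_iff.2 fun i _ => neg_ne_zero.2 (mul_ne_zero hw0 (zpow_ne_zero _ hq0))
  field_simp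

variable {P} {v : ℕ → ℤ}

lemma tendsto_logp (hq : P.logq.re < 0) (hv : Tendsto v atTop atTop) :
    Tendsto (fun k => P.logp (v k)) atTop atBot := by
  unfold logp
  refine tendsto_atBot_add_const_left _ _ ?_
  exact (tendsto_intCast_atTop_atTop.comp hv).atTop_mul_const_of_neg hq

lemma tendsto_norm_p (hq : P.logq.re < 0) (hv : Tendsto v atTop atTop) :
    Tendsto (fun k => ‖P.p (v k)‖) atTop (𝓝 0) := by
  simp only [norm_p]
  exact Real.tendsto_exp_atBot.comp (tendsto_logp hq hv)

lemma eventually_norm_p_lt (hq : P.logq.re < 0) (hv : Tendsto v atTop atTop) :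
    ∀ᶠ k in atTop, ‖P.p (v k)‖ < ‖P.q‖ :=
  (tendsto_norm_p hq hv).eventually_lt_const (norm_pos_iff.2 P.q_ne_zero)

lemma tendsto_ppow_mul (hq : P.logq.re < 0) (hv : Tendsto v atTop atTop) {a : ℝ} (ha : 0 < a)
    (y : ℂ) : Tendsto (fun k => ‖P.ppow (v k) a * y‖) atTop (𝓝 0) := by
  simp only [norm_mul, norm_ppow]
  have := Real.tendsto_exp_atBot.comp ((tendsto_logp hq hv).const_mul_atBot ha)
  simpa [logp] using this.mul_const ‖y‖

lemma tendsto_of_norm_sub_one_le {f : ℕ → ℂ} {g : ℕ → ℝ} {D : ℝ} (hg : Tendsto g atTop (𝓝 0))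
    (h : ∀ᶠ k in atTop, ‖f k - 1‖ ≤ Real.exp (g k / D) - 1) : Tendsto f atTop (𝓝 1) := by
  rw [tendsto_iff_norm_sub_tendsto_zero]
  refine squeeze_zero' (Eventually.of_forall fun _ => norm_nonneg _) h ?_
  have := ((Real.continuous_exp.tendsto 0).comp (by simpa using hg.div_const D)).sub_const 1
  simpa using this

lemma tendsto_pqSymbol_one (hq : P.logq.re < 0) (hv : Tendsto v atTop atTop) {f : ℕ → ℂ}
    (hf : Tendsto (fun k => ‖f k‖) atTop (𝓝 0)) :
    Tendsto (fun k => pqSymbol (f k) (P.p (v k)) P.q) atTop (𝓝 1) := by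
  refine tendsto_of_norm_sub_one_le (D := (1 - ‖P.q‖) ^ 2) hf ?_
  filter_upwards [eventually_norm_p_lt hq hv] with k hk
  exact norm_pqSymbol_sub_one_le hk.le (P.norm_q_lt_one hq)

lemma tendsto_qSymbol_one (hq : P.logq.re < 0) {f : ℕ → ℂ}
    (hf : Tendsto (fun k => ‖f k‖) atTop (𝓝 0)) :
    Tendsto (fun k => qSymbol (f k) P.q) atTop (𝓝 1) :=
  tendsto_of_norm_sub_one_le hf
    (Eventually.of_forall fun _ => norm_qSymbol_sub_one_le (P.norm_q_lt_one hq))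

/-- For a > 0 the argument tends to 0. For a = 0 the layer of factors without p survives and gives
(y;q). -/
lemma exists_tendsto_pqSymbol (hq : P.logq.re < 0) (hv : Tendsto v atTop atTop) {a : ℝ}
    (ha : 0 ≤ a) (y : ℂ) :
    ∃ L, Tendsto (fun k => pqSymbol (P.ppow (v k) a * y) (P.p (v k)) P.q) atTop (𝓝 L) := by
  rcases ha.eq_or_lt with rfl | ha
  · refine ⟨qSymbol y P.q * 1, ?_⟩
    have h1 : Tendsto (fun k => pqSymbol (y * P.p (v k)) (P.p (v k)) P.q) atTop (𝓝 1) := by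
      refine tendsto_pqSymbol_one hq hv ?_
      simpa using (tendsto_norm_p hq hv).const_mul ‖y‖
    refine (h1.const_mul (qSymbol y P.q)).congr' ?_
    filter_upwards [eventually_norm_p_lt hq hv] with k hk
    have hq1 := P.norm_q_lt_one hq
    rw [ppow_zero, one_mul, pqSymbol_succ y (hk.trans hq1) hq1]
  · exact ⟨1, tendsto_pqSymbol_one hq hv (tendsto_ppow_mul hq hv ha y)⟩

lemma exists_tendsto_qSymbol_of_nonneg (hq : P.logq.re < 0) (hv : Tendsto v atTop atTop) {a : ℝ}
    (ha : 0 ≤ a) (y : ℂ) :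
    ∃ L, Tendsto (fun k => qSymbol (P.ppow (v k) a * y) P.q) atTop (𝓝 L) := by
  rcases ha.eq_or_lt with rfl | ha
  · simp only [ppow_zero]; exact ⟨_, tendsto_const_nhds⟩
  · exact ⟨1, tendsto_qSymbol_one hq (tendsto_ppow_mul hq hv ha y)⟩

/-- For b < 0 the exact evaluation depends on v only through the number -vb of factors of a finite
product, which converges to the infinite product. -/
lemma exists_tendsto_qSymbol_mul (hq : P.logq.re < 0) (hv : Tendsto v atTop atTop) {b : ℝ}
    (hb : b ≤ 0) (hint : ∀ k, ∃ N : ℤ, (v k : ℝ) * b = N) (logy : ℂ) :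
    ∃ L, Tendsto (fun k => qSymbol (P.ppow (v k) b * Complex.exp logy) P.q *
      (thetaFactor P.logq P.logx (v k) b logy * phase (v k) b)) atTop (𝓝 L) := by
  rcases hb.eq_or_lt with rfl | hb
  · refine ⟨qSymbol (Complex.exp logy) P.q, tendsto_const_nhds.congr fun k => ?_⟩
    rw [ppow_zero, one_mul, phase_zero, thetaFactor, zero_pow two_ne_zero, scaleFactor_zero]
    simp
  choose N hN using hint
  set y := P.q / (P.xpow b * Complex.exp logy) with hy
  have hmul : Multipliable fun i : ℕ => (1 - y * P.q ^ i) :=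
    multipliable_one_sub (summable_qSymbol y (P.norm_q_lt_one hq))
  have hNreal : Tendsto (fun k => -((v k : ℝ) * b)) atTop atTop :=
    tendsto_neg_atBot_atTop.comp ((tendsto_intCast_atTop_atTop.comp hv).atTop_mul_const_of_neg hb)
  have hNt : Tendsto (fun k => (-N k).toNat) atTop atTop := by
    have h1 : Tendsto (fun k => -N k) atTop atTop := by
      rw [← tendsto_intCast_atTop_iff (R := ℝ)]
      refine hNreal.congr fun k => ?_
      rw [hN k]; push_cast; rfl
    exact tendsto_atTop_atTop.2 fun m => by
      obtain ⟨i, hi⟩ := tendsto_atTop_atTop.1 h1 m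
      exact ⟨i, fun k hk => by have := hi k hk; omega⟩
  refine ⟨qSymbol (P.xpow b * Complex.exp logy) P.q * ∏' i : ℕ, (1 - y * P.q ^ i),
    ((hmul.hasProd.tendsto_prod_nat.comp hNt).const_mul _).congr' ?_⟩
  filter_upwards [hNreal.eventually_ge_atTop 0] with k hk
  have hk0 : 0 ≤ -N k := by rw [hN k] at hk; exact_mod_cast hk
  have e : ((v k : ℤ) : ℝ) * b = -(((-N k).toNat : ℕ) : ℝ) := by
    rw [hN k]
    have : (((-N k).toNat : ℤ) : ℝ) = ((-N k : ℤ) : ℝ) := by rw [Int.toNat_of_nonneg hk0]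
    push_cast at this
    linarith
  rw [P.qSymbol_mul_thetaFactor_mul_phase hq e]
  rfl

lemma exists_tendsto_prod {ι : Type*} (s : Finset ι) {f : ι → ℕ → ℂ}
    (h : ∀ i ∈ s, ∃ L, Tendsto (f i) atTop (𝓝 L)) :
    ∃ L, Tendsto (fun k => ∏ i ∈ s, f i k) atTop (𝓝 L) := by
  classical
  choose! L hL using h
  exact ⟨∏ i ∈ s, L i, tendsto_finsetProd s hL⟩

lemma exists_tendsto_pqSymbol_mul (hq : P.logq.re < 0) (hv : Tendsto v atTop atTop) {a : ℝ}
    (hint : ∀ k, ∃ N : ℤ, (v k : ℝ) * a = N) (logy : ℂ) {n : ℕ} (h0 : 0 ≤ a + n)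
    (h1 : ∀ j < n, a + j ≤ 0) :
    ∃ L, Tendsto (fun k => pqSymbol (P.ppow (v k) a * Complex.exp logy) (P.p (v k)) P.q *
      (∏ j ∈ Finset.range n, thetaFactor P.logq P.logx (v k) (a + j) logy) *
        phase (v k) (∑ j ∈ Finset.range n, (a + j))) atTop (𝓝 L) := by
  obtain ⟨L₁, hL₁⟩ := exists_tendsto_prod (Finset.range n)
    (f := fun (j : ℕ) k => qSymbol (P.ppow (v k) (a + j) * Complex.exp logy) P.q *
      (thetaFactor P.logq P.logx (v k) (a + j) logy * phase (v k) (a + j)))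
    fun j hj => exists_tendsto_qSymbol_mul hq hv (h1 j (Finset.mem_range.1 hj)) (fun k => by
      obtain ⟨N, hN⟩ := hint k
      exact ⟨N + v k * j, by push_cast; rw [mul_add, hN]⟩) logy
  obtain ⟨L₂, hL₂⟩ := exists_tendsto_pqSymbol hq hv h0 (Complex.exp logy)
  refine ⟨L₁ * L₂, (hL₁.mul hL₂).congr' ?_⟩
  filter_upwards [eventually_norm_p_lt hq hv] with k hk
  rw [P.pqSymbol_split hq hk a logy n, phase_sum, Finset.prod_mul_distrib, Finset.prod_mul_distrib]
  ring

end Data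

/-- The phases of the peeled factors of Γ, numerator against denominator, thus combine to the phase
of b(a), up to signs that do not matter for integral exponents. -/
lemma sum_range_toNat_floor (a : ℝ) :
    -∑ j ∈ Finset.range ⌊a⌋.toNat, (1 - a + j) - ∑ j ∈ Finset.range (-⌊a⌋).toNat, (a + j) =
      binomDiff a := by
  rw [sum_range_add_eq_binomTwo, sum_range_add_eq_binomTwo, binomDiff]
  unfold binomTwo Int.fract
  rcases le_total 0 ⌊a⌋ with h | h
  · have h1 : (-⌊a⌋).toNat = 0 := by omega
    have h2 : ((⌊a⌋.toNat : ℕ) : ℝ) = ⌊a⌋ := by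
      rw [← Int.cast_natCast, Int.toNat_of_nonneg h]
    rw [h1, h2]; push_cast; ring
  · have h1 : ⌊a⌋.toNat = 0 := by omega
    have h2 : (((-⌊a⌋).toNat : ℕ) : ℝ) = -⌊a⌋ := by
      rw [← Int.cast_natCast, Int.toNat_of_nonneg (by omega)]; push_cast; rfl
    rw [h1, h2]; push_cast; ring

namespace Data

variable {P : Data} {v : ℕ → ℤ}

lemma exists_tendsto_ellGamma_mul (hq : P.logq.re < 0) (hv : Tendsto v atTop atTop) {a : ℝ}
    (hint : ∀ k, ∃ N : ℤ, (v k : ℝ) * a = N) (logy : ℂ) {ε : ℝ} (hε : 0 < ε)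
    (hsep : ∀ᶠ n in atTop, ∀ j k : ℕ,
      ε ≤ ‖1 - P.ppow (v n) a * Complex.exp logy * P.p (v n) ^ j * P.q ^ k‖) :
    ∃ L, Tendsto (fun k => ellGamma (P.ppow (v k) a * Complex.exp logy) (P.p (v k)) P.q *
      scaleFactor P.logq P.logx (v k) (binomDiff a) (gDiff a) logy * phase (v k) (binomDiff a))
        atTop (𝓝 L) := by
  obtain ⟨c1, c2, c3, c4⟩ := toNat_floor_cond a
  obtain ⟨L₁, hL₁⟩ := exists_tendsto_pqSymbol_mul hq hv (a := 1 - a) (fun k => by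
    obtain ⟨N, hN⟩ := hint k
    exact ⟨v k - N, by push_cast; rw [mul_sub, hN, mul_one]⟩) (P.logq - logy) c3 c4
  obtain ⟨L₂, hL₂⟩ := exists_tendsto_pqSymbol_mul hq hv hint logy c1 c2
  obtain ⟨c, hc, hlow⟩ := P.le_norm_pqSymbol_mul hq (max |a| |logy.re|) (-⌊a⌋).toNat hε
  -- The denominators are bounded away from zero uniformly in v, because the point stays away from
  -- the poles, so their limit does not vanish.
  have hL₂0 : L₂ ≠ 0 := by
    refine norm_pos_iff.1 (hc.trans_le (ge_of_tendsto hL₂.norm ?_))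
    filter_upwards [hsep, eventually_norm_p_lt hq hv] with k hk hk2
    rw [norm_mul, norm_phase, mul_one]
    exact hlow _ hk2 a logy _ (le_max_left _ _) (le_max_right _ _) le_rfl c1 c2 hk
  refine ⟨L₁ / L₂, (hL₁.div hL₂ hL₂0).congr fun k => ?_⟩
  obtain ⟨N, hN⟩ := hint k
  have hsum : (v k : ℝ) * ∑ j ∈ Finset.range ⌊a⌋.toNat, (1 - a + j) =
      ((∑ j ∈ Finset.range ⌊a⌋.toNat, (v k - N + v k * j) : ℤ) : ℝ) := by
    push_cast
    rw [Finset.mul_sum]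
    exact Finset.sum_congr rfl fun j _ => by rw [← hN]; ring
  rw [P.ellGamma_mul_scaleFactor, ← sum_range_toNat_floor a, sub_eq_add_neg _ (∑ j ∈ _, (a + _)),
    phase_add, phase_neg _ (∑ j ∈ _, (a + _)), phase_neg_of_int hsum, Pi.div_apply,
    ← div_eq_mul_inv, div_mul_div_comm]

lemma exists_tendsto_theta_mul_of_nonpos (hq : P.logq.re < 0) (hv : Tendsto v atTop atTop) {b : ℝ}
    (hb : b ≤ 0) (hint : ∀ k, ∃ N : ℤ, (v k : ℝ) * b = N) (logy : ℂ) :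
    ∃ L, Tendsto (fun k => theta (P.ppow (v k) b * Complex.exp logy) P.q *
      thetaFactor P.logq P.logx (v k) b logy * phase (v k) b) atTop (𝓝 L) := by
  obtain ⟨L₁, hL₁⟩ := exists_tendsto_qSymbol_mul hq hv hb hint logy
  obtain ⟨L₂, hL₂⟩ := exists_tendsto_qSymbol_of_nonneg hq hv (neg_nonneg.2 hb)
    (Complex.exp (P.logq - logy))
  refine ⟨L₁ * L₂, (hL₁.mul hL₂).congr fun k => ?_⟩
  rw [theta, P.q_div_arg]; ring

lemma exists_tendsto_theta_mul (hq : P.logq.re < 0) (hv : Tendsto v atTop atTop) {b : ℝ}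
    (hint : ∀ k, ∃ N : ℤ, (v k : ℝ) * b = N) (logy : ℂ) :
    ∃ L, Tendsto (fun k => theta (P.ppow (v k) b * Complex.exp logy) P.q *
      thetaFactor P.logq P.logx (v k) b logy * phase (v k) b) atTop (𝓝 L) := by
  rcases le_total b 0 with hb | hb
  · exact exists_tendsto_theta_mul_of_nonpos hq hv hb hint logy
  · choose N hN using hint
    obtain ⟨L, hL⟩ := exists_tendsto_theta_mul_of_nonpos hq hv (neg_nonpos.2 hb)
      (fun k => ⟨-N k, by push_cast; rw [mul_neg, hN]⟩) (P.logq - logy)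
    refine ⟨L, hL.congr fun k => ?_⟩
    rw [P.theta_exp_reflect, thetaFactor_neg, phase_neg_of_int (hN k)]

/-- As p tends to 0, all factors but the first tend to 1 together. -/
lemma tendsto_qSymbol_p (hq : P.logq.re < 0) (hv : Tendsto v atTop atTop) {f : ℕ → ℂ} {L : ℂ}
    (hf : Tendsto f atTop (𝓝 L)) :
    Tendsto (fun k => qSymbol (f k) (P.p (v k))) atTop (𝓝 (1 - L)) := by
  have h1 : Tendsto (fun k => qSymbol (f k * P.p (v k)) (P.p (v k))) atTop (𝓝 1) := by
    have hg : Tendsto (fun k => ‖f k * P.p (v k)‖) atTop (𝓝 0) := by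
      simpa using hf.norm.mul (tendsto_norm_p hq hv)
    have hg' : Tendsto (fun k => ‖f k * P.p (v k)‖ / (1 - ‖P.p (v k)‖)) atTop (𝓝 0) := by
      simpa [Pi.div_def] using hg.div (((tendsto_const_nhds (x := (1 : ℝ))).sub (tendsto_norm_p hq hv))) (by norm_num)
    refine tendsto_of_norm_sub_one_le (D := 1) hg' ?_
    filter_upwards [eventually_norm_p_lt hq hv] with k hk
    rw [div_one]
    exact norm_qSymbol_sub_one_le (hk.trans (P.norm_q_lt_one hq))
  refine ((((tendsto_const_nhds (x := (1 : ℂ))).sub hf).mul h1).congr' ?_).trans_eq (by simp)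
  filter_upwards [eventually_norm_p_lt hq hv] with k hk
  rw [qSymbol_succ (f k) (hk.trans (P.norm_q_lt_one hq))]

lemma exists_tendsto_ppow_mul (hq : P.logq.re < 0) (hv : Tendsto v atTop atTop) {a : ℝ}
    (ha : 0 ≤ a) (y : ℂ) : ∃ L, Tendsto (fun k => P.ppow (v k) a * y) atTop (𝓝 L) := by
  rcases ha.eq_or_lt with rfl | ha
  · simp only [ppow_zero]; exact ⟨_, tendsto_const_nhds⟩
  · exact ⟨0, tendsto_zero_iff_norm_tendsto_zero.2 (tendsto_ppow_mul hq hv ha y)⟩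

lemma ppow_eq_xpow_mul_exp (P : Data) (v : ℤ) (a : ℝ) :
    P.ppow v a = P.xpow a * Complex.exp ((a : ℂ) * v * P.logq) := by
  rw [ppow, xpow, ← Complex.exp_add]; congr 1; ring

lemma exists_tendsto_exp (hq : P.logq.re < 0) (hv : Tendsto v atTop atTop) {a : ℝ}
    (ha : 0 ≤ a) : ∃ L, Tendsto (fun k => Complex.exp ((a : ℂ) * v k * P.logq)) atTop (𝓝 L) := by
  obtain ⟨L, hL⟩ := exists_tendsto_ppow_mul hq hv ha 1
  refine ⟨(P.xpow a)⁻¹ * L, (hL.const_mul (P.xpow a)⁻¹).congr fun k => ?_⟩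
  rw [mul_one, ppow_eq_xpow_mul_exp, inv_mul_cancel_left₀ (P.xpow_ne_zero a)]

/-- A large factor 1 - p^{a+j} y multiplied by q^{-(a+j)v} is q^{-(a+j)v} - x^{a+j} y, which
converges as a+j ≤ 0. The product of these powers of q is the second order behaviour. -/
lemma exists_tendsto_theta_p_mul_of_lt (hq : P.logq.re < 0) (hv : Tendsto v atTop atTop) {a : ℝ}
    (ha : a < 1) (logy : ℂ) :
    ∃ L, Tendsto (fun k => theta (P.ppow (v k) a * Complex.exp logy) (P.p (v k)) *
      sobThetaP P.logq a ^ v k) atTop (𝓝 L) := by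
  obtain ⟨c1, c2, -, -⟩ := toNat_floor_cond a
  set n := (-⌊a⌋).toNat with hn
  have h0 : ⌊a⌋.toNat = 0 := by
    have : ⌊a⌋ < 1 := Int.floor_lt.2 (by exact_mod_cast ha)
    omega
  have hb : binomDiff a = ∑ j ∈ Finset.range n, -(a + j) := by
    rw [← sum_range_toNat_floor a, h0, ← hn, Finset.sum_neg_distrib]; simp
  obtain ⟨L₁, hL₁⟩ := exists_tendsto_prod (Finset.range n)
    (f := fun (j : ℕ) k => Complex.exp (((-(a + j) : ℝ) : ℂ) * v k * P.logq) -
      P.xpow (a + j) * Complex.exp logy) fun j hj => by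
      obtain ⟨L, hL⟩ := exists_tendsto_exp hq hv (neg_nonneg.2 (c2 j (Finset.mem_range.1 hj)))
      exact ⟨_, hL.sub tendsto_const_nhds⟩
  obtain ⟨M₁, hM₁⟩ := exists_tendsto_ppow_mul hq hv c1 (Complex.exp logy)
  obtain ⟨M₂, hM₂⟩ := exists_tendsto_ppow_mul hq hv (sub_nonneg.2 ha.le) (Complex.exp (-logy))
  refine ⟨_, ((hL₁.mul (tendsto_qSymbol_p hq hv hM₁)).mul (tendsto_qSymbol_p hq hv hM₂)).congr' ?_⟩
  filter_upwards [eventually_norm_p_lt hq hv] with k hk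
  have hs : sobThetaP P.logq a ^ v k =
      ∏ j ∈ Finset.range n, Complex.exp (((-(a + j) : ℝ) : ℂ) * v k * P.logq) := by
    rw [← Complex.exp_sum, sobThetaP, ← Complex.exp_int_mul, hb, Complex.ofReal_sum,
      Finset.sum_mul, Finset.mul_sum]
    congr 1
    exact Finset.sum_congr rfl fun j _ => by ring
  rw [P.theta_p_split hq hk a logy n, hs]
  have hp : ∀ j ∈ Finset.range n, Complex.exp (((-(a + j) : ℝ) : ℂ) * v k * P.logq) -
      P.xpow (a + j) * Complex.exp logy = (1 - P.ppow (v k) (a + j) * Complex.exp logy) *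
        Complex.exp (((-(a + j) : ℝ) : ℂ) * v k * P.logq) := fun j _ => by
    have e : Complex.exp (((a + j : ℝ) : ℂ) * v k * P.logq) *
        Complex.exp (((-(a + j) : ℝ) : ℂ) * v k * P.logq) = 1 := by
      rw [← Complex.exp_add, Complex.exp_eq_one_iff]; exact ⟨0, by push_cast; ring⟩
    rw [ppow_eq_xpow_mul_exp]
    linear_combination (P.xpow (a + j) * Complex.exp logy) * e
  rw [Finset.prod_congr rfl hp, Finset.prod_mul_distrib]
  ring

lemma exists_tendsto_theta_p_mul (hq : P.logq.re < 0) (hv : Tendsto v atTop atTop) (a : ℝ)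
    (logy : ℂ) :
    ∃ L, Tendsto (fun k => theta (P.ppow (v k) a * Complex.exp logy) (P.p (v k)) *
      sobThetaP P.logq a ^ v k) atTop (𝓝 L) := by
  rcases lt_or_ge a 1 with ha | ha
  · exact exists_tendsto_theta_p_mul_of_lt hq hv ha logy
  · obtain ⟨L, hL⟩ := exists_tendsto_theta_p_mul_of_lt hq hv (a := 1 - a) (by linarith) (-logy)
    refine ⟨L, hL.congr fun k => ?_⟩
    rw [P.theta_p_reflect]
    simp only [sobThetaP, binomDiff_one_sub]

/-- With k = ⌊a⌋ one has b(a) = ka - k(k+1)/2, and k(k+1) is even. -/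
lemma exists_int_mul_binomDiff {v : ℤ} {a : ℝ} {N : ℤ} (h : (v : ℝ) * a = N) :
    ∃ N' : ℤ, (v : ℝ) * binomDiff a = N' := by
  obtain ⟨m, hm⟩ := (Int.even_mul_succ_self ⌊a⌋).two_dvd
  refine ⟨⌊a⌋ * N - v * m, ?_⟩
  have hm' : (⌊a⌋ : ℝ) * (⌊a⌋ + 1) = 2 * m := by exact_mod_cast hm
  rw [binomDiff_of_mem (Int.floor_le a) (Int.lt_floor_add_one a).le]
  push_cast
  linear_combination (⌊a⌋ : ℝ) * h - (v : ℝ) / 2 * hm'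

/-- Away from the poles, the normalized integrand converges along sequences of `v` for which the
exponents of `q` are integers. -/
theorem exists_tendsto_normalized (hq : P.logq.re < 0) (hv : Tendsto v atTop atTop) {μ : ℝ}
    (hμ : P.sobExp μ = 0)
    (hα : ∀ r k, ∃ N : ℤ, (v k : ℝ) * (P.α r + μ) = N)
    (hβ : ∀ r k, ∃ N : ℤ, (v k : ℝ) * (P.β r - μ) = N)
    (hγ : ∀ r k, ∃ N : ℤ, (v k : ℝ) * (P.γ r + μ) = N) (logz : ℂ) {ε : ℝ} (hε : 0 < ε)
    (hsep : ∀ᶠ k in atTop, P.AwayFromPoles (v k) ε (P.ppow (v k) μ * Complex.exp logz)) :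
    ∃ L, Tendsto (fun k => P.normalized (v k) μ logz) atTop (𝓝 L) := by
  obtain ⟨L₁, hL₁⟩ := exists_tendsto_prod Finset.univ fun r _ =>
    exists_tendsto_ellGamma_mul hq hv (hα r) (P.logt r + logz) hε (hsep.mono fun n hn j k => by
      have := hn.1 r j k
      rwa [t, P.ppow_mul_mul_exp] at this)
  obtain ⟨L₂, hL₂⟩ := exists_tendsto_prod Finset.univ fun r _ =>
    exists_tendsto_ellGamma_mul hq hv (hβ r) (P.logu r - logz) hε (hsep.mono fun n hn j k => by
      have := hn.2 r j k
      rwa [u, P.ppow_mul_div_exp] at this)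
  obtain ⟨L₃, hL₃⟩ := exists_tendsto_prod Finset.univ fun r _ =>
    exists_tendsto_theta_mul hq hv (hγ r) (P.logv r + logz)
  obtain ⟨L₄, hL₄⟩ := exists_tendsto_prod Finset.univ fun r _ =>
    exists_tendsto_theta_p_mul hq hv (P.δ r + μ) (P.logw r + logz)
  refine ⟨L₁ * L₂ * L₃ * L₄, (((hL₁.mul hL₂).mul hL₃).mul hL₄).congr fun k => ?_⟩
  -- All exponents are integers after multiplication by v, so the phases of the β-factors may be
  -- inverted. The total exponent is then v `sobExp μ`, which is zero.
  have hphase : (∏ r, phase (v k) (binomDiff (P.α r + μ))) *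
      (∏ r, phase (v k) (binomDiff (P.β r - μ))) * (∏ r, phase (v k) (P.γ r + μ)) = 1 := by
    have h1 : ∀ r, phase (v k) (binomDiff (P.β r - μ)) = phase (v k) (-binomDiff (P.β r - μ)) :=
      fun r => by
        obtain ⟨N, hN⟩ := hβ r k
        obtain ⟨N', hN'⟩ := exists_int_mul_binomDiff hN
        exact (phase_neg_of_int hN').symm
    simp only [h1]
    rw [← phase_sum, ← phase_sum, ← phase_sum, ← phase_add, ← phase_add, Finset.sum_neg_distrib,
      ← sub_eq_add_neg]
    have := hμ
    unfold sobExp at this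
    rw [this, phase_zero]
  rw [normalized_eq]
  simp only [Finset.prod_mul_distrib] at hphase ⊢
  linear_combination ((∏ r, ellGamma (P.ppow (v k) (P.α r + μ) * Complex.exp (P.logt r + logz)) (P.p (v k)) P.q) *
    (∏ r, scaleFactor P.logq P.logx (v k) (binomDiff (P.α r + μ)) (gDiff (P.α r + μ)) (P.logt r + logz)) *
    ((∏ r, ellGamma (P.ppow (v k) (P.β r - μ) * Complex.exp (P.logu r - logz)) (P.p (v k)) P.q) *
    (∏ r, scaleFactor P.logq P.logx (v k) (binomDiff (P.β r - μ)) (gDiff (P.β r - μ)) (P.logu r - logz))) *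
    ((∏ r, theta (P.ppow (v k) (P.γ r + μ) * Complex.exp (P.logv r + logz)) P.q) *
    (∏ r, thetaFactor P.logq P.logx (v k) (P.γ r + μ) (P.logv r + logz))) *
    ((∏ r, theta (P.ppow (v k) (P.δ r + μ) * Complex.exp (P.logw r + logz)) (P.p (v k))) *
    (∏ r, sobThetaP P.logq (P.δ r + μ) ^ v k))) * hphase

end Data

/-! ### Separation of geometric progressions -/

lemma exists_pos_le {ι : Type*} (s : Finset ι) (f : ι → ℝ) (h : ∀ i ∈ s, 0 < f i) :
    ∃ ε > 0, ∀ i ∈ s, ε ≤ f i := by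
  classical
  induction s using Finset.induction_on with
  | empty => exact ⟨1, one_pos, fun i hi => absurd hi (Finset.notMem_empty i)⟩
  | insert a s ha ih =>
    obtain ⟨ε, hε, h'⟩ := ih fun i hi => h i (Finset.mem_insert_of_mem hi)
    refine ⟨min ε (f a), lt_min hε (h a (Finset.mem_insert_self _ _)), fun i hi => ?_⟩
    rcases Finset.mem_insert.1 hi with rfl | hi
    · exact min_le_right _ _
    · exact (min_le_left _ _).trans (h' i hi)

/-- For y ≠ 0 the points y q^n tend to 0 or infinity as n tends to ±∞, so all but finitely many are
at distance at least 1/2 from 1. -/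
lemma exists_le_norm_one_sub_mul_zpow {q : ℂ} (hq : ‖q‖ < 1) (hq0 : q ≠ 0) (y : ℂ) :
    ∃ ε > 0, ∀ n : ℤ, y * q ^ n = 1 ∨ ε ≤ ‖1 - y * q ^ n‖ := by
  rcases eq_or_ne y 0 with rfl | hy
  · exact ⟨1, one_pos, fun n => by simp⟩
  have hq' : 0 < ‖q‖ := norm_pos_iff.2 hq0
  have hy' : 0 < ‖y‖ := norm_pos_iff.2 hy
  have hev : ∀ᶠ n : ℤ in cofinite, 1 / 2 ≤ ‖1 - y * q ^ n‖ := by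
    rw [Int.cofinite_eq, eventually_sup]
    constructor
    · have h1 : Tendsto (fun n : ℤ => ‖y‖ * ‖q‖ ^ n) atBot atTop := by
        refine Tendsto.const_mul_atTop hy' ?_
        have := (tendsto_pow_atTop_atTop_of_one_lt (one_lt_inv_iff₀.2 ⟨hq', hq⟩)).comp
          (tendsto_atTop_atTop.2 fun m : ℕ => ⟨(m : ℤ), fun n hn => by omega⟩ :
            Tendsto Int.toNat atTop atTop)
        refine (this.comp tendsto_neg_atBot_atTop).congr' ?_
        filter_upwards [eventually_le_atBot 0] with n hn
        simp only [Function.comp_apply]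
        rw [inv_pow, ← zpow_natCast, Int.toNat_of_nonneg (by omega), zpow_neg, inv_inv]
      filter_upwards [h1.eventually_ge_atTop 2] with n hn
      have := norm_sub_norm_le (y * q ^ n) 1
      rw [norm_sub_rev, norm_mul, norm_zpow, norm_one] at this
      linarith
    · have h1 : Tendsto (fun n : ℤ => ‖y‖ * ‖q‖ ^ n) atTop (𝓝 0) := by
        have := (tendsto_pow_atTop_nhds_zero_of_lt_one hq'.le hq).comp
          (tendsto_atTop_atTop.2 fun m : ℕ => ⟨(m : ℤ), fun n hn => by omega⟩ :
            Tendsto Int.toNat atTop atTop)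
        have := this.const_mul ‖y‖
        rw [mul_zero] at this
        refine this.congr' ?_
        filter_upwards [eventually_ge_atTop 0] with n hn
        simp only [Function.comp_apply]
        rw [← zpow_natCast, Int.toNat_of_nonneg hn]
      filter_upwards [h1.eventually_le_const (by norm_num : (0 : ℝ) < 1 / 2)] with n hn
      have := norm_sub_norm_le 1 (y * q ^ n)
      rw [norm_mul, norm_zpow, norm_one] at this
      linarith
  have hfin : {n : ℤ | ¬ 1 / 2 ≤ ‖1 - y * q ^ n‖}.Finite := hev
  classical
  obtain ⟨ε, hε, h⟩ := exists_pos_le (hfin.toFinset.filter fun n => y * q ^ n ≠ 1)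
    (fun n => ‖1 - y * q ^ n‖) fun n hn =>
      norm_pos_iff.2 (sub_ne_zero.2 (Finset.mem_filter.1 hn).2.symm)
  refine ⟨min ε (1 / 2), lt_min hε (by norm_num), fun n => ?_⟩
  by_cases h1 : y * q ^ n = 1
  · exact Or.inl h1
  · right
    by_cases h2 : 1 / 2 ≤ ‖1 - y * q ^ n‖
    · exact (min_le_right _ _).trans h2
    · exact (min_le_left _ _).trans (h n (by simp [h1]; simpa using h2))

/-- Only the ratio (y/y') q^{m-m'} of two points of the progressions matters, so finitely many
applications of the previous bound suffice uniformly in m and m'. A small disc around one such point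
then stays away from all different ones. -/
lemma exists_separation {q : ℂ} (hq : ‖q‖ < 1) (hq0 : q ≠ 0) (Y : Finset ℂ) (hY : ∀ y ∈ Y, y ≠ 0) :
    ∃ ε > 0, ε ≤ 1 / 2 ∧ ∀ y ∈ Y, ∀ y' ∈ Y, ∀ (m m' : ℤ) (w : ℂ),
      ‖w - y * q ^ m‖ ≤ ε * ‖y * q ^ m‖ →
        y' * q ^ m' = y * q ^ m ∨ ε ≤ ‖1 - w / (y' * q ^ m')‖ := by
  choose f hf hf' using fun y : ℂ => exists_le_norm_one_sub_mul_zpow hq hq0 y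
  obtain ⟨δ, hδ, h⟩ := exists_pos_le (Y ×ˢ Y) (fun x => f (x.1 / x.2)) fun x _ => hf _
  -- If the ratio R satisfies |R| ≤ 2, moving to w costs at most 2ε out of δ ≥ 4ε. If |R| ≥ 2, the
  -- distance to 1 stays at least 2(1 - ε) - 1 ≥ ε.
  refine ⟨min δ 1 / 4, by positivity, by linarith [min_le_right δ 1], ?_⟩
  intro y hy y' hy' m m' w hw
  set ε := min δ 1 / 4 with hε
  have hδε : 4 * ε ≤ δ := by rw [hε]; linarith [min_le_left δ 1]
  have h1ε : 4 * ε ≤ 1 := by rw [hε]; linarith [min_le_right δ 1]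
  have hε0 : 0 < ε := by positivity
  have hb : y' * q ^ m' ≠ 0 := mul_ne_zero (hY y' hy') (zpow_ne_zero _ hq0)
  set R := y * q ^ m / (y' * q ^ m') with hR
  have hR' : R = y / y' * q ^ (m - m') := by rw [hR, zpow_sub₀ hq0]; field_simp
  have hclose : ‖w / (y' * q ^ m') - R‖ ≤ ε * ‖R‖ := by
    rw [hR, ← sub_div, norm_div, norm_div, ← mul_div_assoc]
    gcongr
  rcases hf' (y / y') (m - m') with h1 | h1
  · left
    rw [← hR', hR, div_eq_one_iff_eq hb] at h1
    exact h1.symm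
  · right
    rw [← hR'] at h1
    have h2 : δ ≤ ‖1 - R‖ := (h (y, y') (Finset.mk_mem_product hy hy')).trans h1
    rcases le_total ‖R‖ 2 with h3 | h3
    · have : ‖1 - R‖ ≤ ‖1 - w / (y' * q ^ m')‖ + ‖w / (y' * q ^ m') - R‖ := by
        simpa using norm_add_le (1 - w / (y' * q ^ m')) (w / (y' * q ^ m') - R)
      nlinarith
    · have e1 : ‖R‖ ≤ ‖w / (y' * q ^ m')‖ + ‖w / (y' * q ^ m') - R‖ := by
        have := norm_sub_norm_le R (w / (y' * q ^ m'))
        rw [norm_sub_rev] at this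
        linarith
      have e2 := norm_sub_norm_le (w / (y' * q ^ m')) 1
      rw [norm_sub_rev, norm_one] at e2
      nlinarith

namespace Data

variable (P : Data)

/-- The base points `x^{-α_r - l} / t_r` of the progressions that contain the outer poles. -/
def outerBase (r : Fin P.nα) (l : ℕ) : ℂ := (P.xpow (P.α r + l) * P.t r)⁻¹

/-- The base points `x^{β_r + l} u_r` of the progressions that contain the inner poles. -/
def innerBase (r : Fin P.nβ) (l : ℕ) : ℂ := P.xpow (P.β r + l) * P.u r

/-- `v α_r` and `v β_r` are integers. -/
def IntegralAt (v : ℤ) : Prop :=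
  (∀ r, ∃ N : ℤ, (v : ℝ) * P.α r = N) ∧ ∀ r, ∃ N : ℤ, (v : ℝ) * P.β r = N

lemma outerBase_ne_zero (r : Fin P.nα) (l : ℕ) : P.outerBase r l ≠ 0 :=
  inv_ne_zero (mul_ne_zero (P.xpow_ne_zero _) (Complex.exp_ne_zero _))

lemma innerBase_ne_zero (r : Fin P.nβ) (l : ℕ) : P.innerBase r l ≠ 0 :=
  mul_ne_zero (P.xpow_ne_zero _) (Complex.exp_ne_zero _)

/-- The base points with `l < N`. -/
def bases (N : ℕ) : Finset ℂ :=
  ((Finset.univ ×ˢ Finset.range N).image fun x : Fin P.nα × ℕ => P.outerBase x.1 x.2) ∪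
  ((Finset.univ ×ˢ Finset.range N).image fun x : Fin P.nβ × ℕ => P.innerBase x.1 x.2)

lemma outerBase_mem_bases {N l : ℕ} (h : l < N) (r : Fin P.nα) : P.outerBase r l ∈ P.bases N :=
  Finset.mem_union_left _ (Finset.mem_image.2 ⟨(r, l), by simpa using h, rfl⟩)

lemma innerBase_mem_bases {N l : ℕ} (h : l < N) (r : Fin P.nβ) : P.innerBase r l ∈ P.bases N :=
  Finset.mem_union_right _ (Finset.mem_image.2 ⟨(r, l), by simpa using h, rfl⟩)

lemma ne_zero_of_mem_bases {N : ℕ} {y : ℂ} (h : y ∈ P.bases N) : y ≠ 0 := by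
  rcases Finset.mem_union.1 h with h | h <;> obtain ⟨x, -, rfl⟩ := Finset.mem_image.1 h
  · exact P.outerBase_ne_zero _ _
  · exact P.innerBase_ne_zero _ _

lemma ppow_add_nat_of_int {v N : ℤ} {a : ℝ} (h : (v : ℝ) * a = N) (l : ℕ) :
    P.ppow v (a + l) = P.xpow (a + l) * P.q ^ (N + v * l) :=
  P.ppow_eq_of_int (by push_cast; rw [mul_add, h])

/-- As vα_r is an integer, powers of p become powers of x times integral powers of q. The poles
therefore lie in progressions with ratio q and base points independent of v. -/
lemma outer_arg {v N : ℤ} {r : Fin P.nα} (h : (v : ℝ) * P.α r = N) (w : ℂ) (j k : ℕ) :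
    P.ppow v (P.α r) * P.t r * w * P.p v ^ j * P.q ^ k =
      w / (P.outerBase r j * P.q ^ (-(N + v * j + k))) := by
  have hq0 := P.q_ne_zero
  have : P.ppow v (P.α r) * P.p v ^ j = P.xpow (P.α r + j) * P.q ^ (N + v * j) := by
    rw [p_pow, ← ppow_add, P.ppow_add_nat_of_int h]
  rw [outerBase, zpow_neg, ← mul_inv, div_inv_eq_mul, zpow_add₀ hq0 (N + v * j), zpow_natCast]
  linear_combination (P.t r * w * P.q ^ k) * this

lemma inner_arg {v N : ℤ} {r : Fin P.nβ} (h : (v : ℝ) * P.β r = N) (w : ℂ) (j k : ℕ) :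
    P.ppow v (P.β r) * P.u r / w * P.p v ^ j * P.q ^ k =
      P.innerBase r j * P.q ^ (N + v * j + k) / w := by
  have hq0 := P.q_ne_zero
  have : P.ppow v (P.β r) * P.p v ^ j = P.xpow (P.β r + j) * P.q ^ (N + v * j) := by
    rw [p_pow, ← ppow_add, P.ppow_add_nat_of_int h]
  rw [innerBase, zpow_add₀ hq0 (N + v * j), zpow_natCast, div_eq_mul_inv, div_eq_mul_inv]
  linear_combination (P.u r * w⁻¹ * P.q ^ k) * this

variable {P}

lemma tendsto_logp_int (hq : P.logq.re < 0) : Tendsto P.logp atTop atBot := by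
  unfold logp
  refine tendsto_atBot_add_const_left _ _ ?_
  exact tendsto_intCast_atTop_atTop.atTop_mul_const_of_neg hq

lemma eventually_logp_neg (hq : P.logq.re < 0) : ∀ᶠ v : ℤ in atTop, P.logp v ≤ 0 :=
  (tendsto_logp_int hq).eventually_le_atBot 0

lemma eventually_norm_p_lt_int (hq : P.logq.re < 0) : ∀ᶠ v : ℤ in atTop, ‖P.p v‖ < ‖P.q‖ := by
  filter_upwards [(tendsto_logp_int hq).eventually_lt_atBot P.logq.re] with v hv
  rw [norm_p, norm_q]
  exact Real.exp_lt_exp.2 hv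

lemma exp_zpow (x : ℝ) (n : ℤ) : Real.exp x ^ n = Real.exp (n * x) := by
  rw [← Real.rpow_intCast, ← Real.exp_mul, mul_comm]

lemma half_le_of_norm_le {z : ℂ} (h : ‖z‖ ≤ 1 / 2) : 1 / 2 ≤ ‖1 - z‖ := by
  have := norm_sub_norm_le 1 z
  rw [norm_one] at this
  linarith

/-- Only the poles in finitely many geometric progressions are close to a given annulus. -/
lemma exists_awayFromPoles (hq : P.logq.re < 0) (a b : ℝ) : ∃ N₀ : ℕ, ∀ N ≥ N₀,
    ∀ K : ℝ, ∀ᶠ v : ℤ in atTop, P.IntegralAt v →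
      ∀ ε ≤ (1 / 2 : ℝ), ∀ ζ ∈ Set.Icc a b, ∀ w : ℂ, w ≠ 0 →
      |Real.log ‖w‖ - ζ * v * P.logq.re| ≤ K →
      (∀ r, ∀ l < N, ∀ m : ℤ, ε ≤ ‖1 - w / (P.outerBase r l * P.q ^ m)‖) →
      (∀ r, ∀ l < N, ∀ m : ℤ, ε ≤ ‖1 - P.innerBase r l * P.q ^ m / w‖) →
      P.AwayFromPoles v ε w := by
  -- For l ≥ N₀ and ζ ∈ [a,b] the exponent of p in the corresponding factor is at least 1. The pole
  -- is then so far away that the quantity subtracted from 1 is eventually at most 1/2.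
  obtain ⟨N₀, hN₀⟩ : ∃ N : ℕ, (∀ r, 1 - a ≤ P.α r + N) ∧ ∀ r, 1 + b ≤ P.β r + N := by
    obtain ⟨N, hN⟩ := exists_nat_ge (∑ r, |1 - a - P.α r| + ∑ r, |1 + b - P.β r|)
    refine ⟨N, fun r => ?_, fun r => ?_⟩
    · have h1 := Finset.single_le_sum (f := fun r => |1 - a - P.α r|) (fun _ _ => abs_nonneg _)
        (Finset.mem_univ r)
      have h2 : 0 ≤ ∑ r, |1 + b - (P.β r : ℝ)| := Finset.sum_nonneg fun _ _ => abs_nonneg _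
      have h3 := le_abs_self (1 - a - (P.α r : ℝ))
      linarith
    · have h1 := Finset.single_le_sum (f := fun r => |1 + b - P.β r|) (fun _ _ => abs_nonneg _)
        (Finset.mem_univ r)
      have h2 : 0 ≤ ∑ r, |1 - a - (P.α r : ℝ)| := Finset.sum_nonneg fun _ _ => abs_nonneg _
      have h3 := le_abs_self (1 + b - (P.β r : ℝ))
      linarith
  refine ⟨N₀, fun N hNN₀ K => ?_⟩
  have hN : (∀ r, 1 - a ≤ P.α r + N) ∧ ∀ r, 1 + b ≤ P.β r + N := by
    have : (N₀ : ℝ) ≤ N := by exact_mod_cast hNN₀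
    exact ⟨fun r => (hN₀.1 r).trans (by linarith), fun r => (hN₀.2 r).trans (by linarith)⟩
  have hsmall : ∀ D : ℝ, ∀ᶠ v : ℤ in atTop, Real.exp (v * P.logq.re + D) ≤ 1 / 2 := fun D =>
    (Real.tendsto_exp_atBot.comp (tendsto_atBot_add_const_right _ D
      (tendsto_intCast_atTop_atTop.atTop_mul_const_of_neg hq))).eventually_le_const (by norm_num)
  filter_upwards [eventually_logp_neg hq, eventually_ge_atTop 0,
    eventually_all.2 fun r => hsmall ((P.α r + N) * P.logx.re + (P.logt r).re + K),
    eventually_all.2 fun r => hsmall ((P.β r + N) * P.logx.re + (P.logu r).re + K)]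
    with v hv hv0 h1 h2 hint ε hε ζ hζ w hw hwK hout hin
  have hv0' : (0 : ℝ) ≤ v := by exact_mod_cast hv0
  have hvl : v * P.logq.re ≤ 0 := mul_nonpos_of_nonneg_of_nonpos hv0' hq.le
  have hnw : ‖w‖ = Real.exp (Real.log ‖w‖) := (Real.exp_log (norm_pos_iff.2 hw)).symm
  rw [abs_le] at hwK
  constructor
  · intro r j k
    rcases lt_or_ge j N with hj | hj
    · obtain ⟨M, hM⟩ := hint.1 r
      rw [P.outer_arg hM]
      exact hout r j hj _
    · have hE : (P.α r + j) * P.logp v + (P.logt r).re + Real.log ‖w‖ + k * P.logq.re ≤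
          v * P.logq.re + ((P.α r + N) * P.logx.re + (P.logt r).re + K) := ?_
      · refine hε.trans (half_le_of_norm_le (le_trans (le_of_eq ?_)
          ((Real.exp_le_exp.2 hE).trans (h1 r))))
        rw [p_pow, norm_mul, norm_mul, norm_mul, norm_mul, norm_ppow, norm_ppow, norm_pow, norm_q, t,
          Complex.norm_exp, hnw, ← Real.exp_nat_mul, ← Real.exp_add, ← Real.exp_add, ← Real.exp_add,
          ← Real.exp_add, Real.log_exp, logp]
        congr 1; ring
      · have hj' : (N : ℝ) ≤ j := by exact_mod_cast hj
        have e1 : (P.α r + j : ℝ) * P.logp v ≤ (P.α r + N) * P.logp v :=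
          mul_le_mul_of_nonpos_right (by linarith) hv
        have e2 : (k : ℝ) * P.logq.re ≤ 0 := mul_nonpos_of_nonneg_of_nonpos (Nat.cast_nonneg k) hq.le
        have e3 : (P.α r + N + ζ) * (v * P.logq.re) ≤ 1 * (v * P.logq.re) :=
          mul_le_mul_of_nonpos_right (by linarith [hN.1 r, hζ.1]) hvl
        rw [logp] at *
        nlinarith
  · intro r j k
    rcases lt_or_ge j N with hj | hj
    · obtain ⟨M, hM⟩ := hint.2 r
      rw [P.inner_arg hM]
      exact hin r j hj _
    · have hE : (P.β r + j) * P.logp v + (P.logu r).re - Real.log ‖w‖ + k * P.logq.re ≤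
          v * P.logq.re + ((P.β r + N) * P.logx.re + (P.logu r).re + K) := ?_
      · refine hε.trans (half_le_of_norm_le (le_trans (le_of_eq ?_)
          ((Real.exp_le_exp.2 hE).trans (h2 r))))
        rw [p_pow, norm_mul, norm_mul, norm_div, norm_mul, norm_ppow, norm_ppow, norm_pow, norm_q, u,
          Complex.norm_exp, hnw, ← Real.exp_nat_mul, ← Real.exp_add, ← Real.exp_sub, ← Real.exp_add,
          ← Real.exp_add, Real.log_exp, logp]
        congr 1; ring
      · have hj' : (N : ℝ) ≤ j := by exact_mod_cast hj
        have e1 : (P.β r + j : ℝ) * P.logp v ≤ (P.β r + N) * P.logp v :=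
          mul_le_mul_of_nonpos_right (by linarith) hv
        have e2 : (k : ℝ) * P.logq.re ≤ 0 := mul_nonpos_of_nonneg_of_nonpos (Nat.cast_nonneg k) hq.le
        have e3 : (P.β r + N - ζ) * (v * P.logq.re) ≤ 1 * (v * P.logq.re) :=
          mul_le_mul_of_nonpos_right (by linarith [hN.2 r, hζ.2]) hvl
        rw [logp] at *
        nlinarith

/-! ### The size of the rescaled integrand -/

lemma norm_scale {sobMin : ℂ} {Lmin : ℝ} (h : ‖sobMin‖ = Real.exp Lmin) (v : ℤ) :
    ‖P.scale sobMin v‖ = Real.exp (P.fobMax * v ^ 2 / 2 * P.logq.re + v * Lmin) := by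
  rw [scale, norm_mul, norm_zpow, h, Complex.norm_exp, exp_zpow, ← Real.exp_add]
  congr 2
  have : ((P.fobMax : ℂ) * (v : ℂ) ^ 2 / 2 * P.logq) =
      ((P.fobMax * (v : ℝ) ^ 2 / 2 : ℝ) : ℂ) * P.logq := by push_cast; ring
  rw [this, Complex.re_ofReal_mul]

lemma norm_scale_mul_integrand {sobMin : ℂ} {Lmin : ℝ} (h : ‖sobMin‖ = Real.exp Lmin) (v : ℤ) (ζ : ℝ)
    {logz : ℂ} (hz : logz.re = 0) :
    ‖P.scale sobMin v * P.integrand v (P.ppow v ζ * Complex.exp logz)‖ =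
      ‖P.normalized v ζ logz‖ * Real.exp (-P.energy Lmin v ζ) := by
  have e1 : ((P.fob ζ : ℂ) * (v : ℂ) ^ 2 / 2 * P.logq) =
      ((P.fob ζ * (v : ℝ) ^ 2 / 2 : ℝ) : ℂ) * P.logq := by push_cast; ring
  rw [norm_mul, norm_scale h, normalized, norm_mul, norm_mul, norm_zpow, norm_sob, hz, mul_zero,
    add_zero, exp_zpow, e1, Complex.norm_exp, Complex.re_ofReal_mul, mul_assoc, mul_assoc,
    ← Real.exp_add, ← Real.exp_add, mul_comm, energy]
  congr 2
  ring

/-- The rescaled integrand decays away from the minimizers of the second order behaviour. -/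
theorem exists_norm_scale_mul_integrand_le (hq : P.logq.re < 0) (hfin : P.M₀.Finite) {sobMin : ℂ}
    {Lmin a b : ℝ} (h : ‖sobMin‖ = Real.exp Lmin) (hd : P.IsDecayInterval Lmin a b) (K : ℝ)
    {ε : ℝ} (hε : 0 < ε) :
    ∃ κ > 0, ∃ C > 0, ∀ᶠ v : ℤ in atTop, ∀ ζ ∈ Set.Icc a b, ∀ w : ℂ, w ≠ 0 →
      |Real.log ‖w‖ - ζ * v * P.logq.re| ≤ K → P.AwayFromPoles v ε w →
      ‖P.scale sobMin v * P.integrand v w‖ ≤ C * Real.exp (-(κ * (v * Metric.infDist ζ P.M₀))) := by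
  set B := max |a| |b| with hB
  have hl : 0 < -P.logq.re := neg_pos.2 hq
  -- The exact exponent of w is log|w| / log|p|. Passing from v log q to log p = log x + v log q
  -- adds B|log|x||, and the factor 2 comes from |log|p|| ≥ v|log|q||/2 for large v.
  set K' := 2 * (K + B * |P.logx.re|) / -P.logq.re with hK'
  obtain ⟨κ, hκ, C, V, hV, hE⟩ := energyBound_Icc hq hfin hd K'
  obtain ⟨D, hD, hN⟩ := P.exists_norm_normalized_le hq (max (B + |K'|) 0) hε
  refine ⟨κ, hκ, D * Real.exp C, by positivity, ?_⟩
  have hbig : ∀ᶠ v : ℤ in atTop, P.logp v ≤ v * P.logq.re / 2 := by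
    have := (tendsto_intCast_atTop_atTop (R := ℝ)).atTop_mul_const_of_neg hq
    filter_upwards [this.eventually_le_atBot (-2 * P.logx.re)] with v hv
    rw [logp]; linarith
  filter_upwards [eventually_norm_p_lt_int hq, hbig,
    (tendsto_intCast_atTop_atTop (R := ℝ)).eventually_ge_atTop V] with v hv1 hv2 hv3 ζ hζ w hw hwK haway
  have hv0 : (0 : ℝ) < v := by linarith
  have hlogp : P.logp v < 0 := by nlinarith
  set ζ' := Real.log ‖w‖ / P.logp v with hζ'
  have hζB : |ζ| ≤ B := abs_le_max_abs_abs hζ.1 hζ.2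
  have hclose : |ζ' - ζ| ≤ K' / v := by
    have e1 : ζ' - ζ = (Real.log ‖w‖ - ζ * v * P.logq.re - ζ * P.logx.re) / P.logp v := by
      rw [hζ', eq_div_iff hlogp.ne, sub_mul, div_mul_cancel₀ _ hlogp.ne, logp]; ring
    have e2 : |Real.log ‖w‖ - ζ * v * P.logq.re - ζ * P.logx.re| ≤ K + B * |P.logx.re| := by
      refine (abs_sub _ _).trans (add_le_add hwK ?_)
      rw [abs_mul]; gcongr
    rw [e1, abs_div, abs_of_neg hlogp, hK', div_div, div_le_div_iff₀ (neg_pos.2 hlogp) (by positivity)]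
    have e3 : 0 ≤ K + B * |P.logx.re| := (abs_nonneg _).trans e2
    have e4 : -P.logq.re * v ≤ 2 * -P.logp v := by linarith
    calc _ ≤ (K + B * |P.logx.re|) * (2 * -P.logp v) :=
          mul_le_mul e2 e4 (by positivity) e3
      _ = _ := by ring
  have hζ'B : |ζ'| ≤ max (B + |K'|) 0 := by
    refine le_trans ?_ (le_max_left _ _)
    have e1 : K' / v ≤ |K'| :=
      (div_le_div_of_nonneg_right (le_abs_self K') hv0.le).trans
        (div_le_self (abs_nonneg _) (hV.trans hv3))
    have e2 := abs_add_le ζ (ζ' - ζ)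
    rw [add_sub_cancel] at e2
    linarith
  set logz : ℂ := Complex.log (w / P.ppow v ζ') with hlogz
  have hpz : P.ppow v ζ' * Complex.exp logz = w := by
    rw [hlogz, Complex.exp_log (div_ne_zero hw (P.ppow_ne_zero _ _)),
      mul_div_cancel₀ _ (P.ppow_ne_zero _ _)]
  have hre : logz.re = 0 := by
    have e : ζ' * (P.logx.re + v * P.logq.re) = Real.log ‖w‖ := by
      rw [hζ', show P.logx.re + v * P.logq.re = P.logp v from rfl, div_mul_cancel₀ _ hlogp.ne]
    rw [hlogz, Complex.log_re, norm_div, norm_ppow, e, Real.exp_log (norm_pos_iff.2 hw),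
      div_self (norm_ne_zero_iff.2 hw), Real.log_one]
  rw [← hpz, norm_scale_mul_integrand h v ζ' hre]
  have h1 := hN v hv1 ζ' logz hζ'B (by rw [hre, abs_zero]; exact le_max_right _ _)
    (by rw [hpz]; exact haway)
  have h2 := hE v hv3 ζ hζ ζ' hclose
  calc _ ≤ D * Real.exp (C + -(κ * (v * Metric.infDist ζ P.M₀))) :=
        mul_le_mul h1 (Real.exp_le_exp.2 (by linarith)) (Real.exp_pos _).le hD.le
    _ = _ := by rw [Real.exp_add]; ring

end Data

/-! ### Analyticity of the integrand -/

lemma analyticAt_pqSymbol {p q : ℂ} (hp : ‖p‖ < 1) (hq : ‖q‖ < 1) {f : ℂ → ℂ} {z : ℂ}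
    (hf : AnalyticAt ℂ f z) : AnalyticAt ℂ (fun z => pqSymbol (f z) p q) z :=
  ((differentiable_pqSymbol hp hq).analyticAt (f z)).fun_comp hf

lemma analyticAt_qSymbol {q : ℂ} (hq : ‖q‖ < 1) {f : ℂ → ℂ} {z : ℂ}
    (hf : AnalyticAt ℂ f z) : AnalyticAt ℂ (fun z => qSymbol (f z) q) z :=
  ((differentiable_qSymbol hq).analyticAt (f z)).fun_comp hf

lemma analyticAt_theta {q : ℂ} (hq : ‖q‖ < 1) {f : ℂ → ℂ} {z : ℂ} (hf : AnalyticAt ℂ f z)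
    (h0 : f z ≠ 0) : AnalyticAt ℂ (fun z => theta (f z) q) z :=
  (analyticAt_qSymbol hq hf).mul (analyticAt_qSymbol hq (analyticAt_const.div hf h0))

lemma analyticAt_ellGamma {p q : ℂ} (hp : ‖p‖ < 1) (hq : ‖q‖ < 1) {f : ℂ → ℂ} {z : ℂ}
    (hf : AnalyticAt ℂ f z) (h0 : f z ≠ 0) (h : ∀ j k : ℕ, f z * p ^ j * q ^ k ≠ 1) :
    AnalyticAt ℂ (fun z => ellGamma (f z) p q) z :=
  (analyticAt_pqSymbol hp hq (analyticAt_const.div hf h0)).div (analyticAt_pqSymbol hp hq hf)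
    (pqSymbol_ne_zero hp hq h)

lemma meromorphicAt_ellGamma {p q : ℂ} (hp : ‖p‖ < 1) (hq : ‖q‖ < 1) {f : ℂ → ℂ} {z : ℂ}
    (hf : AnalyticAt ℂ f z) (h0 : f z ≠ 0) : MeromorphicAt (fun z => ellGamma (f z) p q) z :=
  (analyticAt_pqSymbol hp hq (analyticAt_const.div hf h0)).meromorphicAt.fun_div
    (analyticAt_pqSymbol hp hq hf).meromorphicAt

/-- Multiplication by c scales the circle and rotates it by arg c; the rotation is absorbed by
periodicity of the parametrization. It turns circles around moving poles into a fixed circle. -/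
lemma circleIntegral_mul_left (f : ℂ → ℂ) (c : ℂ) (z₀ : ℂ) (ρ : ℝ) :
    (∮ z in C(c * z₀, ‖c‖ * ρ), f z) = ∮ z in C(z₀, ρ), c * f (c * z) := by
  have hmap : ∀ θ : ℝ, circleMap (c * z₀) (‖c‖ * ρ) (θ + c.arg) = c * circleMap z₀ ρ θ := by
    intro θ
    have := Complex.norm_mul_exp_arg_mul_I c
    simp only [circleMap]
    push_cast
    rw [add_mul, Complex.exp_add]
    linear_combination (ρ * Complex.exp (θ * Complex.I)) * this
  have hmap0 : ∀ θ : ℝ, circleMap 0 (‖c‖ * ρ) (θ + c.arg) = c * circleMap 0 ρ θ := by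
    intro θ
    have := Complex.norm_mul_exp_arg_mul_I c
    simp only [circleMap]
    push_cast
    rw [add_mul, Complex.exp_add]
    linear_combination (ρ * Complex.exp (θ * Complex.I)) * this
  have hper : Function.Periodic (fun θ : ℝ => deriv (circleMap (c * z₀) (‖c‖ * ρ)) θ •
      f (circleMap (c * z₀) (‖c‖ * ρ) θ)) (2 * Real.pi) := by
    intro θ
    simp only [deriv_circleMap]
    rw [periodic_circleMap, periodic_circleMap]
  have h1 := hper.intervalIntegral_add_eq 0 c.arg
  rw [zero_add] at h1
  rw [circleIntegral, h1, circleIntegral]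
  have h2 := intervalIntegral.integral_comp_add_right (a := 0) (b := 2 * Real.pi)
    (fun θ : ℝ => deriv (circleMap (c * z₀) (‖c‖ * ρ)) θ • f (circleMap (c * z₀) (‖c‖ * ρ) θ)) c.arg
  rw [zero_add, add_comm (2 * Real.pi)] at h2
  rw [← h2]
  refine intervalIntegral.integral_congr fun θ _ => ?_
  simp only [deriv_circleMap, hmap, hmap0, smul_eq_mul]
  ring

namespace Data

variable (P : Data)

/-- The poles of the gamma factors of the integrand. -/
def IsPole (v : ℤ) (w : ℂ) : Prop :=
  (∃ r, ∃ j k : ℕ, P.ppow v (P.α r) * P.t r * w * P.p v ^ j * P.q ^ k = 1) ∨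
    ∃ r, ∃ j k : ℕ, P.ppow v (P.β r) * P.u r / w * P.p v ^ j * P.q ^ k = 1

variable {P}

lemma AwayFromPoles.not_isPole {v : ℤ} {ε : ℝ} (hε : 0 < ε) {w : ℂ} (h : P.AwayFromPoles v ε w) :
    ¬P.IsPole v w := by
  rintro (⟨r, j, k, hr⟩ | ⟨r, j, k, hr⟩)
  · exact ne_of_lt_norm_one_sub hε (h.1 r j k) hr
  · exact ne_of_lt_norm_one_sub hε (h.2 r j k) hr

lemma t_ne_zero (r : Fin P.nα) : P.t r ≠ 0 := Complex.exp_ne_zero _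

lemma u_ne_zero (r : Fin P.nβ) : P.u r ≠ 0 := Complex.exp_ne_zero _

lemma vv_ne_zero (r : Fin P.nγ) : P.vv r ≠ 0 := Complex.exp_ne_zero _

lemma w_ne_zero (r : Fin P.nδ) : P.w r ≠ 0 := Complex.exp_ne_zero _

lemma analyticAt_integrand (hq : P.logq.re < 0) {v : ℤ} (hv : ‖P.p v‖ < ‖P.q‖) {z : ℂ}
    (hz : z ≠ 0) (h : ¬P.IsPole v z) : AnalyticAt ℂ (P.integrand v) z := by
  have hq1 := P.norm_q_lt_one hq
  have hp1 := hv.trans hq1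
  rw [IsPole, not_or] at h
  push Not at h
  unfold integrand
  refine (((Finset.analyticAt_fun_prod _ fun r _ => ?_).mul
    (Finset.analyticAt_fun_prod _ fun r _ => ?_)).mul
    (Finset.analyticAt_fun_prod _ fun r _ => ?_)).mul (Finset.analyticAt_fun_prod _ fun r _ => ?_)
  · exact analyticAt_ellGamma hp1 hq1 (by fun_prop)
      (mul_ne_zero (mul_ne_zero (P.ppow_ne_zero _ _) (t_ne_zero r)) hz) (h.1 r)
  · exact analyticAt_ellGamma hp1 hq1 (by fun_prop (disch := assumption))
      (div_ne_zero (mul_ne_zero (P.ppow_ne_zero _ _) (u_ne_zero r)) hz) (h.2 r)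
  · exact analyticAt_theta hq1 (by fun_prop)
      (mul_ne_zero (mul_ne_zero (P.ppow_ne_zero _ _) (vv_ne_zero r)) hz)
  · exact analyticAt_theta hp1 (by fun_prop)
      (mul_ne_zero (mul_ne_zero (P.ppow_ne_zero _ _) (w_ne_zero r)) hz)

lemma meromorphicAt_integrand (hq : P.logq.re < 0) {v : ℤ} (hv : ‖P.p v‖ < ‖P.q‖) {z : ℂ}
    (hz : z ≠ 0) : MeromorphicAt (P.integrand v) z := by
  have hq1 := P.norm_q_lt_one hq
  have hp1 := hv.trans hq1
  unfold integrand
  refine (((MeromorphicAt.fun_prod fun r _ => ?_).mul (MeromorphicAt.fun_prod fun r _ => ?_)).mul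
    (MeromorphicAt.fun_prod fun r _ => ?_)).mul (MeromorphicAt.fun_prod fun r _ => ?_)
  · exact meromorphicAt_ellGamma hp1 hq1 (by fun_prop)
      (mul_ne_zero (mul_ne_zero (P.ppow_ne_zero _ _) (t_ne_zero r)) hz)
  · exact meromorphicAt_ellGamma hp1 hq1 (by fun_prop (disch := assumption))
      (div_ne_zero (mul_ne_zero (P.ppow_ne_zero _ _) (u_ne_zero r)) hz)
  · exact (analyticAt_theta hq1 (by fun_prop)
      (mul_ne_zero (mul_ne_zero (P.ppow_ne_zero _ _) (vv_ne_zero r)) hz)).meromorphicAt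
  · exact (analyticAt_theta hp1 (by fun_prop)
      (mul_ne_zero (mul_ne_zero (P.ppow_ne_zero _ _) (w_ne_zero r)) hz)).meromorphicAt

lemma differentiableAt_integrand_div (hq : P.logq.re < 0) {v : ℤ} (hv : ‖P.p v‖ < ‖P.q‖) {z : ℂ}
    (hz : z ≠ 0) (h : ¬P.IsPole v z) : DifferentiableAt ℂ (fun z => P.integrand v z / z) z :=
  (analyticAt_integrand hq hv hz h).differentiableAt.fun_div differentiableAt_id hz

/-! ### Residues of the integrand -/

variable (P) in
/-- In the annuli `|w| ≍ |q|^(ζ v)`, `ζ ∈ [a, b]`, all poles have relative distance at least `ε` from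
each pole in one of the progressions starting at `P.bases N`. -/
def SeparatedPoles (a b : ℝ) (N : ℕ) (ε : ℝ) : Prop :=
  ∀ K : ℝ, ∃ K' : ℝ, ∀ᶠ v : ℤ in atTop, P.IntegralAt v →
    ∀ y ∈ P.bases N, ∀ m : ℤ, ∀ ζ ∈ Set.Icc a b, |m - ζ * v| ≤ K →
    ∀ w, w ≠ y * P.q ^ m → ‖w - y * P.q ^ m‖ ≤ ε * ‖y * P.q ^ m‖ →
      w ≠ 0 ∧ |Real.log ‖w‖ - ζ * v * P.logq.re| ≤ K' ∧
        P.AwayFromPoles v (min ε ‖1 - w / (y * P.q ^ m)‖ / 2) w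

lemma exists_separatedPoles (hq : P.logq.re < 0) (a b : ℝ) : ∃ N₀ : ℕ, ∀ N ≥ N₀,
    ∃ ε > 0, ε ≤ 1 / 2 ∧ P.SeparatedPoles a b N ε := by
  obtain ⟨N₀, h⟩ := exists_awayFromPoles hq a b
  refine ⟨N₀, fun N hN => ?_⟩
  have hq0 := P.q_ne_zero
  obtain ⟨ε, hε, hε2, hsep⟩ := exists_separation (P.norm_q_lt_one hq) hq0 (P.bases N)
    fun y hy => P.ne_zero_of_mem_bases hy
  refine ⟨ε, hε, hε2, fun K => ?_⟩
  set K' := ∑ y ∈ P.bases N, |Real.log ‖y‖| + K * |P.logq.re| + 1 with hK'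
  refine ⟨K', ?_⟩
  filter_upwards [h N hN K'] with v hv hint y hy m ζ hζ hmζ w hwa hw
  have hy0 := P.ne_zero_of_mem_bases hy
  set a₀ := y * P.q ^ m with ha₀
  have ha0 : a₀ ≠ 0 := mul_ne_zero hy0 (zpow_ne_zero _ hq0)
  have hna : 0 < ‖a₀‖ := norm_pos_iff.2 ha0
  have h1 : ‖w / a₀ - 1‖ ≤ ε := by
    rw [← div_self ha0, ← sub_div, norm_div, div_le_iff₀ hna]
    exact hw
  have h2 : 1 / 2 ≤ ‖w / a₀‖ := by
    have := norm_sub_norm_le 1 (1 - w / a₀)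
    rw [sub_sub_cancel, norm_one, norm_sub_rev] at this
    linarith
  have h3 : ‖w / a₀‖ ≤ 2 := by
    have := norm_add_le (w / a₀ - 1) 1
    rw [sub_add_cancel, norm_one] at this
    linarith
  have hw0 : w ≠ 0 := by
    rintro rfl
    rw [zero_div, norm_zero] at h2
    norm_num at h2
  have hlog : |Real.log ‖w‖ - ζ * v * P.logq.re| ≤ K' := by
    have e1 : Real.log ‖w‖ - ζ * v * P.logq.re =
        Real.log ‖y‖ + (m - ζ * v) * P.logq.re + Real.log ‖w / a₀‖ := by
      have e2 : ‖w‖ = ‖y‖ * ‖P.q‖ ^ m * ‖w / a₀‖ := by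
        rw [norm_div, ha₀, norm_mul, norm_zpow, mul_div_cancel₀]
        rw [← norm_zpow, ← norm_mul]; exact hna.ne'
      rw [e2, Real.log_mul, Real.log_mul, Real.log_zpow, norm_q, Real.log_exp]
      · ring
      · exact norm_ne_zero_iff.2 hy0
      · exact zpow_ne_zero _ (norm_ne_zero_iff.2 hq0)
      · exact mul_ne_zero (norm_ne_zero_iff.2 hy0) (zpow_ne_zero _ (norm_ne_zero_iff.2 hq0))
      · exact norm_ne_zero_iff.2 (div_ne_zero hw0 ha0)
    have e3 : |Real.log ‖w / a₀‖| ≤ 1 := by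
      have hpos : 0 < ‖w / a₀‖ := by linarith
      have hl2 := Real.log_two_lt_d9
      rw [abs_le]
      constructor
      · have := Real.log_le_log (by norm_num) h2
        rw [one_div, Real.log_inv] at this
        linarith
      · have := Real.log_le_log hpos h3
        linarith
    have e4 : |Real.log ‖y‖| ≤ ∑ y ∈ P.bases N, |Real.log ‖y‖| :=
      Finset.single_le_sum (f := fun y => |Real.log ‖y‖|) (fun _ _ => abs_nonneg _) hy
    have e5 : |(m - ζ * v) * P.logq.re| ≤ K * |P.logq.re| := by
      rw [abs_mul]; gcongr
    rw [e1]
    exact (abs_add_three _ _ _).trans (add_le_add (add_le_add e4 e5) e3)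
  refine ⟨hw0, hlog, ?_⟩
  set η := min ε ‖1 - w / a₀‖ with hη
  have hη0 : 0 < η := lt_min hε (norm_pos_iff.2 (sub_ne_zero.2 fun he =>
    hwa ((div_eq_one_iff_eq ha0).1 he.symm)))
  have hη1 : η ≤ 1 / 2 := (min_le_left _ _).trans hε2
  -- A member of the progressions either coincides with the given centre, in which case the distance
  -- is |1 - w/a₀|, or is separated by ε. The halving in the conclusion pays for inverting the ratio
  -- at inner poles.
  have key : ∀ y' ∈ P.bases N, ∀ m' : ℤ, η ≤ ‖1 - w / (y' * P.q ^ m')‖ := by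
    intro y' hy' m'
    rcases hsep y hy y' hy' m m' w hw with he | he
    · rw [he]; exact min_le_right _ _
    · exact (min_le_left _ _).trans he
  refine hv hint _ (by linarith) ζ hζ w hw0 hlog (fun r l hl m' => ?_) (fun r l hl m' => ?_)
  · linarith [key _ (P.outerBase_mem_bases hl r) m']
  · have k1 := key _ (P.innerBase_mem_bases hl r) m'
    have k2 := norm_one_sub_inv_ge hη0 (div_ne_zero hw0
      (mul_ne_zero (P.innerBase_ne_zero r l) (zpow_ne_zero m' hq0))) k1
    rw [inv_div] at k2
    exact (le_min (by linarith) le_rfl).trans k2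

end Data

namespace Data

variable {P : Data}

lemma mem_circle {a w : ℂ} (ha : a ≠ 0) {ε : ℝ} (hε : 0 < ε)
    (hw : w ∈ Metric.sphere a (ε * ‖a‖)) :
    w ≠ a ∧ ‖w - a‖ ≤ ε * ‖a‖ ∧ ‖1 - w / a‖ = ε := by
  have hna : 0 < ‖a‖ := norm_pos_iff.2 ha
  rw [mem_sphere_iff_norm] at hw
  refine ⟨fun h => ?_, hw.le, ?_⟩
  · rw [h, sub_self, norm_zero] at hw
    exact (mul_pos hε hna).ne hw
  · rw [norm_sub_rev, ← div_self ha, ← sub_div, norm_div, hw, mul_div_cancel_right₀ _ hna.ne']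

lemma SeparatedPoles.residue_eq (hq : P.logq.re < 0) {a b ε : ℝ} {N : ℕ} (hε : 0 < ε)
    (hs : P.SeparatedPoles a b N ε) (K : ℝ) : ∀ᶠ v : ℤ in atTop, P.IntegralAt v →
      ∀ y ∈ P.bases N, ∀ m : ℤ, ∀ ζ ∈ Set.Icc a b, |m - ζ * v| ≤ K →
      residue (fun z => P.integrand v z / z) (y * P.q ^ m) =
        (2 * (Real.pi : ℂ) * Complex.I)⁻¹ *
          ∮ z in C(y * P.q ^ m, ε * ‖y * P.q ^ m‖), P.integrand v z / z := by
  obtain ⟨K', h⟩ := hs K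
  filter_upwards [h, eventually_norm_p_lt_int hq] with v hv hv2 hint y hy m ζ hζ hm
  have ha : y * P.q ^ m ≠ 0 := mul_ne_zero (P.ne_zero_of_mem_bases hy) (zpow_ne_zero _ P.q_ne_zero)
  refine residue_eq_circleIntegral (mul_pos hε (norm_pos_iff.2 ha)) fun z hz hza => ?_
  rw [mem_closedBall_iff_norm] at hz
  obtain ⟨h1, -, h3⟩ := hv hint y hy m ζ hζ hm z hza hz
  refine differentiableAt_integrand_div hq hv2 h1 (h3.not_isPole (half_pos (lt_min hε
    (norm_pos_iff.2 (sub_ne_zero.2 fun he => hza ((div_eq_one_iff_eq ha).1 he.symm))))))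

/-- The rescaled residues decay away from the minimizers of the second order behaviour. -/
theorem exists_norm_scale_mul_residue_le (hq : P.logq.re < 0) (hfin : P.M₀.Finite) {sobMin : ℂ}
    {Lmin a b ε : ℝ} {N : ℕ} (h : ‖sobMin‖ = Real.exp Lmin) (hd : P.IsDecayInterval Lmin a b)
    (hε : 0 < ε) (hε2 : ε ≤ 1 / 2) (hs : P.SeparatedPoles a b N ε) (K : ℝ) :
    ∃ κ > 0, ∃ C > 0, ∀ᶠ v : ℤ in atTop, P.IntegralAt v → ∀ y ∈ P.bases N, ∀ m : ℤ,
      ∀ ζ ∈ Set.Icc a b, |m - ζ * v| ≤ K →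
      ‖P.scale sobMin v * residue (fun z => P.integrand v z / z) (y * P.q ^ m)‖ ≤
        C * Real.exp (-(κ * (v * Metric.infDist ((m : ℝ) / v) P.M₀))) := by
  obtain ⟨K', h1⟩ := hs K
  obtain ⟨κ, hκ, C, hC, h2⟩ := exists_norm_scale_mul_integrand_le hq hfin h hd K' (half_pos hε)
  refine ⟨κ, hκ, C * Real.exp (κ * K), by positivity, ?_⟩
  filter_upwards [h1, h2, hs.residue_eq hq hε K, eventually_gt_atTop 0]
    with v hv1 hv2 hv3 hv0 hint y hy m ζ hζ hm
  have hv0' : (0 : ℝ) < v := by exact_mod_cast hv0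
  have ha : y * P.q ^ m ≠ 0 := mul_ne_zero (P.ne_zero_of_mem_bases hy) (zpow_ne_zero _ P.q_ne_zero)
  have hna := norm_pos_iff.2 ha
  set a₀ := y * P.q ^ m with ha₀
  set E := C * Real.exp (-(κ * (v * Metric.infDist ζ P.M₀))) with hE
  have hbound : ∀ z ∈ Metric.sphere a₀ (ε * ‖a₀‖),
      ‖P.scale sobMin v * (P.integrand v z / z)‖ ≤ E * (2 / ‖a₀‖) := by
    intro z hz
    obtain ⟨c1, c2, c3⟩ := mem_circle ha hε hz
    obtain ⟨h1, h4, h3⟩ := hv1 hint y hy m ζ hζ hm z c1 c2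
    rw [← ha₀, c3, min_self] at h3
    have h5 := hv2 ζ hζ z h1 h4 h3
    have h6 : ‖a₀‖ / 2 ≤ ‖z‖ := by
      have := norm_sub_norm_le a₀ (a₀ - z)
      rw [sub_sub_cancel, norm_sub_rev] at this
      nlinarith
    rw [← mul_div_assoc, norm_div, div_eq_mul_inv]
    refine mul_le_mul h5 ?_ (inv_nonneg.2 (norm_nonneg _)) (by positivity)
    rw [← inv_div]
    exact inv_anti₀ (by positivity) h6
  have hres : P.scale sobMin v * residue (fun z => P.integrand v z / z) a₀ =
      (2 * (Real.pi : ℂ) * Complex.I)⁻¹ •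
        ∮ z in C(a₀, ε * ‖a₀‖), P.scale sobMin v * (P.integrand v z / z) := by
    rw [hv3 hint y hy m ζ hζ hm, circleIntegral.integral_const_mul, smul_eq_mul]
    ring
  rw [hres]
  refine (circleIntegral.norm_two_pi_i_inv_smul_integral_le_of_norm_le_const (by positivity)
    hbound).trans ?_
  -- Measuring the distance to M₀ at m/v instead of ζ costs at most K, which accounts for exp(κK) in
  -- the constant.
  have hdist : v * Metric.infDist ((m : ℝ) / v) P.M₀ ≤ v * Metric.infDist ζ P.M₀ + K := by
    have e1 := Metric.infDist_le_infDist_add_dist (s := P.M₀) (x := (m : ℝ) / v) (y := ζ)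
    have e2 : v * dist ((m : ℝ) / v) ζ = |m - ζ * v| := by
      rw [Real.dist_eq, ← abs_of_pos hv0', ← abs_mul, abs_of_pos hv0', mul_sub,
        mul_div_cancel₀ _ hv0'.ne', mul_comm ζ]
    calc _ ≤ v * (Metric.infDist ζ P.M₀ + dist ((m : ℝ) / v) ζ) := by gcongr
      _ ≤ _ := by rw [mul_add, e2]; gcongr
  calc ε * ‖a₀‖ * (E * (2 / ‖a₀‖)) = E * (2 * ε) := by field_simp
    _ ≤ E * 1 := by gcongr; linarith
    _ ≤ C * (Real.exp (κ * K) * Real.exp (-(κ * (v * Metric.infDist ((m : ℝ) / v) P.M₀)))) := by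
        rw [mul_one, hE, ← Real.exp_add]
        gcongr
        nlinarith
    _ = _ := by ring

/-- The rescaled residues at poles that move with `p^μ` converge. -/
theorem exists_tendsto_scale_mul_residue (hq : P.logq.re < 0) (hend : P.CriticalEnds)
    (hfin : P.M₀.Finite) {sobMin : ℂ}
    {Lmin a b ε : ℝ} {N : ℕ} (h : ‖sobMin‖ = Real.exp Lmin) (hd : P.IsDecayInterval Lmin a b)
    (hε : 0 < ε) (hs : P.SeparatedPoles a b N ε) {v : ℕ → ℤ}
    (hv : Tendsto v atTop atTop) (hint : ∀ k, P.IntegralAt (v k))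
    (hγ : ∀ r k, ∃ N : ℤ, (v k : ℝ) * P.γ r = N) {μ : ℝ} (hμ : μ ∈ P.M₀) (hμab : μ ∈ Set.Icc a b)
    (hμv : ∀ k, ∃ N : ℤ, (v k : ℝ) * μ = N) (hsob : ∀ k, P.sob μ 0 ^ v k = sobMin ^ v k)
    {y : ℂ} (hy : y ∈ P.bases N) (n : ℤ) :
    ∃ L, Tendsto (fun k => P.scale sobMin (v k) *
      residue (fun z => P.integrand (v k) z / z) (P.ppow (v k) μ * (y * P.q ^ n / P.xpow μ)))
        atTop (𝓝 L) := by
  have hμM := P.M₀_subset_M hμ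
  choose m hm using hμv
  -- In the variable Z = p^{-μ} z the pole stays at Z₀, and the circle of relative radius ε around
  -- it does not depend on v. Dominated convergence applies on this fixed circle.
  set Z₀ := y * P.q ^ n / P.xpow μ with hZ₀
  have hq0 := P.q_ne_zero
  have hZ0 : Z₀ ≠ 0 := div_ne_zero (mul_ne_zero (P.ne_zero_of_mem_bases hy) (zpow_ne_zero _ hq0))
    (P.xpow_ne_zero μ)
  have hpt : ∀ k, P.ppow (v k) μ * Z₀ = y * P.q ^ (m k + n) := fun k => by
    have := P.xpow_ne_zero μ
    rw [P.ppow_eq_of_int (hm k), hZ₀, zpow_add₀ hq0]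
    field_simp
  have hmn : ∀ k, |((m k + n : ℤ) : ℝ) - μ * v k| ≤ |(n : ℝ)| := fun k => by
    rw [mul_comm μ, hm k]; push_cast; rw [add_sub_cancel_left]
  obtain ⟨K', h1⟩ := hs |(n : ℝ)|
  obtain ⟨κ, hκ, C, hC, h2⟩ := exists_norm_scale_mul_integrand_le hq hfin h hd K' (half_pos hε)
  have hnear : ∀ᶠ k in atTop, ∀ Z ∈ Metric.sphere Z₀ (ε * ‖Z₀‖),
      P.ppow (v k) μ * Z ≠ 0 ∧ |Real.log ‖P.ppow (v k) μ * Z‖ - μ * v k * P.logq.re| ≤ K' ∧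
        P.AwayFromPoles (v k) (ε / 2) (P.ppow (v k) μ * Z) := by
    filter_upwards [hv.eventually h1] with k hk Z hZ
    obtain ⟨c1, c2, c3⟩ := mem_circle hZ0 hε hZ
    have hp0 := P.ppow_ne_zero (v k) μ
    have := hk (hint k) y hy (m k + n) μ hμab (hmn k) (P.ppow (v k) μ * Z)
      (by rw [← hpt k]; exact fun he => c1 (mul_left_cancel₀ hp0 he))
      (by rw [← hpt k, ← mul_sub, norm_mul, norm_mul, mul_left_comm]; gcongr)
    rwa [← hpt k, mul_div_mul_left _ _ hp0, c3, min_self] at this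
  have hlim : ∀ Z ∈ Metric.sphere Z₀ (ε * ‖Z₀‖), ∃ L, Tendsto (fun k => P.scale sobMin (v k) *
      P.integrand (v k) (P.ppow (v k) μ * Z)) atTop (𝓝 L) := by
    intro Z hZ
    have hZne : Z ≠ 0 := by
      obtain ⟨k, hk⟩ := hnear.exists
      exact right_ne_zero_of_mul (hk Z hZ).1
    obtain ⟨L, hL⟩ := exists_tendsto_normalized hq hv (P.sobExp_eq_zero hend hμM)
      (fun r k => by
        obtain ⟨A, hA⟩ := (hint k).1 r
        exact ⟨A + m k, by push_cast; rw [mul_add, hA, hm]⟩)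
      (fun r k => by
        obtain ⟨A, hA⟩ := (hint k).2 r
        exact ⟨A - m k, by push_cast; rw [mul_sub, hA, hm]⟩)
      (fun r k => by
        obtain ⟨A, hA⟩ := hγ r k
        exact ⟨A + m k, by push_cast; rw [mul_add, hA, hm]⟩) (Complex.log Z) (half_pos hε)
      (hnear.mono fun k hk => by rw [Complex.exp_log hZne]; exact (hk Z hZ).2.2)
    refine ⟨L, hL.congr fun k => ?_⟩
    rw [normalized, Complex.exp_log hZne, P.sob_eq_of_mem_M hend hμM, hsob, scale,
      P.fobMax_eq hμM]
    ring
  choose! G hG using hlim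
  have hsph : ∀ θ : ℝ, circleMap Z₀ (ε * ‖Z₀‖) θ ∈ Metric.sphere Z₀ (ε * ‖Z₀‖) := fun θ =>
    circleMap_mem_sphere _ (by positivity) θ
  set ρ := ε * ‖Z₀‖ with hρ
  set F : ℕ → ℝ → ℂ := fun k θ => deriv (circleMap Z₀ ρ) θ * (P.scale sobMin (v k) *
    P.integrand (v k) (P.ppow (v k) μ * circleMap Z₀ ρ θ) / circleMap Z₀ ρ θ) with hF
  have hne : ∀ θ, circleMap Z₀ ρ θ ≠ 0 := fun θ => by
    obtain ⟨k, hk⟩ := hnear.exists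
    exact right_ne_zero_of_mul (hk _ (hsph θ)).1
  have hcm : Continuous (circleMap Z₀ ρ) := continuous_circleMap _ _
  have hcd : Continuous (deriv (circleMap Z₀ ρ)) := by
    have : deriv (circleMap Z₀ ρ) = fun θ => circleMap 0 ρ θ * Complex.I :=
      funext fun θ => deriv_circleMap _ _ _
    rw [this]
    exact (continuous_circleMap _ _).mul continuous_const
  have hmeas : ∀ᶠ k in atTop, MeasureTheory.AEStronglyMeasurable (F k)
      (MeasureTheory.volume.restrict (Set.uIoc 0 (2 * Real.pi))) := by
    filter_upwards [hnear, eventually_norm_p_lt hq hv] with k hk hk2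
    refine Continuous.aestronglyMeasurable (hcd.mul ((continuous_const.mul ?_).div₀ hcm hne))
    refine continuous_iff_continuousAt.2 fun θ => ?_
    obtain ⟨c1, -, c3⟩ := hk _ (hsph θ)
    exact ContinuousAt.comp (f := fun θ => P.ppow (v k) μ * circleMap Z₀ ρ θ)
      (analyticAt_integrand hq hk2 c1 (c3.not_isPole (half_pos hε))).continuousAt
      (continuous_const.mul hcm).continuousAt
  have hbound : ∀ᶠ k in atTop, ∀ᵐ θ ∂MeasureTheory.volume, θ ∈ Set.uIoc 0 (2 * Real.pi) →
      ‖F k θ‖ ≤ ‖deriv (circleMap Z₀ ρ) θ‖ * (C * ‖circleMap Z₀ ρ θ‖⁻¹) := by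
    filter_upwards [hnear, hv.eventually h2, hv.eventually_ge_atTop 0] with k hk hk2 hk0
    refine Eventually.of_forall fun θ _ => ?_
    obtain ⟨c1, c2, c3⟩ := hk _ (hsph θ)
    rw [hF]
    simp only
    rw [norm_mul, norm_div, div_eq_mul_inv]
    have hk0' : (0 : ℝ) ≤ v k := by exact_mod_cast hk0
    have : 0 ≤ Metric.infDist μ P.M₀ := Metric.infDist_nonneg
    have e := hk2 μ hμab _ c1 c2 c3
    have e2 : Real.exp (-(κ * (v k * Metric.infDist μ P.M₀))) ≤ 1 :=
      Real.exp_le_one_iff.2 (by have : 0 ≤ κ * (v k * Metric.infDist μ P.M₀) := by positivity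
                                linarith)
    have e3 := e.trans (mul_le_of_le_one_right hC.le e2)
    gcongr
  have hbint : IntervalIntegrable
      (fun θ => ‖deriv (circleMap Z₀ ρ) θ‖ * (C * ‖circleMap Z₀ ρ θ‖⁻¹))
      MeasureTheory.volume 0 (2 * Real.pi) :=
    (hcd.norm.mul (continuous_const.mul
      (hcm.norm.inv₀ fun θ => norm_ne_zero_iff.2 (hne θ)))).intervalIntegrable _ _
  have hdom := intervalIntegral.tendsto_integral_filter_of_dominated_convergence _ hmeas hbound
    hbint (f := fun θ => deriv (circleMap Z₀ ρ) θ * (G (circleMap Z₀ ρ θ) / circleMap Z₀ ρ θ))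
    (Eventually.of_forall fun θ _ => ((hG _ (hsph θ)).div_const _).const_mul _)
  refine ⟨(2 * (Real.pi : ℂ) * Complex.I)⁻¹ * _, (hdom.const_mul _).congr' ?_⟩
  filter_upwards [hv.eventually (hs.residue_eq hq hε |(n : ℝ)|)] with k hk
  have hp0 := P.ppow_ne_zero (v k) μ
  have hr := hk (hint k) y hy (m k + n) μ hμab (hmn k)
  rw [← hpt k] at hr
  rw [hr, norm_mul, mul_left_comm ε, circleIntegral_mul_left, circleIntegral,
    mul_left_comm (P.scale sobMin (v k))]
  congr 1
  rw [← intervalIntegral.integral_const_mul]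
  refine intervalIntegral.integral_congr (E := ℂ) fun θ _ => ?_
  simp only [smul_eq_mul, hF, ← hρ]
  have := hne θ
  field_simp

end Data

/-! ### Sums that concentrate near finitely many moving points -/

lemma summable_exp_neg_abs {κ : ℝ} (hκ : 0 < κ) :
    Summable fun n : ℤ => Real.exp (-(κ * |(n : ℝ)|)) := by
  have h : Summable fun n : ℕ => Real.exp (-(κ * n)) := by
    have := summable_geometric_of_lt_one (Real.exp_pos (-κ)).le
      (Real.exp_lt_one_iff.2 (neg_lt_zero.2 hκ))
    refine this.congr fun n => ?_
    rw [← Real.exp_nat_mul]; congr 1; ring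
  refine Summable.of_nat_of_neg ?_ ?_ <;> simpa using h

/-- Dominated convergence for sums over `ℤ` whose terms are concentrated near the points `v μ`. -/
theorem tendsto_tsum_of_concentrated {T : Finset ℝ} (hT : T.Nonempty) {v : ℕ → ℝ}
    (hv : Tendsto v atTop atTop) (N : ℝ → ℕ → ℤ) (hN : ∀ μ ∈ T, ∀ k, v k * μ = N μ k)
    {F : ℕ → ℤ → ℂ} {G : ℝ → ℤ → ℂ} {κ C : ℝ} (hκ : 0 < κ)
    (hF : ∀ᶠ k in atTop, ∀ m : ℤ,
      ‖F k m‖ ≤ C * Real.exp (-(κ * (v k * Metric.infDist ((m : ℝ) / v k) T))))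
    (hG : ∀ μ ∈ T, ∀ n : ℤ, Tendsto (fun k => F k (N μ k + n)) atTop (𝓝 (G μ n))) :
    (∀ μ ∈ T, Summable (G μ)) ∧
      Tendsto (fun k => ∑' m, F k m) atTop (𝓝 (∑ μ ∈ T, ∑' n, G μ n)) := by
  classical
  have hnear : ∀ k (m : ℤ), ∃ ν ∈ T, Metric.infDist ((m : ℝ) / v k) T = dist ((m : ℝ) / v k) ν :=
    fun k m => T.finite_toSet.isCompact.exists_infDist_eq_dist hT _
  choose ν hνT hν using hnear
  have hdist : ∀ μ ∈ T, ∀ k, 0 < v k → ∀ n : ℤ,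
      v k * dist (((N μ k + n : ℤ) : ℝ) / v k) μ = |(n : ℝ)| := by
    intro μ hμ k hk n
    rw [Real.dist_eq, ← abs_of_pos hk, ← abs_mul, abs_of_pos hk, mul_sub, mul_div_cancel₀ _ hk.ne',
      hN μ hμ k]
    push_cast; rw [add_sub_cancel_left]
  -- Each m is assigned to a point of T nearest to m/v. This splits the sum into disjoint pieces,
  -- one for each μ, dominated by a multiple of exp(-κ|n|) after recentring at vμ.
  set F' : ℝ → ℕ → ℤ → ℂ := fun μ k n => if ν k (N μ k + n) = μ then F k (N μ k + n) else 0 with hF'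
  have hC : 0 ≤ C := by
    obtain ⟨k, hk⟩ := hF.exists
    exact nonneg_of_mul_nonneg_left ((norm_nonneg _).trans (hk 0)) (Real.exp_pos _)
  have hF'le : ∀ᶠ k in atTop, ∀ μ ∈ T, ∀ n, ‖F' μ k n‖ ≤ C * Real.exp (-(κ * |(n : ℝ)|)) := by
    filter_upwards [hF, hv.eventually_gt_atTop 0] with k hk hk0 μ hμ n
    simp only [hF']
    split_ifs with h
    · refine (hk _).trans_eq ?_
      rw [hν, h, hdist μ hμ k hk0]
    · rw [norm_zero]; positivity
  have hF'lim : ∀ μ ∈ T, ∀ n, Tendsto (fun k => F' μ k n) atTop (𝓝 (G μ n)) := by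
    intro μ hμ n
    refine (hG μ hμ n).congr' ?_
    -- Here δ is at most the gap between μ and the rest of T. Once 2|n|/v < δ, the nearest point to
    -- μ + n/v is μ itself, so fixed n eventually belongs to the piece of μ.
    obtain ⟨δ, hδ, h⟩ := exists_pos_le (T.erase μ) (fun μ' => dist μ μ') fun μ' h' =>
      dist_pos.2 (Finset.ne_of_mem_erase h').symm
    filter_upwards [hv.eventually_gt_atTop 0, hv.eventually_gt_atTop (2 * |(n : ℝ)| / δ)]
      with k hk0 hk
    simp only [hF']
    rw [if_pos]
    by_contra hne
    have h1 := h _ (Finset.mem_erase.2 ⟨hne, hνT k (N μ k + n)⟩)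
    have h2 : dist (((N μ k + n : ℤ) : ℝ) / v k) (ν k (N μ k + n)) ≤
        dist (((N μ k + n : ℤ) : ℝ) / v k) μ := by
      rw [← hν]; exact Metric.infDist_le_dist_of_mem hμ
    have h3 := dist_triangle_left μ (ν k (N μ k + n)) (((N μ k + n : ℤ) : ℝ) / v k)
    have h4 := hdist μ hμ k hk0 n
    rw [div_lt_iff₀ hδ] at hk
    have h5 : v k * δ ≤ v k * (2 * dist (((N μ k + n : ℤ) : ℝ) / v k) μ) := by
      gcongr; linarith
    linarith
  have hsum : Summable fun n : ℤ => C * Real.exp (-(κ * |(n : ℝ)|)) :=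
    (summable_exp_neg_abs hκ).mul_left C
  refine ⟨fun μ hμ => Summable.of_norm_bounded hsum fun n =>
    le_of_tendsto (hF'lim μ hμ n).norm (hF'le.mono fun k hk => hk μ hμ n), ?_⟩
  have hlim := tendsto_finsetSum T fun μ hμ =>
    tendsto_tsum_of_dominated_convergence hsum (hF'lim μ hμ) (hF'le.mono fun k hk => hk μ hμ)
  refine hlim.congr' ?_
  filter_upwards [hF'le] with k hk
  have e1 : ∀ μ ∈ T, Summable (F' μ k) := fun μ hμ => Summable.of_norm_bounded hsum (hk μ hμ)
  have e2 : ∀ μ, F' μ k = (fun m => if ν k m = μ then F k m else 0) ∘ Equiv.addLeft (N μ k) :=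
    fun μ => rfl
  have e3 : ∀ μ ∈ T, Summable fun m => if ν k m = μ then F k m else 0 := fun μ hμ =>
    (Equiv.addLeft (N μ k)).summable_iff.1 (by rw [← e2]; exact e1 μ hμ)
  calc ∑ μ ∈ T, ∑' n, F' μ k n = ∑ μ ∈ T, ∑' m, (if ν k m = μ then F k m else 0) :=
        Finset.sum_congr rfl fun μ _ => 
          (Equiv.addLeft (N μ k)).tsum_eq fun m => if ν k m = μ then F k m else 0
    _ = ∑' m, ∑ μ ∈ T, (if ν k m = μ then F k m else 0) := (Summable.tsum_finsetSum e3).symm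
    _ = ∑' m, F k m := tsum_congr fun m => by
        rw [Finset.sum_ite_eq, if_pos (hνT k m)]

lemma zpow_injective {q : ℂ} (hq : ‖q‖ < 1) (hq0 : q ≠ 0) : Function.Injective fun m : ℤ => q ^ m := by
  intro m m' h
  have h' : ‖q‖ ^ m = ‖q‖ ^ m' := by rw [← norm_zpow, ← norm_zpow]; exact congrArg _ h
  exact (zpow_right_strictAnti₀ (norm_pos_iff.2 hq0) hq).injective h'

/-- A finite sum over a union of disjoint pieces of geometric progressions. -/
lemma finsum_progressions {q : ℂ} (hq : ‖q‖ < 1) (hq0 : q ≠ 0) {ι : Type*} (X : Finset ι)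
    (A : ι → ℂ) (T : ι → Set ℤ) (hA : ∀ x ∈ X, A x ≠ 0)
    (hdisj : ∀ x ∈ X, ∀ x' ∈ X, x ≠ x' → ∀ m m' : ℤ, A x * q ^ m ≠ A x' * q ^ m')
    {S : Set ℂ} (hS : S = {w | ∃ x ∈ X, ∃ m ∈ T x, w = A x * q ^ m}) (hfin : S.Finite)
    (f : ℂ → ℂ) :
    ∑ᶠ w ∈ S, f w = ∑ x ∈ X, ∑' m, (T x).indicator (fun m => f (A x * q ^ m)) m := by
  have hinj : ∀ x ∈ X, Function.Injective fun m : ℤ => A x * q ^ m := fun x hx m m' h =>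
    zpow_injective hq hq0 (mul_left_cancel₀ (hA x hx) h)
  have hS' : S = ⋃ x ∈ (X : Set ι), (fun m : ℤ => A x * q ^ m) '' T x := by
    rw [hS]; ext w
    simp only [Set.mem_ofPred_eq, Set.mem_iUnion, Set.mem_image, Finset.mem_coe, exists_prop, eq_comm]
  have hfinx : ∀ x ∈ X, (T x).Finite := fun x hx => by
    refine Set.Finite.of_finite_image (hfin.subset ?_) (hinj x hx).injOn
    rw [hS']; exact Set.subset_biUnion_of_mem (u := fun x => (fun m : ℤ => A x * q ^ m) '' T x) hx
  rw [hS', finsum_mem_biUnion ?_ X.finite_toSet fun x hx => (hfinx x hx).image _,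
    finsum_mem_coe_finset]
  · refine Finset.sum_congr rfl fun x hx => ?_
    rw [finsum_mem_image (hinj x hx).injOn, finsum_mem_def, tsum_eq_finsum]
    exact (hfinx x hx).subset Set.support_indicator_subset
  · intro x hx x' hx' hne
    refine Set.disjoint_left.2 ?_
    rintro w ⟨m, -, rfl⟩ ⟨m', -, h⟩
    exact hdisj x hx x' hx' hne m m' h.symm

/-! ### The poles of the integrand and the residue theorem. -/

namespace Data

variable (P : Data)

/-- The poles `p^{-α_r - l} q^{-k} / t_r`. -/
def outerPoles (v : ℤ) : Set ℂ :=
  {w | ∃ r, ∃ l k : ℕ, w = (P.ppow v (P.α r + l) * P.q ^ k * P.t r)⁻¹}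

/-- The poles `p^{β_r + l} q^k u_r`. -/
def innerPoles (v : ℤ) : Set ℂ :=
  {w | ∃ r, ∃ l k : ℕ, w = P.ppow v (P.β r + l) * P.q ^ k * P.u r}

lemma isPole_iff {v : ℤ} {w : ℂ} (hw : w ≠ 0) :
    P.IsPole v w ↔ w ∈ P.outerPoles v ∨ w ∈ P.innerPoles v := by
  have e1 : ∀ r, ∀ j k : ℕ, P.ppow v (P.α r) * P.t r * w * P.p v ^ j * P.q ^ k = 1 ↔
      w = (P.ppow v (P.α r + j) * P.q ^ k * P.t r)⁻¹ := by
    intro r j k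
    have h0 : P.ppow v (P.α r + j) * P.q ^ k * P.t r ≠ 0 := mul_ne_zero
      (mul_ne_zero (P.ppow_ne_zero _ _) (pow_ne_zero _ P.q_ne_zero)) (t_ne_zero r)
    rw [← mul_eq_one_iff_eq_inv₀ h0, ppow_add, ← p_pow]
    constructor <;> intro h <;> rw [← h] <;> ring
  have e2 : ∀ r, ∀ j k : ℕ, P.ppow v (P.β r) * P.u r / w * P.p v ^ j * P.q ^ k = 1 ↔
      w = P.ppow v (P.β r + j) * P.q ^ k * P.u r := by
    intro r j k
    rw [ppow_add, ← p_pow, div_mul_eq_mul_div, div_mul_eq_mul_div, div_eq_one_iff_eq hw]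
    constructor <;> intro h <;> [rw [← h]; rw [h]] <;> ring
  simp only [IsPole, outerPoles, innerPoles, Set.mem_ofPred_eq, e1, e2]

variable {P}

lemma finite_norm_ge {p q : ℂ} (hp : ‖p‖ < 1) (hq : ‖q‖ < 1) (y : ℂ) {r : ℝ} (hr : 0 < r) :
    {x : ℕ × ℕ | r ≤ ‖y * p ^ x.1 * q ^ x.2‖}.Finite := by
  have := (hasSum_pqSymbol y hp hq).summable.tendsto_cofinite_zero.eventually_lt_const hr
  have h2 : {x : ℕ × ℕ | ¬ ‖y * p ^ x.1 * q ^ x.2‖ < r}.Finite := this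
  simpa only [not_lt] using h2

lemma finite_outerPoles (hq : P.logq.re < 0) {v : ℤ} (hv : ‖P.p v‖ < ‖P.q‖) {R : ℝ} (hR : 0 < R) :
    {w ∈ P.outerPoles v | ‖w‖ < R}.Finite := by
  have hq1 := P.norm_q_lt_one hq
  have hfin := Set.finite_iUnion fun r : Fin P.nα =>
    (finite_norm_ge (hv.trans hq1) hq1 (P.ppow v (P.α r) * P.t r) (inv_pos.2 hR)).image
      fun x : ℕ × ℕ => (P.ppow v (P.α r + x.1) * P.q ^ x.2 * P.t r)⁻¹
  refine hfin.subset ?_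
  rintro w ⟨⟨r, l, k, rfl⟩, hw⟩
  refine Set.mem_iUnion.2 ⟨r, (l, k), ?_, rfl⟩
  have hpos : 0 < ‖P.ppow v (P.α r + l) * P.q ^ k * P.t r‖ := norm_pos_iff.2 (mul_ne_zero
      (mul_ne_zero (P.ppow_ne_zero _ _) (pow_ne_zero _ P.q_ne_zero)) (t_ne_zero r))
  rw [norm_inv] at hw
  have := (inv_lt_comm₀ hpos hR).1 hw
  rw [ppow_add, ← p_pow] at this
  refine this.le.trans_eq ?_
  congr 1; ring

lemma finite_innerPoles (hq : P.logq.re < 0) {v : ℤ} (hv : ‖P.p v‖ < ‖P.q‖) {R : ℝ} (hR : 0 < R) :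
    {w ∈ P.innerPoles v | R < ‖w‖}.Finite := by
  have hq1 := P.norm_q_lt_one hq
  have hfin := Set.finite_iUnion fun r : Fin P.nβ =>
    (finite_norm_ge (hv.trans hq1) hq1 (P.ppow v (P.β r) * P.u r) hR).image
      fun x : ℕ × ℕ => P.ppow v (P.β r + x.1) * P.q ^ x.2 * P.u r
  refine hfin.subset ?_
  rintro w ⟨⟨r, l, k, rfl⟩, hw⟩
  refine Set.mem_iUnion.2 ⟨r, (l, k), ?_, rfl⟩
  rw [ppow_add, ← p_pow] at hw
  refine hw.le.trans_eq ?_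
  congr 1; ring

lemma ne_zero_of_mem_outerPoles {v : ℤ} {w : ℂ} (h : w ∈ P.outerPoles v) : w ≠ 0 := by
  obtain ⟨r, l, k, rfl⟩ := h
  exact inv_ne_zero (mul_ne_zero
      (mul_ne_zero (P.ppow_ne_zero _ _) (pow_ne_zero _ P.q_ne_zero)) (t_ne_zero r))

/-- The residue theorem for the integrand. -/
theorem integral_eq (hq : P.logq.re < 0) {v : ℤ} (hv : ‖P.p v‖ < ‖P.q‖) {c : ℝ → ℂ}
    (hc : P.IsContour v c) {ρ : ℝ} (hρ : 0 < ρ) (hρpole : ∀ w, ‖w‖ = ρ → ¬P.IsPole v w) :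
    P.integral v c =
      (2 * (Real.pi : ℂ) * Complex.I)⁻¹ * (∮ z in C(0, ρ), P.integrand v z / z) +
      ∑ᶠ w ∈ {w ∈ P.innerPoles v | ρ < ‖w‖}, residue (fun z => P.integrand v z / z) w -
      ∑ᶠ w ∈ {w ∈ P.outerPoles v | ‖w‖ < ρ}, residue (fun z => P.integrand v z / z) w := by
  classical
  set F : ℂ → ℂ := fun z => P.integrand v z / z with hF
  have hcompact : IsCompact ((fun τ => ‖c τ‖) '' Set.Icc (0 : ℝ) 1) :=
    isCompact_Icc.image_of_continuousOn hc.isClosedCurve.continuousOn.norm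
  obtain ⟨r₁, hr₁, hr₁'⟩ : ∃ r₁ > 0, ∀ τ ∈ Set.Icc (0 : ℝ) 1, r₁ < ‖c τ‖ := by
    obtain ⟨τ₀, h1, h2⟩ := isCompact_Icc.exists_isMinOn (Set.nonempty_Icc.2 zero_le_one)
      hc.isClosedCurve.continuousOn.norm
    have h3 : 0 < ‖c τ₀‖ := norm_pos_iff.2 (hc.avoids_zero τ₀ h1)
    exact ⟨‖c τ₀‖ / 2, by positivity, fun τ hτ => (half_lt_self h3).trans_le (h2 hτ)⟩
  obtain ⟨R₁, hR₁⟩ := hcompact.bddAbove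
  have hR₁' : ∀ τ ∈ Set.Icc (0 : ℝ) 1, ‖c τ‖ ≤ R₁ := fun τ hτ => hR₁ ⟨τ, hτ, rfl⟩
  have hIn := finite_innerPoles hq hv hρ
  have hOut := finite_outerPoles hq hv hρ
  obtain ⟨R₂, hR₂⟩ := (hIn.image fun w => ‖w‖).bddAbove
  obtain ⟨r₂, hr₂, hr₂'⟩ := exists_pos_le hOut.toFinset (fun w => ‖w‖) fun w hw =>
    norm_pos_iff.2 (ne_zero_of_mem_outerPoles ((hOut.mem_toFinset.1 hw).1))
  set r := min (min r₁ r₂) ρ / 2 with hr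
  set R := max (max R₁ R₂) ρ + 1 with hR
  have hmin : 0 < min (min r₁ r₂) ρ := lt_min (lt_min hr₁ hr₂) hρ
  have hr0 : 0 < r := by rw [hr]; positivity
  have hrm : r < min (min r₁ r₂) ρ := half_lt_self hmin
  have hRm : max (max R₁ R₂) ρ < R := lt_add_one _
  have hR0 : 0 < R := hρ.trans ((le_max_right _ _).trans_lt hRm)
  have hfinS : ({w ∈ P.outerPoles v | ‖w‖ < R} ∪ {w ∈ P.innerPoles v | r < ‖w‖}).Finite :=
    (finite_outerPoles hq hv hR0).union (finite_innerPoles hq hv hr0)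
  obtain ⟨S, hS⟩ : ∃ S : Finset ℂ, ∀ w, w ∈ S ↔
      (w ∈ P.outerPoles v ∨ w ∈ P.innerPoles v) ∧ r < ‖w‖ ∧ ‖w‖ < R := by
    refine ⟨hfinS.toFinset.filter fun w => r < ‖w‖ ∧ ‖w‖ < R, fun w => ?_⟩
    simp only [Finset.mem_filter, Set.Finite.mem_toFinset, Set.mem_union, Set.mem_ofPred_eq]
    tauto
  have hne : ∀ z : ℂ, r < ‖z‖ → z ≠ 0 := fun z hz => norm_pos_iff.1 (hr0.trans hz)
  have key := curveIntegral_eq_circleIntegral_add_sum hr0 (hrm.trans_le (min_le_right _ _))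
    ((le_max_right _ _).trans_lt hRm) S (F := F)
    (fun z h1 h2 h3 => differentiableAt_integrand_div hq hv (hne z h1) fun hp =>
      h3 ((hS z).2 ⟨(P.isPole_iff (hne z h1)).1 hp, h1, h2⟩))
    (fun z hz => by
      obtain ⟨h1, h2, h3⟩ := (hS z).1 hz
      exact ⟨h2, h3, fun he => hρpole z he ((P.isPole_iff (hne z h2)).2 h1),
        (meromorphicAt_integrand hq hv (hne z h2)).fun_div (MeromorphicAt.id z)⟩)
    hc.isClosedCurve
    (fun τ hτ => ⟨hrm.trans ((min_le_left _ _).trans_lt ((min_le_left _ _).trans_lt (hr₁' τ hτ))),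
      ((hR₁' τ hτ).trans ((le_max_left _ _).trans (le_max_left _ _))).trans_lt hRm, fun hm => by
      rcases ((hS _).1 hm).1 with ⟨r, l, k, h⟩ | ⟨r, l, k, h⟩
      · exact hc.avoids_outer r k l τ hτ h
      · exact hc.avoids_inner r k l τ hτ h⟩) hc.winding_zero
  have hwo : ∀ w ∈ P.outerPoles v, winding c w = 0 := by
    rintro w ⟨r, l, k, rfl⟩; exact hc.winding_outer r k l
  have hwi : ∀ w ∈ P.innerPoles v, winding c w = 1 := by
    rintro w ⟨r, l, k, rfl⟩; exact hc.winding_inner r k l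
  rw [integral, key, add_sub_assoc]
  congr 1
  rw [finsum_mem_eq_finite_toFinset_sum _ hIn, finsum_mem_eq_finite_toFinset_sum _ hOut]
  have e1 : hIn.toFinset = S.filter fun w => w ∈ P.innerPoles v ∧ ρ < ‖w‖ := by
    ext w
    simp only [Set.Finite.mem_toFinset, Set.mem_ofPred_eq, Finset.mem_filter, hS]
    refine ⟨fun h => ⟨⟨Or.inr h.1, ?_, ?_⟩, h⟩, fun h => h.2⟩
    · exact (hrm.trans_le (min_le_right _ _)).trans h.2
    · exact (hR₂ ⟨w, h, rfl⟩).trans_lt (((le_max_right _ _).trans (le_max_left _ _)).trans_lt hRm)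
  have e2 : hOut.toFinset = S.filter fun w => w ∈ P.outerPoles v ∧ ‖w‖ < ρ := by
    ext w
    constructor
    · intro h
      have h' := hOut.mem_toFinset.1 h
      refine Finset.mem_filter.2 ⟨(hS w).2 ⟨Or.inl h'.1, ?_, ?_⟩, h'⟩
      · exact hrm.trans_le (((min_le_left _ _).trans (min_le_right _ _)).trans (hr₂' w h))
      · exact h'.2.trans ((le_max_right _ _).trans_lt hRm)
    · intro h
      exact hOut.mem_toFinset.2 (Finset.mem_filter.1 h).2
  rw [e1, e2, Finset.sum_filter, Finset.sum_filter, ← Finset.sum_sub_distrib]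
  refine Finset.sum_congr rfl fun w hw => ?_
  obtain ⟨h1, h2, h3⟩ := (hS w).1 hw
  have hwρ : ‖w‖ ≠ ρ := fun he => hρpole w he ((P.isPole_iff (hne w h2)).2 h1)
  -- The winding number of the contour is 0 at outer and 1 at inner poles, so no point can be both.
  by_cases ho : w ∈ P.outerPoles v
  · have hi : w ∉ P.innerPoles v := fun hi => by
      have := (hwo w ho).symm.trans (hwi w hi)
      exact zero_ne_one this
    simp only [hwo w ho, ho, hi, true_and, false_and, if_false]
    split_ifs <;> ring
  · have hi : w ∈ P.innerPoles v := h1.resolve_left ho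
    simp only [hwi w hi, ho, hi, true_and, false_and, if_false]
    rcases lt_or_gt_of_ne hwρ with h | h
    · rw [if_pos h, if_neg (not_lt.2 h.le)]; ring
    · rw [if_pos h, if_neg (not_lt.2 h.le)]; ring

end Data

namespace Data

/-! ### The decay interval and the separating circle -/

variable {P : Data}

lemma isDecayInterval_interval (hend : P.CriticalEnds) {μ : ℝ} (hμ : μ ∈ P.M₀) :
    P.IsDecayInterval (P.logSob μ) P.mMinus P.mPlus where
  fob_le _ hζ := P.fob_le_fobMax hζ
  sobExp_eq _ hζ h := P.sobExp_eq_zero hend (P.mem_M_iff.2 ⟨hζ, h⟩)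
  le_logSob _ hζ h := P.logSob_le_of_mem_M₀ hμ (P.mem_M_iff.2 ⟨hζ, h⟩)
  mem_M₀ _ hζ h h' := P.mem_M₀_of_le hμ (P.mem_M_iff.2 ⟨hζ, h⟩) h'

/-- If m_- = 0 belongs to M₀, the separating circle must lie to the left of 0, outside [m_-, m_+].
The assumption on a left neighbourhood of 0 extends the decay there. -/
lemma exists_isDecayInterval_left (hend : P.CriticalEnds) (hm : P.mMinus = 0) (h0 : (0 : ℝ) ∈ P.M₀)
    (hleft : ∀ᶠ ζ in 𝓝[<] (0 : ℝ),
      P.fob ζ < P.fob 0 ∨ P.fob ζ = P.fob 0 ∧ ‖P.sob 0 0‖ < ‖P.sob ζ 0‖) :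
    ∃ δ > 0, P.IsDecayInterval (P.logSob 0) (-δ) P.mPlus := by
  obtain ⟨η, hη, h⟩ := mem_nhdsLT_iff_exists_Ioo_subset.1 hleft
  have hη0 : η < 0 := hη
  have hmax : P.fobMax = P.fob 0 := P.fobMax_eq (P.M₀_subset_M h0)
  have hint := isDecayInterval_interval hend h0
  rw [hm, Rat.cast_zero] at hint
  have hneg : ∀ ζ ∈ Set.Icc (-(-η / 2)) (P.mPlus : ℝ), ζ < 0 → ζ ∈ Set.Ioo η 0 := fun ζ hζ h0 =>
    ⟨by linarith [hζ.1], h0⟩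
  refine ⟨-η / 2, by linarith, ⟨fun ζ hζ => ?_, fun ζ hζ he => ?_, fun ζ hζ he => ?_,
    fun ζ hζ he hle => ?_⟩⟩ <;> rcases le_or_gt 0 ζ with h1 | h1
  · exact hint.fob_le ζ ⟨h1, hζ.2⟩
  · rw [hmax]
    rcases h (hneg ζ hζ h1) with h2 | h2
    · exact h2.le
    · exact h2.1.le
  · exact hint.sobExp_eq ζ ⟨h1, hζ.2⟩ he
  -- To the left of 0 membership in M is not available. But `fob` does not exceed its value at 0 on
  -- the whole neighbourhood, so reaching the maximum at ζ makes ζ a local maximum.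
  · have hloc : IsLocalMax P.fob ζ := by
      filter_upwards [Ioo_mem_nhds (hneg ζ hζ h1).1 h1] with ξ hξ
      rw [he, hmax]
      rcases h hξ with h2 | h2
      · exact h2.le
      · exact h2.1.le
    have := hloc.hasDerivAt_eq_zero (P.hasDerivAt_fob ζ)
    linarith
  · exact hint.le_logSob ζ ⟨h1, hζ.2⟩ he
  · rcases h (hneg ζ hζ h1) with h2 | h2
    · rw [he, hmax] at h2; exact absurd h2 (lt_irrefl _)
    · have := h2.2
      rw [norm_sob_zero, norm_sob_zero] at this
      exact (Real.exp_lt_exp.1 this).le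
  · exact hint.mem_M₀ ζ ⟨h1, hζ.2⟩ he hle
  · rcases h (hneg ζ hζ h1) with h2 | h2
    · rw [he, hmax] at h2; exact absurd h2 (lt_irrefl _)
    · have := h2.2
      rw [norm_sob_zero, norm_sob_zero] at this
      exact absurd (Real.exp_lt_exp.1 this) (not_lt.2 hle)

/-- A position for the circle `|w| ≍ |q|^(ζ₀ v)` which separates the negative from the non-negative
elements of `M₀`. -/
lemma exists_separatingExponent (hend : P.CriticalEnds) (hfin : P.M₀.Finite)
    (hleft : P.mMinus = 0 → (0 : ℝ) ∈ P.M₀ → ∀ᶠ ζ in 𝓝[<] (0 : ℝ),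
      P.fob ζ < P.fob 0 ∨ P.fob ζ = P.fob 0 ∧ ‖P.sob 0 0‖ < ‖P.sob ζ 0‖) {η : ℝ} (hη : 0 < η) :
    ∃ Lmin a ζ₀ : ℝ, P.IsDecayInterval Lmin a P.mPlus ∧ (∀ μ ∈ P.M₀, Lmin = P.logSob μ) ∧
      a ≤ P.mMinus ∧ a ≤ ζ₀ ∧ ζ₀ ≤ 0 ∧ -η < ζ₀ ∧ ∀ μ ∈ P.M₀, 0 ≤ μ ∧ ζ₀ < μ ∨ μ < 0 ∧ μ < ζ₀ := by
  obtain ⟨μ₀, hμ₀⟩ := P.M₀_nonempty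
  have hL : ∀ μ ∈ P.M₀, P.logSob μ₀ = P.logSob μ := fun μ hμ =>
    le_antisymm (P.logSob_le_of_mem_M₀ hμ₀ (P.M₀_subset_M hμ))
      (P.logSob_le_of_mem_M₀ hμ (P.M₀_subset_M hμ₀))
  have hM : ∀ μ ∈ P.M₀, (P.mMinus : ℝ) ≤ μ := fun μ hμ => (P.M₀_subset_M hμ).1.1
  have hm0 : (P.mMinus : ℝ) ≤ 0 := by exact_mod_cast P.mMinus_le_zero
  have hmain : ∀ δ > 0, ∀ a ≤ (P.mMinus : ℝ), a ≤ -δ → P.IsDecayInterval (P.logSob μ₀) a P.mPlus →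
      ∃ Lmin a ζ₀ : ℝ, P.IsDecayInterval Lmin a P.mPlus ∧ (∀ μ ∈ P.M₀, Lmin = P.logSob μ) ∧
        a ≤ P.mMinus ∧ a ≤ ζ₀ ∧ ζ₀ ≤ 0 ∧ -η < ζ₀ ∧
          ∀ μ ∈ P.M₀, 0 ≤ μ ∧ ζ₀ < μ ∨ μ < 0 ∧ μ < ζ₀ := by
    intro δ hδ a ha haδ hd
    classical
    obtain ⟨ε, hε, hsep⟩ := exists_pos_le (hfin.toFinset.filter fun μ => μ < 0) (fun μ => -μ)
      fun μ hμ => neg_pos.2 (Finset.mem_filter.1 hμ).2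
    -- The exponent -ε' stays inside the decay interval, above -η, and above all negative elements
    -- of M₀.
    set ε' := min δ (min η ε / 2) with hε'
    have hpos : 0 < min η ε := lt_min hη hε
    have hε'0 : 0 < ε' := lt_min hδ (half_pos hpos)
    have h1 : ε' ≤ δ := min_le_left _ _
    have h2 : ε' < min η ε := (min_le_right _ _).trans_lt (half_lt_self hpos)
    refine ⟨P.logSob μ₀, a, -ε', hd, hL, ha, by linarith, by linarith,
      by linarith [h2.trans_le (min_le_left η ε)], fun μ hμ => ?_⟩
    rcases le_or_gt 0 μ with h | h
    · exact Or.inl ⟨h, by linarith⟩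
    · right
      have := hsep μ (Finset.mem_filter.2 ⟨hfin.mem_toFinset.2 hμ, h⟩)
      exact ⟨h, by linarith [h2.trans_le (min_le_right η ε)]⟩
  rcases hm0.lt_or_eq with hm | hm
  · exact hmain (-P.mMinus) (by linarith) P.mMinus le_rfl (by simp)
      (isDecayInterval_interval hend hμ₀)
  · by_cases h0 : (0 : ℝ) ∈ P.M₀
    · have hm' : P.mMinus = 0 := by exact_mod_cast hm
      obtain ⟨δ, hδ, hd⟩ := exists_isDecayInterval_left hend hm' h0 (hleft hm' h0)
      rw [← hL 0 h0] at hd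
      exact hmain δ hδ (-δ) (by rw [hm]; linarith) le_rfl hd
    -- Here m_- = 0 is not in M₀, so all minimizers are positive and the exponent 0 separates.
    · refine ⟨P.logSob μ₀, P.mMinus, 0, isDecayInterval_interval hend hμ₀, hL, le_rfl, hm.le, le_rfl,
        by linarith, fun μ hμ => Or.inl ?_⟩
      have h1 : 0 < μ := lt_of_le_of_ne (by rw [← hm]; exact hM μ hμ) fun h => h0 (h ▸ hμ)
      exact ⟨h1.le, h1⟩

variable (P) in
/-- The radius `c |q|^(-j)` of the separating circle, `j = ⌊-ζ₀ v⌋`. -/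
def radius (c ζ₀ : ℝ) (v : ℤ) : ℝ := c * Real.exp (-(⌊-ζ₀ * v⌋₊ * P.logq.re))

lemma radius_pos {c : ℝ} (hc : 0 < c) (ζ₀ : ℝ) (v : ℤ) : 0 < P.radius c ζ₀ v :=
  mul_pos hc (Real.exp_pos _)

lemma log_radius {c : ℝ} (hc : 0 < c) (ζ₀ : ℝ) (v : ℤ) :
    Real.log (P.radius c ζ₀ v) = Real.log c - ⌊-ζ₀ * v⌋₊ * P.logq.re := by
  rw [radius, Real.log_mul hc.ne' (Real.exp_pos _).ne', Real.log_exp]; ring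

lemma le_log_radius (hq : P.logq.re < 0) {c : ℝ} (hc : 0 < c) (ζ₀ : ℝ) (v : ℤ) :
    Real.log c + (ζ₀ * v + 1) * P.logq.re ≤ Real.log (P.radius c ζ₀ v) := by
  rw [log_radius hc]
  have := Nat.lt_floor_add_one (-ζ₀ * (v : ℝ))
  nlinarith

lemma log_radius_le (hq : P.logq.re < 0) {c : ℝ} (hc : 0 < c) {ζ₀ : ℝ} (hζ₀ : ζ₀ ≤ 0) {v : ℤ}
    (hv : 0 ≤ v) : Real.log (P.radius c ζ₀ v) ≤ Real.log c + ζ₀ * v * P.logq.re := by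
  rw [log_radius hc]
  have hv' : (0 : ℝ) ≤ v := by exact_mod_cast hv
  have := Nat.floor_le (show 0 ≤ -ζ₀ * (v : ℝ) from mul_nonneg (by linarith) hv')
  nlinarith

/-- The separating radii are c times integral powers of |q|, so their ratios to the moduli |y q^m|
form a set independent of v. It suffices that c avoids a countable set. -/
lemma exists_generic_radius (hq : P.logq.re < 0) (Y : Finset ℂ) (hY : ∀ y ∈ Y, y ≠ 0) (c₀ : ℝ) :
    ∃ c > c₀, ∃ ε > 0, ε ≤ 1 / 2 ∧ ∀ y ∈ Y, ∀ n : ℤ, ε ≤ |1 - c / ‖y‖ * ‖P.q‖ ^ n| := by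
  have hqn : 0 < ‖P.q‖ := norm_pos_iff.2 P.q_ne_zero
  have hcount : (⋃ y ∈ Y, Set.range fun n : ℤ => ‖y‖ * ‖P.q‖ ^ n).Countable :=
    Set.Countable.biUnion Y.countable_toSet fun y _ => Set.countable_range _
  obtain ⟨c, hc, hc'⟩ := (hcount.dense_compl ℝ).exists_mem_open isOpen_Ioi
    (Set.nonempty_Ioi (a := c₀))
  have hc'0 : c₀ < c := hc'
  refine ⟨c, hc', ?_⟩
  choose f hf hf' using fun y : ℂ => exists_le_norm_one_sub_mul_zpow (q := ((‖P.q‖ : ℝ) : ℂ))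
    (by rw [Complex.norm_real, norm_norm]; exact P.norm_q_lt_one hq)
    (by exact_mod_cast hqn.ne') (((c / ‖y‖ : ℝ) : ℂ))
  obtain ⟨ε, hε, h⟩ := exists_pos_le Y f fun y _ => hf y
  refine ⟨min ε (1 / 2), lt_min hε (by norm_num), min_le_right _ _, fun y hy n => ?_⟩
  have hy0 : 0 < ‖y‖ := norm_pos_iff.2 (hY y hy)
  refine (min_le_left _ _).trans ((h y hy).trans ?_)
  have e : ‖(1 : ℂ) - ((c / ‖y‖ : ℝ) : ℂ) * ((‖P.q‖ : ℝ) : ℂ) ^ n‖ =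
      |1 - c / ‖y‖ * ‖P.q‖ ^ n| := by
    rw [← Real.norm_eq_abs, ← Complex.norm_real]; push_cast; rfl
  rcases hf' y n with h1 | h1
  · exfalso
    refine hc (Set.mem_biUnion hy ⟨-n, ?_⟩)
    have h2 : c / ‖y‖ * ‖P.q‖ ^ n = 1 := by exact_mod_cast h1
    have : ‖P.q‖ ^ n ≠ 0 := zpow_ne_zero _ hqn.ne'
    simp only [zpow_neg]
    field_simp at h2 ⊢
    linarith
  · rw [← e]; exact h1

/-- The separating circle keeps a fixed relative distance from all poles. -/
lemma exists_awayFromPoles_circle (hq : P.logq.re < 0) {a b ζ₀ : ℝ} (hζ : ζ₀ ∈ Set.Icc a b)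
    (hζ₀ : ζ₀ ≤ 0) (c₀ : ℝ) (hc₀ : 0 < c₀) : ∃ c > c₀, ∃ ε > 0, ∃ K : ℝ,
      ∀ᶠ v : ℤ in atTop, P.IntegralAt v → ∀ w, ‖w‖ = P.radius c ζ₀ v →
        w ≠ 0 ∧ |Real.log ‖w‖ - ζ₀ * v * P.logq.re| ≤ K ∧ P.AwayFromPoles v ε w := by
  obtain ⟨N, h⟩ := exists_awayFromPoles hq a b
  obtain ⟨c, hc, ε, hε, hε2, hsep⟩ := exists_generic_radius hq (P.bases N)
    (fun y hy => P.ne_zero_of_mem_bases hy) c₀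
  have hc0 : 0 < c := hc₀.trans hc
  refine ⟨c, hc, ε / 2, half_pos hε, |Real.log c| + |P.logq.re|, ?_⟩
  filter_upwards [h N le_rfl (|Real.log c| + |P.logq.re|), eventually_ge_atTop 0]
    with v hv hv0 hint w hw
  have hw0 : w ≠ 0 := norm_pos_iff.1 (by rw [hw]; exact radius_pos hc0 _ _)
  have hlog : |Real.log ‖w‖ - ζ₀ * v * P.logq.re| ≤ |Real.log c| + |P.logq.re| := by
    rw [hw, abs_of_neg hq]
    have h1 := le_log_radius hq hc0 ζ₀ v
    have h2 := log_radius_le hq hc0 hζ₀ hv0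
    have h3 := le_abs_self (Real.log c)
    have h4 := neg_abs_le (Real.log c)
    exact abs_le.2 ⟨by nlinarith, by nlinarith⟩
  refine ⟨hw0, hlog, ?_⟩
  have key : ∀ y ∈ P.bases N, ∀ m : ℤ, ε ≤ ‖1 - w / (y * P.q ^ m)‖ := by
    intro y hy m
    have e : ‖w / (y * P.q ^ m)‖ = c / ‖y‖ * ‖P.q‖ ^ (-⌊-ζ₀ * (v : ℝ)⌋₊ - m : ℤ) := by
      have hqn : ‖P.q‖ ≠ 0 := norm_ne_zero_iff.2 P.q_ne_zero
      rw [norm_div, hw, norm_mul, norm_zpow, radius, zpow_sub₀ hqn, zpow_neg, zpow_natCast,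
        Real.exp_neg, Real.exp_nat_mul, ← norm_q]
      field_simp
    refine (hsep y hy (-⌊-ζ₀ * (v : ℝ)⌋₊ - m : ℤ)).trans ?_
    rw [← e]
    simpa using abs_norm_sub_norm_le 1 (w / (y * P.q ^ m))
  refine hv hint _ (by linarith) ζ₀ hζ w hw0 hlog (fun r l hl m => ?_) (fun r l hl m => ?_)
  · linarith [key _ (P.outerBase_mem_bases hl r) m]
  · have k1 := key _ (P.innerBase_mem_bases hl r) m
    have k2 := norm_one_sub_inv_ge hε (div_ne_zero hw0
      (mul_ne_zero (P.innerBase_ne_zero r l) (zpow_ne_zero m P.q_ne_zero))) k1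
    rw [inv_div] at k2
    exact (le_min (by linarith) le_rfl).trans k2

/-- The rescaled integral over the separating circle tends to `0`. -/
lemma tendsto_scale_mul_circleIntegral (hq : P.logq.re < 0) (hfin : P.M₀.Finite) {sobMin : ℂ}
    {Lmin a b ζ₀ c ε K : ℝ} (h : ‖sobMin‖ = Real.exp Lmin) (hd : P.IsDecayInterval Lmin a b)
    (hζ : ζ₀ ∈ Set.Icc a b) (hζM : ζ₀ ∉ P.M₀) (hc : 0 < c) (hε : 0 < ε)
    (haway : ∀ᶠ v : ℤ in atTop, P.IntegralAt v → ∀ w, ‖w‖ = P.radius c ζ₀ v →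
        w ≠ 0 ∧ |Real.log ‖w‖ - ζ₀ * v * P.logq.re| ≤ K ∧ P.AwayFromPoles v ε w)
    {v : ℕ → ℤ} (hv : Tendsto v atTop atTop) (hint : ∀ k, P.IntegralAt (v k)) :
    Tendsto (fun k => P.scale sobMin (v k) * ((2 * (Real.pi : ℂ) * Complex.I)⁻¹ *
      ∮ z in C(0, P.radius c ζ₀ (v k)), P.integrand (v k) z / z)) atTop (𝓝 0) := by
  obtain ⟨κ, hκ, C, hC, hb⟩ := exists_norm_scale_mul_integrand_le hq hfin h hd K hε
  have hdist : 0 < Metric.infDist ζ₀ P.M₀ :=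
    (hfin.isClosed.notMem_iff_infDist_pos P.M₀_nonempty).1 hζM
  have hlim : Tendsto (fun k => C * Real.exp (-(κ * (v k * Metric.infDist ζ₀ P.M₀)))) atTop
      (𝓝 0) := by
    have h1 : Tendsto (fun k => (v k : ℝ)) atTop atTop := tendsto_intCast_atTop_atTop.comp hv
    have h2 := ((h1.atTop_mul_const hdist).const_mul_atTop hκ)
    simpa using (Real.tendsto_exp_atBot.comp (tendsto_neg_atTop_atBot.comp h2)).const_mul C
  refine squeeze_zero_norm' ?_ hlim
  filter_upwards [hv.eventually hb, hv.eventually haway] with k hk1 hk2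
  have hρ := radius_pos (P := P) hc ζ₀ (v k)
  set ρ := P.radius c ζ₀ (v k) with hρdef
  set E := C * Real.exp (-(κ * (v k * Metric.infDist ζ₀ P.M₀))) with hE
  have e1 : P.scale sobMin (v k) * ((2 * (Real.pi : ℂ) * Complex.I)⁻¹ *
      ∮ z in C(0, ρ), P.integrand (v k) z / z) = (2 * (Real.pi : ℂ) * Complex.I)⁻¹ •
        ∮ z in C(0, ρ), P.scale sobMin (v k) * (P.integrand (v k) z / z) := by
    rw [circleIntegral.integral_const_mul, smul_eq_mul]; ring
  rw [e1]
  refine (circleIntegral.norm_two_pi_i_inv_smul_integral_le_of_norm_le_const hρ.le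
    (C := E / ρ) fun z hz => ?_).trans_eq (by field_simp)
  have hz' : ‖z‖ = ρ := by simpa using hz
  obtain ⟨h1, h2, h3⟩ := hk2 (hint k) z hz'
  rw [← mul_div_assoc, norm_div, hz']
  gcongr
  exact hk1 ζ₀ hζ z h1 h2 h3

end Data

namespace Data

/-! ### Sums of residues over pieces of progressions -/

variable {P : Data}

lemma ppow_mul_progression {v N : ℤ} {μ : ℝ} (h : (v : ℝ) * μ = N) (y : ℂ) (n : ℤ) :
    P.ppow v μ * (y * P.q ^ n / P.xpow μ) = y * P.q ^ (N + n) := by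
  have := P.xpow_ne_zero μ
  rw [P.ppow_eq_of_int h, zpow_add₀ P.q_ne_zero]
  field_simp

/-- The limit of the sum of the rescaled residues over a piece of a progression. -/
theorem tendsto_tsum_residue (hq : P.logq.re < 0) (hfin : P.M₀.Finite) {sobMin : ℂ}
    {Lmin a b ε K : ℝ} {N : ℕ} (h : ‖sobMin‖ = Real.exp Lmin) (hd : P.IsDecayInterval Lmin a b)
    (hε : 0 < ε) (hε2 : ε ≤ 1 / 2) (hs : P.SeparatedPoles a b N ε) {v : ℕ → ℤ}
    (hv : Tendsto v atTop atTop) (hint : ∀ k, P.IntegralAt (v k))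
    (hμv : ∀ μ ∈ P.M₀, ∀ k, ∃ N : ℤ, (v k : ℝ) * μ = N) {y : ℂ} (hy : y ∈ P.bases N)
    {T : ℕ → Set ℤ} {Q : ℝ → Set ℤ}
    (hT : ∀ᶠ k in atTop, ∀ m ∈ T k, ∃ ζ ∈ Set.Icc a b, |m - ζ * v k| ≤ K)
    (hTQ : ∀ μ ∈ P.M₀, ∀ n, ∀ᶠ k in atTop, ∀ N : ℤ, (v k : ℝ) * μ = N → (N + n ∈ T k ↔ n ∈ Q μ))
    {L : ℝ → ℤ → ℂ} (hL : ∀ μ ∈ P.M₀, ∀ n ∈ Q μ, Tendsto (fun k => P.scale sobMin (v k) *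
      residue (fun z => P.integrand (v k) z / z) (P.ppow (v k) μ * (y * P.q ^ n / P.xpow μ)))
        atTop (𝓝 (L μ n))) :
    (∀ μ ∈ P.M₀, Summable ((Q μ).indicator (L μ))) ∧
      Tendsto (fun k => ∑' m, (T k).indicator (fun m => P.scale sobMin (v k) *
        residue (fun z => P.integrand (v k) z / z) (y * P.q ^ m)) m) atTop
        (𝓝 (∑ μ ∈ hfin.toFinset, ∑' n, (Q μ).indicator (L μ) n)) := by
  classical
  obtain ⟨κ, hκ, C, hC, hb⟩ := exists_norm_scale_mul_residue_le hq hfin h hd hε hε2 hs K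
  have hex : ∀ μ k, ∃ N : ℤ, μ ∈ P.M₀ → (v k : ℝ) * μ = N := fun μ k => by
    by_cases hμ : μ ∈ P.M₀
    · exact (hμv μ hμ k).imp fun _ h _ => h
    · exact ⟨0, fun h => absurd h hμ⟩
  choose Nμ hNμ using hex
  have key := tendsto_tsum_of_concentrated (T := hfin.toFinset)
    (hfin.toFinset_nonempty.2 P.M₀_nonempty) (tendsto_intCast_atTop_atTop.comp hv) Nμ
    (fun μ hμ k => hNμ μ k (hfin.mem_toFinset.1 hμ)) (C := C)
    (F := fun k => (T k).indicator fun m => P.scale sobMin (v k) *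
        residue (fun z => P.integrand (v k) z / z) (y * P.q ^ m))
    (G := fun μ => (Q μ).indicator (L μ)) hκ ?_ ?_
  · exact ⟨fun μ hμ => key.1 μ (hfin.mem_toFinset.2 hμ), key.2⟩
  · filter_upwards [hT, hv.eventually hb] with k hk1 hk2 m
    by_cases hm : m ∈ T k
    · obtain ⟨ζ, hζ, hζm⟩ := hk1 m hm
      rw [Set.indicator_of_mem hm]
      simpa using hk2 (hint k) y hy m ζ hζ hζm
    · rw [Set.indicator_of_notMem hm, norm_zero]
      positivity
  · intro μ hμ n
    have hμ' := hfin.mem_toFinset.1 hμ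
    have hev := hTQ μ hμ' n
    by_cases hn : n ∈ Q μ
    · rw [Set.indicator_of_mem hn]
      refine (hL μ hμ' n hn).congr' ?_
      filter_upwards [hev] with k hk
      rw [Set.indicator_of_mem ((hk _ (hNμ μ k hμ')).2 hn), ppow_mul_progression (hNμ μ k hμ')]
    · rw [Set.indicator_of_notMem hn]
      refine tendsto_const_nhds.congr' ?_
      filter_upwards [hev] with k hk
      rw [Set.indicator_of_notMem fun h => hn ((hk _ (hNμ μ k hμ')).1 h)]

variable (P) in
/-- The `m` for which the outer progression contains a pole inside the circle of radius `ρ`. -/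
def outerRange (v : ℤ) (ρ : ℝ) (r : Fin P.nα) (l : ℕ) : Set ℤ :=
  {m | (m : ℝ) ≤ -(v * (P.α r + l)) ∧ ‖P.outerBase r l * P.q ^ m‖ < ρ}

variable (P) in
/-- The `m` for which the inner progression contains a pole outside the circle of radius `ρ`. -/
def innerRange (v : ℤ) (ρ : ℝ) (r : Fin P.nβ) (l : ℕ) : Set ℤ :=
  {m | v * (P.β r + l) ≤ (m : ℝ) ∧ ρ < ‖P.innerBase r l * P.q ^ m‖}

variable (P) in
/-- The `(r, l)` with `α_r + l ≤ 0`. -/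
def outerIndices (N : ℕ) : Finset (Fin P.nα × ℕ) :=
  (Finset.univ ×ˢ Finset.range N).filter fun x => P.α x.1 + x.2 ≤ 0

variable (P) in
/-- The `(r, l)` with `β_r + l < 0`. -/
def innerIndices (N : ℕ) : Finset (Fin P.nβ × ℕ) :=
  (Finset.univ ×ˢ Finset.range N).filter fun x => P.β x.1 + x.2 < 0

lemma mem_outerIndices {N : ℕ} (hN : ∀ r, 0 < P.α r + N) {x : Fin P.nα × ℕ} :
    x ∈ P.outerIndices N ↔ P.α x.1 + x.2 ≤ 0 := by
  simp only [outerIndices, Finset.mem_filter, Finset.mem_product, Finset.mem_univ, true_and,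
    Finset.mem_range, and_iff_right_iff_imp]
  intro h
  have := hN x.1
  have h2 : (x.2 : ℚ) < N := by linarith
  exact_mod_cast h2

lemma mem_innerIndices {N : ℕ} (hN : ∀ r, 0 ≤ P.β r + N) {x : Fin P.nβ × ℕ} :
    x ∈ P.innerIndices N ↔ P.β x.1 + x.2 < 0 := by
  simp only [innerIndices, Finset.mem_filter, Finset.mem_product, Finset.mem_univ, true_and,
    Finset.mem_range, and_iff_right_iff_imp]
  intro h
  have := hN x.1
  have h2 : (x.2 : ℚ) < N := by linarith
  exact_mod_cast h2

lemma outer_point {v M : ℤ} {r : Fin P.nα} (h : (v : ℝ) * P.α r = M) (l k : ℕ) :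
    (P.ppow v (P.α r + l) * P.q ^ k * P.t r)⁻¹ =
      P.outerBase r l * P.q ^ (-(M + v * l) - k : ℤ) := by
  have hq0 := P.q_ne_zero
  rw [P.ppow_add_nat_of_int h, outerBase, zpow_sub₀ hq0, zpow_neg, zpow_natCast]
  simp only [mul_inv, div_eq_mul_inv]; ring

lemma inner_point {v M : ℤ} {r : Fin P.nβ} (h : (v : ℝ) * P.β r = M) (l k : ℕ) :
    P.ppow v (P.β r + l) * P.q ^ k * P.u r = P.innerBase r l * P.q ^ (M + v * l + k : ℤ) := by
  rw [P.ppow_add_nat_of_int h, innerBase, zpow_add₀ P.q_ne_zero (M + v * l), zpow_natCast]; ring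

/-- The poles with α_r + l > 0 lie on or outside the circle by assumption, so only finitely many
pairs (r, l) remain. Integrality of vα_r puts their poles into progressions in q. -/
lemma outerPoles_eq {v : ℤ} (hint : P.IntegralAt v) {N : ℕ} (hN : ∀ r, 0 < P.α r + N) {ρ : ℝ}
    (hρ : ∀ r, ∀ l k : ℕ, 0 < P.α r + l → ρ ≤ ‖(P.ppow v (P.α r + l) * P.q ^ k * P.t r)⁻¹‖) :
    {w ∈ P.outerPoles v | ‖w‖ < ρ} = {w | ∃ x ∈ P.outerIndices N,
      ∃ m ∈ P.outerRange v ρ x.1 x.2, w = P.outerBase x.1 x.2 * P.q ^ m} := by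
  ext w
  constructor
  · rintro ⟨⟨r, l, k, rfl⟩, hw⟩
    obtain ⟨M, hM⟩ := hint.1 r
    have e := outer_point hM l k
    refine ⟨(r, l), (mem_outerIndices hN).2 (not_lt.1 fun h => not_le.2 hw (hρ r l k h)),
      _, ⟨?_, by rwa [← e]⟩, e⟩
    push_cast
    have : (0 : ℝ) ≤ k := k.cast_nonneg
    rw [mul_add, hM]; linarith
  · rintro ⟨⟨r, l⟩, -, m, ⟨hm1, hm2⟩, rfl⟩
    obtain ⟨M, hM⟩ := hint.1 r
    refine ⟨⟨r, l, (-(M + v * l) - m).toNat, ?_⟩, hm2⟩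
    have h0 : 0 ≤ -(M + v * l) - m := by
      rw [mul_add, hM] at hm1
      have : m ≤ -(M + v * l) := by exact_mod_cast hm1
      linarith
    rw [outer_point hM, Int.toNat_of_nonneg h0, sub_sub_cancel]

lemma innerPoles_eq {v : ℤ} (hint : P.IntegralAt v) {N : ℕ} (hN : ∀ r, 0 ≤ P.β r + N) {ρ : ℝ}
    (hρ : ∀ r, ∀ l k : ℕ, 0 ≤ P.β r + l → ‖P.ppow v (P.β r + l) * P.q ^ k * P.u r‖ ≤ ρ) :
    {w ∈ P.innerPoles v | ρ < ‖w‖} = {w | ∃ x ∈ P.innerIndices N,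
      ∃ m ∈ P.innerRange v ρ x.1 x.2, w = P.innerBase x.1 x.2 * P.q ^ m} := by
  ext w
  constructor
  · rintro ⟨⟨r, l, k, rfl⟩, hw⟩
    obtain ⟨M, hM⟩ := hint.2 r
    have e := inner_point hM l k
    refine ⟨(r, l), (mem_innerIndices hN).2 (not_le.1 fun h => not_le.2 hw (hρ r l k h)),
      _, ⟨?_, by rwa [← e]⟩, e⟩
    push_cast
    have : (0 : ℝ) ≤ k := k.cast_nonneg
    rw [mul_add, hM]; linarith
  · rintro ⟨⟨r, l⟩, -, m, ⟨hm1, hm2⟩, rfl⟩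
    obtain ⟨M, hM⟩ := hint.2 r
    refine ⟨⟨r, l, (m - (M + v * l)).toNat, ?_⟩, hm2⟩
    have h0 : 0 ≤ m - (M + v * l) := by
      rw [mul_add, hM] at hm1
      have : M + v * l ≤ m := by exact_mod_cast hm1
      linarith
    rw [inner_point hM, Int.toNat_of_nonneg h0, add_sub_cancel]

/-- A pole with α_r + l ≥ η has modulus at least about |q|^{-ηv}, which eventually exceeds |q|^{ζ₀v}
because -η < ζ₀. -/
lemma eventually_radius_le_outer (hq : P.logq.re < 0) {c ζ₀ η : ℝ} (hc : 0 < c) (hζ₀ : ζ₀ ≤ 0)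
    (hηζ : -η < ζ₀) (hα : ∀ r, ∀ l : ℕ, 0 < P.α r + l → η ≤ P.α r + l) :
    ∀ᶠ v : ℤ in atTop, ∀ r, ∀ l k : ℕ, 0 < P.α r + l →
      P.radius c ζ₀ v ≤ ‖(P.ppow v (P.α r + l) * P.q ^ k * P.t r)⁻¹‖ := by
  have h1 : ∀ r, ∀ᶠ v : ℤ in atTop,
      Real.log c + (ζ₀ + η) * P.logq.re * v + η * P.logx.re + (P.logt r).re ≤ 0 := by
    intro r
    have h2 : Tendsto (fun v : ℤ => (ζ₀ + η) * P.logq.re * (v : ℝ)) atTop atBot :=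
      tendsto_intCast_atTop_atTop.const_mul_atTop_of_neg
        (mul_neg_of_pos_of_neg (by linarith) hq)
    filter_upwards [h2.eventually_le_atBot (-(Real.log c + η * P.logx.re + (P.logt r).re))]
      with v hv
    linarith
  filter_upwards [eventually_all.2 h1, eventually_logp_neg hq, eventually_ge_atTop 0]
    with v hv hp hv0 r l k hl
  have hl' := hα r l hl
  have e : ‖(P.ppow v (P.α r + l) * P.q ^ k * P.t r)⁻¹‖ =
      Real.exp (-((P.α r + l) * P.logp v + k * P.logq.re + (P.logt r).re)) := by
    rw [norm_inv, norm_mul, norm_mul, norm_pow, norm_ppow, norm_q, t, Complex.norm_exp,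
      ← Real.exp_nat_mul, ← Real.exp_add, ← Real.exp_add, Real.exp_neg, logp]
  rw [e, ← Real.log_le_iff_le_exp (radius_pos hc _ _)]
  refine (log_radius_le hq hc hζ₀ hv0).trans ?_
  have h3 : (P.α r + l) * P.logp v ≤ η * P.logp v := mul_le_mul_of_nonpos_right hl' hp
  have h4 : (k : ℝ) * P.logq.re ≤ 0 := mul_nonpos_of_nonneg_of_nonpos k.cast_nonneg hq.le
  have h5 := hv r
  rw [logp] at h3 ⊢
  nlinarith

/-- Poles with β_r + l ≥ 0 eventually have modulus at most |u_r|, while the radius is at least c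
since ζ₀ enters only through a natural number. -/
lemma eventually_inner_le_radius (hq : P.logq.re < 0) {c : ℝ} (ζ₀ : ℝ) (hc : ∀ r, ‖P.u r‖ ≤ c)
    (hc0 : 0 < c) : ∀ᶠ v : ℤ in atTop, ∀ r, ∀ l k : ℕ, 0 ≤ P.β r + l →
      ‖P.ppow v (P.β r + l) * P.q ^ k * P.u r‖ ≤ P.radius c ζ₀ v := by
  filter_upwards [eventually_logp_neg hq] with v hp r l k hl
  have hl' : (0 : ℝ) ≤ P.β r + l := by exact_mod_cast hl
  have h1 : c ≤ P.radius c ζ₀ v := le_mul_of_one_le_right hc0.le (Real.one_le_exp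
    (neg_nonneg.2 (mul_nonpos_of_nonneg_of_nonpos (Nat.cast_nonneg _) hq.le)))
  refine le_trans ?_ ((hc r).trans h1)
  rw [norm_mul, norm_mul, norm_pow, norm_ppow]
  refine mul_le_of_le_one_left (norm_nonneg _) (mul_le_one₀ (Real.exp_le_one_iff.2
    (mul_nonpos_of_nonneg_of_nonpos hl' hp)) (by positivity)
    (pow_le_one₀ (norm_nonneg _) (P.norm_q_lt_one hq).le))

lemma norm_progression_lt_iff {A : ℂ} (hA : A ≠ 0) (m : ℤ) {ρ : ℝ} (hρ : 0 < ρ) :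
    ‖A * P.q ^ m‖ < ρ ↔ Real.log ‖A‖ + m * P.logq.re < Real.log ρ := by
  have hA' := norm_pos_iff.2 hA
  rw [norm_mul, norm_zpow, norm_q, exp_zpow, ← Real.log_lt_log_iff (by positivity) hρ,
    Real.log_mul hA'.ne' (Real.exp_pos _).ne', Real.log_exp]

lemma lt_norm_progression_iff {A : ℂ} (hA : A ≠ 0) (m : ℤ) {ρ : ℝ} (hρ : 0 < ρ) :
    ρ < ‖A * P.q ^ m‖ ↔ Real.log ρ < Real.log ‖A‖ + m * P.logq.re := by
  have hA' := norm_pos_iff.2 hA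
  rw [norm_mul, norm_zpow, norm_q, exp_zpow, ← Real.log_lt_log_iff hρ (by positivity),
    Real.log_mul hA'.ne' (Real.exp_pos _).ne', Real.log_exp]

lemma eventually_norm_progression_lt (hq : P.logq.re < 0) {c ζ₀ μ : ℝ} (hc : 0 < c)
    (h : ζ₀ < μ) {A : ℂ} (hA : A ≠ 0) (n : ℤ) : ∀ᶠ v : ℤ in atTop, ∀ N : ℤ, (v : ℝ) * μ = N →
      ‖A * P.q ^ (N + n)‖ < P.radius c ζ₀ v := by
  have h2 : Tendsto (fun v : ℤ => (μ - ζ₀) * P.logq.re * (v : ℝ)) atTop atBot :=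
    tendsto_intCast_atTop_atTop.const_mul_atTop_of_neg (mul_neg_of_pos_of_neg (by linarith) hq)
  filter_upwards [h2.eventually_lt_atBot (Real.log c - Real.log ‖A‖ - (n - 1) * P.logq.re)]
    with v hv N hN
  rw [norm_progression_lt_iff hA _ (radius_pos hc _ _)]
  refine lt_of_lt_of_le ?_ (le_log_radius hq hc ζ₀ v)
  push_cast; rw [← hN]; nlinarith

lemma eventually_lt_norm_progression (hq : P.logq.re < 0) {c ζ₀ μ : ℝ} (hc : 0 < c)
    (hζ₀ : ζ₀ ≤ 0) (h : μ < ζ₀) {A : ℂ} (hA : A ≠ 0) (n : ℤ) :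
    ∀ᶠ v : ℤ in atTop, ∀ N : ℤ, (v : ℝ) * μ = N →
      P.radius c ζ₀ v < ‖A * P.q ^ (N + n)‖ := by
  have h2 : Tendsto (fun v : ℤ => (ζ₀ - μ) * P.logq.re * (v : ℝ)) atTop atBot :=
    tendsto_intCast_atTop_atTop.const_mul_atTop_of_neg (mul_neg_of_pos_of_neg (by linarith) hq)
  filter_upwards [h2.eventually_lt_atBot (Real.log ‖A‖ + n * P.logq.re - Real.log c),
    eventually_ge_atTop 0] with v hv hv0 N hN
  rw [lt_norm_progression_iff hA _ (radius_pos hc _ _)]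
  refine (log_radius_le hq hc hζ₀ hv0).trans_lt ?_
  push_cast; rw [← hN]; nlinarith

/-- The progression ends at m = -v(α_r + l) ≤ v m_+, and the circle bounds m from below by ζ₀v up to
a constant. So m/v lies in the decay interval up to O(1/v). -/
lemma exists_near_outerRange (hq : P.logq.re < 0) {a c ζ₀ : ℝ} (hc : 0 < c) (ha : a ≤ ζ₀)
    (hζ₀ : ζ₀ ≤ 0) (r : Fin P.nα) (l : ℕ) : ∃ K : ℝ, ∀ᶠ v : ℤ in atTop,
      ∀ m ∈ P.outerRange v (P.radius c ζ₀ v) r l,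
        ∃ ζ ∈ Set.Icc a (P.mPlus : ℝ), |m - ζ * v| ≤ K := by
  set A := P.outerBase r l
  refine ⟨|(Real.log c - Real.log ‖A‖) / P.logq.re|, ?_⟩
  filter_upwards [eventually_gt_atTop 0] with v hv m ⟨hm1, hm2⟩
  have hv' : (0 : ℝ) < v := by exact_mod_cast hv
  have hp : (0 : ℝ) ≤ P.mPlus := by exact_mod_cast P.zero_le_mPlus
  rcases le_or_gt (ζ₀ * v) m with h | h
  · refine ⟨m / v, ⟨ha.trans ((le_div_iff₀ hv').2 h), (div_le_iff₀ hv').2 (hm1.trans ?_)⟩, ?_⟩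
    · have h1 : -(P.α r : ℝ) ≤ P.mPlus := by exact_mod_cast P.le_mPlus r
      have h2 : (0 : ℝ) ≤ l := l.cast_nonneg
      nlinarith
    · rw [div_mul_cancel₀ _ hv'.ne', sub_self, abs_zero]; positivity
  · refine ⟨ζ₀, ⟨ha, hζ₀.trans hp⟩, ?_⟩
    rw [norm_progression_lt_iff (P.outerBase_ne_zero r l) _ (radius_pos hc _ _)] at hm2
    have h1 := hm2.trans_le (log_radius_le hq hc hζ₀ hv.le)
    have h2 : (Real.log c - Real.log ‖A‖) / P.logq.re < m - ζ₀ * v := by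
      rw [div_lt_iff_of_neg hq]; linarith
    rw [abs_of_neg (by linarith), abs_of_neg (by linarith)]
    linarith

lemma exists_near_innerRange (hq : P.logq.re < 0) {a c ζ₀ : ℝ} (hc : 0 < c) (ha : a ≤ P.mMinus)
    (haζ : a ≤ ζ₀) (hζ₀ : ζ₀ ≤ 0) (r : Fin P.nβ) (l : ℕ) : ∃ K : ℝ, ∀ᶠ v : ℤ in atTop,
      ∀ m ∈ P.innerRange v (P.radius c ζ₀ v) r l,
        ∃ ζ ∈ Set.Icc a (P.mPlus : ℝ), |m - ζ * v| ≤ K := by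
  set A := P.innerBase r l
  refine ⟨|(Real.log c - Real.log ‖A‖) / P.logq.re| + 1, ?_⟩
  filter_upwards [eventually_gt_atTop 0] with v hv m ⟨hm1, hm2⟩
  have hv' : (0 : ℝ) < v := by exact_mod_cast hv
  have hp : (0 : ℝ) ≤ P.mPlus := by exact_mod_cast P.zero_le_mPlus
  rcases le_or_gt (m : ℝ) (ζ₀ * v) with h | h
  · refine ⟨m / v, ⟨(le_div_iff₀ hv').2 (le_trans ?_ hm1),
      ((div_le_iff₀ hv').2 h).trans (hζ₀.trans hp)⟩, ?_⟩
    · have h1 : (P.mMinus : ℝ) ≤ P.β r := by exact_mod_cast P.mMinus_le r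
      have h2 : (0 : ℝ) ≤ l := l.cast_nonneg
      nlinarith
    · rw [div_mul_cancel₀ _ hv'.ne', sub_self, abs_zero]; positivity
  · refine ⟨ζ₀, ⟨haζ, hζ₀.trans hp⟩, ?_⟩
    rw [lt_norm_progression_iff (P.innerBase_ne_zero r l) _ (radius_pos hc _ _)] at hm2
    have h1 := (le_log_radius hq hc ζ₀ v).trans_lt hm2
    have h2 : m - ζ₀ * v - 1 < (Real.log c - Real.log ‖A‖) / P.logq.re := by
      rw [lt_div_iff_of_neg hq]; linarith
    rw [abs_of_pos (by linarith)]
    linarith [le_abs_self ((Real.log c - Real.log ‖A‖) / P.logq.re)]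

variable (P) in
/-- The `n` for which the point at position `n` relative to `p^μ` of the outer progression
eventually contributes. -/
def outerLimitRange (ζ₀ : ℝ) (r : Fin P.nα) (l : ℕ) (μ : ℝ) : Set ℤ :=
  {n | ζ₀ < μ ∧ (P.α r + μ + l < 0 ∨ P.α r + μ + l = 0 ∧ n ≤ 0)}

variable (P) in
/-- The `n` for which the point at position `n` relative to `p^μ` of the inner progression
eventually contributes. -/
def innerLimitRange (ζ₀ : ℝ) (r : Fin P.nβ) (l : ℕ) (μ : ℝ) : Set ℤ :=
  {n | μ < ζ₀ ∧ (P.β r - μ + l < 0 ∨ P.β r - μ + l = 0 ∧ 0 ≤ n)}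

/-- The sign of d decides for large v. The borderline case d = 0, where the condition on n survives,
is what makes a series unilateral. -/
lemma eventually_le_mul (d n : ℝ) : ∀ᶠ v : ℤ in atTop, (n ≤ v * d ↔ 0 < d ∨ d = 0 ∧ n ≤ 0) := by
  rcases lt_trichotomy d 0 with h | h | h
  · filter_upwards [(tendsto_intCast_atTop_atTop (R := ℝ)).atTop_mul_const_of_neg h
      |>.eventually_lt_atBot n] with v hv
    simp [h.ne, h.not_gt, hv]
  · simp [h]
  · filter_upwards [(tendsto_intCast_atTop_atTop (R := ℝ)).atTop_mul_const h
      |>.eventually_ge_atTop n] with v hv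
    simp [h, hv]

lemma eventually_mem_outerRange_iff (hq : P.logq.re < 0) {c ζ₀ μ : ℝ} (hc : 0 < c)
    (hζ₀ : ζ₀ ≤ 0) (hμ : ζ₀ < μ ∨ μ < ζ₀) (r : Fin P.nα) (l : ℕ) (n : ℤ) :
    ∀ᶠ v : ℤ in atTop, ∀ N : ℤ, (v : ℝ) * μ = N →
      (N + n ∈ P.outerRange v (P.radius c ζ₀ v) r l ↔ n ∈ P.outerLimitRange ζ₀ r l μ) := by
  rcases hμ with h | h
  · filter_upwards [eventually_norm_progression_lt hq hc h (P.outerBase_ne_zero r l) n,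
      eventually_le_mul (-(P.α r + μ + l)) n] with v hv1 hv2 N hN
    have e : ((N + n : ℤ) : ℝ) ≤ -(v * (P.α r + l)) ↔ (n : ℝ) ≤ v * -(P.α r + μ + l) := by
      push_cast; rw [← hN]; constructor <;> intro h <;> linarith
    simp only [outerRange, outerLimitRange, Set.mem_ofPred_eq, hv1 N hN, h, and_true, true_and, e,
      hv2, neg_eq_zero, Left.neg_pos_iff, Int.cast_nonpos]
  · filter_upwards [eventually_lt_norm_progression hq hc hζ₀ h (P.outerBase_ne_zero r l) n]
      with v hv1 N hN
    simp only [outerRange, outerLimitRange, Set.mem_ofPred_eq, (hv1 N hN).not_gt, h.not_gt,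
      and_false, false_and]

lemma eventually_mem_innerRange_iff (hq : P.logq.re < 0) {c ζ₀ μ : ℝ} (hc : 0 < c)
    (hζ₀ : ζ₀ ≤ 0) (hμ : ζ₀ < μ ∨ μ < ζ₀) (r : Fin P.nβ) (l : ℕ) (n : ℤ) :
    ∀ᶠ v : ℤ in atTop, ∀ N : ℤ, (v : ℝ) * μ = N →
      (N + n ∈ P.innerRange v (P.radius c ζ₀ v) r l ↔ n ∈ P.innerLimitRange ζ₀ r l μ) := by
  rcases hμ with h | h
  · filter_upwards [eventually_norm_progression_lt hq hc h (P.innerBase_ne_zero r l) n]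
      with v hv1 N hN
    simp only [innerRange, innerLimitRange, Set.mem_ofPred_eq, (hv1 N hN).not_gt, h.not_gt,
      and_false, false_and]
  · filter_upwards [eventually_lt_norm_progression hq hc hζ₀ h (P.innerBase_ne_zero r l) n,
      eventually_le_mul (-(P.β r - μ + l)) (-n)] with v hv1 hv2 N hN
    have e : v * (P.β r + l) ≤ ((N + n : ℤ) : ℝ) ↔ -(n : ℝ) ≤ v * -(P.β r - μ + l) := by
      push_cast; rw [← hN]; constructor <;> intro h <;> linarith
    simp only [innerRange, innerLimitRange, Set.mem_ofPred_eq, hv1 N hN, h, and_true, true_and, e,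
      hv2, neg_eq_zero, Left.neg_pos_iff, Left.neg_nonpos_iff, Int.cast_nonneg_iff]

end Data

/-! ### Reindexing the limiting sums as the residue series of the theorem. -/

/-- Summation over the index range of a residue series, as a sum over all integers. -/
lemma tsum_indexRange_eq {d : ℝ} {Q : Set ℤ} (hQ : ∀ n, n ∈ Q ↔ n ∈ indexRange d) (F : ℤ → ℂ) :
    ∑' n : indexRange d, F n = ∑' n, Q.indicator F n := by
  rw [Set.ext hQ, tsum_subtype]

lemma tsum_indexRange_eq_neg {d : ℝ} {Q : Set ℤ} (hQ : ∀ n, n ∈ Q ↔ -n ∈ indexRange d) (F : ℤ → ℂ) :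
    ∑' n : indexRange d, F n = ∑' n, Q.indicator (fun n => F (-n)) n := by
  classical
  rw [tsum_subtype, ← (Equiv.neg ℤ).tsum_eq]
  refine tsum_congr fun n => ?_
  simp only [Set.indicator_apply, Equiv.neg_apply, hQ]

lemma summable_indexRange_iff {d : ℝ} {Q : Set ℤ} (hQ : ∀ n, n ∈ Q ↔ n ∈ indexRange d) (F : ℤ → ℂ) :
    (Summable fun n : indexRange d => F n) ↔ Summable (Q.indicator F) := by
  rw [Set.ext hQ, ← summable_subtype_iff_indicator]; rfl

lemma summable_indexRange_iff_neg {d : ℝ} {Q : Set ℤ} (hQ : ∀ n, n ∈ Q ↔ -n ∈ indexRange d)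
    (F : ℤ → ℂ) :
    (Summable fun n : indexRange d => F n) ↔ Summable (Q.indicator fun n => F (-n)) := by
  classical
  have h1 : (Summable fun n : indexRange d => F n) ↔ Summable ((indexRange d).indicator F) := by
    rw [← summable_subtype_iff_indicator]; rfl
  have h2 : (indexRange d).indicator F ∘ Equiv.neg ℤ = Q.indicator fun n => F (-n) := by
    funext n
    simp only [Set.indicator_apply, Function.comp_apply, Equiv.neg_apply, hQ]
  rw [h1, ← (Equiv.neg ℤ).summable_iff, h2]

lemma finsum_mem_inter_eq {S : Set ℝ} (hS : S.Finite) (p : ℝ → Prop) [DecidablePred p] (f : ℝ → ℂ) :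
    ∑ᶠ μ ∈ S ∩ {μ | p μ}, f μ = ∑ μ ∈ hS.toFinset, if p μ then f μ else 0 := by
  rw [← Finset.sum_filter, ← finsum_mem_coe_finset]
  simp [Set.inter_def]

namespace Data

variable {P : Data}

/-- The limit of the sum of the rescaled residues over finitely many pieces of progressions. -/
theorem tendsto_finsum_residue (hq : P.logq.re < 0) (hfin : P.M₀.Finite) {sobMin : ℂ}
    {Lmin a b ε : ℝ} {N : ℕ} (h : ‖sobMin‖ = Real.exp Lmin) (hd : P.IsDecayInterval Lmin a b)
    (hε : 0 < ε) (hε2 : ε ≤ 1 / 2) (hs : P.SeparatedPoles a b N ε) {v : ℕ → ℤ}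
    (hv : Tendsto v atTop atTop) (hint : ∀ k, P.IntegralAt (v k))
    (hμv : ∀ μ ∈ P.M₀, ∀ k, ∃ N : ℤ, (v k : ℝ) * μ = N) {ι : Type*} {X : Finset ι} {A : ι → ℂ}
    (hA : ∀ x ∈ X, A x ∈ P.bases N)
    (hdisj : ∀ x ∈ X, ∀ x' ∈ X, x ≠ x' → ∀ m m' : ℤ, A x * P.q ^ m ≠ A x' * P.q ^ m')
    {T : ι → ℤ → Set ℤ} {Q : ι → ℝ → Set ℤ} {S : ℕ → Set ℂ} (hfinS : ∀ᶠ k in atTop, (S k).Finite)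
    (hS : ∀ᶠ k in atTop, S k = {w | ∃ x ∈ X, ∃ m ∈ T x (v k), w = A x * P.q ^ m})
    (hT : ∀ x ∈ X, ∃ K : ℝ, ∀ᶠ v : ℤ in atTop, ∀ m ∈ T x v, ∃ ζ ∈ Set.Icc a b, |m - ζ * v| ≤ K)
    (hTQ : ∀ x ∈ X, ∀ μ ∈ P.M₀, ∀ n, ∀ᶠ v : ℤ in atTop, ∀ N : ℤ, (v : ℝ) * μ = N →
      (N + n ∈ T x v ↔ n ∈ Q x μ))
    {L : ι → ℝ → ℤ → ℂ} (hL : ∀ x ∈ X, ∀ μ ∈ P.M₀, ∀ n ∈ Q x μ, Tendsto (fun k =>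
      P.scale sobMin (v k) * residue (fun z => P.integrand (v k) z / z)
        (P.ppow (v k) μ * (A x * P.q ^ n / P.xpow μ))) atTop (𝓝 (L x μ n))) :
    (∀ x ∈ X, ∀ μ ∈ P.M₀, Summable ((Q x μ).indicator (L x μ))) ∧
      Tendsto (fun k => P.scale sobMin (v k) *
        ∑ᶠ w ∈ S k, residue (fun z => P.integrand (v k) z / z) w) atTop
        (𝓝 (∑ x ∈ X, ∑ μ ∈ hfin.toFinset, ∑' n, (Q x μ).indicator (L x μ) n)) := by
  choose K hK using hT
  have key := fun x hx =>
    tendsto_tsum_residue hq hfin h hd hε hε2 hs hv hint hμv (hA x hx)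
      (hv.eventually (hK x hx)) (fun μ hμ n => hv.eventually (hTQ x hx μ hμ n)) (hL x hx)
  refine ⟨fun x hx => (key x hx).1, (tendsto_finsetSum X fun x hx => (key x hx).2).congr' ?_⟩
  filter_upwards [hfinS, hS] with k hk1 hk2
  rw [finsum_progressions (P.norm_q_lt_one hq) P.q_ne_zero X A (fun x => T x (v k))
    (fun x hx => P.ne_zero_of_mem_bases (hA x hx)) hdisj hk2 hk1, Finset.mul_sum]
  refine Finset.sum_congr rfl fun x _ => ?_
  rw [← tsum_mul_left]
  refine tsum_congr fun m => ?_
  rw [← Set.indicator_const_mul]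

lemma outerLimitRange_eq_empty {ζ₀ μ : ℝ} {r : Fin P.nα} {l : ℕ}
    (h : μ < ζ₀ ∨ 0 < P.α r + μ + l) : P.outerLimitRange ζ₀ r l μ = ∅ := by
  ext n
  simp only [outerLimitRange, Set.mem_ofPred_eq, Set.mem_empty_iff_false, iff_false]
  rintro ⟨h1, h2⟩
  rcases h with h | h <;> rcases h2 with h2 | ⟨h2, -⟩ <;> linarith

lemma innerLimitRange_eq_empty {ζ₀ μ : ℝ} {r : Fin P.nβ} {l : ℕ}
    (h : ζ₀ < μ ∨ 0 < P.β r - μ + l) : P.innerLimitRange ζ₀ r l μ = ∅ := by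
  ext n
  simp only [innerLimitRange, Set.mem_ofPred_eq, Set.mem_empty_iff_false, iff_false]
  rintro ⟨h1, h2⟩
  rcases h with h | h <;> rcases h2 with h2 | ⟨h2, -⟩ <;> linarith

lemma mem_outerLimitRange_iff {ζ₀ μ : ℝ} {r : Fin P.nα} {l : ℕ} (hμ : ζ₀ < μ)
    (h : P.α r + μ + l ≤ 0) (n : ℤ) :
    n ∈ P.outerLimitRange ζ₀ r l μ ↔ -n ∈ indexRange (P.α r + μ + l) := by
  simp only [outerLimitRange, indexRange, Set.mem_ofPred_eq, hμ, true_and, Left.nonneg_neg_iff]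
  rcases h.lt_or_eq with h | h
  · simp [h, h.ne]
  · simp [h]

lemma mem_innerLimitRange_iff {ζ₀ μ : ℝ} {r : Fin P.nβ} {l : ℕ} (hμ : μ < ζ₀)
    (h : P.β r - μ + l ≤ 0) (n : ℤ) :
    n ∈ P.innerLimitRange ζ₀ r l μ ↔ n ∈ indexRange (P.β r - μ + l) := by
  simp only [innerLimitRange, indexRange, Set.mem_ofPred_eq, hμ, true_and]
  rcases h.lt_or_eq with h | h
  · simp [h, h.ne]
  · simp [h]

lemma outer_sum_eq (hfin : P.M₀.Finite) {N : ℕ} (hN : ∀ r, 0 < P.α r + N) {ζ₀ : ℝ}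
    (hsep : ∀ μ ∈ P.M₀, 0 ≤ μ ∧ ζ₀ < μ ∨ μ < 0 ∧ μ < ζ₀) (F : ℝ → Fin P.nα → ℕ → ℤ → ℂ) :
    ∑ x ∈ P.outerIndices N, ∑ μ ∈ hfin.toFinset, ∑' n,
        (P.outerLimitRange ζ₀ x.1 x.2 μ).indicator (fun n => F μ x.1 x.2 (-n)) n =
      ∑ᶠ μ ∈ P.M₀ ∩ Set.Ici 0, ∑' l : ℕ, ∑ r, if P.α r + μ + l ≤ 0 then
        ∑' n : indexRange (P.α r + μ + l), F μ r l n else 0 := by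
  classical
  rw [Finset.sum_comm]
  refine Eq.trans ?_ (finsum_mem_inter_eq hfin (fun μ => 0 ≤ μ) _).symm
  refine Finset.sum_congr rfl fun μ hμ => ?_
  rcases hsep μ (hfin.mem_toFinset.1 hμ) with ⟨h0, h1⟩ | ⟨h0, h1⟩
  · rw [if_pos h0, tsum_eq_sum (s := Finset.range N), ← Finset.sum_product_right', outerIndices,
      Finset.sum_filter]
    · refine Finset.sum_congr rfl fun x _ => ?_
      split_ifs with h2 h3 h3
      · exact (tsum_indexRange_eq_neg (mem_outerLimitRange_iff h1 h3) _).symm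
      · simp [outerLimitRange_eq_empty (Or.inr (not_le.1 h3))]
      · refine absurd ?_ h2
        have : (P.α x.1 : ℝ) + x.2 ≤ 0 := by linarith
        exact_mod_cast this
      · rfl
    · intro l hl
      refine Finset.sum_eq_zero fun r _ => if_neg ?_
      have h2 : (0 : ℝ) < P.α r + N := by exact_mod_cast hN r
      have h3 : (N : ℝ) ≤ l := by exact_mod_cast not_lt.1 fun h => hl (Finset.mem_range.2 h)
      linarith
  · rw [if_neg h0.not_ge]
    exact Finset.sum_eq_zero fun x _ => by simp [outerLimitRange_eq_empty (Or.inl h1)]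

lemma inner_sum_eq (hfin : P.M₀.Finite) {N : ℕ} (hN : ∀ r, 0 ≤ P.β r + N) {ζ₀ : ℝ}
    (hsep : ∀ μ ∈ P.M₀, 0 ≤ μ ∧ ζ₀ < μ ∨ μ < 0 ∧ μ < ζ₀) (F : ℝ → Fin P.nβ → ℕ → ℤ → ℂ) :
    ∑ x ∈ P.innerIndices N, ∑ μ ∈ hfin.toFinset, ∑' n,
        (P.innerLimitRange ζ₀ x.1 x.2 μ).indicator (F μ x.1 x.2) n =
      ∑ᶠ μ ∈ P.M₀ ∩ Set.Iio 0, ∑' l : ℕ, ∑ r, if P.β r - μ + l ≤ 0 then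
        ∑' n : indexRange (P.β r - μ + l), F μ r l n else 0 := by
  classical
  rw [Finset.sum_comm]
  refine Eq.trans ?_ (finsum_mem_inter_eq hfin (fun μ => μ < 0) _).symm
  refine Finset.sum_congr rfl fun μ hμ => ?_
  rcases hsep μ (hfin.mem_toFinset.1 hμ) with ⟨h0, h1⟩ | ⟨h0, h1⟩
  · rw [if_neg h0.not_gt]
    exact Finset.sum_eq_zero fun x _ => by simp [innerLimitRange_eq_empty (Or.inl h1)]
  · rw [if_pos h0, tsum_eq_sum (s := Finset.range N), ← Finset.sum_product_right', innerIndices,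
      Finset.sum_filter]
    · refine Finset.sum_congr rfl fun x _ => ?_
      split_ifs with h2 h3 h3
      · exact (tsum_indexRange_eq (mem_innerLimitRange_iff h1 h3) _).symm
      · simp [innerLimitRange_eq_empty (Or.inr (not_le.1 h3))]
      · refine absurd ?_ h2
        have : (P.β x.1 : ℝ) + x.2 < 0 := by linarith
        exact_mod_cast this
      · rfl
    · intro l hl
      refine Finset.sum_eq_zero fun r _ => if_neg ?_
      have h2 : (0 : ℝ) ≤ P.β r + N := by exact_mod_cast hN r
      have h3 : (N : ℝ) ≤ l := by exact_mod_cast not_lt.1 fun h => hl (Finset.mem_range.2 h)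
      linarith

lemma resPlus_eq (v : ℤ) (μ : ℝ) (r : Fin P.nα) (l : ℕ) (n : ℤ) :
    P.resPlus v μ r l n = residue (fun z => P.integrand v z / z)
      (P.ppow v μ * (P.outerBase r l * P.q ^ (-n) / P.xpow μ)) := by
  rw [resPlus, outerBase]
  congr 1
  rw [show -(P.α r : ℝ) - l - μ = -(P.α r + l) + -μ by ring, xpow_add, xpow_neg, xpow_neg, mul_inv]
  ring

lemma resMinus_eq (v : ℤ) (μ : ℝ) (r : Fin P.nβ) (l : ℕ) (n : ℤ) :
    P.resMinus v μ r l n = residue (fun z => P.integrand v z / z)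
      (P.ppow v μ * (P.innerBase r l * P.q ^ n / P.xpow μ)) := by
  rw [resMinus, innerBase]
  congr 1
  rw [show (l : ℝ) + P.β r - μ = (P.β r + l) + -μ by ring, xpow_add, xpow_neg]
  ring

lemma outerBase_disjoint {N : ℕ} (hN : ∀ r, 0 < P.α r + N)
    (hdist : ∀ r r' : Fin P.nα, ∀ l l' : ℕ, (P.α r + l ≤ 0) → (P.α r' + l' ≤ 0) →
      (r, l) ≠ (r', l') → ∀ k : ℤ,
      P.xpow (P.α r + l) * P.t r ≠ P.q ^ k * (P.xpow (P.α r' + l') * P.t r')) :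
    ∀ x ∈ P.outerIndices N, ∀ x' ∈ P.outerIndices N, x ≠ x' → ∀ m m' : ℤ,
      P.outerBase x.1 x.2 * P.q ^ m ≠ P.outerBase x'.1 x'.2 * P.q ^ m' := by
  intro x hx x' hx' hne m m' h
  refine hdist x.1 x'.1 x.2 x'.2 ((mem_outerIndices hN).1 hx) ((mem_outerIndices hN).1 hx')
    hne (m - m') ?_
  have h1 : P.q ^ m' ≠ 0 := zpow_ne_zero _ P.q_ne_zero
  have h2 := mul_ne_zero (P.xpow_ne_zero (P.α x.1 + x.2)) (P.t_ne_zero x.1)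
  have h3 := mul_ne_zero (P.xpow_ne_zero (P.α x'.1 + x'.2)) (P.t_ne_zero x'.1)
  rw [outerBase, outerBase, inv_mul_eq_div, inv_mul_eq_div, div_eq_div_iff h2 h3] at h
  rw [zpow_sub₀ P.q_ne_zero]
  field_simp
  linear_combination -h

lemma innerBase_disjoint {N : ℕ} (hN : ∀ r, 0 ≤ P.β r + N)
    (hdist : ∀ r r' : Fin P.nβ, ∀ l l' : ℕ, (P.β r + l < 0) → (P.β r' + l' < 0) →
      (r, l) ≠ (r', l') → ∀ k : ℤ,
      P.xpow (P.β r + l) * P.u r ≠ P.q ^ k * (P.xpow (P.β r' + l') * P.u r')) :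
    ∀ x ∈ P.innerIndices N, ∀ x' ∈ P.innerIndices N, x ≠ x' → ∀ m m' : ℤ,
      P.innerBase x.1 x.2 * P.q ^ m ≠ P.innerBase x'.1 x'.2 * P.q ^ m' := by
  intro x hx x' hx' hne m m' h
  refine hdist x.1 x'.1 x.2 x'.2 ((mem_innerIndices hN).1 hx) ((mem_innerIndices hN).1 hx')
    hne (m' - m) ?_
  have h1 : P.q ^ m ≠ 0 := zpow_ne_zero _ P.q_ne_zero
  rw [innerBase, innerBase] at h
  rw [zpow_sub₀ P.q_ne_zero]
  field_simp
  linear_combination h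

lemma exists_index_bound (P : Data) (N₀ : ℕ) : ∃ N ≥ N₀, (∀ r, 0 < P.α r + N) ∧ ∀ r, 0 ≤ P.β r + N := by
  have h : ∀ a : ℚ, ∀ᶠ N : ℕ in atTop, -a < N := fun a =>
    tendsto_natCast_atTop_atTop.eventually_gt_atTop (-a)
  obtain ⟨N, h1, h2, h3⟩ := ((eventually_ge_atTop N₀).and ((eventually_all.2 fun r => h (P.α r)).and
    (eventually_all.2 fun r => h (P.β r)))).exists
  exact ⟨N, h1, fun r => by linarith [h2 r], fun r => by linarith [h3 r]⟩

end Data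

namespace Data

variable {P : Data}

/-! ### The limit of the rescaled integral -/

/-- The limit of the rescaled integral as a sum of limits of rescaled residues. -/
theorem exists_tendsto_scale_mul_integral (hq : P.logq.re < 0) (hend : P.CriticalEnds)
    (hfin : P.M₀.Finite) {s : ℕ} {sobMin : ℂ} {c : ℕ → ℝ → ℂ} (hs : 0 < s)
    (hα : ∀ r, ∃ j : ℤ, P.α r * s = 2 * j) (hβ : ∀ r, ∃ j : ℤ, P.β r * s = 2 * j)
    (hγ : ∀ r, ∃ j : ℤ, P.γ r * s = 2 * j) (hμ : ∀ μ ∈ P.M₀, ∃ j : ℤ, μ * s = 2 * j)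
    (hsob : ∀ μ ∈ P.M₀, P.sob μ 0 ^ s = sobMin ^ s)
    (hleft : P.mMinus = 0 → (0 : ℝ) ∈ P.M₀ → ∀ᶠ ζ in 𝓝[<] (0 : ℝ),
      P.fob ζ < P.fob 0 ∨ P.fob ζ = P.fob 0 ∧ ‖P.sob 0 0‖ < ‖P.sob ζ 0‖)
    (houter : ∀ r r' : Fin P.nα, ∀ l l' : ℕ, (P.α r + l ≤ 0) → (P.α r' + l' ≤ 0) →
      (r, l) ≠ (r', l') → ∀ k : ℤ,
      P.xpow (P.α r + l) * P.t r ≠ P.q ^ k * (P.xpow (P.α r' + l') * P.t r'))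
    (hinner : ∀ r r' : Fin P.nβ, ∀ l l' : ℕ, (P.β r + l < 0) → (P.β r' + l' < 0) →
      (r, l) ≠ (r', l') → ∀ k : ℤ,
      P.xpow (P.β r + l) * P.u r ≠ P.q ^ k * (P.xpow (P.β r' + l') * P.u r'))
    (hcont : ∀ᶠ k : ℕ in atTop, P.IsContour (s * k : ℕ) (c k)) :
    ∃ (limPlus : ℝ → Fin P.nα → ℕ → ℤ → ℂ) (limMinus : ℝ → Fin P.nβ → ℕ → ℤ → ℂ),
      (∀ μ ∈ P.M₀, 0 ≤ μ → ∀ r, ∀ l : ℕ, P.α r + μ + l ≤ 0 →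
        (∀ n ∈ indexRange (P.α r + μ + l),
          Tendsto (fun k : ℕ => P.scale sobMin (s * k : ℕ) * P.resPlus (s * k : ℕ) μ r l n)
            atTop (𝓝 (limPlus μ r l n))) ∧
        Summable fun n : indexRange (P.α r + μ + l) => limPlus μ r l n) ∧
      (∀ μ ∈ P.M₀, μ < 0 → ∀ r, ∀ l : ℕ, P.β r - μ + l ≤ 0 →
        (∀ n ∈ indexRange (P.β r - μ + l),
          Tendsto (fun k : ℕ => P.scale sobMin (s * k : ℕ) * P.resMinus (s * k : ℕ) μ r l n)
            atTop (𝓝 (limMinus μ r l n))) ∧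
        Summable fun n : indexRange (P.β r - μ + l) => limMinus μ r l n) ∧
      Tendsto (fun k : ℕ => P.scale sobMin (s * k : ℕ) * P.integral (s * k : ℕ) (c k)) atTop
        (𝓝 (-(∑ᶠ μ ∈ P.M₀ ∩ Set.Ici 0, ∑' l : ℕ, ∑ r,
                if P.α r + μ + l ≤ 0 then
                  ∑' n : indexRange (P.α r + μ + l), limPlus μ r l n
                else 0) +
            (∑ᶠ μ ∈ P.M₀ ∩ Set.Iio 0, ∑' l : ℕ, ∑ r,
                if P.β r - μ + l ≤ 0 then
                  ∑' n : indexRange (P.β r - μ + l), limMinus μ r l n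
                else 0))) := by
  have hs0 : (0 : ℝ) < s := by exact_mod_cast hs
  set v : ℕ → ℤ := fun k => ((s * k : ℕ) : ℤ) with hvdef
  have hv : Tendsto v atTop atTop :=
    tendsto_natCast_atTop_atTop.comp (tendsto_id.const_mul_atTop' hs)
  have hintQ : ∀ {a : ℚ}, (∃ j : ℤ, a * s = 2 * j) → ∀ k, ∃ M : ℤ, (v k : ℝ) * a = M := by
    rintro a ⟨j, hj⟩ k
    have hj' : (a : ℝ) * s = 2 * j := by exact_mod_cast hj
    exact ⟨2 * j * k, by simp only [hvdef]; push_cast; linear_combination (k : ℝ) * hj'⟩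
  have hint : ∀ k, P.IntegralAt (v k) := fun k =>
    ⟨fun r => hintQ (hα r) k, fun r => hintQ (hβ r) k⟩
  have hγv : ∀ r k, ∃ M : ℤ, (v k : ℝ) * P.γ r = M := fun r k => hintQ (hγ r) k
  have hμv : ∀ μ ∈ P.M₀, ∀ k, ∃ M : ℤ, (v k : ℝ) * μ = M := fun μ hμM k => by
    obtain ⟨j, hj⟩ := hμ μ hμM
    exact ⟨2 * j * k, by simp only [hvdef]; push_cast; linear_combination (k : ℝ) * hj⟩
  have hsobv : ∀ μ ∈ P.M₀, ∀ k, P.sob μ 0 ^ v k = sobMin ^ v k := fun μ hμM k => by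
    simp only [hvdef, zpow_natCast, pow_mul, hsob μ hμM]
  -- The numbers α_r + l are integral multiples of 1/s, so the positive ones are at least 1/s. With
  -- ζ₀ > -1/s the corresponding outer poles stay outside the circle.
  obtain ⟨Lmin, a, ζ₀, hd, hLmin, ha, haζ, hζ₀, hηζ, hsep⟩ :=
    exists_separatingExponent hend hfin hleft (one_div_pos.2 hs0)
  have hp0 : (0 : ℝ) ≤ P.mPlus := by exact_mod_cast P.zero_le_mPlus
  have hζab : ζ₀ ∈ Set.Icc a (P.mPlus : ℝ) := ⟨haζ, hζ₀.trans hp0⟩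
  have hnorm : ‖sobMin‖ = Real.exp Lmin := by
    obtain ⟨μ, hμM⟩ := P.M₀_nonempty
    rw [hLmin μ hμM, ← norm_sob_zero]
    refine (pow_left_inj₀ (norm_nonneg _) (norm_nonneg _) hs.ne').1 ?_
    rw [← norm_pow, ← norm_pow, hsob μ hμM]
  have hne : ∀ μ ∈ P.M₀, ζ₀ < μ ∨ μ < ζ₀ := fun μ hμM =>
    (hsep μ hμM).imp And.right And.right
  have hζM : ζ₀ ∉ P.M₀ := fun h => (hne _ h).elim (lt_irrefl _) (lt_irrefl _)
  have hαη : ∀ r, ∀ l : ℕ, 0 < P.α r + l → 1 / (s : ℝ) ≤ P.α r + l := by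
    intro r l hl
    obtain ⟨j, hj⟩ := hα r
    have hj' : (P.α r : ℝ) * s = 2 * j := by exact_mod_cast hj
    have hl' : (0 : ℝ) < P.α r + l := by exact_mod_cast hl
    have h1 : ((P.α r : ℝ) + l) * s = ((2 * j + l * s : ℤ) : ℝ) := by
      push_cast; rw [add_mul, hj']
    have h2 : (0 : ℝ) < ((2 * j + l * s : ℤ) : ℝ) := by rw [← h1]; positivity
    have h3 : (1 : ℤ) ≤ 2 * j + l * s := by exact_mod_cast h2
    rw [div_le_iff₀ hs0, h1]
    exact_mod_cast h3
  -- Taking the constant of the radius larger than every |u_r| keeps the inner poles with β_r + l ≥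
  -- 0 inside the circle.
  obtain ⟨ρc, hρc, ε', hε', K, haway⟩ := exists_awayFromPoles_circle hq hζab hζ₀
    (1 + ∑ r, ‖P.u r‖) (by positivity)
  have hρc0 : 0 < ρc := lt_trans (by positivity) hρc
  have hu : ∀ r, ‖P.u r‖ ≤ ρc := fun r => by
    have := Finset.single_le_sum (f := fun r => ‖P.u r‖) (fun r _ => norm_nonneg _)
      (Finset.mem_univ r)
    linarith
  obtain ⟨N₀, hN₀⟩ := exists_separatedPoles (P := P) hq a P.mPlus
  obtain ⟨N, hN, hNα, hNβ⟩ := P.exists_index_bound N₀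
  obtain ⟨ε, hε, hε2, hsp⟩ := hN₀ N hN
  have hμab : ∀ μ ∈ P.M₀, μ ∈ Set.Icc a (P.mPlus : ℝ) := fun μ hμM =>
    ⟨ha.trans (P.M₀_subset_M hμM).1.1, (P.M₀_subset_M hμM).1.2⟩
  have hlim : ∀ μ ∈ P.M₀, ∀ y ∈ P.bases N, ∀ n : ℤ, ∃ L, Tendsto (fun k =>
      P.scale sobMin (v k) * residue (fun z => P.integrand (v k) z / z)
        (P.ppow (v k) μ * (y * P.q ^ n / P.xpow μ))) atTop (𝓝 L) := fun μ hμM y hy n =>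
    exists_tendsto_scale_mul_residue hq hend hfin hnorm hd hε hsp hv hint hγv hμM (hμab μ hμM)
      (hμv μ hμM) (hsobv μ hμM) hy n
  have houterBase : ∀ x ∈ P.outerIndices N, P.outerBase x.1 x.2 ∈ P.bases N := fun x hx =>
    P.outerBase_mem_bases (Finset.mem_range.1 (Finset.mem_product.1 (Finset.mem_filter.1 hx).1).2) _
  have hinnerBase : ∀ x ∈ P.innerIndices N, P.innerBase x.1 x.2 ∈ P.bases N := fun x hx =>
    P.innerBase_mem_bases (Finset.mem_range.1 (Finset.mem_product.1 (Finset.mem_filter.1 hx).1).2) _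
  -- The limits are named by `limUnder`, which has an arbitrary value where no limit exists;
  -- existence is checked for all indices that enter the series.
  set limPlus : ℝ → Fin P.nα → ℕ → ℤ → ℂ := fun μ r l n =>
    limUnder atTop fun k => P.scale sobMin (v k) * P.resPlus (v k) μ r l n with hlimPlus
  set limMinus : ℝ → Fin P.nβ → ℕ → ℤ → ℂ := fun μ r l n =>
    limUnder atTop fun k => P.scale sobMin (v k) * P.resMinus (v k) μ r l n with hlimMinus
  have hplus : ∀ μ ∈ P.M₀, ∀ x ∈ P.outerIndices N, ∀ n, Tendsto
      (fun k => P.scale sobMin (v k) * P.resPlus (v k) μ x.1 x.2 n) atTop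
        (𝓝 (limPlus μ x.1 x.2 n)) := fun μ hμM x hx n => by
    obtain ⟨L, hL⟩ := hlim μ hμM _ (houterBase x hx) (-n)
    simp only [← resPlus_eq] at hL
    exact tendsto_nhds_limUnder ⟨L, hL⟩
  have hminus : ∀ μ ∈ P.M₀, ∀ x ∈ P.innerIndices N, ∀ n, Tendsto
      (fun k => P.scale sobMin (v k) * P.resMinus (v k) μ x.1 x.2 n) atTop
        (𝓝 (limMinus μ x.1 x.2 n)) := fun μ hμM x hx n => by
    obtain ⟨L, hL⟩ := hlim μ hμM _ (hinnerBase x hx) n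
    simp only [← resMinus_eq] at hL
    exact tendsto_nhds_limUnder ⟨L, hL⟩
  have hpv := hv.eventually (eventually_norm_p_lt_int hq)
  have kouter := tendsto_finsum_residue hq hfin hnorm hd hε hε2 hsp hv hint hμv houterBase
    (outerBase_disjoint hNα houter)
    (T := fun x v => P.outerRange v (P.radius ρc ζ₀ v) x.1 x.2)
    (Q := fun x μ => P.outerLimitRange ζ₀ x.1 x.2 μ)
    (S := fun k => {w ∈ P.outerPoles (v k) | ‖w‖ < P.radius ρc ζ₀ (v k)})
    (by filter_upwards [hpv] with k hk using finite_outerPoles hq hk (radius_pos hρc0 _ _))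
    (by
      filter_upwards [hv.eventually (eventually_radius_le_outer hq hρc0 hζ₀ hηζ hαη)] with k hk
      exact outerPoles_eq (hint k) hNα hk)
    (fun x _ => exists_near_outerRange hq hρc0 haζ hζ₀ x.1 x.2)
    (fun x _ μ hμM n => eventually_mem_outerRange_iff hq hρc0 hζ₀ (hne μ hμM) x.1 x.2 n)
    (L := fun x μ n => limPlus μ x.1 x.2 (-n))
    (fun x hx μ hμM n _ => by
      have h1 := hplus μ hμM x hx (-n)
      simpa only [resPlus_eq, neg_neg] using h1)
  have kinner := tendsto_finsum_residue hq hfin hnorm hd hε hε2 hsp hv hint hμv hinnerBase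
    (innerBase_disjoint hNβ hinner)
    (T := fun x v => P.innerRange v (P.radius ρc ζ₀ v) x.1 x.2)
    (Q := fun x μ => P.innerLimitRange ζ₀ x.1 x.2 μ)
    (S := fun k => {w ∈ P.innerPoles (v k) | P.radius ρc ζ₀ (v k) < ‖w‖})
    (by filter_upwards [hpv] with k hk using finite_innerPoles hq hk (radius_pos hρc0 _ _))
    (by
      filter_upwards [hv.eventually (eventually_inner_le_radius hq ζ₀ hu hρc0)] with k hk
      exact innerPoles_eq (hint k) hNβ hk)
    (fun x _ => exists_near_innerRange hq hρc0 ha haζ hζ₀ x.1 x.2)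
    (fun x _ μ hμM n => eventually_mem_innerRange_iff hq hρc0 hζ₀ (hne μ hμM) x.1 x.2 n)
    (L := fun x μ => limMinus μ x.1 x.2)
    (fun x hx μ hμM n _ => by simpa only [resMinus_eq] using hminus μ hμM x hx n)
  refine ⟨limPlus, limMinus, fun μ hμM h0 r l hl => ?_, fun μ hμM h0 r l hl => ?_, ?_⟩
  · have hx : (r, l) ∈ P.outerIndices N := by
      rw [mem_outerIndices hNα]
      have : (P.α r : ℝ) + l ≤ 0 := by linarith
      exact_mod_cast this
    refine ⟨fun n _ => hplus μ hμM _ hx n, ?_⟩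
    have hζμ : ζ₀ < μ := ((hsep μ hμM).resolve_right fun h => h.1.not_ge h0).2
    exact (summable_indexRange_iff_neg (mem_outerLimitRange_iff hζμ hl) _).2 (kouter.1 _ hx μ hμM)
  · have hx : (r, l) ∈ P.innerIndices N := by
      rw [mem_innerIndices hNβ]
      have : (P.β r : ℝ) + l < 0 := by linarith
      exact_mod_cast this
    refine ⟨fun n _ => hminus μ hμM _ hx n, ?_⟩
    have hζμ : μ < ζ₀ := ((hsep μ hμM).resolve_left fun h => h.1.not_gt h0).2
    exact (summable_indexRange_iff (mem_innerLimitRange_iff hζμ hl) _).2 (kinner.1 _ hx μ hμM)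
  -- The three terms of `integral_eq` converge separately: the circle to 0, the inner and outer
  -- residues to their series.
  · have kcircle := tendsto_scale_mul_circleIntegral hq hfin hnorm hd hζab hζM hρc0 hε' haway hv hint
    have ko := kouter.2
    have ki := kinner.2
    rw [outer_sum_eq hfin hNα hsep limPlus] at ko
    rw [inner_sum_eq hfin hNβ hsep limMinus] at ki
    have key := (kcircle.add ki).sub ko
    rw [zero_add, sub_eq_neg_add] at key
    refine key.congr' ?_
    filter_upwards [hpv, hcont, hv.eventually haway] with k hk1 hk2 hk3
    have hI := integral_eq hq hk1 hk2 (radius_pos hρc0 ζ₀ (v k)) fun w hw =>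
      (hk3 (hint k) w hw).2.2.not_isPole hε'
    change _ = P.scale sobMin (v k) * P.integral (v k) (c k)
    rw [hI, mul_sub, mul_add]; rfl

end Data

end EllipticLimit

end

/-! ### The main theorem. -/

theorem mainTheorem1 (P : EllipticLimit.Data) (hq : P.logq.re < 0)
    -- an endpoint of the interval at which `fob` is maximal is a critical point of `fob`
    (hend : ∀ ζ ∈ P.M, ζ = (P.mMinus : ℝ) ∨ ζ = (P.mPlus : ℝ) → deriv P.fob ζ = 0) :
    P.IsOrderBehaviour P.fob P.sob ∧
    (∀ ζ ∈ P.M, ∀ logz logz' : ℂ, P.sob ζ logz = P.sob ζ logz') ∧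
    (P.M₀.Finite →
      (∀ μ ∈ P.M₀, ∃ a : ℚ, (a : ℝ) = μ) ∧
      ∀ (s : ℕ) (sobMin : ℂ) (c : ℕ → ℝ → ℂ), 0 < s →
        -- the limit is taken along `v = s k`
        (∀ r, ∃ j : ℤ, P.α r * s = 2 * j) →
        (∀ r, ∃ j : ℤ, P.β r * s = 2 * j) →
        (∀ r, ∃ j : ℤ, P.γ r * s = 2 * j) →
        (∀ μ ∈ P.M₀, ∃ j : ℤ, μ * s = 2 * j) →
        -- `sob_min` is the common value of `sob` on `M₀`, up to `s`-th roots of unity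
        (∀ μ ∈ P.M₀, P.sob μ 0 ^ s = sobMin ^ s) →
        -- if `m_- = 0` is in `M₀`, then `I` is of smaller order just to the left of `0`
        (P.mMinus = 0 → (0 : ℝ) ∈ P.M₀ → ∀ᶠ ζ in 𝓝[<] (0 : ℝ),
          P.fob ζ < P.fob 0 ∨ P.fob ζ = P.fob 0 ∧ ‖P.sob 0 0‖ < ‖P.sob ζ 0‖) →
        -- the poles on the wrong side of the unit circle are distinct
        (∀ r r' : Fin P.nα, ∀ l l' : ℕ, (P.α r + l ≤ 0) → (P.α r' + l' ≤ 0) →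
          (r, l) ≠ (r', l') → ∀ k : ℤ,
          P.xpow (P.α r + l) * P.t r ≠ P.q ^ k * (P.xpow (P.α r' + l') * P.t r')) →
        (∀ r r' : Fin P.nβ, ∀ l l' : ℕ, (P.β r + l < 0) → (P.β r' + l' < 0) →
          (r, l) ≠ (r', l') → ∀ k : ℤ,
          P.xpow (P.β r + l) * P.u r ≠ P.q ^ k * (P.xpow (P.β r' + l') * P.u r')) →
        (∀ᶠ k : ℕ in atTop, P.IsContour (s * k : ℕ) (c k)) →
        ∃ (limPlus : ℝ → Fin P.nα → ℕ → ℤ → ℂ) (limMinus : ℝ → Fin P.nβ → ℕ → ℤ → ℂ),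
          (∀ μ ∈ P.M₀, 0 ≤ μ → ∀ r, ∀ l : ℕ, P.α r + μ + l ≤ 0 →
            (∀ n ∈ EllipticLimit.indexRange (P.α r + μ + l),
              Tendsto (fun k : ℕ => P.scale sobMin (s * k : ℕ) * P.resPlus (s * k : ℕ) μ r l n)
                atTop (𝓝 (limPlus μ r l n))) ∧
            Summable fun n : EllipticLimit.indexRange (P.α r + μ + l) => limPlus μ r l n) ∧
          (∀ μ ∈ P.M₀, μ < 0 → ∀ r, ∀ l : ℕ, P.β r - μ + l ≤ 0 →
            (∀ n ∈ EllipticLimit.indexRange (P.β r - μ + l),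
              Tendsto (fun k : ℕ => P.scale sobMin (s * k : ℕ) * P.resMinus (s * k : ℕ) μ r l n)
                atTop (𝓝 (limMinus μ r l n))) ∧
            Summable fun n : EllipticLimit.indexRange (P.β r - μ + l) => limMinus μ r l n) ∧
          Tendsto (fun k : ℕ => P.scale sobMin (s * k : ℕ) * P.integral (s * k : ℕ) (c k)) atTop
            (𝓝 (-(∑ᶠ μ ∈ P.M₀ ∩ Set.Ici 0, ∑' l : ℕ, ∑ r,
                    if P.α r + μ + l ≤ 0 then
                      ∑' n : EllipticLimit.indexRange (P.α r + μ + l), limPlus μ r l n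
                    else 0) +
                (∑ᶠ μ ∈ P.M₀ ∩ Set.Iio 0, ∑' l : ℕ, ∑ r,
                    if P.β r - μ + l ≤ 0 then
                      ∑' n : EllipticLimit.indexRange (P.β r - μ + l), limMinus μ r l n
                    else 0)))) := by
  refine ⟨EllipticLimit.Data.isOrderBehaviour P hq, fun ζ hζ logz logz' => ?_, fun hfin =>
    ⟨fun μ hμ => EllipticLimit.Data.rational_of_mem_M₀ P hend hfin hμ, ?_⟩⟩
  · rw [EllipticLimit.Data.sob_eq_of_mem_M P hend hζ logz,
      EllipticLimit.Data.sob_eq_of_mem_M P hend hζ logz']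
  · intro s sobMin c hs hα hβ hγ hμ hsob hleft houter hinner hcont
    exact EllipticLimit.Data.exists_tendsto_scale_mul_integral hq hend hfin hs hα hβ hγ hμ hsob
      hleft houter hinner hcont
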